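/- **Conventions.** Let $\mathbb K$ be a field of characteristic $0$. All spaces are $\mathbb Z$-graded, $\pm_K$ denotes Koszul signs, and differentials have degree $1$. For a graded space $U$ let $S(U)=\bigoplus_{n\ge 0}U^{\odot n}$ be the graded symmetric algebra, with its unshuffle coproduct $\Delta$ (the algebra morphism with $\Delta(x)=x\otimes 1+1\otimes x$ for $x\in U$), counit $\epsilon$ and unit $\mathbf 1$; let $p:S(U)\to U$ be the projection. For $n\ge1$, $\Delta^{n-1}:S(U)\to S(U)^{\otimes n}$ is the iterated coproduct and $\pi:S(U)^{\otimes n}\to S(U)^{\odot n}$ the projection, where $S(U)^{\odot n}\subset S(S(U))$. Let $t$ be a central variable of degree $2$. A $\mathbb K[[t]]$-linear map $F:S(U)[[t]]\to S(V)[[t]]$ is written $F=\sum_{n\ge0}t^nF_n$ with $F_n:S(U)\to S(V)$; it has degree $d$ if every $F_n$ has degree $d-2n$. Its *linear part* is the composition $U\hookrightarrow S(U)\xrightarrow{F_0}S(V)\xrightarrow{p}V$. Let $E$ be the unital algebra automorphism of $\widehat S(S(U))$ (the completed symmetric algebra of the space $S(U)$) with $E(c)=\sum_{n\ge1}\frac1{n!}\pi\Delta^{n-1}(c)$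 for $c\in S(U)$; its inverse satisfies $E^{-1}(c)=\sum_{n\ge1}\frac{(-1)^{n-1}}{n}\pi\Delta^{n-1}(c)$. For a $\mathbb K[[t]]$-linear $\delta$ of degree $1$ on $S(U)[[t]]$, let $\widetilde\delta$ be the derivation of the symmetric algebra extending $\delta$; the *Koszul cobracket* $\mathcal K^{co}(\delta)_n:S(U)\to S(U)^{\odot n}[[t]]$ is the component in symmetric degree $n$ of $E\,\widetilde\delta\,E^{-1}$ restricted to $S(U)$. For a $\mathbb K[[t]]$-linear $F:S(U)[[t]]\to S(V)[[t]]$ of degree $0$, the *cocumulant* $\kappa^{co}(F)_n:S(U)\to S(V)^{\odot n}[[t]]$ is the component in symmetric degree $n$ of $E\,S(F)\,E^{-1}$ restricted to $S(U)$, where $S(F)$ is the algebra morphism extending $F$. An *$IBL_\infty[1]$ algebra structure* on $U$ (a degree $-1$ derived $BV$ coalgebra structure on $S(U)$) is a $\mathbb K[[t]]$-linear map $\delta:S(U)[[t]]\to S(U)[[t]]$ of degree $1$ with $\delta(\mathbf 1)=0$, $\epsilon\circ\delta=0$, $\delta^2=0$ and $\mathcal K^{co}(\delta)_n\equiv0\pmod{t^{n-1}}$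 for all $n\ge2$. An *$IBL_\infty[1]$ morphism* from $(U,\delta)$ to $(V,\delta')$ is a $\mathbb K[[t]]$-linear map $F:S(U)[[t]]\to S(V)[[t]]$ of degree $0$ with $F(\mathbf 1)=\mathbf 1$, $\epsilon\circ F=\epsilon$, $F\circ\delta=\delta'\circ F$ and $\kappa^{co}(F)_n\equiv0\pmod{t^{n-1}}$ for all $n\ge2$. **Data.** Let $\delta=\sum_{n\ge0}t^n\delta_n$ be an $IBL_\infty[1]$ algebra structure on $U$, with linear part $d_U:U\to U$. Let $(V,d_V)$ be a complex and let $(g,f,h)$ be a contraction of $(U,d_U)$ onto $(V,d_V)$, that is, $g:U\to V$ and $f:V\to U$ are of degree $0$ and commute with the differentials, $h:U\to U$ has degree $-1$, and $$gf=\mathrm{id}_V,\qquad hd_U+d_Uh=fg-\mathrm{id}_U,\qquad gh=0,\quad hf=0,\quad h^2=0.$$ **Transfer.** For $d=d_U$ or $d=d_V$ let $\widetilde d$ be the coderivation $x_1\odot\cdots\odot x_n\mapsto\sum_i\pm_K d(x_i)\odot x_1\odot\cdots\widehat{x_i}\cdots\odot x_n$. Let $\widehat h:S(U)\to S(U)$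 be given by $\widehat h(\mathbf 1)=0$ and $$\widehat h(x_1\odot\cdots\odot x_n)=\frac1{n!}\sum_{j=1}^n\sum_{s\in S_n}\pm_K\,fg(x_{s(1)})\odot\cdots\odot fg(x_{s(j-1)})\odot h(x_{s(j)})\odot x_{s(j+1)}\odot\cdots\odot x_{s(n)} .$$ *Step 1.* Put $\delta_0^+=\delta_0-\widetilde{d_U}$ and $$\delta_0'=\widetilde{d_V}+\sum_{k\ge0}S(g)\,\delta_0^+(\widehat h\,\delta_0^+)^kS(f),\quad G_0=\sum_{k\ge0}S(g)(\delta_0^+\widehat h)^k,\quad F_0=\sum_{k\ge0}(\widehat h\,\delta_0^+)^kS(f),\quad H_0=\sum_{k\ge0}(\widehat h\,\delta_0^+)^k\,\widehat h .$$ These sums are finite on each element, and the maps are extended $\mathbb K[[t]]$-linearly. *Step 2.* Put $\delta_+=\delta-\delta_0=\sum_{n\ge1}t^n\delta_n$ and $$\delta'=\delta_0'+\sum_{k\ge0}G_0\,\delta_+(H_0\,\delta_+)^kF_0,\qquad G=\sum_{k\ge0}G_0(\delta_+H_0)^k,\qquad F=\sum_{k\ge0}(H_0\,\delta_+)^kF_0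 ,$$ where the sums converge $t$-adically. **Theorem.** Then $\delta'$ is an $IBL_\infty[1]$ algebra structure on $V$ with linear part $d_V$; the map $F:S(V)[[t]]\to S(U)[[t]]$ is an $IBL_\infty[1]$ morphism from $(V,\delta')$ to $(U,\delta)$ with linear part $f$; and the map $G:S(U)[[t]]\to S(V)[[t]]$ is an $IBL_\infty[1]$ morphism from $(U,\delta)$ to $(V,\delta')$ with linear part $g$. -/

import Mathlib

open scoped DirectSum TensorProduct PowerSeries

noncomputable section

namespace IBL

variable {K : Type*} [Field K]

/-! ## Graded spaces

A graded space is a `K`-module `U` with an internal direct sum decomposition `𝒰 : ℤ → Submodule K U`. -/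

section Graded

variable {U V : Type*} [AddCommGroup U] [Module K U] [AddCommGroup V] [Module K V]

/-- `φ` is homogeneous of degree `d`. -/
def IsHomogeneousMap (𝒰 : ℤ → Submodule K U) (𝒱 : ℤ → Submodule K V) (d : ℤ)
    (φ : U →ₗ[K] V) : Prop :=
  ∀ i : ℤ, ∀ x ∈ 𝒰 i, φ x ∈ 𝒱 (i + d)

/-- The parity operator `x ↦ (-1)^|x| x` of a graded space. -/
def parity (𝒰 : ℤ → Submodule K U) [DirectSum.Decomposition 𝒰] : U →ₗ[K] U :=
  DirectSum.toModule K ℤ U (fun i => ((-1 : K) ^ i) • (𝒰 i).subtype) ∘ₗ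
    (DirectSum.decomposeLinearEquiv 𝒰).toLinearMap

/-- `d` is a differential: of degree one and of square zero. -/
structure IsDifferential (𝒰 : ℤ → Submodule K U) (d : U →ₗ[K] U) : Prop where
  degree_one : IsHomogeneousMap 𝒰 𝒰 1 d
  sq_zero : d ∘ₗ d = 0

/-- A contraction `(σ, τ, h)` of `(U, dU)` onto `(V, dV)`. -/
structure Contraction (𝒰 : ℤ → Submodule K U) (dU : U →ₗ[K] U)
    (𝒱 : ℤ → Submodule K V) (dV : V →ₗ[K] V) where
  σ : U →ₗ[K] V
  τ : V →ₗ[K] U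
  h : U →ₗ[K] U
  σ_degree : IsHomogeneousMap 𝒰 𝒱 0 σ
  τ_degree : IsHomogeneousMap 𝒱 𝒰 0 τ
  h_degree : IsHomogeneousMap 𝒰 𝒰 (-1) h
  σ_comm : σ ∘ₗ dU = dV ∘ₗ σ
  τ_comm : τ ∘ₗ dV = dU ∘ₗ τ
  σ_τ : σ ∘ₗ τ = LinearMap.id
  homotopy : h ∘ₗ dU + dU ∘ₗ h = τ ∘ₗ σ - LinearMap.id
  σ_h : σ ∘ₗ h = 0
  h_τ : h ∘ₗ τ = 0
  h_h : h ∘ₗ h = 0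

end Graded

/-! ## The symmetric algebra of a graded space -/

section SymmetricAlgebra

variable {U : Type*} [AddCommGroup U] [Module K U]

/-- The relations `x ⊙ y = (-1)^{|x||y|} y ⊙ x` for homogeneous `x`, `y`. -/
inductive GSymRel (𝒰 : ℤ → Submodule K U) : TensorAlgebra K U → TensorAlgebra K U → Prop
  | swap {i j : ℤ} {x y : U} (hx : x ∈ 𝒰 i) (hy : y ∈ 𝒰 j) :
      GSymRel 𝒰 (TensorAlgebra.ι K x * TensorAlgebra.ι K y)
        (((-1 : K) ^ (i * j)) • (TensorAlgebra.ι K y * TensorAlgebra.ι K x))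

/-- `S(U) = ⨁ₙ U^{⊙n}`, with the symmetric product. -/
abbrev GSym (𝒰 : ℤ → Submodule K U) : Type _ := RingQuot (GSymRel 𝒰)

namespace GSym

/-- The inclusion `U → S(U)`. -/
def ι (𝒰 : ℤ → Submodule K U) : U →ₗ[K] GSym 𝒰 :=
  (RingQuot.mkAlgHom K (GSymRel 𝒰)).toLinearMap ∘ₗ TensorAlgebra.ι K

theorem ι_mul_ι (𝒰 : ℤ → Submodule K U) {i j : ℤ} {x y : U} (hx : x ∈ 𝒰 i) (hy : y ∈ 𝒰 j) :
    ι 𝒰 x * ι 𝒰 y = ((-1 : K) ^ (i * j)) • (ι 𝒰 y * ι 𝒰 x) := by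
  have h := RingQuot.mkAlgHom_rel K (GSymRel.swap hx hy)
  rw [map_mul, map_smul, map_mul] at h
  exact h

/-- The universal property of `S(U)`. -/
def lift (𝒰 : ℤ → Submodule K U) {A : Type*} [Semiring A] [Algebra K A] (φ : U →ₗ[K] A)
    (hφ : ∀ (i j : ℤ) (x y : U), x ∈ 𝒰 i → y ∈ 𝒰 j →
      φ x * φ y = ((-1 : K) ^ (i * j)) • (φ y * φ x)) : GSym 𝒰 →ₐ[K] A :=
  RingQuot.liftAlgHom K ⟨TensorAlgebra.lift K φ, by
    rintro _ _ ⟨hx, hy⟩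
    rw [map_smul, map_mul, map_mul, TensorAlgebra.lift_ι_apply, TensorAlgebra.lift_ι_apply]
    exact hφ _ _ _ _ hx hy⟩

theorem lift_ι (𝒰 : ℤ → Submodule K U) {A : Type*} [Semiring A] [Algebra K A] (φ : U →ₗ[K] A)
    (hφ : ∀ (i j : ℤ) (x y : U), x ∈ 𝒰 i → y ∈ 𝒰 j →
      φ x * φ y = ((-1 : K) ^ (i * j)) • (φ y * φ x)) (x : U) :
    lift 𝒰 φ hφ (ι 𝒰 x) = φ x := by
  rw [lift, ι, LinearMap.comp_apply, AlgHom.toLinearMap_apply]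
  rw [RingQuot.liftAlgHom_mkAlgHom_apply]
  exact TensorAlgebra.lift_ι_apply _ _

theorem algHom_ext (𝒰 : ℤ → Submodule K U) {A : Type*} [Semiring A] [Algebra K A]
    {F G : GSym 𝒰 →ₐ[K] A} (h : ∀ x, F (ι 𝒰 x) = G (ι 𝒰 x)) : F = G := by
  refine RingQuot.ringQuot_ext' K (A := TensorAlgebra K U) F G ?_
  ext x
  exact h x

/-- The (total) degree `d` part of `S(U)`: the span of the products `x₁ ⊙ ⋯ ⊙ xₙ` of homogeneous
elements whose degrees add up to `d`. -/
def degree (𝒰 : ℤ → Submodule K U) (d : ℤ) : Submodule K (GSym 𝒰) :=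
  Submodule.span K {s | ∃ l : List (ℤ × U), (∀ p ∈ l, p.2 ∈ 𝒰 p.1) ∧
    (l.map Prod.fst).sum = d ∧ (l.map fun p => ι 𝒰 p.2).prod = s}

theorem ι_mem_degree (𝒰 : ℤ → Submodule K U) {i : ℤ} {x : U} (hx : x ∈ 𝒰 i) :
    ι 𝒰 x ∈ degree 𝒰 i :=
  Submodule.subset_span ⟨[(i, x)], by simpa using hx, by simp, by simp⟩

instance (𝒰 : ℤ → Submodule K U) : SetLike.GradedMonoid (degree 𝒰) where
  one_mem := Submodule.subset_span ⟨[], by simp, by simp, by simp⟩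
  mul_mem := by
    intro i j a b ha hb
    have hab : a * b ∈ degree 𝒰 i * degree 𝒰 j := Submodule.mul_mem_mul ha hb
    rw [degree, degree, Submodule.span_mul_span] at hab
    refine Submodule.span_mono ?_ hab
    rintro _ ⟨_, ⟨l, hl, rfl, rfl⟩, _, ⟨m, hm, rfl, rfl⟩, rfl⟩
    refine ⟨l ++ m, ?_, by simp, by simp⟩
    intro p hp
    rcases List.mem_append.1 hp with h | h
    exacts [hl p h, hm p h]

section Decomposition

variable (𝒰 : ℤ → Submodule K U) [DirectSum.Decomposition 𝒰]

/-- `ι` with values in the external direct sum of the homogeneous parts. -/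
def ιDegree : U →ₗ[K] ⨁ d, degree 𝒰 d :=
  DirectSum.toModule K ℤ _ (fun i => DirectSum.lof K ℤ (fun d => degree 𝒰 d) i ∘ₗ
    ((ι 𝒰 ∘ₗ (𝒰 i).subtype).codRestrict (degree 𝒰 i) fun x => ι_mem_degree 𝒰 x.2)) ∘ₗ
    (DirectSum.decomposeLinearEquiv 𝒰).toLinearMap

theorem ιDegree_apply {i : ℤ} {x : U} (hx : x ∈ 𝒰 i) :
    ιDegree 𝒰 x = DirectSum.of (fun d => degree 𝒰 d) i ⟨ι 𝒰 x, ι_mem_degree 𝒰 hx⟩ := by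
  rw [ιDegree, LinearMap.comp_apply, LinearEquiv.coe_coe, DirectSum.decomposeLinearEquiv_apply,
    DirectSum.decompose_of_mem 𝒰 hx]
  erw [DirectSum.toModule_lof]
  rfl

/-- The decomposition of `S(U)` into its homogeneous parts. -/
def toDegree : GSym 𝒰 →ₐ[K] ⨁ d, degree 𝒰 d :=
  lift 𝒰 (A := ⨁ d, degree 𝒰 d) (ιDegree 𝒰) (by
    intro i j x y hx hy
    rw [ιDegree_apply 𝒰 hx, ιDegree_apply 𝒰 hy, DirectSum.of_mul_of, DirectSum.of_mul_of,
      ← DirectSum.lof_eq_of K, ← DirectSum.lof_eq_of K, ← map_smul, DirectSum.lof_eq_of,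
      DirectSum.lof_eq_of]
    exact DirectSum.of_eq_of_gradedMonoid_eq
      (Sigma.subtype_ext (add_comm _ _) (ι_mul_ι 𝒰 hx hy)))

theorem toDegree_prod (l : List (ℤ × U)) (hl : ∀ p ∈ l, p.2 ∈ 𝒰 p.1) {d : ℤ}
    (hd : (l.map Prod.fst).sum = d) (hm : (l.map fun p => ι 𝒰 p.2).prod ∈ degree 𝒰 d) :
    toDegree 𝒰 (l.map fun p => ι 𝒰 p.2).prod =
      DirectSum.of (fun d => degree 𝒰 d) d ⟨(l.map fun p => ι 𝒰 p.2).prod, hm⟩ := by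
  induction l generalizing d with
  | nil =>
    subst hd
    simp only [List.map_nil, List.prod_nil, map_one]
    rfl
  | cons p l ih =>
    subst hd
    have hl' : ∀ q ∈ l, q.2 ∈ 𝒰 q.1 := fun q hq => hl q (List.mem_cons_of_mem _ hq)
    have hp : p.2 ∈ 𝒰 p.1 := hl p List.mem_cons_self
    have hm' : (l.map fun p => ι 𝒰 p.2).prod ∈ degree 𝒰 (l.map Prod.fst).sum :=
      Submodule.subset_span ⟨l, hl', rfl, rfl⟩
    have e : toDegree 𝒰 (ι 𝒰 p.2) = ιDegree 𝒰 p.2 := lift_ι 𝒰 _ _ _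
    simp only [List.map_cons, List.prod_cons, map_mul]
    rw [ih hl' rfl hm', e, ιDegree_apply 𝒰 hp, DirectSum.of_mul_of]
    exact DirectSum.of_eq_of_gradedMonoid_eq (Sigma.subtype_ext rfl rfl)

instance : GradedAlgebra (degree 𝒰) :=
  GradedAlgebra.ofAlgHom (degree 𝒰) (toDegree 𝒰)
    (by
      refine algHom_ext 𝒰 fun x => ?_
      rw [AlgHom.comp_apply, AlgHom.id_apply, toDegree, lift_ι]
      induction x using DirectSum.Decomposition.inductionOn 𝒰 with
      | zero => simp
      | homogeneous x => rw [ιDegree_apply 𝒰 x.2, DirectSum.coeAlgHom_of]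
      | add x y hx hy => rw [map_add, map_add, hx, hy, map_add])
    (by
      rintro d ⟨x, hx⟩
      change toDegree 𝒰 x = _
      induction hx using Submodule.span_induction with
      | mem x h =>
        obtain ⟨l, hl, hd, rfl⟩ := h
        exact toDegree_prod 𝒰 l hl hd _
      | zero => rw [map_zero]; exact (map_zero _).symm
      | add x y hx hy ihx ihy => rw [map_add, ihx, ihy, ← map_add]; rfl
      | smul c x hx ih => rw [map_smul, ih, ← DirectSum.lof_eq_of K, ← map_smul]; rfl)

/-- The unshuffle coproduct: the algebra morphism `S(U) → S(U) ⊗ S(U)` (with the Koszul sign rule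
in the product of the target) sending `x ∈ U` to `x ⊗ 1 + 1 ⊗ x`. -/
def comulAlgHom : GSym 𝒰 →ₐ[K] GradedTensorProduct K (degree 𝒰) (degree 𝒰) :=
  lift 𝒰 ((GradedTensorProduct.includeLeft (degree 𝒰) (degree 𝒰)).toLinearMap ∘ₗ ι 𝒰 +
      (GradedTensorProduct.includeRight (degree 𝒰) (degree 𝒰)).toLinearMap ∘ₗ ι 𝒰) (by
    intro i j x y hx hy
    have sgn : ∀ (n : ℤ) (z : GradedTensorProduct K (degree 𝒰) (degree 𝒰)),
        ((-1 : ℤˣ) ^ n) • z = ((-1 : K) ^ n) • z := by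
      intro n z
      rw [Units.smul_def, ← Int.cast_smul_eq_zsmul K]
      congr 1
      exact Int.cast_negOnePow K n
    have one_mul_one : (((-1 : K) ^ (i * j)) * ((-1 : K) ^ (i * j))) = 1 := by
      rw [← mul_zpow]; simp
    have swap : ∀ {i j : ℤ} {x y : U}, x ∈ 𝒰 i → y ∈ 𝒰 j →
        GradedTensorProduct.includeRight (degree 𝒰) (degree 𝒰) (ι 𝒰 x) *
          GradedTensorProduct.includeLeft (degree 𝒰) (degree 𝒰) (ι 𝒰 y) =
        ((-1 : K) ^ (i * j)) • (GradedTensorProduct.includeLeft (degree 𝒰) (degree 𝒰) (ι 𝒰 y) *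
          GradedTensorProduct.includeRight (degree 𝒰) (degree 𝒰) (ι 𝒰 x)) := by
      intro i j x y hx hy
      have h := GradedTensorProduct.tmul_coe_mul_coe_tmul (R := K) (degree 𝒰) (degree 𝒰)
        (1 : GSym 𝒰) ⟨ι 𝒰 x, ι_mem_degree 𝒰 hx⟩ ⟨ι 𝒰 y, ι_mem_degree 𝒰 hy⟩ (1 : GSym 𝒰)
      rw [one_mul, mul_one] at h
      have h' := GradedTensorProduct.tmul_one_mul_one_tmul (R := K) (degree 𝒰) (degree 𝒰)
        (ι 𝒰 y) (ι 𝒰 x)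
      refine h.trans ((sgn _ _).trans ?_)
      congr 1
      exact h'.symm
    simp only [LinearMap.add_apply, LinearMap.comp_apply, AlgHom.toLinearMap_apply, mul_add,
      add_mul, smul_add]
    rw [swap hx hy, swap hy hx]
    simp only [← map_mul]
    rw [ι_mul_ι 𝒰 hx hy, map_smul, map_smul, smul_smul, mul_comm j i, one_mul_one, one_smul]
    abel)

/-- The counit, vanishing on `U^{⊙n}` for `n ≥ 1`. -/
def counitAlgHom : GSym 𝒰 →ₐ[K] K := lift 𝒰 0 (by simp)

instance : CoalgebraStruct K (GSym 𝒰) where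
  comul := (GradedTensorProduct.of K (degree 𝒰) (degree 𝒰)).symm.toLinearMap ∘ₗ
    (comulAlgHom 𝒰).toLinearMap
  counit := (counitAlgHom 𝒰).toLinearMap

end Decomposition

/-- The algebra morphism `S(U) → S(U)[z]` sending `x ∈ U` to `x z`: the coefficient of `zⁿ` is the
projection onto `U^{⊙n}`. -/
def weights (𝒰 : ℤ → Submodule K U) : GSym 𝒰 →ₐ[K] Polynomial (GSym 𝒰) :=
  lift 𝒰 ((Polynomial.monomial 1).restrictScalars K ∘ₗ ι 𝒰) (by
    intro i j x y hx hy
    simp only [LinearMap.comp_apply, LinearMap.coe_restrictScalars,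
      Polynomial.monomial_mul_monomial]
    rw [ι_mul_ι 𝒰 hx hy, ← Polynomial.smul_monomial])

/-- The projection `p : S(U) → U`. -/
def proj (𝒰 : ℤ → Submodule K U) : GSym 𝒰 →ₗ[K] U :=
  letI : Module Kᵐᵒᵖ U := Module.compHom _ ((RingHom.id K).fromOpposite mul_comm)
  haveI : IsCentralScalar K U := ⟨fun _ _ => rfl⟩
  TrivSqZeroExt.sndHom K U ∘ₗ
    (lift 𝒰 (TrivSqZeroExt.inrHom K U) (by
      intro i j x y _ _
      simp [TrivSqZeroExt.inrHom_apply])).toLinearMap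

/-- `S(φ) : S(U) → S(V)` for `φ` of degree zero: `x₁ ⊙ ⋯ ⊙ xₙ ↦ φ x₁ ⊙ ⋯ ⊙ φ xₙ`. -/
def map {V : Type*} [AddCommGroup V] [Module K V] {𝒰 : ℤ → Submodule K U}
    {𝒱 : ℤ → Submodule K V} (φ : U →ₗ[K] V) (hφ : IsHomogeneousMap 𝒰 𝒱 0 φ) :
    GSym 𝒰 →ₐ[K] GSym 𝒱 :=
  lift 𝒰 (ι 𝒱 ∘ₗ φ) (by
    intro i j x y hx hy
    have hx' := hφ i x hx
    have hy' := hφ j y hy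
    rw [add_zero] at hx' hy'
    exact ι_mul_ι 𝒱 hx' hy')

end GSym

end SymmetricAlgebra

/-! ## Convolution, and the operators on `S(U)` -/

section Convolution

variable {C A : Type*} [AddCommGroup C] [Module K C] [CoalgebraStruct K C] [Ring A] [Algebra K A]

/-- The convolution product `φ ⋆ ψ = μ ∘ (φ ⊗ ψ) ∘ Δ`. No sign is inserted in `φ ⊗ ψ`. -/
def conv (φ ψ : C →ₗ[K] A) : C →ₗ[K] A :=
  LinearMap.mul' K A ∘ₗ TensorProduct.map φ ψ ∘ₗ CoalgebraStruct.comul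

/-- The convolution product `φ₁ ⋆ ⋯ ⋆ φₖ = μ ∘ (φ₁ ⊗ ⋯ ⊗ φₖ) ∘ Δ^{k-1}` of a list of maps. -/
def convList (l : List (C →ₗ[K] A)) : C →ₗ[K] A :=
  l.foldr conv (Algebra.linearMap K A ∘ₗ CoalgebraStruct.counit)

end Convolution

section Operators

variable {U V : Type*} [AddCommGroup U] [Module K U] [AddCommGroup V] [Module K V]
variable (𝒰 : ℤ → Submodule K U) [DirectSum.Decomposition 𝒰]

/-- The coderivation of `S(U)` with the only Taylor coefficient `d : U → U`:
`x₁ ⊙ ⋯ ⊙ xₙ ↦ ∑_σ ± d(x_{σ(1)}) ⊙ x_{σ(2)} ⊙ ⋯ ⊙ x_{σ(n)}`, over the `(1, n-1)`-unshuffles. -/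
def linearCoderivation (d : U →ₗ[K] U) : GSym 𝒰 →ₗ[K] GSym 𝒰 :=
  conv (GSym.ι 𝒰 ∘ₗ d ∘ₗ GSym.proj 𝒰) LinearMap.id

/-- On `U^{⊙n}`, the symmetrized tensor trick homotopy
`x₁ ⊙ ⋯ ⊙ xₙ ↦ (1/n!) ∑_{j=1}^n ∑_{π ∈ Sₙ} ± e(x_{π(1)}) ⊙ ⋯ ⊙ e(x_{π(j-1)}) ⊙ h(x_{π(j)}) ⊙
x_{π(j+1)} ⊙ ⋯ ⊙ x_{π(n)}`, for `e` of degree `0` and `h` of odd degree. The projection of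
`Δ^{n-1}(x₁ ⊙ ⋯ ⊙ xₙ)` to `U^{⊗n}` is `∑_π ± x_{π(1)} ⊗ ⋯ ⊗ x_{π(n)}`, and the parity operator
accounts for the sign of moving `h` past `x_{π(1)}, …, x_{π(j-1)}`. -/
def symmetrizedHomotopyTerm (e h : U →ₗ[K] U) (n : ℕ) : GSym 𝒰 →ₗ[K] GSym 𝒰 :=
  ((n.factorial : K)⁻¹) • ∑ j : Fin n, convList (List.ofFn fun i : Fin n =>
    GSym.ι 𝒰 ∘ₗ (if i < j then e ∘ₗ parity 𝒰 else if i = j then h else LinearMap.id) ∘ₗ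
      GSym.proj 𝒰)

/-- The symmetrized tensor trick homotopy on `S(U)`, zero on `U^{⊙0}`. -/
def symmetrizedHomotopy (e h : U →ₗ[K] U) : GSym 𝒰 →ₗ[K] GSym 𝒰 :=
  Polynomial.lsum (fun n => symmetrizedHomotopyTerm 𝒰 e h n) ∘ₗ (GSym.weights 𝒰).toLinearMap

/-- `∑_{k ≥ 0} Nᵏ` for an operator `N` that maps each `U^{⊙n}` to `⨁_{m < n} U^{⊙m}`: then `Nᵏ`
vanishes on `U^{⊙n}` for `k > n`. -/
def geomWeight (𝒰 : ℤ → Submodule K U) (N : Module.End K (GSym 𝒰)) : GSym 𝒰 →ₗ[K] GSym 𝒰 :=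
  Polynomial.lsum (fun n => ∑ k ∈ Finset.range (n + 1), N ^ k) ∘ₗ (GSym.weights 𝒰).toLinearMap

/-- The maps `e_i = (1/i!) π Δ^{i-1} : S(U) → S(U)^{⊙i} ⊆ S(S(U))`, the components of the
coexponential automorphism. -/
def coexpTerm (i : ℕ) : GSym 𝒰 →ₗ[K] GSym (GSym.degree 𝒰) :=
  ((i.factorial : K)⁻¹) • convList (List.replicate i (GSym.ι (GSym.degree 𝒰)))

end Operators

/-! ## Formal power series in `t`

The variable `t` has degree `2`, and it is written `X` in `PowerSeries`. -/

section PowerSeriesMaps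

section Coefficients

variable {A B : Type*} [Ring A] [Algebra K A] [Ring B] [Algebra K B]

/-- The coefficient of `tⁿ`. -/
def coeffT (A : Type*) [Ring A] [Algebra K A] (n : ℕ) : A⟦X⟧ →ₗ[K] A :=
  { toFun := fun a => PowerSeries.coeff n a
    map_add' := fun a b => map_add _ a b
    map_smul' := fun _ _ => rfl }

/-- The inclusion of the constants. -/
def constT (A : Type*) [Ring A] [Algebra K A] : A →ₗ[K] A⟦X⟧ :=
  { toFun := fun a => PowerSeries.C a
    map_add' := fun a b => map_add (PowerSeries.C : A →+* A⟦X⟧) a b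
    map_smul' := fun c a => by
      ext n
      change PowerSeries.coeff n ((PowerSeries.C (c • a) : A⟦X⟧)) =
        c • PowerSeries.coeff n (PowerSeries.C a : A⟦X⟧)
      rw [PowerSeries.coeff_C, PowerSeries.coeff_C]
      split_ifs <;> simp }

/-- `∑ tⁿ aₙ ↦ ∑ tⁿ φ(aₙ)`. -/
def mapT (φ : A →ₗ[K] B) : A⟦X⟧ →ₗ[K] B⟦X⟧ :=
  { toFun := fun a => PowerSeries.mk fun n => φ (PowerSeries.coeff n a)
    map_add' := fun a b => by ext n; simp
    map_smul' := fun c a => by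
      ext n
      rw [PowerSeries.coeff_mk]
      change φ (c • PowerSeries.coeff n a) =
        c • (PowerSeries.coeff n) (PowerSeries.mk fun n => φ (PowerSeries.coeff n a))
      rw [PowerSeries.coeff_mk, map_smul] }

end Coefficients

variable {U V : Type*} [AddCommGroup U] [Module K U] [AddCommGroup V] [Module K V]

/-- `S(U)[[t]]` is a `K[[t]]`-module. -/
instance (𝒰 : ℤ → Submodule K U) : Module K⟦X⟧ (GSym 𝒰)⟦X⟧ :=
  Module.compHom _ (PowerSeries.map (algebraMap K (GSym 𝒰)))

/-- `K[[t]]`-linear maps `S(U)[[t]] → S(V)[[t]]`. -/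
abbrev HomT (𝒰 : ℤ → Submodule K U) (𝒱 : ℤ → Submodule K V) : Type _ :=
  (GSym 𝒰)⟦X⟧ →ₗ[K⟦X⟧] (GSym 𝒱)⟦X⟧

variable {𝒰 : ℤ → Submodule K U} {𝒱 : ℤ → Submodule K V}

theorem coeff_smul (p : K⟦X⟧) (a : (GSym 𝒰)⟦X⟧) (n : ℕ) :
    PowerSeries.coeff n (p • a) = ∑ q ∈ Finset.HasAntidiagonal.antidiagonal n,
      PowerSeries.coeff q.1 p • PowerSeries.coeff q.2 a := by
  change PowerSeries.coeff n (PowerSeries.map (algebraMap K (GSym 𝒰)) p * a) = _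
  rw [PowerSeries.coeff_mul]
  simp [Algebra.smul_def]

theorem C_smul (c : K) (a : (GSym 𝒰)⟦X⟧) : (PowerSeries.C c : K⟦X⟧) • a = c • a := by
  ext n
  rw [coeff_smul, Finset.sum_eq_single (0, n)]
  · simp
  · rintro ⟨i, j⟩ hq hne
    have : i ≠ 0 := by
      rintro rfl
      simp at hq
      exact hne (by rw [hq])
    simp [PowerSeries.coeff_C, this]
  · simp

/-- The restriction `S(U) → S(V)[[t]]` of a `K[[t]]`-linear map. -/
def restrictT (F : HomT 𝒰 𝒱) : GSym 𝒰 →ₗ[K] (GSym 𝒱)⟦X⟧ :=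
  { toFun := fun a => F (PowerSeries.C a)
    map_add' := fun a b => by rw [map_add, map_add]
    map_smul' := fun c a => by
      have h : (PowerSeries.C (c • a) : (GSym 𝒰)⟦X⟧) =
          (PowerSeries.C c : K⟦X⟧) • PowerSeries.C a := by
        rw [C_smul]
        exact (constT (GSym 𝒰)).map_smul c a
      rw [h, map_smul, C_smul]
      rfl }

/-- The components `Fₙ : S(U) → S(V)` of `F = ∑ tⁿ Fₙ`. -/
def component (F : HomT 𝒰 𝒱) (n : ℕ) : GSym 𝒰 →ₗ[K] GSym 𝒱 :=
  coeffT (GSym 𝒱) n ∘ₗ restrictT F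

/-- The `K[[t]]`-linear map `∑ tⁿ φₙ` with given components. -/
def ofComponents (φ : ℕ → GSym 𝒰 →ₗ[K] GSym 𝒱) : HomT 𝒰 𝒱 :=
  { toFun := fun a => PowerSeries.mk fun n => ∑ q ∈ Finset.HasAntidiagonal.antidiagonal n,
      φ q.1 (PowerSeries.coeff q.2 a)
    map_add' := fun a b => by
      ext n
      simp [Finset.sum_add_distrib]
    map_smul' := fun p a => by
      ext n
      rw [RingHom.id_apply, coeff_smul, PowerSeries.coeff_mk]
      simp_rw [coeff_smul, PowerSeries.coeff_mk, map_sum, map_smul, Finset.smul_sum]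
      rw [Finset.sum_sigma', Finset.sum_sigma']
      refine Finset.sum_nbij' (fun x => ⟨(x.2.1, x.1.1 + x.2.2), (x.1.1, x.2.2)⟩)
        (fun x => ⟨(x.2.1, x.1.1 + x.2.2), (x.1.1, x.2.2)⟩) ?_ ?_ ?_ ?_ ?_
      · rintro ⟨⟨i, j⟩, ⟨k, l⟩⟩ hx
        simp only [Finset.mem_sigma, Finset.HasAntidiagonal.mem_antidiagonal] at hx ⊢
        obtain ⟨rfl, rfl⟩ := hx
        exact ⟨by omega, trivial⟩
      · rintro ⟨⟨i, j⟩, ⟨k, l⟩⟩ hx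
        simp only [Finset.mem_sigma, Finset.HasAntidiagonal.mem_antidiagonal] at hx ⊢
        obtain ⟨rfl, rfl⟩ := hx
        exact ⟨by omega, trivial⟩
      · rintro ⟨⟨i, j⟩, ⟨k, l⟩⟩ hx
        simp only [Finset.mem_sigma, Finset.HasAntidiagonal.mem_antidiagonal] at hx
        obtain ⟨rfl, rfl⟩ := hx
        rfl
      · rintro ⟨⟨i, j⟩, ⟨k, l⟩⟩ hx
        simp only [Finset.mem_sigma, Finset.HasAntidiagonal.mem_antidiagonal] at hx
        obtain ⟨rfl, rfl⟩ := hx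
        rfl
      · rintro ⟨⟨i, j⟩, ⟨k, l⟩⟩ _
        rfl }

/-- The `K[[t]]`-linear extension of a map `S(U) → S(V)`. -/
def extendT (φ : GSym 𝒰 →ₗ[K] GSym 𝒱) : HomT 𝒰 𝒱 :=
  ofComponents fun n => if n = 0 then φ else 0

/-- `∑_{k ≥ 0} Nᵏ` for an operator `N` divisible by `t`: then `Nᵏ` is divisible by `tᵏ`, and only
the terms with `k ≤ n` contribute to the coefficient of `tⁿ`. -/
def geomT (N : HomT 𝒰 𝒰) : HomT 𝒰 𝒰 :=
  ofComponents fun n => ∑ k ∈ Finset.range (n + 1), component ((N : Module.End K⟦X⟧ _) ^ k) n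

/-- The linear part `U → S(U) → S(V)[[t]] → S(V) → V` of `F`: the component of degree one in `V` of
the restriction to `U` of the coefficient of `t⁰`. -/
def linearPart (F : HomT 𝒰 𝒱) : U →ₗ[K] V :=
  GSym.proj 𝒱 ∘ₗ component F 0 ∘ₗ GSym.ι 𝒰

end PowerSeriesMaps

/-! ## `IBL_∞[1]` algebras and their morphisms -/

section IBLAlgebras

variable {U V : Type*} [AddCommGroup U] [Module K U] [AddCommGroup V] [Module K V]
variable {𝒰 : ℤ → Submodule K U} [DirectSum.Decomposition 𝒰]
variable {𝒱 : ℤ → Submodule K V} [DirectSum.Decomposition 𝒱]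

/-- The Koszul cobracket `S(U) → S(U)^{⊙n}[[t]]` of an operator `δ` of odd degree, for `n ≥ 1`:
the component in `S(U)^{⊙n}` of `E ∘ δ̃ ∘ L` restricted to `C = S(U)`, where
`L(c) = ∑ₖ ((-1)^{k-1}/k) π Δ^{k-1}(c)`, `δ̃` is the derivation
`c₁ ⊙ ⋯ ⊙ cₖ ↦ ∑ⱼ (-1)^{|c₁| + ⋯ + |c_{j-1}|} c₁ ⊙ ⋯ ⊙ δ(cⱼ) ⊙ ⋯ ⊙ cₖ`, and `E` is the algebra
morphism with `E(c) = ∑ᵢ (1/i!) π Δ^{i-1}(c)`. A composition `n = i₁ + ⋯ + iₖ` records the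
components `e_{i₁}, …, e_{iₖ}` of `E` applied to the `k` factors. -/
def koszulCobracket (δ : HomT 𝒰 𝒰) (n : ℕ) : GSym 𝒰 →ₗ[K] (GSym (GSym.degree 𝒰))⟦X⟧ :=
  ∑ c : Composition n, ((-1 : K) ^ (c.length + 1) / (c.length : K)) •
    ∑ j : Fin c.length, convList (List.ofFn fun i : Fin c.length =>
      mapT (coexpTerm 𝒰 (c.blocksFun i)) ∘ₗ
        (if i < j then constT (GSym 𝒰) ∘ₗ parity (GSym.degree 𝒰)
          else if i = j then restrictT δ else constT (GSym 𝒰)))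

/-- The cocumulant `S(U) → S(V)^{⊙n}[[t]]` of an operator `F` of degree zero, for `n ≥ 1`: the
component in `S(V)^{⊙n}` of `E ∘ S(F) ∘ L` restricted to `S(U)`, with `E`, `L` as above. -/
def cocumulant (F : HomT 𝒰 𝒱) (n : ℕ) : GSym 𝒰 →ₗ[K] (GSym (GSym.degree 𝒱))⟦X⟧ :=
  ∑ c : Composition n, ((-1 : K) ^ (c.length + 1) / (c.length : K)) •
    convList (List.ofFn fun i : Fin c.length =>
      mapT (coexpTerm 𝒱 (c.blocksFun i)) ∘ₗ restrictT F)

/-- `δ` is an `IBL_∞[1]` algebra structure on `U`: a degree `-1` derived BV coalgebra structure on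
the symmetric coalgebra `S(U)`. As `|t| = 2`, `δ = ∑ tⁿ δₙ` has degree one when `|δₙ| = 1 - 2n`. -/
structure IsIBLAlgebra (δ : HomT 𝒰 𝒰) : Prop where
  degree_one : ∀ n : ℕ, IsHomogeneousMap (GSym.degree 𝒰) (GSym.degree 𝒰) (1 - 2 * n) (component δ n)
  map_one : δ 1 = 0
  counit : ∀ (n : ℕ) (a : GSym 𝒰), CoalgebraStruct.counit (R := K) (component δ n a) = 0
  sq_zero : δ ∘ₗ δ = 0
  cobracket : ∀ n : ℕ, 2 ≤ n → ∀ a : GSym 𝒰, PowerSeries.X ^ (n - 1) ∣ koszulCobracket δ n a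

/-- `F : S(U)[[t]] → S(V)[[t]]` is a morphism of `IBL_∞[1]` algebras from `(U, δ)` to `(V, δ')`. -/
structure IsIBLMorphism (δ : HomT 𝒰 𝒰) (δ' : HomT 𝒱 𝒱) (F : HomT 𝒰 𝒱) : Prop where
  degree_zero : ∀ n : ℕ, IsHomogeneousMap (GSym.degree 𝒰) (GSym.degree 𝒱) (-2 * n) (component F n)
  map_one : F 1 = 1
  counit : ∀ (n : ℕ) (a : GSym 𝒰), CoalgebraStruct.counit (R := K) (component F n a) =
    if n = 0 then CoalgebraStruct.counit (R := K) a else 0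
  comm : F ∘ₗ δ = δ' ∘ₗ F
  cocumulant : ∀ n : ℕ, 2 ≤ n → ∀ a : GSym 𝒰, PowerSeries.X ^ (n - 1) ∣ cocumulant F n a

end IBLAlgebras

/-! ## Homotopy transfer -/

namespace Contraction

variable {U V : Type*} [AddCommGroup U] [Module K U] [AddCommGroup V] [Module K V]
variable {𝒰 : ℤ → Submodule K U} [DirectSum.Decomposition 𝒰]
variable {𝒱 : ℤ → Submodule K V} [DirectSum.Decomposition 𝒱]
variable {dU : U →ₗ[K] U} {dV : V →ₗ[K] V} (c : Contraction 𝒰 dU 𝒱 dV)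

/-- `S(σ)`. -/
def symσ : GSym 𝒰 →ₗ[K] GSym 𝒱 := (GSym.map c.σ c.σ_degree).toLinearMap

/-- `S(τ)`. -/
def symτ : GSym 𝒱 →ₗ[K] GSym 𝒰 := (GSym.map c.τ c.τ_degree).toLinearMap

/-- The homotopy `ĥ` on `S(U)`. -/
def symh : GSym 𝒰 →ₗ[K] GSym 𝒰 := symmetrizedHomotopy 𝒰 (c.τ ∘ₗ c.σ) c.h

/-! First step: perturbation of the contraction `(S(σ), S(τ), ĥ)` of `(S(U), d̃_U)` onto
`(S(V), d̃_V)` by `δ₀ - d̃_U`. -/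

/-- The perturbation `δ₀⁺ = δ₀ - d̃_U`. -/
def pert₀ (_c : Contraction 𝒰 dU 𝒱 dV) (δ : HomT 𝒰 𝒰) : Module.End K (GSym 𝒰) :=
  component δ 0 - linearCoderivation 𝒰 dU

/-- `δ₀' = d̃_V + ∑ₖ S(σ) δ₀⁺ (ĥ δ₀⁺)ᵏ S(τ)`. -/
def δ₀' (δ : HomT 𝒰 𝒰) : GSym 𝒱 →ₗ[K] GSym 𝒱 :=
  linearCoderivation 𝒱 dV +
    c.symσ ∘ₗ c.pert₀ δ ∘ₗ geomWeight 𝒰 (c.symh ∘ₗ c.pert₀ δ) ∘ₗ c.symτ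

/-- `G₀ = ∑ₖ S(σ) (δ₀⁺ ĥ)ᵏ`. -/
def G₀ (δ : HomT 𝒰 𝒰) : GSym 𝒰 →ₗ[K] GSym 𝒱 :=
  c.symσ ∘ₗ geomWeight 𝒰 (c.pert₀ δ ∘ₗ c.symh)

/-- `F₀ = ∑ₖ (ĥ δ₀⁺)ᵏ S(τ)`. -/
def F₀ (δ : HomT 𝒰 𝒰) : GSym 𝒱 →ₗ[K] GSym 𝒰 :=
  geomWeight 𝒰 (c.symh ∘ₗ c.pert₀ δ) ∘ₗ c.symτ

/-- `H₀ = ∑ₖ (ĥ δ₀⁺)ᵏ ĥ`. -/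
def H₀ (δ : HomT 𝒰 𝒰) : GSym 𝒰 →ₗ[K] GSym 𝒰 :=
  geomWeight 𝒰 (c.symh ∘ₗ c.pert₀ δ) ∘ₗ c.symh

/-! Second step: perturbation of the `K[[t]]`-linear contraction `(G₀, F₀, H₀)` of
`(S(U)[[t]], δ₀)` onto `(S(V)[[t]], δ₀')` by `δ - δ₀`. -/

/-- The perturbation `δ₊ = δ - δ₀ = ∑_{n ≥ 1} tⁿ δₙ`. -/
def pert (_c : Contraction 𝒰 dU 𝒱 dV) (δ : HomT 𝒰 𝒰) : HomT 𝒰 𝒰 :=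
  δ - extendT (component δ 0)

/-- The transferred differential `δ' = δ₀' + ∑ₖ G₀ δ₊ (H₀ δ₊)ᵏ F₀`. -/
def transfer (δ : HomT 𝒰 𝒰) : HomT 𝒱 𝒱 :=
  extendT (c.δ₀' δ) + extendT (c.G₀ δ) ∘ₗ c.pert δ ∘ₗ
    geomT (extendT (c.H₀ δ) ∘ₗ c.pert δ) ∘ₗ extendT (c.F₀ δ)

/-- `G = ∑ₖ G₀ (δ₊ H₀)ᵏ`. -/
def transferG (δ : HomT 𝒰 𝒰) : HomT 𝒰 𝒱 :=
  extendT (c.G₀ δ) ∘ₗ geomT (c.pert δ ∘ₗ extendT (c.H₀ δ))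

/-- `F = ∑ₖ (H₀ δ₊)ᵏ F₀`. -/
def transferF (δ : HomT 𝒰 𝒰) : HomT 𝒱 𝒰 :=
  geomT (extendT (c.H₀ δ) ∘ₗ c.pert δ) ∘ₗ extendT (c.F₀ δ)

end Contraction

end IBL
end

open scoped DirectSum TensorProduct PowerSeries

noncomputable section

namespace IBL

/-! ### Signs and parity twists on graded spaces. -/

section Signs

variable {K : Type*} [Field K]

/-! Write `σ`, `τ` for the maps `g`, `f` of the statement, `e = τσ`, and a tilde for the
coderivation of `S(U)` extending a linear map of `U`. The symmetrized homotopy `ĥ` is not a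
coderivation, so it interacts badly with iterated coproducts. The proof trades it for the
coderivation `h̃`. Let `N` be the coderivation extending `1 - e`. A telescoping sum in the
convolution ring gives `N ĥ = h̃ = ĥ N` (`symN_symh`, `symh_symN`). In characteristic zero `N` is
diagonalizable with eigenvalues `0, 1, 2, …`, and `S(e)` is the projection onto its kernel. Hence an
element of `S(U)` is determined by its images under `N` and `S(σ)` (`ext_symN`), and the contraction
identities for `ĥ` reduce to identities for `h̃`.

The two perturbation steps amount to one: `F = S(τ) + ĥ (δ - d̃) F` and `G = S(σ) + G (δ - d̃) ĥ`.
These equations give `ĥ F = ĥ δ F = 0`, `G ĥ = G δ ĥ = 0`, `S(σ) F = id`, `G S(τ) = id` and `δ' =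
S(σ) δ F = G δ S(τ)` (`IsPerturbation`). Put `P = h̃ δ + δ h̃`. Then `P F = 0` and `G P = 0`, and
`P` commutes with `δ` since `δ² = 0`. As `δ₀` is a coderivation with linear part `d_U`
(`component_zero_eq_conv`), the constant term of `P` in `t` is `-(N + r)`, where `r` lowers the
number of factors. So `P` and `S(σ)` jointly detect elements, and `P` and `S(τ)` jointly detect maps
out of `S(U)` (`eq_zero_of_anticommutator`, `family_eq_zero`). The chain map equations and `δ'² = 0`
follow from this principle, and so do several of the unit and counit conditions.

The conditions on cobrackets and cocumulants come from the same equations lifted to `S(S(U))`. Let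
`z` record the increase of symmetric degree, and call a series admissible if its coefficient of `zⁿ`
is divisible by `tⁿ`; the conditions say that `E δ̃ E⁻¹` and `E S(F) E⁻¹` are admissible on
constants, where `δ̃` is now the derivation of `S(S(U))` extending `δ`. Because `h̃` is a
coderivation, its extension to `S(S(U))` commutes with `E` (`mapS_linearCoderivation_convHom`).
Conjugating the extension of `P` by `E` therefore yields the anticommutator of that of `h̃` with `E
δ̃ E⁻¹`, which is admissible. It annihilates `E S(F) E⁻¹`, while `S(S(e))` maps `E S(F) E⁻¹` to
`S(S(τ))`, which contains no `z`. Its leading term extends `-(N + r)` and is injective on the kernel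
of `S(S(e))`, so induction on the power of `t` shows that `E S(F) E⁻¹` is admissible
(`isAdmissible_of_apply_eq_zero`). A dual argument treats `G`. Finally `E δ̃' E⁻¹ = (E S(G) E⁻¹) (E
δ̃ E⁻¹) S(S(τ))` is a composite of admissible operators. -/

theorem neg_one_zpow_congr {a b : ℤ} (h : Even (a - b)) : (-1 : K) ^ a = (-1 : K) ^ b := by
  have e : a = (a - b) + b := by ring
  rw [e, zpow_add₀ (neg_ne_zero.2 one_ne_zero), h.neg_one_zpow, one_mul]

theorem neg_one_zpow_mul (a b : ℤ) : (-1 : K) ^ a * (-1 : K) ^ b = (-1 : K) ^ (a + b) :=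
  (zpow_add₀ (neg_ne_zero.2 one_ne_zero) a b).symm

end Signs

section Twist

variable {K : Type*} [Field K] {U V M : Type*} [AddCommGroup U] [Module K U] [AddCommGroup V]
  [Module K V] [AddCommGroup M] [Module K M]
variable (𝒰 : ℤ → Submodule K U) [DirectSum.Decomposition 𝒰]

/-- Linear maps that agree on homogeneous elements are equal. -/
theorem homogeneous_ext {f g : U →ₗ[K] M} (h : ∀ i, ∀ x ∈ 𝒰 i, f x = g x) : f = g := by
  ext x
  induction x using DirectSum.Decomposition.inductionOn 𝒰 with
  | zero => simp
  | homogeneous x => exact h _ _ x.2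
  | add x y hx hy => rw [map_add, map_add, hx, hy]

/-- The operator `x ↦ (-1)^{k|x|} x`. -/
def twist (k : ℤ) : U →ₗ[K] U :=
  DirectSum.toModule K ℤ U (fun i => ((-1 : K) ^ (k * i)) • (𝒰 i).subtype) ∘ₗ
    (DirectSum.decomposeLinearEquiv 𝒰).toLinearMap

theorem twist_of_mem (k : ℤ) {i : ℤ} {x : U} (hx : x ∈ 𝒰 i) :
    twist 𝒰 k x = ((-1 : K) ^ (k * i)) • x := by
  rw [twist, LinearMap.comp_apply, LinearEquiv.coe_coe, DirectSum.decomposeLinearEquiv_apply,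
    DirectSum.decompose_of_mem 𝒰 hx]
  erw [DirectSum.toModule_lof]
  rfl

theorem parity_eq_twist : parity 𝒰 = twist 𝒰 1 := by
  simp only [parity, twist, one_mul]

theorem twist_even {k : ℤ} (hk : Even k) : twist 𝒰 k = LinearMap.id := by
  refine homogeneous_ext 𝒰 fun i x hx => ?_
  rw [twist_of_mem 𝒰 k hx, (hk.mul_right i).neg_one_zpow, one_smul]
  rfl

theorem twist_zero : twist 𝒰 0 = LinearMap.id := twist_even 𝒰 Even.zero

theorem twist_twist (k l : ℤ) (x : U) : twist 𝒰 k (twist 𝒰 l x) = twist 𝒰 (k + l) x := by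
  suffices h : twist 𝒰 k ∘ₗ twist 𝒰 l = twist 𝒰 (k + l) from LinearMap.congr_fun h x
  refine homogeneous_ext 𝒰 fun i x hx => ?_
  rw [LinearMap.comp_apply, twist_of_mem 𝒰 _ hx, map_smul, twist_of_mem 𝒰 _ hx, smul_smul,
    twist_of_mem 𝒰 _ hx, neg_one_zpow_mul]
  congr 2
  ring

theorem twist_congr {k l : ℤ} (h : Even (k - l)) : twist 𝒰 k = twist 𝒰 l := by
  refine homogeneous_ext 𝒰 fun i x hx => ?_
  rw [twist_of_mem 𝒰 _ hx, twist_of_mem 𝒰 _ hx, neg_one_zpow_congr]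
  rw [← sub_mul]
  exact h.mul_right i

theorem twist_mem (k : ℤ) {i : ℤ} {x : U} (hx : x ∈ 𝒰 i) : twist 𝒰 k x ∈ 𝒰 i := by
  rw [twist_of_mem 𝒰 k hx]
  exact Submodule.smul_mem _ _ hx

variable {𝒰} {𝒱 : ℤ → Submodule K V} [DirectSum.Decomposition 𝒱]

theorem IsHomogeneousMap.twist_apply {d : ℤ} {φ : U →ₗ[K] V} (hφ : IsHomogeneousMap 𝒰 𝒱 d φ)
    (k : ℤ) (x : U) : twist 𝒱 k (φ x) = ((-1 : K) ^ (k * d)) • φ (twist 𝒰 k x) := by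
  suffices h : twist 𝒱 k ∘ₗ φ = ((-1 : K) ^ (k * d)) • (φ ∘ₗ twist 𝒰 k) from
    LinearMap.congr_fun h x
  refine homogeneous_ext 𝒰 fun i x hx => ?_
  rw [LinearMap.comp_apply, twist_of_mem 𝒱 k (hφ i x hx), LinearMap.smul_apply,
    LinearMap.comp_apply, twist_of_mem 𝒰 k hx, map_smul, smul_smul, neg_one_zpow_mul]
  congr 2
  ring

omit [DirectSum.Decomposition 𝒰] [DirectSum.Decomposition 𝒱] in
theorem IsHomogeneousMap.sub {d : ℤ} {φ ψ : U →ₗ[K] V} (hφ : IsHomogeneousMap 𝒰 𝒱 d φ)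
    (hψ : IsHomogeneousMap 𝒰 𝒱 d ψ) : IsHomogeneousMap 𝒰 𝒱 d (φ - ψ) := fun i x hx =>
  Submodule.sub_mem _ (hφ i x hx) (hψ i x hx)

omit [DirectSum.Decomposition 𝒰] [DirectSum.Decomposition 𝒱] in
theorem IsHomogeneousMap.smul {d : ℤ} {φ : U →ₗ[K] V} (c : K)
    (hφ : IsHomogeneousMap 𝒰 𝒱 d φ) : IsHomogeneousMap 𝒰 𝒱 d (c • φ) := fun i x hx =>
  Submodule.smul_mem _ _ (hφ i x hx)

omit [DirectSum.Decomposition 𝒰] [DirectSum.Decomposition 𝒱] in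
theorem IsHomogeneousMap.zero {d : ℤ} : IsHomogeneousMap 𝒰 𝒱 d (0 : U →ₗ[K] V) :=
  fun _ _ _ => Submodule.zero_mem _

omit [DirectSum.Decomposition 𝒰] in
theorem IsHomogeneousMap.id : IsHomogeneousMap 𝒰 𝒰 0 (LinearMap.id : U →ₗ[K] U) :=
  fun i x hx => by simpa using hx

omit [DirectSum.Decomposition 𝒰] [DirectSum.Decomposition 𝒱] in
theorem IsHomogeneousMap.comp {𝓂 : ℤ → Submodule K M} {d d' d'' : ℤ} {ψ : V →ₗ[K] M}
    {φ : U →ₗ[K] V} (hψ : IsHomogeneousMap 𝒱 𝓂 d' ψ) (hφ : IsHomogeneousMap 𝒰 𝒱 d φ)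
    (h : d + d' = d'') : IsHomogeneousMap 𝒰 𝓂 d'' (ψ ∘ₗ φ) := fun i x hx => by
  rw [← h, ← add_assoc]
  exact hψ _ _ (hφ i x hx)

theorem isHomogeneousMap_twist (k : ℤ) : IsHomogeneousMap 𝒰 𝒰 0 (twist 𝒰 k) := fun i x hx => by
  rw [add_zero]
  exact twist_mem 𝒰 k hx

end Twist

/-! ### Induction principles, sign twists and graded commutativity in the symmetric algebra. -/

namespace GSym

variable {K : Type*} [Field K] {U M : Type*} [AddCommGroup U] [Module K U] [AddCommGroup M]
  [Module K M]

theorem mkAlgHom_surjective (𝒰 : ℤ → Submodule K U) :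
    Function.Surjective (RingQuot.mkAlgHom K (GSymRel 𝒰)) :=
  RingQuot.mkAlgHom_surjective K (GSymRel 𝒰)

/-- Induction on `S(U)`, spanned by the products `x₁ ⊙ ⋯ ⊙ xₙ`. -/
theorem induction (𝒰 : ℤ → Submodule K U) {p : GSym 𝒰 → Prop} (one : p 1)
    (ι_mul : ∀ (x : U) (a : GSym 𝒰), p a → p (ι 𝒰 x * a)) (add : ∀ a b, p a → p b → p (a + b))
    (smul : ∀ (c : K) (a : GSym 𝒰), p a → p (c • a)) (a : GSym 𝒰) : p a := by
  obtain ⟨a, rfl⟩ := mkAlgHom_surjective 𝒰 a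
  suffices h : ∀ b, p b → p (RingQuot.mkAlgHom K (GSymRel 𝒰) a * b) by
    simpa using h 1 one
  induction a using TensorAlgebra.induction with
  | algebraMap r =>
    intro b hb
    rw [AlgHom.commutes, ← Algebra.smul_def]
    exact smul _ _ hb
  | ι x => exact fun b hb => ι_mul x b hb
  | mul a b ha hb =>
    intro c hc
    rw [map_mul, mul_assoc]
    exact ha _ (hb _ hc)
  | add a b ha hb =>
    intro c hc
    rw [map_add, add_mul]
    exact add _ _ (ha _ hc) (hb _ hc)

variable (𝒰 : ℤ → Submodule K U) [DirectSum.Decomposition 𝒰]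

theorem induction_homogeneous {p : GSym 𝒰 → Prop} (one : p 1)
    (ι_mul : ∀ (i : ℤ) (x : U) (a : GSym 𝒰), x ∈ 𝒰 i → p a → p (ι 𝒰 x * a))
    (add : ∀ a b, p a → p b → p (a + b))
    (smul : ∀ (c : K) (a : GSym 𝒰), p a → p (c • a)) (a : GSym 𝒰) : p a := by
  refine induction 𝒰 one (fun x a ha => ?_) add smul a
  induction x using DirectSum.Decomposition.inductionOn 𝒰 with
  | zero => simpa using smul 0 _ ha
  | homogeneous x => exact ι_mul _ _ _ x.2 ha
  | add x y hx hy => rw [map_add, add_mul]; exact add _ _ hx hy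

theorem linearMap_ext {f g : GSym 𝒰 →ₗ[K] M} (one : f 1 = g 1)
    (ι_mul : ∀ (i : ℤ) (x : U) (a : GSym 𝒰), x ∈ 𝒰 i → f a = g a →
      f (ι 𝒰 x * a) = g (ι 𝒰 x * a)) : f = g := by
  ext a
  induction a using induction_homogeneous 𝒰 with
  | one => exact one
  | ι_mul i x a hx ha => exact ι_mul i x a hx ha
  | add a b ha hb => rw [map_add, map_add, ha, hb]
  | smul c a ha => rw [map_smul, map_smul, ha]

/-- Degrees add under multiplication, so the twists are algebra automorphisms. Koszul signs can then
be carried by operators acting on arbitrary elements instead of exponents attached to homogeneous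
ones. -/
theorem twist_mul (k : ℤ) (a b : GSym 𝒰) :
    twist (degree 𝒰) k (a * b) = twist (degree 𝒰) k a * twist (degree 𝒰) k b := by
  suffices h : (LinearMap.mul K (GSym 𝒰)).compr₂ (twist (degree 𝒰) k) =
      (LinearMap.mul K (GSym 𝒰)).compl₁₂ (twist (degree 𝒰) k) (twist (degree 𝒰) k) from
    LinearMap.congr_fun₂ h a b
  refine homogeneous_ext (degree 𝒰) fun i a ha => homogeneous_ext (degree 𝒰) fun j b hb => ?_
  simp only [LinearMap.compr₂_apply, LinearMap.mul_apply', LinearMap.compl₁₂_apply]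
  rw [twist_of_mem _ k ha, twist_of_mem _ k hb, twist_of_mem _ k (SetLike.mul_mem_graded ha hb),
    smul_mul_smul_comm, neg_one_zpow_mul, mul_add]

theorem twist_one (k : ℤ) : twist (degree 𝒰) k (1 : GSym 𝒰) = 1 := by
  rw [twist_of_mem _ k SetLike.GradedOne.one_mem, mul_zero, zpow_zero, one_smul]

theorem twist_ι (k : ℤ) (x : U) : twist (degree 𝒰) k (ι 𝒰 x) = ι 𝒰 (twist 𝒰 k x) := by
  suffices h : twist (degree 𝒰) k ∘ₗ ι 𝒰 = ι 𝒰 ∘ₗ twist 𝒰 k from LinearMap.congr_fun h x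
  refine homogeneous_ext 𝒰 fun i x hx => ?_
  rw [LinearMap.comp_apply, LinearMap.comp_apply, twist_of_mem _ k (ι_mem_degree 𝒰 hx),
    twist_of_mem _ k hx, map_smul]

theorem ι_mul_eq {i : ℤ} {x : U} (hx : x ∈ 𝒰 i) (b : GSym 𝒰) :
    ι 𝒰 x * b = twist (degree 𝒰) i b * ι 𝒰 x := by
  induction b using induction_homogeneous 𝒰 with
  | one => rw [twist_one, mul_one, one_mul]
  | ι_mul j y b hy hb =>
    rw [← mul_assoc, ι_mul_ι 𝒰 hx hy, smul_mul_assoc, mul_assoc, hb, twist_mul, twist_ι,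
      twist_of_mem 𝒰 i hy, map_smul, smul_mul_assoc, smul_mul_assoc, mul_assoc]
  | add a b ha hb => rw [mul_add, ha, hb, map_add, add_mul]
  | smul c a ha => rw [mul_smul_comm, ha, map_smul, smul_mul_assoc]

/-- Graded commutativity of `S(U)`. -/
theorem mul_eq_twist_mul {i : ℤ} {a : GSym 𝒰} (ha : a ∈ degree 𝒰 i) (b : GSym 𝒰) :
    a * b = twist (degree 𝒰) i b * a := by
  induction ha using Submodule.span_induction with
  | mem a h =>
    obtain ⟨l, hl, rfl, rfl⟩ := h
    clear * - hl
    induction l generalizing b with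
    | nil => simp [twist_zero]
    | cons p l ih =>
      have hl' : ∀ q ∈ l, q.2 ∈ 𝒰 q.1 := fun q hq => hl q (List.mem_cons_of_mem _ hq)
      simp only [List.map_cons, List.prod_cons, List.sum_cons]
      rw [mul_assoc, ih _ hl', ← mul_assoc, ι_mul_eq 𝒰 (hl p List.mem_cons_self), twist_twist,
        mul_assoc]
  | zero => simp
  | add a b ha hb iha ihb => rw [add_mul, iha, ihb, mul_add]
  | smul c a ha ih => rw [smul_mul_assoc, ih, mul_smul_comm]

theorem mul_comm_graded {i j : ℤ} {a b : GSym 𝒰} (ha : a ∈ degree 𝒰 i) (hb : b ∈ degree 𝒰 j) :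
    a * b = ((-1 : K) ^ (i * j)) • (b * a) := by
  rw [mul_eq_twist_mul 𝒰 ha, twist_of_mem _ i hb, smul_mul_assoc]

/-! ### The coproduct -/

theorem comul_eq (a : GSym 𝒰) : CoalgebraStruct.comul (R := K) a =
    (GradedTensorProduct.of K (degree 𝒰) (degree 𝒰)).symm (comulAlgHom 𝒰 a) := rfl

theorem comul_one : CoalgebraStruct.comul (R := K) (1 : GSym 𝒰) = 1 ⊗ₜ[K] (1 : GSym 𝒰) := by
  rw [comul_eq, map_one]
  rfl

/-- The coproduct is multiplicative; in the summand `1 ⊗ x`, moving `x` past the left tensor factor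
costs a Koszul sign, which is the twist. Together with `comul_one` this recursion replaces explicit
sums over unshuffles. -/
theorem comul_ι_mul {i : ℤ} {x : U} (hx : x ∈ 𝒰 i) (a : GSym 𝒰) :
    CoalgebraStruct.comul (R := K) (ι 𝒰 x * a) =
      TensorProduct.map (LinearMap.mulLeft K (ι 𝒰 x)) LinearMap.id
        (CoalgebraStruct.comul (R := K) a) +
      TensorProduct.map (twist (degree 𝒰) i) (LinearMap.mulLeft K (ι 𝒰 x))
        (CoalgebraStruct.comul (R := K) a) := by
  rw [comul_eq, comul_eq, map_mul]
  have hι : comulAlgHom 𝒰 (ι 𝒰 x) = GradedTensorProduct.tmul K (ι 𝒰 x) 1 +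
      GradedTensorProduct.tmul K 1 (ι 𝒰 x) := lift_ι 𝒰 _ _ _
  rw [hι]
  generalize comulAlgHom 𝒰 a = t
  suffices h : GradedTensorProduct.mulHom (degree 𝒰) (degree 𝒰)
      (GradedTensorProduct.tmul K (ι 𝒰 x) (1 : GSym 𝒰) +
        GradedTensorProduct.tmul K (1 : GSym 𝒰) (ι 𝒰 x)) =
      (GradedTensorProduct.of K (degree 𝒰) (degree 𝒰)).toLinearMap ∘ₗ
      (TensorProduct.map (LinearMap.mulLeft K (ι 𝒰 x)) LinearMap.id +
        TensorProduct.map (twist (degree 𝒰) i) (LinearMap.mulLeft K (ι 𝒰 x))) ∘ₗ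
        (GradedTensorProduct.of K (degree 𝒰) (degree 𝒰)).symm.toLinearMap by
    exact congrArg (GradedTensorProduct.of K (degree 𝒰) (degree 𝒰)).symm (LinearMap.congr_fun h t)
  refine GradedTensorProduct.hom_ext _ _ (TensorProduct.ext ?_)
  refine homogeneous_ext (degree 𝒰) fun j a ha => ?_
  ext b
  change (GradedTensorProduct.tmul K (𝒜 := degree 𝒰) (ℬ := degree 𝒰) (ι 𝒰 x) 1 +
      GradedTensorProduct.tmul K 1 (ι 𝒰 x)) * GradedTensorProduct.tmul K a b =
    GradedTensorProduct.tmul K (ι 𝒰 x * a) b +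
      GradedTensorProduct.tmul K (twist (degree 𝒰) i a) (ι 𝒰 x * b)
  rw [add_mul]
  congr 1
  · have h := GradedTensorProduct.tmul_one_mul_coe_tmul (R := K) (degree 𝒰) (degree 𝒰)
      (ι 𝒰 x) ⟨a, ha⟩ b
    exact h
  · have h := GradedTensorProduct.tmul_coe_mul_coe_tmul (R := K) (degree 𝒰) (degree 𝒰)
      (1 : GSym 𝒰) ⟨ι 𝒰 x, ι_mem_degree 𝒰 hx⟩ ⟨a, ha⟩ b
    rw [one_mul] at h
    refine h.trans ?_
    rw [twist_of_mem _ i ha, Units.smul_def, ← Int.cast_smul_eq_zsmul K]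
    have e : (((-1 : ℤˣ) ^ (i * j) : ℤˣ) : ℤ) = (i * j).negOnePow := rfl
    rw [e, Int.cast_negOnePow]
    simp only [GradedTensorProduct.tmul]
    rw [← LinearEquiv.map_smul, TensorProduct.smul_tmul']

theorem counit_one : CoalgebraStruct.counit (R := K) (1 : GSym 𝒰) = 1 :=
  map_one (counitAlgHom 𝒰)

theorem counit_ι_mul (x : U) (a : GSym 𝒰) :
    CoalgebraStruct.counit (R := K) (ι 𝒰 x * a) = 0 := by
  change counitAlgHom 𝒰 (ι 𝒰 x * a) = 0
  have h : counitAlgHom 𝒰 (ι 𝒰 x) = 0 := lift_ι 𝒰 _ _ _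
  rw [map_mul, h, zero_mul]

omit [DirectSum.Decomposition 𝒰] in
theorem proj_one : proj 𝒰 1 = 0 := by
  let _ : Module Kᵐᵒᵖ U := Module.compHom _ ((RingHom.id K).fromOpposite mul_comm)
  have _ : IsCentralScalar K U := ⟨fun _ _ => rfl⟩
  have hc : ∀ (i j : ℤ) (x y : U), x ∈ 𝒰 i → y ∈ 𝒰 j →
      TrivSqZeroExt.inrHom K U x * TrivSqZeroExt.inrHom K U y =
        ((-1 : K) ^ (i * j)) • (TrivSqZeroExt.inrHom K U y * TrivSqZeroExt.inrHom K U x) := by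
    intro i j x y _ _
    simp [TrivSqZeroExt.inrHom_apply]
  have h : (lift 𝒰 (TrivSqZeroExt.inrHom K U) hc 1).snd = 0 := by
    rw [map_one, TrivSqZeroExt.snd_one]
  exact h

theorem counit_eq_algHom (a : GSym 𝒰) : CoalgebraStruct.counit (R := K) a = counitAlgHom 𝒰 a := rfl

/-- `p` is the second coordinate of an algebra morphism into the square-zero extension of `K` by
`U`. The first coordinate of that morphism is the counit, and this is all that a generator sees of
its cofactor. -/
theorem proj_ι_mul (x : U) (a : GSym 𝒰) :
    proj 𝒰 (ι 𝒰 x * a) = CoalgebraStruct.counit (R := K) a • x := by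
  let _ : Module Kᵐᵒᵖ U := Module.compHom _ ((RingHom.id K).fromOpposite mul_comm)
  have _ : IsCentralScalar K U := ⟨fun _ _ => rfl⟩
  have hc : ∀ (i j : ℤ) (x y : U), x ∈ 𝒰 i → y ∈ 𝒰 j →
      TrivSqZeroExt.inrHom K U x * TrivSqZeroExt.inrHom K U y =
        ((-1 : K) ^ (i * j)) • (TrivSqZeroExt.inrHom K U y * TrivSqZeroExt.inrHom K U x) := by
    intro i j x y _ _
    simp [TrivSqZeroExt.inrHom_apply]
  let F := lift 𝒰 (TrivSqZeroExt.inrHom K U) hc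
  have e : ∀ b, proj 𝒰 b = (F b).snd := fun b => rfl
  have hF : (TrivSqZeroExt.fstHom K K U).comp F = counitAlgHom 𝒰 := by
    refine algHom_ext 𝒰 fun y => ?_
    rw [AlgHom.comp_apply]
    have h1 : F (ι 𝒰 y) = TrivSqZeroExt.inr y := lift_ι 𝒰 _ hc y
    have h2 : counitAlgHom 𝒰 (ι 𝒰 y) = 0 := lift_ι 𝒰 _ _ _
    rw [h1, h2]
    rfl
  have h1 : F (ι 𝒰 x) = TrivSqZeroExt.inr x := lift_ι 𝒰 _ hc x
  rw [e, map_mul, h1, TrivSqZeroExt.snd_mul, TrivSqZeroExt.snd_inr, TrivSqZeroExt.fst_inr, zero_smul,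
    zero_add, counit_eq_algHom, ← hF]
  rfl

theorem proj_ι (x : U) : proj 𝒰 (ι 𝒰 x) = x := by
  have h := proj_ι_mul 𝒰 x 1
  rwa [mul_one, counit_one, one_smul] at h

end GSym

/-! ### The symmetric algebra as a coalgebra. -/

namespace GSym

variable {K : Type*} [Field K] {U V : Type*} [AddCommGroup U] [Module K U] [AddCommGroup V]
  [Module K V]
variable (𝒰 : ℤ → Submodule K U) [DirectSum.Decomposition 𝒰]
variable {𝒱 : ℤ → Submodule K V} [DirectSum.Decomposition 𝒱]

theorem comul_comp_mulLeft {i : ℤ} {x : U} (hx : x ∈ 𝒰 i) :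
    CoalgebraStruct.comul (R := K) ∘ₗ LinearMap.mulLeft K (ι 𝒰 x) =
      (TensorProduct.map (LinearMap.mulLeft K (ι 𝒰 x)) LinearMap.id +
        TensorProduct.map (twist (degree 𝒰) i) (LinearMap.mulLeft K (ι 𝒰 x))) ∘ₗ
      CoalgebraStruct.comul (R := K) :=
  LinearMap.ext fun a => comul_ι_mul 𝒰 hx a

theorem twist_ι_mul (k : ℤ) {i : ℤ} {x : U} (hx : x ∈ 𝒰 i) (a : GSym 𝒰) :
    twist (degree 𝒰) k (ι 𝒰 x * a) = ((-1 : K) ^ (k * i)) • (ι 𝒰 x * twist (degree 𝒰) k a) := by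
  rw [twist_mul, twist_ι, twist_of_mem 𝒰 k hx, map_smul, smul_mul_assoc]

theorem twist_comp_mulLeft (k : ℤ) {i : ℤ} {x : U} (hx : x ∈ 𝒰 i) :
    twist (degree 𝒰) k ∘ₗ LinearMap.mulLeft K (ι 𝒰 x) =
      ((-1 : K) ^ (k * i)) • (LinearMap.mulLeft K (ι 𝒰 x) ∘ₗ twist (degree 𝒰) k) :=
  LinearMap.ext fun a => twist_ι_mul 𝒰 k hx a

theorem twist_comp_twist (k l : ℤ) :
    twist (degree 𝒰) k ∘ₗ twist (degree 𝒰) l = twist (degree 𝒰) (k + l) :=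
  LinearMap.ext fun a => twist_twist _ k l a

theorem comul_twist (k : ℤ) (a : GSym 𝒰) :
    CoalgebraStruct.comul (R := K) (twist (degree 𝒰) k a) =
      TensorProduct.map (twist (degree 𝒰) k) (twist (degree 𝒰) k)
        (CoalgebraStruct.comul (R := K) a) := by
  suffices h : CoalgebraStruct.comul (R := K) ∘ₗ twist (degree 𝒰) k =
      TensorProduct.map (twist (degree 𝒰) k) (twist (degree 𝒰) k) ∘ₗ
        CoalgebraStruct.comul (R := K) from LinearMap.congr_fun h a
  refine linearMap_ext (M := GSym 𝒰 ⊗[K] GSym 𝒰) 𝒰 ?_ fun i x a hx ha => ?_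
  · simp only [LinearMap.comp_apply, twist_one, comul_one, TensorProduct.map_tmul]
  · simp only [LinearMap.comp_apply] at ha ⊢
    rw [twist_ι_mul 𝒰 k hx, map_smul, comul_ι_mul 𝒰 hx, comul_ι_mul 𝒰 hx, ha, map_add, smul_add]
    rw [TensorProduct.map_map, TensorProduct.map_map, TensorProduct.map_map, TensorProduct.map_map]
    rw [twist_comp_mulLeft 𝒰 k hx, twist_comp_twist, twist_comp_twist, add_comm i k,
      TensorProduct.map_smul_left, TensorProduct.map_smul_right]
    rfl

/-- Coassociativity and the counit laws make convolution an associative unital product, in which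
iterated coproducts become powers. Each axiom is checked by adding one generator at a time through
`comul_ι_mul`. -/
instance : Coalgebra K (GSym 𝒰) where
  coassoc := by
    refine linearMap_ext (M := GSym 𝒰 ⊗[K] (GSym 𝒰 ⊗[K] GSym 𝒰)) 𝒰 ?_ fun i x a hx ha => ?_
    · simp only [LinearMap.comp_apply, comul_one, LinearMap.rTensor_tmul, LinearMap.lTensor_tmul,
        LinearEquiv.coe_coe, TensorProduct.assoc_tmul]
    · simp only [LinearMap.comp_apply, LinearEquiv.coe_coe] at ha ⊢
      have hassoc : ∀ (f g h : GSym 𝒰 →ₗ[K] GSym 𝒰) t,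
          TensorProduct.assoc K _ _ _ (TensorProduct.map (TensorProduct.map f g) h t) =
            TensorProduct.map f (TensorProduct.map g h) (TensorProduct.assoc K _ _ _ t) :=
        fun f g h t => LinearMap.congr_fun (TensorProduct.map_map_comp_assoc_eq f g h).symm t
      have hr : ∀ (f g : GSym 𝒰 →ₗ[K] GSym 𝒰) (F : Module.End K (GSym 𝒰 ⊗[K] GSym 𝒰)) t,
          CoalgebraStruct.comul (R := K) ∘ₗ f = F ∘ₗ CoalgebraStruct.comul (R := K) →
          LinearMap.rTensor _ (CoalgebraStruct.comul (R := K)) (TensorProduct.map f g t) =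
          TensorProduct.map F g (LinearMap.rTensor _ (CoalgebraStruct.comul (R := K)) t) := by
        intro f g F t h
        rw [LinearMap.rTensor, TensorProduct.map_map, TensorProduct.map_map, h]
        rfl
      have hl : ∀ (f g : GSym 𝒰 →ₗ[K] GSym 𝒰) (F : Module.End K (GSym 𝒰 ⊗[K] GSym 𝒰)) t,
          CoalgebraStruct.comul (R := K) ∘ₗ g = F ∘ₗ CoalgebraStruct.comul (R := K) →
          LinearMap.lTensor _ (CoalgebraStruct.comul (R := K)) (TensorProduct.map f g t) =
          TensorProduct.map f F (LinearMap.lTensor _ (CoalgebraStruct.comul (R := K)) t) := by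
        intro f g F t h
        rw [LinearMap.lTensor, TensorProduct.map_map, TensorProduct.map_map, h]
        rfl
      have htw : CoalgebraStruct.comul (R := K) ∘ₗ twist (degree 𝒰) i =
        TensorProduct.map (twist (degree 𝒰) i) (twist (degree 𝒰) i) ∘ₗ
          CoalgebraStruct.comul (R := K) := LinearMap.ext fun a => comul_twist 𝒰 i a
      rw [comul_ι_mul 𝒰 hx, map_add, map_add, map_add, hr _ _ _ _ (comul_comp_mulLeft 𝒰 hx),
        hr _ _ _ _ htw, hl _ _ LinearMap.id _ (by rw [LinearMap.comp_id, LinearMap.id_comp]),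
        hl _ _ _ _ (comul_comp_mulLeft 𝒰 hx),
        TensorProduct.map_add_left, TensorProduct.map_add_right, LinearMap.add_apply,
        LinearMap.add_apply, map_add, hassoc, hassoc, hassoc, ha, TensorProduct.map_id, add_assoc]
  rTensor_counit_comp_comul := by
    refine linearMap_ext (M := K ⊗[K] GSym 𝒰) 𝒰 ?_ fun i x a hx ha => ?_
    · simp only [LinearMap.comp_apply, comul_one, LinearMap.rTensor_tmul, counit_one,
        TensorProduct.mk_apply]
    · simp only [LinearMap.comp_apply, TensorProduct.mk_apply] at ha ⊢
      have h1 : CoalgebraStruct.counit (R := K) ∘ₗ LinearMap.mulLeft K (ι 𝒰 x) = 0 :=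
        LinearMap.ext fun a => counit_ι_mul 𝒰 x a
      have h2 : CoalgebraStruct.counit (R := K) ∘ₗ twist (degree 𝒰) i =
          CoalgebraStruct.counit (R := K) := by
        refine linearMap_ext 𝒰 ?_ fun j y b hy hb => ?_
        · rw [LinearMap.comp_apply, twist_one]
        · rw [LinearMap.comp_apply, twist_ι_mul 𝒰 i hy, map_smul, counit_ι_mul, counit_ι_mul,
            smul_zero]
      rw [comul_ι_mul 𝒰 hx, map_add, LinearMap.rTensor, TensorProduct.map_map, TensorProduct.map_map, h1, h2,
        TensorProduct.map_zero_left, LinearMap.zero_apply, zero_add, LinearMap.id_comp]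
      have h3 : TensorProduct.map (CoalgebraStruct.counit (R := K) (A := GSym 𝒰)) (LinearMap.mulLeft K (ι 𝒰 x)) =
          TensorProduct.map LinearMap.id (LinearMap.mulLeft K (ι 𝒰 x)) ∘ₗ
            LinearMap.rTensor (GSym 𝒰) (CoalgebraStruct.counit (R := K)) := by
        rw [LinearMap.rTensor, ← TensorProduct.map_comp]
        rfl
      rw [h3, LinearMap.comp_apply, ha, TensorProduct.map_tmul]
      rfl
  lTensor_counit_comp_comul := by
    refine linearMap_ext (M := GSym 𝒰 ⊗[K] K) 𝒰 ?_ fun i x a hx ha => ?_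
    · simp only [LinearMap.comp_apply, comul_one, LinearMap.lTensor_tmul, counit_one,
        TensorProduct.mk_apply, LinearMap.flip_apply]
    · simp only [LinearMap.comp_apply, TensorProduct.mk_apply, LinearMap.flip_apply] at ha ⊢
      have h1 : CoalgebraStruct.counit (R := K) ∘ₗ LinearMap.mulLeft K (ι 𝒰 x) = 0 :=
        LinearMap.ext fun a => counit_ι_mul 𝒰 x a
      rw [comul_ι_mul 𝒰 hx, map_add, LinearMap.lTensor, TensorProduct.map_map, TensorProduct.map_map, h1,
        TensorProduct.map_zero_right, LinearMap.zero_apply, add_zero, LinearMap.id_comp]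
      have h3 : TensorProduct.map (LinearMap.mulLeft K (ι 𝒰 x))
          (CoalgebraStruct.counit (R := K) (A := GSym 𝒰) ∘ₗ LinearMap.id) =
          TensorProduct.map (LinearMap.mulLeft K (ι 𝒰 x)) (LinearMap.id : K →ₗ[K] K) ∘ₗ
            LinearMap.lTensor (GSym 𝒰) (CoalgebraStruct.counit (R := K)) := by
        rw [LinearMap.lTensor, ← TensorProduct.map_comp]
        rfl
      rw [h3, LinearMap.comp_apply, ha, TensorProduct.map_tmul]
      rfl

end GSym

/-! ### Convolution -/

section Convolution

variable {K : Type*} [Field K]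

section Coalgebra

variable {C A B : Type*} [AddCommGroup C] [Module K C] [CoalgebraStruct K C] [Ring A] [Algebra K A]
  [Ring B] [Algebra K B]

theorem conv_apply (φ ψ : C →ₗ[K] A) (c : C) : conv φ ψ c =
    LinearMap.mul' K A (TensorProduct.map φ ψ (CoalgebraStruct.comul c)) := rfl

theorem conv_add (φ ψ χ : C →ₗ[K] A) : conv φ (ψ + χ) = conv φ ψ + conv φ χ := by
  simp only [conv, TensorProduct.map_add_right, LinearMap.add_comp, LinearMap.comp_add]

theorem add_conv (φ ψ χ : C →ₗ[K] A) : conv (φ + ψ) χ = conv φ χ + conv ψ χ := by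
  simp only [conv, TensorProduct.map_add_left, LinearMap.add_comp, LinearMap.comp_add]

theorem conv_smul (c : K) (φ ψ : C →ₗ[K] A) : conv φ (c • ψ) = c • conv φ ψ := by
  simp only [conv, TensorProduct.map_smul_right, LinearMap.smul_comp, LinearMap.comp_smul]

theorem smul_conv (c : K) (φ ψ : C →ₗ[K] A) : conv (c • φ) ψ = c • conv φ ψ := by
  simp only [conv, TensorProduct.map_smul_left, LinearMap.smul_comp, LinearMap.comp_smul]

/-- The convolution product as a bilinear map. -/
def convBilin (C A : Type*) [AddCommGroup C] [Module K C] [CoalgebraStruct K C] [Ring A]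
    [Algebra K A] : (C →ₗ[K] A) →ₗ[K] (C →ₗ[K] A) →ₗ[K] (C →ₗ[K] A) :=
  LinearMap.mk₂ K conv add_conv smul_conv conv_add conv_smul

theorem conv_sum {κ : Type*} (s : Finset κ) (φ : C →ₗ[K] A) (ψ : κ → C →ₗ[K] A) :
    conv φ (∑ i ∈ s, ψ i) = ∑ i ∈ s, conv φ (ψ i) :=
  map_sum (convBilin C A φ) ψ s

theorem sub_conv (φ ψ χ : C →ₗ[K] A) : conv (φ - ψ) χ = conv φ χ - conv ψ χ :=
  LinearMap.congr_fun (map_sub (convBilin C A) φ ψ) χ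

theorem conv_zero (φ : C →ₗ[K] A) : conv φ 0 = 0 := map_zero (convBilin C A φ)

theorem zero_conv (φ : C →ₗ[K] A) : conv 0 φ = 0 :=
  LinearMap.congr_fun (map_zero (convBilin C A)) φ

/-- A twisted product rule passes to convolution products. -/
theorem comp_conv_of_add {D D₁ D₂ E₁ E₂ : A →ₗ[K] B}
    (h : ∀ a b, D (a * b) = D₁ a * E₁ b + E₂ a * D₂ b) (φ ψ : C →ₗ[K] A) :
    D ∘ₗ conv φ ψ = conv (D₁ ∘ₗ φ) (E₁ ∘ₗ ψ) + conv (E₂ ∘ₗ φ) (D₂ ∘ₗ ψ) := by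
  have e : D ∘ₗ LinearMap.mul' K A = LinearMap.mul' K B ∘ₗ
      (TensorProduct.map D₁ E₁ + TensorProduct.map E₂ D₂) := by
    ext a b
    simpa using h a b
  ext c
  rw [LinearMap.comp_apply, conv_apply, ← LinearMap.comp_apply, e, LinearMap.comp_apply,
    LinearMap.add_apply, TensorProduct.map_map, TensorProduct.map_map, map_add]
  rfl

theorem comp_conv {f : A →ₗ[K] B} (h : ∀ a b, f (a * b) = f a * f b) (φ ψ : C →ₗ[K] A) :
    f ∘ₗ conv φ ψ = conv (f ∘ₗ φ) (f ∘ₗ ψ) := by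
  have e := comp_conv_of_add (D := f) (D₁ := f) (E₁ := f) (D₂ := 0) (E₂ := 0)
    (fun a b => by simpa using h a b) φ ψ
  rwa [LinearMap.zero_comp, zero_conv, add_zero] at e

theorem comp_convList {f : A →ₗ[K] B} (h : ∀ a b, f (a * b) = f a * f b)
    (h1 : ∀ c : K, f (algebraMap K A c) = algebraMap K B c) (l : List (C →ₗ[K] A)) :
    f ∘ₗ convList l = convList (l.map (f ∘ₗ ·)) := by
  induction l with
  | nil => exact LinearMap.ext fun c => h1 _
  | cons φ l ih =>
    change f ∘ₗ conv φ (convList l) = conv (f ∘ₗ φ) (convList (l.map (f ∘ₗ ·)))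
    rw [comp_conv h, ih]

theorem convList_cons (φ : C →ₗ[K] A) (l : List (C →ₗ[K] A)) :
    convList (φ :: l) = conv φ (convList l) := rfl

theorem convList_nil : convList ([] : List (C →ₗ[K] A)) =
    Algebra.linearMap K A ∘ₗ CoalgebraStruct.counit := rfl

end Coalgebra

section Ring

variable {C A : Type*} [AddCommGroup C] [Module K C] [Coalgebra K C] [Ring A] [Algebra K A]

theorem conv_eq_mul (φ ψ : C →ₗ[K] A) :
    conv φ ψ = (WithConv.toConv φ * WithConv.toConv ψ).ofConv := rfl

theorem conv_assoc (φ ψ χ : C →ₗ[K] A) : conv (conv φ ψ) χ = conv φ (conv ψ χ) :=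
  congrArg WithConv.ofConv
    (mul_assoc (WithConv.toConv φ) (WithConv.toConv ψ) (WithConv.toConv χ))

theorem convList_eq_prod (l : List (C →ₗ[K] A)) :
    convList l = (l.map WithConv.toConv).prod.ofConv := by
  induction l with
  | nil => rfl
  | cons φ l ih => rw [convList_cons, ih, conv_eq_mul, List.map_cons, List.prod_cons]

theorem convList_replicate (n : ℕ) (φ : C →ₗ[K] A) :
    convList (List.replicate n φ) = (WithConv.toConv φ ^ n).ofConv := by
  rw [convList_eq_prod, List.map_replicate, List.prod_replicate]

theorem conv_nil (φ : C →ₗ[K] A) : conv φ (convList []) = φ := by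
  rw [convList_eq_prod, conv_eq_mul]
  simp

end Ring

end Convolution

section Convolution

variable {K : Type*} [Field K] {C A B : Type*} [AddCommGroup C] [Module K C] [Ring A] [Algebra K A]
  [Ring B] [Algebra K B]

theorem mulLeft_comp_conv [CoalgebraStruct K C] (b : A) (φ ψ : C →ₗ[K] A) :
    LinearMap.mulLeft K b ∘ₗ conv φ ψ = conv (LinearMap.mulLeft K b ∘ₗ φ) ψ := by
  have e := comp_conv_of_add (D := LinearMap.mulLeft K b) (D₁ := LinearMap.mulLeft K b)
    (E₁ := LinearMap.id) (D₂ := 0) (E₂ := 0) (fun a c => by simp [mul_assoc]) φ ψ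
  rwa [LinearMap.zero_comp, zero_conv, add_zero, LinearMap.id_comp] at e

theorem mulRight_comp_conv [CoalgebraStruct K C] (b : A) (φ ψ : C →ₗ[K] A) :
    conv (LinearMap.mulRight K b ∘ₗ φ) ψ = conv φ (LinearMap.mulLeft K b ∘ₗ ψ) := by
  have e : LinearMap.mul' K A ∘ₗ TensorProduct.map (LinearMap.mulRight K b) LinearMap.id =
      LinearMap.mul' K A ∘ₗ TensorProduct.map LinearMap.id (LinearMap.mulLeft K b) := by
    ext a c
    simp [mul_assoc]
  ext c
  have h := LinearMap.congr_fun e (TensorProduct.map φ ψ (CoalgebraStruct.comul c))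
  rw [LinearMap.comp_apply, LinearMap.comp_apply, TensorProduct.map_map, TensorProduct.map_map] at h
  exact h

theorem one_conv [Coalgebra K C] (ψ : C →ₗ[K] A) : conv (convList []) ψ = ψ := by
  rw [convList_eq_prod, conv_eq_mul]
  simp

theorem counit_smulRight_conv [Coalgebra K C] (b : A) (ψ : C →ₗ[K] A) (c : C) :
    conv (LinearMap.smulRight (CoalgebraStruct.counit (R := K) (A := C)) b) ψ c = b * ψ c := by
  have e : LinearMap.smulRight (CoalgebraStruct.counit (R := K) (A := C)) b =
      LinearMap.mulLeft K b ∘ₗ convList [] := by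
    ext c
    simp [convList_nil, Algebra.smul_def, Algebra.commutes]
  rw [e, ← mulLeft_comp_conv, one_conv]
  rfl

end Convolution

/-! ### Convolution on the symmetric algebra: functoriality and signs. -/

namespace GSym

variable {K : Type*} [Field K] {U V : Type*} [AddCommGroup U] [Module K U] [AddCommGroup V]
  [Module K V]
variable (𝒰 : ℤ → Submodule K U) [DirectSum.Decomposition 𝒰]
variable {𝒱 : ℤ → Submodule K V}
variable {B : Type*} [Ring B] [Algebra K B]

theorem conv_one (φ ψ : GSym 𝒰 →ₗ[K] B) : conv φ ψ 1 = φ 1 * ψ 1 := by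
  rw [conv_apply, comul_one, TensorProduct.map_tmul, LinearMap.mul'_apply]

/-- The coproduct recursion with the tensor product eliminated. Inductions built on it let both maps
vary, since removing a generator changes them. -/
theorem conv_ι_mul (φ ψ : GSym 𝒰 →ₗ[K] B) {i : ℤ} {x : U} (hx : x ∈ 𝒰 i) (a : GSym 𝒰) :
    conv φ ψ (ι 𝒰 x * a) = conv (φ ∘ₗ LinearMap.mulLeft K (ι 𝒰 x)) ψ a +
      conv (φ ∘ₗ twist (degree 𝒰) i) (ψ ∘ₗ LinearMap.mulLeft K (ι 𝒰 x)) a := by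
  rw [conv_apply, comul_ι_mul 𝒰 hx, map_add, TensorProduct.map_map, TensorProduct.map_map, map_add]
  rfl

omit [DirectSum.Decomposition 𝒰] in
theorem map_ι (f : U →ₗ[K] V) (hf : IsHomogeneousMap 𝒰 𝒱 0 f) (x : U) :
    map f hf (ι 𝒰 x) = ι 𝒱 (f x) := lift_ι 𝒰 _ _ x

omit [DirectSum.Decomposition 𝒰] in
theorem map_degree (f : U →ₗ[K] V) (hf : IsHomogeneousMap 𝒰 𝒱 0 f) :
    IsHomogeneousMap (degree 𝒰) (degree 𝒱) 0 (map f hf).toLinearMap := by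
  intro d a ha
  rw [add_zero, AlgHom.toLinearMap_apply]
  induction ha using Submodule.span_induction with
  | mem a h =>
    obtain ⟨l, hl, rfl, rfl⟩ := h
    rw [map_list_prod]
    refine Submodule.subset_span ⟨l.map fun p => (p.1, f p.2), ?_, ?_, ?_⟩
    · intro p hp
      obtain ⟨q, hq, rfl⟩ := List.mem_map.1 hp
      simpa using hf _ _ (hl q hq)
    · rw [List.map_map]; rfl
    · rw [List.map_map, List.map_map]
      congr 1
      refine List.map_congr_left fun p _ => ?_
      simp [map_ι]
  | zero => rw [map_zero]; exact Submodule.zero_mem _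
  | add a b _ _ iha ihb => rw [map_add]; exact Submodule.add_mem _ iha ihb
  | smul c a _ ih => rw [map_smul]; exact Submodule.smul_mem _ _ ih

/-- A map of degree zero commutes with the twists, so `S(f)` respects the coproduct recursion: it is
a coalgebra morphism, expressed here through convolution. -/
theorem conv_comp_map [DirectSum.Decomposition 𝒱] (f : U →ₗ[K] V) (hf : IsHomogeneousMap 𝒰 𝒱 0 f)
    (φ ψ : GSym 𝒱 →ₗ[K] B) : conv φ ψ ∘ₗ (map f hf).toLinearMap =
      conv (φ ∘ₗ (map f hf).toLinearMap) (ψ ∘ₗ (map f hf).toLinearMap) := by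
  ext a
  induction a using induction_homogeneous 𝒰 generalizing φ ψ with
  | one =>
    simp only [LinearMap.comp_apply, AlgHom.toLinearMap_apply, map_one, conv_one]
  | ι_mul i x a hx ha =>
    have hfx : f x ∈ 𝒱 i := by simpa using hf i x hx
    have e1 : (map f hf).toLinearMap ∘ₗ LinearMap.mulLeft K (ι 𝒰 x) =
        LinearMap.mulLeft K (ι 𝒱 (f x)) ∘ₗ (map f hf).toLinearMap := by
      ext b
      simp [map_ι]
    have e2 : (map f hf).toLinearMap ∘ₗ twist (degree 𝒰) i =
        twist (degree 𝒱) i ∘ₗ (map f hf).toLinearMap := by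
      ext b
      have h := (map_degree 𝒰 f hf).twist_apply i b
      rw [mul_zero, zpow_zero, one_smul] at h
      exact h.symm
    rw [conv_ι_mul 𝒰 _ _ hx, LinearMap.comp_apply, AlgHom.toLinearMap_apply, map_mul, map_ι,
      conv_ι_mul 𝒱 _ _ hfx, LinearMap.comp_assoc, LinearMap.comp_assoc, LinearMap.comp_assoc, e1, e2]
    have h1 := ha (φ ∘ₗ LinearMap.mulLeft K (ι 𝒱 (f x))) ψ
    have h2 := ha (φ ∘ₗ twist (degree 𝒱) i) (ψ ∘ₗ LinearMap.mulLeft K (ι 𝒱 (f x)))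
    rw [LinearMap.comp_apply, AlgHom.toLinearMap_apply] at h1 h2
    rw [h1, h2]
    rfl
  | add a b ha hb => rw [map_add, map_add, ha, hb]
  | smul c a ha => rw [map_smul, map_smul, ha]

theorem counit_map [DirectSum.Decomposition 𝒱] (f : U →ₗ[K] V) (hf : IsHomogeneousMap 𝒰 𝒱 0 f)
    (a : GSym 𝒰) : CoalgebraStruct.counit (R := K) (map f hf a) =
      CoalgebraStruct.counit (R := K) a := by
  induction a using induction 𝒰 with
  | one => rw [map_one, counit_one, counit_one]
  | ι_mul x a _ => rw [map_mul, map_ι, counit_ι_mul, counit_ι_mul]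
  | add a b ha hb => rw [map_add, map_add, map_add, ha, hb]
  | smul c a ha => rw [map_smul, map_smul, map_smul, ha]

/-! ### Degrees -/

theorem proj_degree : IsHomogeneousMap (degree 𝒰) 𝒰 0 (proj 𝒰) := by
  intro d a ha
  rw [add_zero]
  induction ha using Submodule.span_induction with
  | mem a h =>
    obtain ⟨l, hl, rfl, rfl⟩ := h
    rcases l with - | ⟨p, l⟩
    · simp [proj_one]
    · rcases l with - | ⟨q, l⟩
      · simpa [proj_ι] using hl p List.mem_cons_self
      · simp only [List.map_cons, List.prod_cons]
        rw [proj_ι_mul, counit_ι_mul, zero_smul]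
        exact Submodule.zero_mem _
  | zero => rw [map_zero]; exact Submodule.zero_mem _
  | add a b _ _ iha ihb => rw [map_add]; exact Submodule.add_mem _ iha ihb
  | smul c a _ ih => rw [map_smul]; exact Submodule.smul_mem _ _ ih

omit [DirectSum.Decomposition 𝒰] in
theorem ι_degree : IsHomogeneousMap 𝒰 (degree 𝒰) 0 (ι 𝒰) := fun i x hx => by
  rw [add_zero]
  exact ι_mem_degree 𝒰 hx

omit [DirectSum.Decomposition 𝒰] in
theorem isHomogeneousMap_mulLeft {i : ℤ} {x : U} (hx : x ∈ 𝒰 i) :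
    IsHomogeneousMap (degree 𝒰) (degree 𝒰) i (LinearMap.mulLeft K (ι 𝒰 x)) := fun j a ha => by
  rw [add_comm]
  exact SetLike.mul_mem_graded (ι_mem_degree 𝒰 hx) ha

theorem isHomogeneousMap_conv {𝓑 : ℤ → Submodule K B} [SetLike.GradedMonoid 𝓑]
    {φ ψ : GSym 𝒰 →ₗ[K] B} {k l m : ℤ} (hφ : IsHomogeneousMap (degree 𝒰) 𝓑 k φ)
    (hψ : IsHomogeneousMap (degree 𝒰) 𝓑 l ψ) (h : k + l = m) :
    IsHomogeneousMap (degree 𝒰) 𝓑 m (conv φ ψ) := by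
  intro d a ha
  induction ha using Submodule.span_induction with
  | mem a ha =>
    obtain ⟨s, hs, rfl, rfl⟩ := ha
    induction s generalizing φ ψ k l m with
    | nil =>
      have h1 : (1 : GSym 𝒰) ∈ degree 𝒰 0 := SetLike.GradedOne.one_mem
      simp only [List.map_nil, List.prod_nil, List.sum_nil, conv_one]
      have h2 := SetLike.mul_mem_graded (hφ 0 1 h1) (hψ 0 1 h1)
      convert h2 using 2
      omega
    | cons p s ih =>
      have hp := hs p List.mem_cons_self
      have hs' : ∀ q ∈ s, q.2 ∈ 𝒰 q.1 := fun q hq => hs q (List.mem_cons_of_mem _ hq)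
      simp only [List.map_cons, List.prod_cons, List.sum_cons]
      rw [conv_ι_mul 𝒰 _ _ hp]
      have e : p.1 + (s.map Prod.fst).sum + m = (s.map Prod.fst).sum + (m + p.1) := by ring
      rw [e]
      refine Submodule.add_mem _ (ih (k := k + p.1) (l := l) ?_ hψ ?_ hs')
        (ih (k := k) (l := l + p.1) ?_ ?_ ?_ hs')
      · exact hφ.comp (isHomogeneousMap_mulLeft 𝒰 hp) (by ring)
      · rw [← h]; ring
      · exact hφ.comp (isHomogeneousMap_twist p.1) (by ring)
      · exact hψ.comp (isHomogeneousMap_mulLeft 𝒰 hp) (by ring)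
      · rw [← h]; ring
  | zero => rw [map_zero]; exact Submodule.zero_mem _
  | add a b _ _ iha ihb => rw [map_add]; exact Submodule.add_mem _ iha ihb
  | smul c a _ ih => rw [map_smul]; exact Submodule.smul_mem _ _ ih

theorem isHomogeneousMap_convList_nil {𝓑 : ℤ → Submodule K B} [SetLike.GradedMonoid 𝓑] :
    IsHomogeneousMap (degree 𝒰) 𝓑 0 (convList ([] : List (GSym 𝒰 →ₗ[K] B))) := by
  intro d a ha
  induction ha using Submodule.span_induction with
  | mem a h =>
    obtain ⟨l, hl, rfl, rfl⟩ := h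
    rcases l with - | ⟨p, l⟩
    · simpa [convList_nil, counit_one] using SetLike.GradedOne.one_mem
    · simp only [List.map_cons, List.prod_cons, convList_nil, LinearMap.comp_apply, counit_ι_mul,
        map_zero]
      exact Submodule.zero_mem _
  | zero => rw [map_zero]; exact Submodule.zero_mem _
  | add a b _ _ iha ihb => rw [map_add]; exact Submodule.add_mem _ iha ihb
  | smul c a _ ih => rw [map_smul]; exact Submodule.smul_mem _ _ ih

/-- Graded commutativity of the convolution product. -/
theorem conv_comm {φ ψ : GSym 𝒰 →ₗ[K] B} {k l : ℤ}
    (h : ∀ i j, ∀ a ∈ degree 𝒰 i, ∀ b ∈ degree 𝒰 j,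
      φ a * ψ b = ((-1 : K) ^ ((i + k) * (j + l))) • (ψ b * φ a)) :
    conv φ ψ = ((-1 : K) ^ (k * l)) •
      conv (ψ ∘ₗ twist (degree 𝒰) k) (φ ∘ₗ twist (degree 𝒰) l) := by
  ext a
  induction a using induction_homogeneous 𝒰 generalizing φ ψ k l with
  | one =>
    have h1 : (1 : GSym 𝒰) ∈ degree 𝒰 0 := SetLike.GradedOne.one_mem
    rw [LinearMap.smul_apply, conv_one, conv_one, LinearMap.comp_apply, LinearMap.comp_apply,
      twist_one, twist_one, h 0 0 1 h1 1 h1, zero_add, zero_add]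
  | ι_mul i x a hx ha =>
    have e1 : conv (φ ∘ₗ LinearMap.mulLeft K (ι 𝒰 x)) ψ a = _ := ha (k := k + i) (l := l) (by
      intro p q b hb c hc
      have h1 := SetLike.mul_mem_graded (ι_mem_degree 𝒰 hx) hb
      rw [LinearMap.comp_apply, LinearMap.mulLeft_apply, h _ _ _ h1 _ hc]
      congr 2
      ring)
    have e2 : conv (φ ∘ₗ twist (degree 𝒰) i) (ψ ∘ₗ LinearMap.mulLeft K (ι 𝒰 x)) a = _ :=
      ha (k := k) (l := l + i) (by
      intro p q b hb c hc
      have h1 := SetLike.mul_mem_graded (ι_mem_degree 𝒰 hx) hc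
      rw [LinearMap.comp_apply, LinearMap.comp_apply, LinearMap.mulLeft_apply,
        h _ _ _ (twist_mem _ i hb) _ h1, twist_of_mem _ i hb, map_smul, mul_smul_comm]
      congr 2
      congr 1
      ring)
    rw [LinearMap.smul_apply, conv_ι_mul 𝒰 _ _ hx, conv_ι_mul 𝒰 _ _ hx, e1, e2]
    simp only [LinearMap.smul_apply, LinearMap.comp_assoc, twist_comp_mulLeft 𝒰 _ hx,
      twist_comp_twist, LinearMap.comp_smul, smul_conv, conv_smul, smul_add, smul_smul,
      neg_one_zpow_mul]
    rw [add_comm]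
    congr 1
    · rw [twist_congr (degree 𝒰) (k := i + (l + i)) (l := l) ⟨i, by ring⟩, mul_add]
    · rw [add_mul, mul_comm i l]
  | add a b ha hb => rw [map_add, map_add, ha h, hb h]
  | smul c a ha => rw [map_smul, map_smul, ha h]

/-! ### Coderivations with linear Taylor coefficients -/

theorem linearCoderivation_one (d : U →ₗ[K] U) : linearCoderivation 𝒰 d 1 = 0 := by
  rw [linearCoderivation, conv_one, LinearMap.comp_apply, LinearMap.comp_apply, proj_one, map_zero,
    map_zero, zero_mul]

theorem linearCoderivation_add (d d' : U →ₗ[K] U) :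
    linearCoderivation 𝒰 (d + d') = linearCoderivation 𝒰 d + linearCoderivation 𝒰 d' := by
  rw [linearCoderivation, LinearMap.add_comp, LinearMap.comp_add, add_conv]
  rfl

theorem linearCoderivation_smul (c : K) (d : U →ₗ[K] U) :
    linearCoderivation 𝒰 (c • d) = c • linearCoderivation 𝒰 d := by
  rw [linearCoderivation, LinearMap.smul_comp, LinearMap.comp_smul, smul_conv]
  rfl

theorem linearCoderivation_zero : linearCoderivation 𝒰 (0 : U →ₗ[K] U) = 0 := by
  rw [linearCoderivation, LinearMap.zero_comp, LinearMap.comp_zero, zero_conv]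

variable {𝒰} {d d' : U →ₗ[K] U} {k l : ℤ}

theorem linearCoderivation_degree (hd : IsHomogeneousMap 𝒰 𝒰 k d) :
    IsHomogeneousMap (degree 𝒰) (degree 𝒰) k (linearCoderivation 𝒰 d) :=
  isHomogeneousMap_conv 𝒰
    (((ι_degree 𝒰).comp hd (add_zero k)).comp (proj_degree 𝒰) (zero_add k)) IsHomogeneousMap.id
    (add_zero k)

/-- The projection annihilates products of two or more generators. So either `x` is the single
factor on which `d` acts, or it lies in the other tensor factor and is brought to the front. Passing
`d` leaves the sign `(-1)^{k|x|}`; the signs caused by the remaining elements cancel. -/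
theorem conv_ι_comp_proj_ι_mul (hd : IsHomogeneousMap 𝒰 𝒰 k d) {i : ℤ} {x : U} (hx : x ∈ 𝒰 i)
    {ψ χ : GSym 𝒰 →ₗ[K] GSym 𝒰}
    (h : ψ ∘ₗ LinearMap.mulLeft K (ι 𝒰 x) = LinearMap.mulLeft K (ι 𝒰 x) ∘ₗ χ) (a : GSym 𝒰) :
    conv (ι 𝒰 ∘ₗ d ∘ₗ proj 𝒰) ψ (ι 𝒰 x * a) = ι 𝒰 (d x) * ψ a +
      ι 𝒰 (twist 𝒰 k x) * conv (ι 𝒰 ∘ₗ d ∘ₗ proj 𝒰) χ a := by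
  rw [conv_ι_mul 𝒰 _ _ hx]
  congr 1
  · have e : (ι 𝒰 ∘ₗ d ∘ₗ proj 𝒰) ∘ₗ LinearMap.mulLeft K (ι 𝒰 x) =
        LinearMap.smulRight (CoalgebraStruct.counit (R := K) (A := GSym 𝒰)) (ι 𝒰 (d x)) := by
      ext b
      simp [proj_ι_mul]
    rw [e, counit_smulRight_conv]
  · rw [h, ← mulRight_comp_conv]
    have e : LinearMap.mulRight K (ι 𝒰 x) ∘ₗ (ι 𝒰 ∘ₗ d ∘ₗ proj 𝒰) ∘ₗ twist (degree 𝒰) i =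
        LinearMap.mulLeft K (ι 𝒰 (twist 𝒰 k x)) ∘ₗ (ι 𝒰 ∘ₗ d ∘ₗ proj 𝒰) := by
      refine homogeneous_ext (degree 𝒰) fun j b hb => ?_
      have h1 : ι 𝒰 (d (proj 𝒰 b)) ∈ degree 𝒰 (j + k) :=
        ι_mem_degree 𝒰 (hd j _ (by simpa using proj_degree 𝒰 j b hb))
      simp only [LinearMap.comp_apply, LinearMap.mulRight_apply, LinearMap.mulLeft_apply]
      rw [twist_of_mem _ i hb, twist_of_mem _ k hx, map_smul, map_smul, map_smul, map_smul,
        smul_mul_assoc, smul_mul_assoc, mul_comm_graded 𝒰 h1 (ι_mem_degree 𝒰 hx), smul_smul,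
        neg_one_zpow_mul]
      congr 1
      exact neg_one_zpow_congr ⟨i * j, by ring⟩
    rw [e, ← mulLeft_comp_conv]
    rfl

theorem linearCoderivation_ι_mul (hd : IsHomogeneousMap 𝒰 𝒰 k d) (x : U) (a : GSym 𝒰) :
    linearCoderivation 𝒰 d (ι 𝒰 x * a) =
      ι 𝒰 (d x) * a + ι 𝒰 (twist 𝒰 k x) * linearCoderivation 𝒰 d a := by
  suffices h : linearCoderivation 𝒰 d ∘ₗ LinearMap.mulRight K a ∘ₗ ι 𝒰 =
      LinearMap.mulRight K a ∘ₗ ι 𝒰 ∘ₗ d +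
        LinearMap.mulRight K (linearCoderivation 𝒰 d a) ∘ₗ ι 𝒰 ∘ₗ twist 𝒰 k from
    LinearMap.congr_fun h x
  exact homogeneous_ext 𝒰 fun i x hx => conv_ι_comp_proj_ι_mul hd hx
    (ψ := LinearMap.id) (χ := LinearMap.id) rfl a

theorem linearCoderivation_ι (hd : IsHomogeneousMap 𝒰 𝒰 k d) (x : U) :
    linearCoderivation 𝒰 d (ι 𝒰 x) = ι 𝒰 (d x) := by
  have h := linearCoderivation_ι_mul hd x 1
  rwa [linearCoderivation_one, mul_zero, add_zero, mul_one, mul_one] at h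

/-- A coderivation whose only Taylor coefficient is linear is at the same time a derivation of the
product. Both aspects are used: the derivation rule when it is composed after a convolution product,
the coderivation rule when it is composed before one. -/
theorem linearCoderivation_mul (hd : IsHomogeneousMap 𝒰 𝒰 k d) (a b : GSym 𝒰) :
    linearCoderivation 𝒰 d (a * b) =
      linearCoderivation 𝒰 d a * b + twist (degree 𝒰) k a * linearCoderivation 𝒰 d b := by
  induction a using induction 𝒰 with
  | one => rw [one_mul, linearCoderivation_one, zero_mul, zero_add, twist_one, one_mul]
  | ι_mul x a ha =>
    rw [mul_assoc, linearCoderivation_ι_mul hd, linearCoderivation_ι_mul hd, ha, twist_mul, twist_ι]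
    simp only [mul_add, add_mul, mul_assoc, add_assoc]
  | add a c ha hc => simp only [add_mul, map_add, ha, hc]; abel
  | smul c a ha => simp only [smul_mul_assoc, map_smul, ha, smul_add]

/-- The coderivation rule. -/
theorem conv_comp_linearCoderivation (hd : IsHomogeneousMap 𝒰 𝒰 k d) (φ ψ : GSym 𝒰 →ₗ[K] B) :
    conv φ ψ ∘ₗ linearCoderivation 𝒰 d = conv (φ ∘ₗ linearCoderivation 𝒰 d) ψ +
      conv (φ ∘ₗ twist (degree 𝒰) k) (ψ ∘ₗ linearCoderivation 𝒰 d) := by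
  ext a
  induction a using induction_homogeneous 𝒰 generalizing φ ψ with
  | one =>
    simp only [LinearMap.comp_apply, LinearMap.add_apply, linearCoderivation_one, conv_one, map_zero,
      zero_mul, mul_zero, add_zero]
  | ι_mul i x a hx ha =>
    have e1 : linearCoderivation 𝒰 d ∘ₗ LinearMap.mulLeft K (ι 𝒰 x) =
        LinearMap.mulLeft K (ι 𝒰 (d x)) +
          ((-1 : K) ^ (k * i)) • (LinearMap.mulLeft K (ι 𝒰 x) ∘ₗ linearCoderivation 𝒰 d) := by
      ext b
      simp [linearCoderivation_ι_mul hd, twist_of_mem 𝒰 k hx]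
    have e2 : twist (degree 𝒰) i ∘ₗ linearCoderivation 𝒰 d =
        ((-1 : K) ^ (k * i)) • (linearCoderivation 𝒰 d ∘ₗ twist (degree 𝒰) i) := by
      ext b
      simpa [mul_comm k i] using (linearCoderivation_degree hd).twist_apply i b
    have e3 : linearCoderivation 𝒰 d ∘ₗ twist (degree 𝒰) i =
        ((-1 : K) ^ (k * i)) • (twist (degree 𝒰) i ∘ₗ linearCoderivation 𝒰 d) := by
      rw [e2, smul_smul, neg_one_zpow_mul, Even.neg_one_zpow ⟨_, rfl⟩, one_smul]
    have h1 := ha (φ ∘ₗ LinearMap.mulLeft K (ι 𝒰 x)) ψ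
    have h2 := ha (φ ∘ₗ twist (degree 𝒰) i) (ψ ∘ₗ LinearMap.mulLeft K (ι 𝒰 x))
    have e5 : linearCoderivation 𝒰 d (ι 𝒰 x * a) = ι 𝒰 (d x) * a +
        ((-1 : K) ^ (k * i)) • (ι 𝒰 x * linearCoderivation 𝒰 d a) := LinearMap.congr_fun e1 a
    rw [LinearMap.comp_apply, LinearMap.add_apply] at h1 h2
    rw [LinearMap.comp_apply, e5, map_add, map_smul, conv_ι_mul 𝒰 _ _ (hd i x hx),
      conv_ι_mul 𝒰 _ _ hx, LinearMap.add_apply, conv_ι_mul 𝒰 _ _ hx, conv_ι_mul 𝒰 _ _ hx, h1, h2]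
    simp only [LinearMap.comp_assoc, e1, e3, twist_comp_mulLeft 𝒰 _ hx, twist_comp_twist,
      LinearMap.comp_smul, LinearMap.comp_add, smul_conv, conv_smul, smul_add,
      add_conv, conv_add, LinearMap.add_apply, LinearMap.smul_apply]
    rw [add_comm i k]
    abel
  | add a b ha hb => rw [map_add, map_add, ha, hb]
  | smul c a ha => rw [map_smul, map_smul, ha]

theorem linearCoderivation_map {V : Type*} [AddCommGroup V] [Module K V]
    {𝒱 : ℤ → Submodule K V} [DirectSum.Decomposition 𝒱] {dV : V →ₗ[K] V}
    (hd : IsHomogeneousMap 𝒰 𝒰 k d) (hdV : IsHomogeneousMap 𝒱 𝒱 k dV) {f : U →ₗ[K] V}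
    (hf : IsHomogeneousMap 𝒰 𝒱 0 f) (h : f ∘ₗ d = dV ∘ₗ f) (a : GSym 𝒰) :
    map f hf (linearCoderivation 𝒰 d a) = linearCoderivation 𝒱 dV (map f hf a) := by
  induction a using induction 𝒰 with
  | one => rw [linearCoderivation_one, map_zero, map_one, linearCoderivation_one]
  | ι_mul x a ha =>
    have e1 : f (d x) = dV (f x) := LinearMap.congr_fun h x
    have e2 : f (twist 𝒰 k x) = twist 𝒱 k (f x) := by simpa using (hf.twist_apply k x).symm
    rw [linearCoderivation_ι_mul hd, map_add, map_mul, map_mul, map_mul, ha, map_ι, map_ι, map_ι,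
      linearCoderivation_ι_mul hdV, e1, e2]
  | add a b ha hb => simp only [map_add, ha, hb]
  | smul c a ha => simp only [map_smul, ha]

/-- The graded commutator of coderivations. -/
theorem linearCoderivation_comm (hd : IsHomogeneousMap 𝒰 𝒰 k d)
    (hd' : IsHomogeneousMap 𝒰 𝒰 l d') (a : GSym 𝒰) :
    linearCoderivation 𝒰 d (linearCoderivation 𝒰 d' a) -
      ((-1 : K) ^ (k * l)) • linearCoderivation 𝒰 d' (linearCoderivation 𝒰 d a) =
    linearCoderivation 𝒰 (d ∘ₗ d' - ((-1 : K) ^ (k * l)) • (d' ∘ₗ d)) a := by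
  have hc : IsHomogeneousMap 𝒰 𝒰 (k + l) (d ∘ₗ d' - ((-1 : K) ^ (k * l)) • (d' ∘ₗ d)) :=
    (hd.comp hd' (by ring)).sub ((hd'.comp hd rfl).smul _)
  induction a using induction_homogeneous 𝒰 with
  | one => simp only [linearCoderivation_one, map_zero, smul_zero, sub_zero]
  | ι_mul i x a hx ha =>
    have hs : ((-1 : K) ^ (k * l)) * ((-1 : K) ^ (k * l)) = 1 := by
      rw [neg_one_zpow_mul]
      exact Even.neg_one_zpow ⟨_, rfl⟩
    have e1 : ((-1 : K) ^ (k * (i + l))) = (-1 : K) ^ (k * i) * (-1 : K) ^ (k * l) := by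
      rw [neg_one_zpow_mul]; congr 1; ring
    have e2 : ((-1 : K) ^ (l * (i + k))) = (-1 : K) ^ (l * i) * (-1 : K) ^ (k * l) := by
      rw [neg_one_zpow_mul]; congr 1; ring
    have e3 : ((-1 : K) ^ ((k + l) * i)) = (-1 : K) ^ (k * i) * (-1 : K) ^ (l * i) := by
      rw [neg_one_zpow_mul]; congr 1; ring
    rw [linearCoderivation_ι_mul hc, ← ha]
    simp only [linearCoderivation_ι_mul hd, linearCoderivation_ι_mul hd', map_add,
      twist_of_mem 𝒰 _ hx, twist_of_mem 𝒰 _ (hd i x hx), twist_of_mem 𝒰 _ (hd' i x hx), map_smul,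
      smul_mul_assoc, LinearMap.sub_apply, LinearMap.smul_apply, LinearMap.comp_apply, map_sub,
      sub_mul, mul_sub, mul_smul_comm, e1, e2, e3]
    -- Of the two mixed terms one cancels literally; the other carries the square of `(-1)^{kl}`.
    linear_combination (norm := module) (-(-1 : K) ^ (l * i)) •
      congrArg (fun c : K => c • (ι 𝒰 (d x) * linearCoderivation 𝒰 d' a)) hs
  | add a b ha hb =>
    simp only [map_add, smul_add] at ha hb ⊢
    rw [← ha, ← hb]
    abel
  | smul c a ha =>
    simp only [map_smul] at ha ⊢
    rw [← ha, smul_sub, smul_comm c]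

/-! ### Weights -/

variable (𝒰)

/-- The projection of `S(U)` onto `U^{⊙n}`. -/
def weightProj (n : ℕ) : GSym 𝒰 →ₗ[K] GSym 𝒰 :=
  (Polynomial.lcoeff (GSym 𝒰) n).restrictScalars K ∘ₗ (weights 𝒰).toLinearMap

omit [DirectSum.Decomposition 𝒰] in
theorem weightProj_apply (n : ℕ) (a : GSym 𝒰) : weightProj 𝒰 n a = (weights 𝒰 a).coeff n := rfl

omit [DirectSum.Decomposition 𝒰] in
theorem weights_ι_mul (x : U) (a : GSym 𝒰) :
    weights 𝒰 (ι 𝒰 x * a) = Polynomial.monomial 1 (ι 𝒰 x) * weights 𝒰 a := by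
  rw [map_mul]
  congr 1
  exact lift_ι 𝒰 _ _ x

omit [DirectSum.Decomposition 𝒰] in
theorem weightProj_one (n : ℕ) : weightProj 𝒰 n 1 = if n = 0 then 1 else 0 := by
  rw [weightProj_apply, map_one, Polynomial.coeff_one]

omit [DirectSum.Decomposition 𝒰] in
theorem weightProj_zero_ι_mul (x : U) (a : GSym 𝒰) : weightProj 𝒰 0 (ι 𝒰 x * a) = 0 := by
  rw [weightProj_apply, weights_ι_mul, ← Polynomial.C_mul_X_eq_monomial, mul_assoc,
    Polynomial.coeff_C_mul, Polynomial.coeff_X_mul_zero, mul_zero]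

omit [DirectSum.Decomposition 𝒰] in
theorem weightProj_succ_ι_mul (n : ℕ) (x : U) (a : GSym 𝒰) :
    weightProj 𝒰 (n + 1) (ι 𝒰 x * a) = ι 𝒰 x * weightProj 𝒰 n a := by
  rw [weightProj_apply, weights_ι_mul, ← Polynomial.C_mul_X_eq_monomial, mul_assoc,
    Polynomial.coeff_C_mul, Polynomial.coeff_X_mul]
  rfl

omit [DirectSum.Decomposition 𝒰] in
theorem lsum_weights (f : ℕ → GSym 𝒰 →ₗ[K] GSym 𝒰) (a : GSym 𝒰) {N : ℕ}
    (hN : (weights 𝒰 a).natDegree < N) :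
    (Polynomial.lsum f ∘ₗ (weights 𝒰).toLinearMap) a =
      ∑ n ∈ Finset.range N, f n (weightProj 𝒰 n a) := by
  change (weights 𝒰 a).sum (f · ·) = _
  exact Polynomial.sum_over_range' _ (fun n => map_zero _) _ hN

omit [DirectSum.Decomposition 𝒰] in
theorem sum_weightProj (a : GSym 𝒰) {N : ℕ} (hN : (weights 𝒰 a).natDegree < N) :
    ∑ n ∈ Finset.range N, weightProj 𝒰 n a = a := by
  -- Setting the weight variable to `1` forgets the weights.
  have h : (weights 𝒰 a).eval 1 = a := by
    clear hN
    induction a using induction 𝒰 with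
    | one => rw [map_one, Polynomial.eval_one]
    | ι_mul x a ha =>
      rw [weights_ι_mul, ← Polynomial.C_mul_X_eq_monomial, mul_assoc, Polynomial.X_mul,
        Polynomial.eval_C_mul, Polynomial.eval_mul_X, mul_one, ha]
    | add a b ha hb => rw [map_add, Polynomial.eval_add, ha, hb]
    | smul c a ha => rw [map_smul, Polynomial.eval_smul, ha]
  have h' := Polynomial.eval_eq_sum_range' hN (1 : GSym 𝒰)
  simp only [one_pow, mul_one] at h'
  rw [h] at h'
  exact h'.symm

end GSym

/-! ### The telescoping identity behind the symmetrized homotopy. -/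

section Derivation

/-- The sum of the values of a derivation on the monomials `u vʲ sᵐ` telescopes. -/
theorem sum_derivation_monomials {R : Type*} [Ring R] {D : R →+ R}
    (hD : ∀ a b, D (a * b) = D a * b + a * D b) {u v s : R} (hu : D u = u) (hv : D v = 0)
    (hs : D s = s - v) (hvs : v * s = s * v) (n : ℕ) :
    ∑ j ∈ Finset.range (n + 1), D (u * (v ^ j * s ^ (n - j))) = (n + 1) • (u * s ^ n) := by
  have h1 : D 1 = 0 := by
    have h := hD 1 1
    rw [mul_one, mul_one, one_mul] at h
    exact left_eq_add.1 h
  have hvj : ∀ j, D (v ^ j) = 0 := by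
    intro j
    induction j with
    | zero => rw [pow_zero, h1]
    | succ j ih => rw [pow_succ, hD, ih, hv, zero_mul, mul_zero, add_zero]
  have hc : Commute v s := hvs
  -- As `v` commutes with `s`, the Leibniz rule collects `m` equal terms. The truncated exponent `m
  -- - 1` at `m = 0` is harmless because of the factor `m`.
  have hsm : ∀ m, D (s ^ m) = m • (s ^ m - v * s ^ (m - 1)) := by
    intro m
    induction m with
    | zero => rw [pow_zero, h1, zero_smul]
    | succ m ih =>
      rw [pow_succ, hD, ih, hs, Nat.add_sub_cancel, add_smul, one_smul, ← pow_succ, mul_sub,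
        ← (hc.pow_right m).eq, ← pow_succ, smul_mul_assoc, sub_mul, ← pow_succ, mul_assoc]
      rcases m with - | m
      · simp
      · rw [Nat.add_sub_cancel, ← pow_succ]
  -- `D` multiplies `u vʲ sⁿ⁻ʲ` by `n + 1 - j`, once for `u` and `n - j` times for the factors `s`,
  -- and subtracts `n - j` copies of the next monomial. Consecutive terms cancel; only the one with
  -- `j = 0` survives, since the last coefficient is zero.
  have hterm : ∀ j ∈ Finset.range (n + 1), D (u * (v ^ j * s ^ (n - j))) =
      (n + 1 - j) • (u * (v ^ j * s ^ (n - j))) -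
        (n + 1 - (j + 1)) • (u * (v ^ (j + 1) * s ^ (n - (j + 1)))) := by
    intro j hj
    have hj' : j ≤ n := Nat.lt_succ_iff.1 (Finset.mem_range.1 hj)
    have e1 : n + 1 - j = (n - j) + 1 := by omega
    have e2 : n + 1 - (j + 1) = n - j := by omega
    have e3 : n - (j + 1) = n - j - 1 := by omega
    rw [hD, hD, hu, hvj, hsm, e1, e2, e3, zero_mul, zero_add, add_smul, one_smul, pow_succ, mul_assoc,
      mul_smul_comm, mul_smul_comm, mul_sub, mul_sub, smul_sub]
    abel
  rw [Finset.sum_congr rfl hterm, Finset.sum_range_sub']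
  simp

end Derivation

/-! ### Weight projections and the symmetrized homotopy. -/

namespace GSym

variable {K : Type*} [Field K] {U V : Type*} [AddCommGroup U] [Module K U] [AddCommGroup V]
  [Module K V]
variable (𝒰 : ℤ → Submodule K U) [DirectSum.Decomposition 𝒰]

theorem weightProj_zero (a : GSym 𝒰) :
    weightProj 𝒰 0 a = algebraMap K _ (CoalgebraStruct.counit (R := K) a) := by
  induction a using induction 𝒰 with
  | one => rw [weightProj_one, if_pos rfl, counit_one, map_one]
  | ι_mul x a ha => rw [weightProj_zero_ι_mul, counit_ι_mul, map_zero]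
  | add a b ha hb => simp only [map_add, ha, hb]
  | smul c a ha => rw [map_smul, map_smul, ha, Algebra.smul_def, smul_eq_mul, map_mul]

/-- Splitting off one factor and applying `d` to it leaves a product with one factor fewer.
Restricting the remainder to weight `n` is therefore the same as restricting the argument to weight
`n + 1`. -/
theorem conv_weightProj {d : U →ₗ[K] U} {k : ℤ} (hd : IsHomogeneousMap 𝒰 𝒰 k d) (n : ℕ) :
    conv (ι 𝒰 ∘ₗ d ∘ₗ proj 𝒰) (weightProj 𝒰 n) = linearCoderivation 𝒰 d ∘ₗ weightProj 𝒰 (n + 1) := by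
  ext a
  rw [LinearMap.comp_apply]
  induction a using induction_homogeneous 𝒰 generalizing n with
  | one =>
    rw [conv_one, LinearMap.comp_apply, LinearMap.comp_apply, proj_one, map_zero, map_zero, zero_mul,
      weightProj_one, if_neg n.succ_ne_zero, map_zero]
  | ι_mul i x a hx ha =>
    rw [weightProj_succ_ι_mul, linearCoderivation_ι_mul hd]
    rcases n with - | n
    · rw [conv_ι_comp_proj_ι_mul hd hx (χ := 0) (by
        rw [LinearMap.comp_zero]
        exact LinearMap.ext fun b => weightProj_zero_ι_mul 𝒰 x b), conv_zero, LinearMap.zero_apply,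
        weightProj_zero, Algebra.algebraMap_eq_smul_one, map_smul, linearCoderivation_one,
        smul_zero]
    · rw [conv_ι_comp_proj_ι_mul hd hx (χ := weightProj 𝒰 n)
        (LinearMap.ext fun b => weightProj_succ_ι_mul 𝒰 n x b), ha]
  | add a b ha hb => simp only [map_add, ha, hb]
  | smul c a ha => simp only [map_smul, ha]

theorem linearCoderivation_weightProj {d : U →ₗ[K] U} {k : ℤ} (hd : IsHomogeneousMap 𝒰 𝒰 k d)
    (n : ℕ) (a : GSym 𝒰) : weightProj 𝒰 n (linearCoderivation 𝒰 d a) =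
      linearCoderivation 𝒰 d (weightProj 𝒰 n a) := by
  induction a using induction 𝒰 generalizing n with
  | one =>
    rw [linearCoderivation_one, map_zero, weightProj_one]
    split_ifs
    · rw [linearCoderivation_one]
    · rw [map_zero]
  | ι_mul x a ha =>
    rw [linearCoderivation_ι_mul hd, map_add]
    rcases n with - | n
    · rw [weightProj_zero_ι_mul, weightProj_zero_ι_mul, weightProj_zero_ι_mul, add_zero, map_zero]
    · rw [weightProj_succ_ι_mul, weightProj_succ_ι_mul, weightProj_succ_ι_mul,
        linearCoderivation_ι_mul hd, ha]
  | add a b ha hb => simp only [map_add, ha, hb]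
  | smul c a ha => simp only [map_smul, ha]

theorem counit_linearCoderivation {d : U →ₗ[K] U} {k : ℤ} (hd : IsHomogeneousMap 𝒰 𝒰 k d)
    (a : GSym 𝒰) : CoalgebraStruct.counit (R := K) (linearCoderivation 𝒰 d a) = 0 := by
  induction a using induction 𝒰 with
  | one => rw [linearCoderivation_one, map_zero]
  | ι_mul x a ha => rw [linearCoderivation_ι_mul hd, map_add, counit_ι_mul, counit_ι_mul, add_zero]
  | add a b ha hb => rw [map_add, map_add, ha, hb, add_zero]
  | smul c a ha => rw [map_smul, map_smul, ha, smul_zero]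

theorem proj_linearCoderivation {d : U →ₗ[K] U} {k : ℤ} (hd : IsHomogeneousMap 𝒰 𝒰 k d)
    (a : GSym 𝒰) : proj 𝒰 (linearCoderivation 𝒰 d a) = d (proj 𝒰 a) := by
  induction a using induction 𝒰 with
  | one => rw [linearCoderivation_one, proj_one, map_zero, map_zero]
  | ι_mul x a ha =>
    rw [linearCoderivation_ι_mul hd, map_add, proj_ι_mul, proj_ι_mul, proj_ι_mul,
      counit_linearCoderivation 𝒰 hd, zero_smul, add_zero, map_smul]
  | add a b ha hb => simp only [map_add, ha, hb]
  | smul c a ha => simp only [map_smul, ha]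

theorem linearCoderivation_id_weightProj (n : ℕ) (a : GSym 𝒰) :
    linearCoderivation 𝒰 LinearMap.id (weightProj 𝒰 n a) = (n : K) • weightProj 𝒰 n a := by
  induction a using induction 𝒰 generalizing n with
  | one =>
    rw [weightProj_one]
    split_ifs with h
    · rw [linearCoderivation_one, h, Nat.cast_zero, zero_smul]
    · rw [map_zero, smul_zero]
  | ι_mul x a ha =>
    rcases n with - | n
    · rw [weightProj_zero_ι_mul, map_zero, smul_zero]
    · rw [weightProj_succ_ι_mul, linearCoderivation_ι_mul IsHomogeneousMap.id, ha, twist_zero,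
        LinearMap.id_apply, mul_smul_comm, Nat.cast_succ, add_smul, one_smul, add_comm]
  | add a b ha hb => simp only [map_add, ha, hb, smul_add]
  | smul c a ha => simp only [map_smul, ha, smul_comm c]

omit [DirectSum.Decomposition 𝒰] in
theorem weightProj_weightProj (n : ℕ) (a : GSym 𝒰) :
    weightProj 𝒰 n (weightProj 𝒰 n a) = weightProj 𝒰 n a := by
  induction a using induction 𝒰 generalizing n with
  | one =>
    rw [weightProj_one]
    split_ifs with h
    · rw [weightProj_one, if_pos h]
    · rw [map_zero]
  | ι_mul x a ha =>
    rcases n with - | n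
    · rw [weightProj_zero_ι_mul, map_zero]
    · rw [weightProj_succ_ι_mul, weightProj_succ_ι_mul, ha]
  | add a b ha hb => simp only [map_add, ha, hb]
  | smul c a ha => simp only [map_smul, ha]

/-- The Euler coderivation multiplies weight `n + 1` by `n + 1`, so `conv_weightProj` for the
identity becomes a recursion that accumulates the factor `n!`. The formula converts weight
components into iterated coproducts and back. -/
theorem weightProj_eq_convList [CharZero K] (n : ℕ) : weightProj 𝒰 n =
    ((n.factorial : K)⁻¹) • convList (List.replicate n (ι 𝒰 ∘ₗ proj 𝒰)) := by
  induction n with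
  | zero =>
    ext a
    rw [weightProj_zero, Nat.factorial_zero, Nat.cast_one, inv_one, one_smul]
    rfl
  | succ n ih =>
    have h := conv_weightProj 𝒰 (IsHomogeneousMap.id (𝒰 := 𝒰) (K := K)) n
    rw [LinearMap.id_comp] at h
    have h' : ((n + 1 : ℕ) : K) • weightProj 𝒰 (n + 1) = conv (ι 𝒰 ∘ₗ proj 𝒰) (weightProj 𝒰 n) := by
      rw [h]
      exact LinearMap.ext fun a => (linearCoderivation_id_weightProj 𝒰 (n + 1) a).symm
    have hn : ((n + 1 : ℕ) : K) ≠ 0 := Nat.cast_ne_zero.2 n.succ_ne_zero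
    rw [ih, conv_smul, ← convList_cons, ← List.replicate_succ] at h'
    rw [← inv_smul_smul₀ hn (weightProj 𝒰 (n + 1)), h', smul_smul, Nat.factorial_succ, Nat.cast_mul,
      mul_inv]

/-! ### The symmetrized homotopy -/

variable {𝒰} {e h : U →ₗ[K] U}

/-- Moving the odd factor `h` to the front absorbs the parity operators on the factors it crosses.
What remains is a monomial `u vʲ sⁿ⁻¹⁻ʲ` in the convolution ring, with `u`, `v`, `s` built from `h`,
`e` and the identity, as required by `sum_derivation_monomials`. -/
theorem convList_homotopy (he : IsHomogeneousMap 𝒰 𝒰 0 e) (hh : IsHomogeneousMap 𝒰 𝒰 (-1) h)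
    (n : ℕ) (j : Fin n) :
    convList (List.ofFn fun i : Fin n => ι 𝒰 ∘ₗ
      (if i < j then e ∘ₗ parity 𝒰 else if i = j then h else LinearMap.id) ∘ₗ proj 𝒰) =
    (WithConv.toConv (ι 𝒰 ∘ₗ h ∘ₗ proj 𝒰) * (WithConv.toConv (ι 𝒰 ∘ₗ e ∘ₗ proj 𝒰) ^ (j : ℕ) *
      WithConv.toConv (ι 𝒰 ∘ₗ proj 𝒰) ^ (n - 1 - j))).ofConv := by
  induction n with
  | zero => exact j.elim0
  | succ n ih =>
    rw [List.ofFn_succ, convList_cons]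
    induction j using Fin.cases with
    | zero =>
      have e1 : (List.ofFn fun i : Fin n => ι 𝒰 ∘ₗ (if i.succ < (0 : Fin (n + 1)) then e ∘ₗ parity 𝒰
          else if i.succ = 0 then h else LinearMap.id) ∘ₗ proj 𝒰) =
          List.replicate n (ι 𝒰 ∘ₗ proj 𝒰) := by
        rw [← List.ofFn_const]
        congr 1
      rw [e1, if_neg (lt_irrefl _), if_pos rfl, convList_replicate, conv_eq_mul]
      simp
    | succ j =>
      simp only [Fin.succ_lt_succ_iff, Fin.succ_inj, if_pos (Fin.succ_pos j)]
      have hc : conv (ι 𝒰 ∘ₗ (e ∘ₗ parity 𝒰) ∘ₗ proj 𝒰) (ι 𝒰 ∘ₗ h ∘ₗ proj 𝒰) =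
          conv (ι 𝒰 ∘ₗ h ∘ₗ proj 𝒰) (ι 𝒰 ∘ₗ e ∘ₗ proj 𝒰) := by
        have h1 : IsHomogeneousMap (degree 𝒰) (degree 𝒰) 0
            (ι 𝒰 ∘ₗ (e ∘ₗ parity 𝒰) ∘ₗ proj 𝒰) := by
          rw [parity_eq_twist]
          exact ((ι_degree 𝒰).comp (he.comp (isHomogeneousMap_twist 1) (add_zero 0)) (add_zero 0)).comp
            (proj_degree 𝒰) (add_zero 0)
        have h2 : IsHomogeneousMap (degree 𝒰) (degree 𝒰) (-1) (ι 𝒰 ∘ₗ h ∘ₗ proj 𝒰) :=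
          ((ι_degree 𝒰).comp hh (add_zero _)).comp (proj_degree 𝒰) (zero_add _)
        rw [conv_comm 𝒰 (k := 0) (l := -1) (fun i j a ha b hb =>
          mul_comm_graded 𝒰 (h1 i a ha) (h2 j b hb)), zero_mul, zpow_zero, one_smul, twist_zero,
          LinearMap.comp_id]
        congr 1
        ext a
        simp only [LinearMap.comp_apply]
        have h3 := (proj_degree 𝒰 (K := K)).twist_apply (-1) a
        rw [mul_zero, zpow_zero, one_smul] at h3
        rw [← h3, parity_eq_twist, twist_twist, add_neg_cancel, twist_zero, LinearMap.id_apply]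
      rw [ih, conv_eq_mul, WithConv.toConv_ofConv, ← mul_assoc]
      have hc' := congrArg WithConv.toConv hc
      rw [conv_eq_mul, conv_eq_mul, WithConv.toConv_ofConv, WithConv.toConv_ofConv] at hc'
      rw [hc', mul_assoc, ← mul_assoc (WithConv.toConv (ι 𝒰 ∘ₗ e ∘ₗ proj 𝒰)), ← pow_succ']
      rw [Fin.val_succ, show n + 1 - 1 - (j + 1) = n - 1 - (j : ℕ) by omega]

theorem symmetrizedHomotopyTerm_succ (he : IsHomogeneousMap 𝒰 𝒰 0 e)
    (hh : IsHomogeneousMap 𝒰 𝒰 (-1) h) (n : ℕ) : symmetrizedHomotopyTerm 𝒰 e h (n + 1) =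
    (((n + 1).factorial : K)⁻¹) • (∑ j ∈ Finset.range (n + 1),
      WithConv.toConv (ι 𝒰 ∘ₗ h ∘ₗ proj 𝒰) * (WithConv.toConv (ι 𝒰 ∘ₗ e ∘ₗ proj 𝒰) ^ j *
        WithConv.toConv (ι 𝒰 ∘ₗ proj 𝒰) ^ (n - j))).ofConv := by
  rw [symmetrizedHomotopyTerm, Finset.sum_range, WithConv.ofConv_sum]
  congr 1
  refine Finset.sum_congr rfl fun j _ => ?_
  rw [convList_homotopy he hh, Nat.add_sub_cancel]

/-- The value on the symmetrized homotopy of a derivation `D` of the convolution algebra that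
restricts to `n = 1 - e` on the Taylor coefficients. -/
theorem derivation_symmetrizedHomotopyTerm [CharZero K] (he : IsHomogeneousMap 𝒰 𝒰 0 e)
    (hh : IsHomogeneousMap 𝒰 𝒰 (-1) h) {D : (GSym 𝒰 →ₗ[K] GSym 𝒰) →ₗ[K] (GSym 𝒰 →ₗ[K] GSym 𝒰)}
    (hD : ∀ φ ψ, D (conv φ ψ) = conv (D φ) ψ + conv φ (D ψ))
    (hu : D (ι 𝒰 ∘ₗ h ∘ₗ proj 𝒰) = ι 𝒰 ∘ₗ h ∘ₗ proj 𝒰) (hv : D (ι 𝒰 ∘ₗ e ∘ₗ proj 𝒰) = 0)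
    (hs : D (ι 𝒰 ∘ₗ proj 𝒰) = ι 𝒰 ∘ₗ proj 𝒰 - ι 𝒰 ∘ₗ e ∘ₗ proj 𝒰) (n : ℕ) :
    D (symmetrizedHomotopyTerm 𝒰 e h n) = linearCoderivation 𝒰 h ∘ₗ weightProj 𝒰 n := by
  rcases n with - | n
  · rw [symmetrizedHomotopyTerm, Finset.univ_eq_empty, Finset.sum_empty, smul_zero, map_zero]
    ext a
    rw [LinearMap.comp_apply, weightProj_zero, Algebra.algebraMap_eq_smul_one, map_smul,
      linearCoderivation_one, smul_zero]
    rfl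
  · let D' : WithConv (GSym 𝒰 →ₗ[K] GSym 𝒰) →+ WithConv (GSym 𝒰 →ₗ[K] GSym 𝒰) :=
      { toFun := fun φ => WithConv.toConv (D φ.ofConv)
        map_zero' := by rw [WithConv.ofConv_zero, map_zero]; rfl
        map_add' := fun φ ψ => by rw [WithConv.ofConv_add, map_add]; rfl }
    -- Degree-zero maps commute under convolution, since `S(U)` is commutative and cocommutative in
    -- the graded sense.
    have hvs : conv (ι 𝒰 ∘ₗ e ∘ₗ proj 𝒰) (ι 𝒰 ∘ₗ proj 𝒰) =
        conv (ι 𝒰 ∘ₗ proj 𝒰) (ι 𝒰 ∘ₗ e ∘ₗ proj 𝒰) := by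
      have h1 : IsHomogeneousMap (degree 𝒰) (degree 𝒰) 0 (ι 𝒰 ∘ₗ e ∘ₗ proj 𝒰) :=
        ((ι_degree 𝒰).comp he (add_zero _)).comp (proj_degree 𝒰) (zero_add _)
      have h2 : IsHomogeneousMap (degree 𝒰) (degree 𝒰) 0 (ι 𝒰 ∘ₗ proj 𝒰) :=
        (ι_degree 𝒰).comp (proj_degree 𝒰) (zero_add _)
      rw [conv_comm 𝒰 (k := 0) (l := 0) (fun i j a ha b hb =>
        mul_comm_graded 𝒰 (h1 i a ha) (h2 j b hb)), zero_mul, zpow_zero, one_smul, twist_zero,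
        LinearMap.comp_id, LinearMap.comp_id]
    have key := sum_derivation_monomials (D := D')
      (u := WithConv.toConv (ι 𝒰 ∘ₗ h ∘ₗ proj 𝒰)) (v := WithConv.toConv (ι 𝒰 ∘ₗ e ∘ₗ proj 𝒰))
      (s := WithConv.toConv (ι 𝒰 ∘ₗ proj 𝒰))
      (fun a b => congrArg WithConv.toConv (hD a.ofConv b.ofConv)) (congrArg WithConv.toConv hu)
      (congrArg WithConv.toConv hv) (congrArg WithConv.toConv hs) (congrArg WithConv.toConv hvs) n
    rw [← map_sum] at key
    have key' := congrArg WithConv.ofConv key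
    change D (WithConv.ofConv _) = _ at key'
    rw [symmetrizedHomotopyTerm_succ he hh, map_smul, key', ← conv_weightProj 𝒰 hh,
      weightProj_eq_convList, conv_smul, convList_replicate, conv_eq_mul, WithConv.toConv_ofConv,
      ← Nat.cast_smul_eq_nsmul K, WithConv.ofConv_smul, smul_smul]
    congr 1
    -- The factor `n + 1` of the telescoping sum turns `1/(n+1)!` into `1/n!`, the normalization of
    -- the projection to weight `n`.
    have hn : ((n + 1 : ℕ) : K) ≠ 0 := Nat.cast_ne_zero.2 n.succ_ne_zero
    rw [Nat.factorial_succ, Nat.cast_mul, mul_inv, mul_right_comm, inv_mul_cancel₀ hn, one_mul]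

theorem symmetrizedHomotopy_apply (a : GSym 𝒰) {N : ℕ} (hN : (weights 𝒰 a).natDegree < N) :
    symmetrizedHomotopy 𝒰 e h a =
      ∑ n ∈ Finset.range N, symmetrizedHomotopyTerm 𝒰 e h n (weightProj 𝒰 n a) :=
  lsum_weights 𝒰 _ a hN

variable [CharZero K]

/-- The symmetrized homotopy inverts, up to the image of `e`, the coderivation extending `1 - e`. -/
theorem linearCoderivation_symmetrizedHomotopy (he : IsHomogeneousMap 𝒰 𝒰 0 e)
    (hh : IsHomogeneousMap 𝒰 𝒰 (-1) h) (hee : ∀ x, e (e x) = e x) (heh : ∀ x, e (h x) = 0) (a : GSym 𝒰) :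
    linearCoderivation 𝒰 (LinearMap.id - e) (symmetrizedHomotopy 𝒰 e h a) =
      linearCoderivation 𝒰 h a := by
  have hn : IsHomogeneousMap 𝒰 𝒰 0 (LinearMap.id - e) := IsHomogeneousMap.id.sub he
  set N := linearCoderivation 𝒰 (LinearMap.id - e) with hN
  have hNι : ∀ x, N (ι 𝒰 x) = ι 𝒰 x - ι 𝒰 (e x) := fun x => by
    rw [hN, linearCoderivation_ι hn, LinearMap.sub_apply, map_sub, LinearMap.id_apply]
  -- Postcomposition with `N` is a derivation of convolution because `N` is a derivation of `S(U)`.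
  -- It fixes the coefficient `h` by `e h = 0` and kills the coefficient `e` by `e e = e`.
  have key : ∀ n, N ∘ₗ symmetrizedHomotopyTerm 𝒰 e h n = linearCoderivation 𝒰 h ∘ₗ weightProj 𝒰 n :=
    derivation_symmetrizedHomotopyTerm he hh (D := LinearMap.llcomp K _ _ _ N)
      (fun φ ψ => by
        have e1 := comp_conv_of_add (D := N) (D₁ := N) (E₁ := LinearMap.id) (D₂ := N)
          (E₂ := LinearMap.id) (fun a b => by
            rw [hN, linearCoderivation_mul hn, twist_zero]; rfl) φ ψ
        exact e1)
      (LinearMap.ext fun b => (hNι (h (proj 𝒰 b))).trans (by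
        rw [heh, map_zero, sub_zero]; rfl))
      (LinearMap.ext fun b => (hNι (e (proj 𝒰 b))).trans (by
        simp only [hee, sub_self]; rfl))
      (LinearMap.ext fun b => hNι (proj 𝒰 b))
  have hlt := Nat.lt_succ_self (weights 𝒰 a).natDegree
  rw [symmetrizedHomotopy_apply a hlt, map_sum]
  conv_rhs => rw [← sum_weightProj 𝒰 a hlt, map_sum]
  refine Finset.sum_congr rfl fun n _ => ?_
  rw [← LinearMap.comp_apply N, key, LinearMap.comp_apply, weightProj_weightProj]

/-- Precomposition with `N` is a derivation of convolution because `N` is a coderivation, so the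
same telescoping applies. Here `h e = 0` is what keeps the coefficient `h` fixed. -/
theorem symmetrizedHomotopy_linearCoderivation (he : IsHomogeneousMap 𝒰 𝒰 0 e)
    (hh : IsHomogeneousMap 𝒰 𝒰 (-1) h) (hee : ∀ x, e (e x) = e x) (hhe : ∀ x, h (e x) = 0) (a : GSym 𝒰) :
    symmetrizedHomotopy 𝒰 e h (linearCoderivation 𝒰 (LinearMap.id - e) a) =
      linearCoderivation 𝒰 h a := by
  have hn : IsHomogeneousMap 𝒰 𝒰 0 (LinearMap.id - e) := IsHomogeneousMap.id.sub he
  set N := linearCoderivation 𝒰 (LinearMap.id - e) with hN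
  have hp : ∀ a, proj 𝒰 (N a) = proj 𝒰 a - e (proj 𝒰 a) := proj_linearCoderivation 𝒰 hn
  have key : ∀ n, symmetrizedHomotopyTerm 𝒰 e h n ∘ₗ N = linearCoderivation 𝒰 h ∘ₗ weightProj 𝒰 n :=
    derivation_symmetrizedHomotopyTerm he hh (D := (LinearMap.llcomp K _ _ _).flip N)
      (fun φ ψ => by
        have e1 := conv_comp_linearCoderivation hn φ ψ
        rw [twist_zero, LinearMap.comp_id] at e1
        exact e1)
      (LinearMap.ext fun b => (congrArg (fun x => ι 𝒰 (h x)) (hp b)).trans (by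
        simp only [map_sub, hhe, sub_zero]; rfl))
      (LinearMap.ext fun b => (congrArg (fun x => ι 𝒰 (e x)) (hp b)).trans (by
        simp only [map_sub, hee, sub_self, map_zero]; rfl))
      (LinearMap.ext fun b => (congrArg (ι 𝒰) (hp b)).trans (map_sub _ _ _))
  have hlt := Nat.lt_succ_of_le (le_max_left (weights 𝒰 a).natDegree (weights 𝒰 (N a)).natDegree)
  have hlt' := Nat.lt_succ_of_le (le_max_right (weights 𝒰 a).natDegree (weights 𝒰 (N a)).natDegree)
  rw [symmetrizedHomotopy_apply _ hlt']
  conv_rhs => rw [← sum_weightProj 𝒰 a hlt, map_sum]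
  refine Finset.sum_congr rfl fun n _ => ?_
  rw [linearCoderivation_weightProj 𝒰 hn, ← LinearMap.comp_apply (symmetrizedHomotopyTerm 𝒰 e h n),
    key, LinearMap.comp_apply, weightProj_weightProj]

omit [CharZero K] in
-- Every monomial of the homotopy contains a factor in the image of `h`, which `f` annihilates.
theorem map_symmetrizedHomotopy (he : IsHomogeneousMap 𝒰 𝒰 0 e)
    (hh : IsHomogeneousMap 𝒰 𝒰 (-1) h) {𝒱 : ℤ → Submodule K V} {f : U →ₗ[K] V}
    (hf : IsHomogeneousMap 𝒰 𝒱 0 f) (hfh : f ∘ₗ h = 0) (a : GSym 𝒰) :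
    map f hf (symmetrizedHomotopy 𝒰 e h a) = 0 := by
  have key : ∀ n, (map f hf).toLinearMap ∘ₗ symmetrizedHomotopyTerm 𝒰 e h n = 0 := by
    intro n
    rcases n with - | n
    · rw [symmetrizedHomotopyTerm, Finset.univ_eq_empty, Finset.sum_empty, smul_zero,
        LinearMap.comp_zero]
    · have hu : (map f hf).toLinearMap ∘ₗ ι 𝒰 ∘ₗ h ∘ₗ proj 𝒰 = 0 := by
        ext b
        rw [LinearMap.comp_apply, LinearMap.comp_apply, LinearMap.comp_apply, AlgHom.toLinearMap_apply,
          map_ι, ← LinearMap.comp_apply f, hfh, LinearMap.zero_apply, map_zero]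
        rfl
      rw [symmetrizedHomotopyTerm_succ he hh, LinearMap.comp_smul, WithConv.ofConv_sum]
      refine (congrArg _ ((map_sum (LinearMap.llcomp K (GSym 𝒰) (GSym 𝒰) (GSym 𝒱)
        (map f hf).toLinearMap) _ _).trans (Finset.sum_eq_zero fun j _ => ?_))).trans (smul_zero _)
      refine (comp_conv (f := (map f hf).toLinearMap) (fun a b => map_mul (map f hf) a b) _ _).trans ?_
      rw [WithConv.ofConv_toConv, hu, zero_conv]
  rw [symmetrizedHomotopy_apply a (Nat.lt_succ_self _), map_sum]
  exact Finset.sum_eq_zero fun n _ => LinearMap.congr_fun (key n) _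

end GSym

/-! ### Maps shifting both a filtration index and a degree. -/

section Bihomogeneous

variable {K : Type*} [Field K] {M M' M'' : Type*} [AddCommGroup M] [Module K M] [AddCommGroup M']
  [Module K M'] [AddCommGroup M''] [Module K M'']

/-- `φ` shifts the two indices of a doubly indexed family of submodules by `s` and `t`. -/
def IsBihomogeneousMap (F : ℤ → ℤ → Submodule K M) (G : ℤ → ℤ → Submodule K M') (s t : ℤ)
    (φ : M →ₗ[K] M') : Prop :=
  ∀ k d, ∀ a ∈ F k d, φ a ∈ G (k + s) (d + t)

variable {F : ℤ → ℤ → Submodule K M} {G : ℤ → ℤ → Submodule K M'} {H : ℤ → ℤ → Submodule K M''}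
  {s t : ℤ}

theorem IsBihomogeneousMap.add {φ ψ : M →ₗ[K] M'} (hφ : IsBihomogeneousMap F G s t φ)
    (hψ : IsBihomogeneousMap F G s t ψ) : IsBihomogeneousMap F G s t (φ + ψ) := fun k d a ha =>
  Submodule.add_mem _ (hφ k d a ha) (hψ k d a ha)

theorem IsBihomogeneousMap.smul {φ : M →ₗ[K] M'} (c : K) (hφ : IsBihomogeneousMap F G s t φ) :
    IsBihomogeneousMap F G s t (c • φ) := fun k d a ha =>
  Submodule.smul_mem _ _ (hφ k d a ha)

theorem IsBihomogeneousMap.sum {κ : Type*} (u : Finset κ) {φ : κ → M →ₗ[K] M'}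
    (hφ : ∀ i ∈ u, IsBihomogeneousMap F G s t (φ i)) :
    IsBihomogeneousMap F G s t (∑ i ∈ u, φ i) := fun k d a ha => by
  rw [LinearMap.sum_apply]
  exact Submodule.sum_mem _ fun i hi => hφ i hi k d a ha

theorem IsBihomogeneousMap.id : IsBihomogeneousMap F F 0 0 (LinearMap.id : M →ₗ[K] M) :=
  fun k d a ha => by simpa using ha

theorem IsBihomogeneousMap.comp {ψ : M' →ₗ[K] M''} {φ : M →ₗ[K] M'} {s' t' s'' t'' : ℤ}
    (hψ : IsBihomogeneousMap G H s' t' ψ) (hφ : IsBihomogeneousMap F G s t φ) (hs : s + s' = s'')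
    (ht : t + t' = t'') : IsBihomogeneousMap F H s'' t'' (ψ ∘ₗ φ) := fun k d a ha => by
  rw [← hs, ← ht, ← add_assoc, ← add_assoc]
  exact hψ _ _ _ (hφ k d a ha)

end Bihomogeneous

/-! ### Operators with nonnegative integral eigenvalues -/

section Eigen

variable {K : Type*} [Field K] {M M' : Type*} [AddCommGroup M] [Module K M] [AddCommGroup M']
  [Module K M']

/-- The eigenvectors of `n` with nonnegative integral eigenvalue, on which `e` is the projection
onto the kernel of `n`. -/
def natEigenvectors (n e : M →ₗ[K] M) : Set M :=
  {y | ∃ m : ℕ, n y = (m : K) • y ∧ e y = if m = 0 then y else 0}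

/-- In characteristic zero a nonzero natural eigenvalue is invertible. The operator `g` is scalar on
each eigenspace, so it preserves every subspace spanned by eigenvectors; applied to filtration
steps, this says that inverting `n` does not leave the filtration. -/
theorem exists_partial_inverse [CharZero K] {n e : M →ₗ[K] M}
    (hspan : Submodule.span K (natEigenvectors n e) = ⊤) :
    ∃ g : M →ₗ[K] M, (∀ v, g (n v) = v - e v) ∧ (∀ v, n (g v) = v - e v) ∧
      ∀ S : Submodule K M, S ≤ Submodule.span K (natEigenvectors n e ∩ S) → ∀ v ∈ S, g v ∈ S := by
  classical
  have htop : ⨆ μ, Module.End.eigenspace (n : Module.End K M) μ = ⊤ := by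
    rw [eq_top_iff, ← hspan, Submodule.span_le]
    rintro y ⟨m, hm, -⟩
    exact Submodule.mem_iSup_of_mem (m : K) (Module.End.mem_eigenspace_iff.2 hm)
  have hint : DirectSum.IsInternal (Module.End.eigenspace (n : Module.End K M)) :=
    DirectSum.isInternal_submodule_of_iSupIndep_of_iSup_eq_top
      (Module.End.eigenspaces_iSupIndep _) htop
  let _ := hint.chooseDecomposition
  -- The convention `0⁻¹ = 0` makes `g` vanish on the kernel of `n`.
  let g : M →ₗ[K] M :=
    DirectSum.toModule K K M (fun μ => μ⁻¹ • (Module.End.eigenspace (n : Module.End K M) μ).subtype) ∘ₗ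
      (DirectSum.decomposeLinearEquiv (Module.End.eigenspace (n : Module.End K M))).toLinearMap
  have hg : ∀ (μ : K) (y : M), n y = μ • y → g y = μ⁻¹ • y := by
    intro μ y hy
    have hy' : y ∈ Module.End.eigenspace (n : Module.End K M) μ := Module.End.mem_eigenspace_iff.2 hy
    change DirectSum.toModule K K M _ (DirectSum.decompose _ y) = _
    rw [DirectSum.decompose_of_mem _ hy']
    erw [DirectSum.toModule_lof]
    rfl
  have key : ∀ y ∈ natEigenvectors n e, g (n y) = y - e y ∧ n (g y) = y - e y := by
    rintro y ⟨m, hm, he⟩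
    rw [hm, map_smul, hg _ _ hm, map_smul, hm, he, smul_smul, smul_smul]
    split_ifs with h
    · simp [h]
    · have h' : (m : K) ≠ 0 := Nat.cast_ne_zero.2 h
      rw [mul_inv_cancel₀ h', inv_mul_cancel₀ h', one_smul, sub_zero]
      exact ⟨rfl, rfl⟩
  have ext : ∀ {φ ψ : M →ₗ[K] M}, (∀ y ∈ natEigenvectors n e, φ y = ψ y) → φ = ψ := fun h =>
    LinearMap.ext_on hspan h
  refine ⟨g, fun v => ?_, fun v => ?_, fun S hS v hv => ?_⟩
  · exact LinearMap.congr_fun (ext (φ := g ∘ₗ n) (ψ := LinearMap.id - e) fun y hy => (key y hy).1) v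
  · exact LinearMap.congr_fun (ext (φ := n ∘ₗ g) (ψ := LinearMap.id - e) fun y hy => (key y hy).2) v
  · have : S ≤ S.comap g := by
      refine hS.trans (Submodule.span_le.2 ?_)
      rintro y ⟨⟨m, hm, -⟩, hy⟩
      rw [SetLike.mem_coe, Submodule.mem_comap, hg _ _ hm]
      exact Submodule.smul_mem _ _ hy
    exact this hv

/-- A filtration of a graded space, exhaustive and bounded below, by submodules spanned by
homogeneous eigenvectors of `n` with nonnegative integral eigenvalues. -/
structure IsEigenFiltration (𝒰 : ℤ → Submodule K M) (F : ℤ → ℤ → Submodule K M)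
    (n e : M →ₗ[K] M) : Prop where
  mono : ∀ {k l : ℤ} (d : ℤ), k ≤ l → F k d ≤ F l d
  eq_bot : ∀ k d : ℤ, k < 0 → F k d = ⊥
  le : ∀ k d : ℤ, F k d ≤ 𝒰 d
  exhaustive : ∀ (d : ℤ), ∀ x ∈ 𝒰 d, ∃ k, x ∈ F k d
  eigen : ∀ k d : ℤ, F k d ≤ Submodule.span K (natEigenvectors n e ∩ F k d)

namespace IsEigenFiltration

variable {𝒰 : ℤ → Submodule K M} [DirectSum.Decomposition 𝒰] {F : ℤ → ℤ → Submodule K M}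
  {n e r : M →ₗ[K] M}

include 𝒰 in
theorem span_eq_top (h : IsEigenFiltration 𝒰 F n e) :
    Submodule.span K (natEigenvectors n e) = ⊤ := by
  rw [eq_top_iff]
  rintro x -
  induction x using DirectSum.Decomposition.inductionOn 𝒰 with
  | zero => exact Submodule.zero_mem _
  | homogeneous x =>
    obtain ⟨k, hk⟩ := h.exhaustive _ _ x.2
    exact Submodule.span_mono Set.inter_subset_left (h.eigen _ _ hk)
  | add x y hx hy => exact Submodule.add_mem _ hx hy

/-- `n + r` is injective on the kernel of `e` when `r` lowers the filtration. -/
theorem eq_zero_of_apply_eq_zero [CharZero K] (h : IsEigenFiltration 𝒰 F n e)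
    (hr : IsBihomogeneousMap F F (-1) 0 r) {v : M} (hv : n v + r v = 0) (he : e v = 0) : v = 0 := by
  obtain ⟨g, hg, -, hgS⟩ := exists_partial_inverse h.span_eq_top
  -- Here `g` preserves the filtration and `r` lowers it, so membership of `v` in one step implies
  -- membership in the preceding one, down to zero.
  have e1 : v = -g (r v) := by
    have := hg v
    rw [he, sub_zero] at this
    rw [← map_neg, ← eq_neg_of_add_eq_zero_left hv, this]
  -- `v` need not be homogeneous, hence the supremum over degrees. Indexing by `m - 1` makes `m = 0`
  -- the zero subspace.
  have hmem : ∀ v : M, ∃ m : ℕ, v ∈ ⨆ d, F (m - 1) d := by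
    intro v
    induction v using DirectSum.Decomposition.inductionOn 𝒰 with
    | zero => exact ⟨0, Submodule.zero_mem _⟩
    | homogeneous x =>
      obtain ⟨k, hk⟩ := h.exhaustive _ _ x.2
      exact ⟨(k + 1).toNat, Submodule.mem_iSup_of_mem _ (h.mono _ (by omega) hk)⟩
    | add x y hx hy =>
      obtain ⟨m, hm⟩ := hx
      obtain ⟨l, hl⟩ := hy
      refine ⟨max m l, Submodule.add_mem _ ?_ ?_⟩
      · exact iSup_mono (fun d => h.mono d (by push_cast; omega)) hm
      · exact iSup_mono (fun d => h.mono d (by push_cast; omega)) hl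
  have hstep : ∀ m : ℕ, v ∈ ⨆ d, F (m - 1) d → v = 0 := by
    intro m
    induction m with
    | zero =>
      intro hm
      have : ⨆ d, F ((0 : ℕ) - 1 : ℤ) d = ⊥ := iSup_eq_bot.2 fun d => h.eq_bot _ d (by simp)
      rw [this] at hm
      exact hm
    | succ m ih =>
      intro hm
      refine ih ?_
      rw [e1]
      refine Submodule.neg_mem _ ?_
      have hle : ⨆ d, F ((m + 1 : ℕ) - 1) d ≤ (⨆ d, F (m - 1) d).comap (g ∘ₗ r) := by
        refine iSup_le fun d w hw => Submodule.mem_iSup_of_mem d ?_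
        refine hgS _ (h.eigen _ _) _ ?_
        convert hr _ _ w hw using 2 <;> push_cast <;> ring
      exact hle hm
  obtain ⟨m, hm⟩ := hmem v
  exact hstep m hm

/-- A linear map that vanishes on the images of `n + r` and `e` is zero when `r` lowers the
filtration. -/
theorem eq_zero_of_comp_eq_zero [CharZero K] (h : IsEigenFiltration 𝒰 F n e)
    (hr : IsBihomogeneousMap F F (-1) 0 r) {φ : M →ₗ[K] M'} (hφ : ∀ v, φ (n v + r v) = 0)
    (he : ∀ v, φ (e v) = 0) : φ = 0 := by
  obtain ⟨g, -, hg, hgS⟩ := exists_partial_inverse h.span_eq_top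
  -- Evaluating `φ` at `(n + r)(g v)` trades `v` for an element one step lower in the filtration.
  have e1 : ∀ v, φ v = -φ (r (g v)) := by
    intro v
    have h1 := hφ (g v)
    rw [hg, map_add, map_sub, he, sub_zero] at h1
    exact eq_neg_of_add_eq_zero_left h1
  have hstep : ∀ (m : ℕ) (d : ℤ), ∀ v ∈ F (m - 1) d, φ v = 0 := by
    intro m
    induction m with
    | zero =>
      intro d v hv
      rw [h.eq_bot _ d (by simp)] at hv
      rw [(Submodule.mem_bot K).1 hv, map_zero]
    | succ m ih =>
      intro d v hv
      rw [e1, neg_eq_zero]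
      refine ih d _ ?_
      convert hr _ _ _ (hgS _ (h.eigen _ _) v hv) using 2 <;> push_cast <;> ring
  refine homogeneous_ext 𝒰 fun d x hx => ?_
  obtain ⟨k, hk⟩ := h.exhaustive d x hx
  exact hstep (k + 1).toNat d x (h.mono d (by omega) hk)

end IsEigenFiltration

end Eigen

/-! ### Multiplicative filtrations of the symmetric algebra. -/

namespace GSym

variable {K : Type*} [Field K] {U B : Type*} [AddCommGroup U] [Module K U] [Ring B] [Algebra K B]
variable (𝒰 : ℤ → Submodule K U) (fil : ℤ → ℤ → Submodule K U)

/-- The multiplicative filtration of `S(U)` generated by a filtration of `U`; the second index is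
the degree. -/
def filtration (k d : ℤ) : Submodule K (GSym 𝒰) :=
  Submodule.span K {s | ∃ l : List (ℤ × ℤ × U), (∀ p ∈ l, p.2.2 ∈ fil p.1 p.2.1) ∧
    (l.map Prod.fst).sum ≤ k ∧ (l.map fun p => p.2.1).sum = d ∧
    (l.map fun p => ι 𝒰 p.2.2).prod = s}

variable {𝒰 fil}

theorem filtration_mono {k l : ℤ} (d : ℤ) (h : k ≤ l) : filtration 𝒰 fil k d ≤ filtration 𝒰 fil l d :=
  Submodule.span_mono fun _ ⟨s, hs, hk, hd, hp⟩ => ⟨s, hs, hk.trans h, hd, hp⟩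

theorem one_mem_filtration : (1 : GSym 𝒰) ∈ filtration 𝒰 fil 0 0 :=
  Submodule.subset_span ⟨[], by simp, by simp, by simp, by simp⟩

theorem mul_mem_filtration {k l d d' : ℤ} {a b : GSym 𝒰} (ha : a ∈ filtration 𝒰 fil k d)
    (hb : b ∈ filtration 𝒰 fil l d') : a * b ∈ filtration 𝒰 fil (k + l) (d + d') := by
  have hab : a * b ∈ filtration 𝒰 fil k d * filtration 𝒰 fil l d' := Submodule.mul_mem_mul ha hb
  rw [filtration, filtration, Submodule.span_mul_span] at hab
  refine Submodule.span_mono ?_ hab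
  rintro _ ⟨_, ⟨s, hs, hsk, rfl, rfl⟩, _, ⟨m, hm, hml, rfl, rfl⟩, rfl⟩
  refine ⟨s ++ m, ?_, by simpa using add_le_add hsk hml, by simp, by simp⟩
  intro p hp
  rcases List.mem_append.1 hp with h | h
  exacts [hs p h, hm p h]

theorem ι_mem_filtration {k d : ℤ} {x : U} (hx : x ∈ fil k d) : ι 𝒰 x ∈ filtration 𝒰 fil k d :=
  Submodule.subset_span ⟨[(k, d, x)], by simpa using hx, by simp, by simp, by simp⟩

theorem filtration_le (hle : ∀ k d, fil k d ≤ 𝒰 d) (k d : ℤ) :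
    filtration 𝒰 fil k d ≤ degree 𝒰 d := by
  refine Submodule.span_le.2 ?_
  rintro _ ⟨l, hl, -, rfl, rfl⟩
  exact Submodule.subset_span ⟨l.map Prod.snd, by
    intro p hp
    obtain ⟨q, hq, rfl⟩ := List.mem_map.1 hp
    exact hle _ _ (hl q hq), by rw [List.map_map]; rfl, by rw [List.map_map]; rfl⟩

/-- Induction over the spanning products of the filtration. -/
theorem filtration_induction {p : ℤ → ℤ → GSym 𝒰 → Prop} (one : p 0 0 1)
    (ι_mul : ∀ (i j k d : ℤ) (x : U) (a : GSym 𝒰), x ∈ fil i j → p k d a →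
      p (i + k) (j + d) (ι 𝒰 x * a))
    (mono : ∀ (k l d : ℤ) (a : GSym 𝒰), k ≤ l → p k d a → p l d a)
    (zero : ∀ k d, p k d 0) (add : ∀ (k d : ℤ) (a b : GSym 𝒰), p k d a → p k d b → p k d (a + b))
    (smul : ∀ (k d : ℤ) (c : K) (a : GSym 𝒰), p k d a → p k d (c • a)) {k d : ℤ} {a : GSym 𝒰}
    (ha : a ∈ filtration 𝒰 fil k d) : p k d a := by
  induction ha using Submodule.span_induction with
  | mem a h =>
    obtain ⟨l, hl, hk, rfl, rfl⟩ := h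
    refine mono _ _ _ _ hk ?_
    clear hk
    induction l with
    | nil => exact one
    | cons q l ih =>
      exact ι_mul _ _ _ _ _ _ (hl q List.mem_cons_self) (ih fun r hr => hl r (List.mem_cons_of_mem _ hr))
  | zero => exact zero _ _
  | add a b _ _ iha ihb => exact add _ _ _ _ iha ihb
  | smul c a _ ih => exact smul _ _ _ _ ih

theorem isBihomogeneousMap_mulLeft {i j : ℤ} {x : U} (hx : x ∈ fil i j) :
    IsBihomogeneousMap (filtration 𝒰 fil) (filtration 𝒰 fil) i j (LinearMap.mulLeft K (ι 𝒰 x)) :=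
  fun k d a ha => by
    rw [add_comm k, add_comm d]
    exact mul_mem_filtration (ι_mem_filtration hx) ha

section

variable [DirectSum.Decomposition 𝒰]

theorem isBihomogeneousMap_twist (hle : ∀ k d, fil k d ≤ 𝒰 d) (k : ℤ) :
    IsBihomogeneousMap (filtration 𝒰 fil) (filtration 𝒰 fil) 0 0 (twist (degree 𝒰) k) :=
  fun l d a ha => by
    rw [add_zero, add_zero, twist_of_mem _ k (filtration_le hle _ _ ha)]
    exact Submodule.smul_mem _ _ ha

theorem isBihomogeneousMap_conv (hle : ∀ k d, fil k d ≤ 𝒰 d) {φ ψ : GSym 𝒰 →ₗ[K] GSym 𝒰}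
    {s t s' t' s'' t'' : ℤ} (hφ : IsBihomogeneousMap (filtration 𝒰 fil) (filtration 𝒰 fil) s t φ)
    (hψ : IsBihomogeneousMap (filtration 𝒰 fil) (filtration 𝒰 fil) s' t' ψ) (hs : s + s' = s'')
    (ht : t + t' = t'') :
    IsBihomogeneousMap (filtration 𝒰 fil) (filtration 𝒰 fil) s'' t'' (conv φ ψ) := by
  intro k d a ha
  revert φ ψ s t s' t' s'' t''
  refine filtration_induction (p := fun k d a => ∀ {φ ψ : GSym 𝒰 →ₗ[K] GSym 𝒰}
    {s t s' t' s'' t'' : ℤ}, IsBihomogeneousMap (filtration 𝒰 fil) (filtration 𝒰 fil) s t φ →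
    IsBihomogeneousMap (filtration 𝒰 fil) (filtration 𝒰 fil) s' t' ψ → s + s' = s'' →
    t + t' = t'' → conv φ ψ a ∈ filtration 𝒰 fil (k + s'') (d + t'')) ?_ ?_ ?_ ?_ ?_ ?_ ha
  · intro φ ψ s t s' t' s'' t'' hφ hψ hs ht
    rw [conv_one]
    have h := mul_mem_filtration (hφ _ _ _ one_mem_filtration) (hψ _ _ _ one_mem_filtration)
    convert h using 2 <;> simp [hs, ht]
  · intro i j k d x a hx ih φ ψ s t s' t' s'' t'' hφ hψ hs ht
    rw [conv_ι_mul 𝒰 _ _ (hle _ _ hx)]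
    have e1 : i + k + s'' = k + (i + s'') := by ring
    have e2 : j + d + t'' = d + (j + t'') := by ring
    rw [e1, e2]
    refine Submodule.add_mem _ (ih (hφ.comp (isBihomogeneousMap_mulLeft hx) rfl rfl) hψ ?_ ?_)
      (ih (hφ.comp (isBihomogeneousMap_twist hle _) rfl rfl)
        (hψ.comp (isBihomogeneousMap_mulLeft hx) rfl rfl) ?_ ?_) <;> omega
  · intro k l d a hkl ih φ ψ s t s' t' s'' t'' hφ hψ hs ht
    exact filtration_mono _ (by omega) (ih hφ hψ hs ht)
  · intro k d φ ψ s t s' t' s'' t'' hφ hψ hs ht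
    rw [map_zero]
    exact Submodule.zero_mem _
  · intro k d a b iha ihb φ ψ s t s' t' s'' t'' hφ hψ hs ht
    rw [map_add]
    exact Submodule.add_mem _ (iha hφ hψ hs ht) (ihb hφ hψ hs ht)
  · intro k d c a ih φ ψ s t s' t' s'' t'' hφ hψ hs ht
    rw [map_smul]
    exact Submodule.smul_mem _ _ (ih hφ hψ hs ht)

theorem isBihomogeneousMap_linearCoderivation (hle : ∀ k d, fil k d ≤ 𝒰 d) {s t : ℤ}
    {φ : U →ₗ[K] U} (hφ : IsBihomogeneousMap fil fil s t φ) (hφ' : IsHomogeneousMap 𝒰 𝒰 t φ) :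
    IsBihomogeneousMap (filtration 𝒰 fil) (filtration 𝒰 fil) s t (linearCoderivation 𝒰 φ) := by
  intro k d a ha
  refine filtration_induction (p := fun k d a => a ∈ filtration 𝒰 fil k d ∧
    linearCoderivation 𝒰 φ a ∈ filtration 𝒰 fil (k + s) (d + t)) ?_ ?_ ?_ ?_ ?_ ?_ ha |>.2
  · exact ⟨one_mem_filtration, by rw [linearCoderivation_one]; exact Submodule.zero_mem _⟩
  · rintro i j k d x a hx ⟨h1, h2⟩
    refine ⟨mul_mem_filtration (ι_mem_filtration hx) h1, ?_⟩
    rw [linearCoderivation_ι_mul hφ', twist_of_mem 𝒰 t (hle _ _ hx), map_smul, smul_mul_assoc]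
    refine Submodule.add_mem _ ?_ (Submodule.smul_mem _ _ ?_)
    · convert mul_mem_filtration (ι_mem_filtration (hφ _ _ _ hx)) h1 using 2 <;> ring
    · convert mul_mem_filtration (ι_mem_filtration hx) h2 using 2 <;> ring
  · rintro k l d a hkl ⟨h1, h2⟩
    exact ⟨filtration_mono _ hkl h1, filtration_mono _ (by omega) h2⟩
  · exact fun k d => ⟨Submodule.zero_mem _, by rw [map_zero]; exact Submodule.zero_mem _⟩
  · rintro k d a b ⟨h1, h2⟩ ⟨h3, h4⟩
    exact ⟨Submodule.add_mem _ h1 h3, by rw [map_add]; exact Submodule.add_mem _ h2 h4⟩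
  · rintro k d c a ⟨h1, h2⟩
    exact ⟨Submodule.smul_mem _ _ h1, by rw [map_smul]; exact Submodule.smul_mem _ _ h2⟩

/-- A derivation adds eigenvalues. A sum of two natural numbers vanishes only if both do, so `S(e)`
is again the projection onto the kernel; with arbitrary scalars as eigenvalues this would fail. -/
theorem mul_mem_natEigenvectors [CharZero K] {n e : U →ₗ[K] U} (hn : IsHomogeneousMap 𝒰 𝒰 0 n)
    (he : IsHomogeneousMap 𝒰 𝒰 0 e) {x : U} {a : GSym 𝒰} (hx : x ∈ natEigenvectors n e)
    (ha : a ∈ natEigenvectors (linearCoderivation 𝒰 n) (map e he).toLinearMap) :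
    ι 𝒰 x * a ∈ natEigenvectors (linearCoderivation 𝒰 n) (map e he).toLinearMap := by
  obtain ⟨m, h1, h2⟩ := hx
  obtain ⟨l, h3, h4⟩ := ha
  refine ⟨m + l, ?_, ?_⟩
  · rw [linearCoderivation_ι_mul hn, h1, h3, twist_zero, map_smul, smul_mul_assoc, LinearMap.id_apply,
      mul_smul_comm, Nat.cast_add, add_smul]
  · rw [AlgHom.toLinearMap_apply] at h4 ⊢
    rw [map_mul, map_ι, h2, h4]
    split_ifs <;> first | omega | simp

/-- Products of homogeneous eigenvectors span each filtration step of `S(U)`. Applied twice, the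
construction reaches `S(S(U))`, where the cocumulants live. -/
theorem isEigenFiltration [CharZero K] {n e : U →ₗ[K] U} (hn : IsHomogeneousMap 𝒰 𝒰 0 n)
    (he : IsHomogeneousMap 𝒰 𝒰 0 e) (h : IsEigenFiltration 𝒰 fil n e) :
    IsEigenFiltration (degree 𝒰) (filtration 𝒰 fil) (linearCoderivation 𝒰 n)
      (map e he).toLinearMap where
  mono d h := filtration_mono d h
  eq_bot k d hk := by
    rw [eq_bot_iff]
    intro a ha
    refine filtration_induction (p := fun k d a => k < 0 → a = 0) ?_ ?_ ?_ ?_ ?_ ?_ ha hk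
    · intro h0
      exact absurd h0 (lt_irrefl _)
    · intro i j k d x a hx ih hik
      by_cases hk : k < 0
      · rw [ih hk, mul_zero]
      · rw [h.eq_bot i j (by omega), Submodule.mem_bot] at hx
        rw [hx, map_zero, zero_mul]
    · exact fun k l d a hkl ih hl => ih (hkl.trans_lt hl)
    · exact fun _ _ _ => rfl
    · intro k d a b ha hb hk
      rw [ha hk, hb hk, add_zero]
    · intro k d c a ha hk
      rw [ha hk, smul_zero]
  le := filtration_le h.le
  exhaustive d a ha := by
    induction ha using Submodule.span_induction with
    | mem a ha =>
      obtain ⟨l, hl, rfl, rfl⟩ := ha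
      induction l with
      | nil => exact ⟨0, one_mem_filtration⟩
      | cons p l ih =>
        obtain ⟨k, hk⟩ := ih fun q hq => hl q (List.mem_cons_of_mem _ hq)
        obtain ⟨i, hi⟩ := h.exhaustive _ _ (hl p List.mem_cons_self)
        exact ⟨i + k, mul_mem_filtration (ι_mem_filtration hi) hk⟩
    | zero => exact ⟨0, Submodule.zero_mem _⟩
    | add a b _ _ iha ihb =>
      obtain ⟨k, hk⟩ := iha
      obtain ⟨l, hl⟩ := ihb
      exact ⟨max k l, Submodule.add_mem _ (filtration_mono _ (le_max_left _ _) hk)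
        (filtration_mono _ (le_max_right _ _) hl)⟩
    | smul c a _ ih =>
      obtain ⟨k, hk⟩ := ih
      exact ⟨k, Submodule.smul_mem _ _ hk⟩
  eigen k d := by
    intro a ha
    refine filtration_induction (p := fun k d a => a ∈ Submodule.span K
      (natEigenvectors (linearCoderivation 𝒰 n) (map e he).toLinearMap ∩ filtration 𝒰 fil k d))
      ?_ ?_ ?_ ?_ ?_ ?_ ha
    · refine Submodule.subset_span ⟨⟨0, ?_, ?_⟩, one_mem_filtration⟩
      · rw [linearCoderivation_one, Nat.cast_zero, zero_smul]
      · rw [AlgHom.toLinearMap_apply, map_one, if_pos rfl]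
    · intro i j k d x a hx ih
      have h1 : ι 𝒰 x * a ∈ (Submodule.span K (natEigenvectors n e ∩ fil i j)).map (ι 𝒰) *
          Submodule.span K (natEigenvectors (linearCoderivation 𝒰 n) (map e he).toLinearMap ∩
            filtration 𝒰 fil k d) :=
        Submodule.mul_mem_mul (Submodule.mem_map_of_mem (h.eigen i j hx)) ih
      rw [Submodule.map_span, Submodule.span_mul_span] at h1
      refine Submodule.span_mono ?_ h1
      rintro _ ⟨_, ⟨y, ⟨hy, hy'⟩, rfl⟩, b, ⟨hb, hb'⟩, rfl⟩
      exact ⟨mul_mem_natEigenvectors hn he hy hb, mul_mem_filtration (ι_mem_filtration hy') hb'⟩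
    · exact fun k l d a hkl ih =>
        Submodule.span_mono (Set.inter_subset_inter_right _ (filtration_mono d hkl)) ih
    · exact fun _ _ => Submodule.zero_mem _
    · exact fun _ _ _ _ ha hb => Submodule.add_mem _ ha hb
    · exact fun _ _ c _ ha => Submodule.smul_mem _ c ha

end

/-! ### The filtration by the number of factors -/

variable (𝒰)

/-- The filtration of `U` that places everything in weight one. -/
def generatorFiltration (k d : ℤ) : Submodule K U := if 1 ≤ k then 𝒰 d else ⊥

/-- The filtration of `S(U)` by the number of factors. -/
abbrev weightFiltration (k d : ℤ) : Submodule K (GSym 𝒰) :=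
  filtration 𝒰 (generatorFiltration 𝒰) k d

variable {𝒰}

theorem generatorFiltration_le (k d : ℤ) : generatorFiltration 𝒰 k d ≤ 𝒰 d := by
  rw [generatorFiltration]
  split_ifs
  exacts [le_rfl, bot_le]

theorem ι_mem_weightFiltration {d : ℤ} {x : U} (hx : x ∈ 𝒰 d) : ι 𝒰 x ∈ weightFiltration 𝒰 1 d :=
  ι_mem_filtration (by rwa [generatorFiltration, if_pos le_rfl])

/-- Writing `x = e x + (x - e x)` splits every vector into eigenvectors for the eigenvalues `0` and
`1`. -/
theorem isEigenFiltration_generatorFiltration {n e : U →ₗ[K] U} (he : IsHomogeneousMap 𝒰 𝒰 0 e)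
    (hn : ∀ x, n x = x - e x) (hee : ∀ x, e (e x) = e x) :
    IsEigenFiltration 𝒰 (generatorFiltration 𝒰) n e where
  mono d h := by
    rw [generatorFiltration, generatorFiltration]
    split_ifs with h1 h2
    exacts [le_rfl, absurd (h1.trans h) h2, bot_le, bot_le]
  eq_bot k d hk := if_neg (by omega)
  le := generatorFiltration_le
  exhaustive d x hx := ⟨1, by rwa [generatorFiltration, if_pos le_rfl]⟩
  eigen k d := by
    rw [generatorFiltration]
    split_ifs
    · intro x hx
      have hex : e x ∈ 𝒰 d := by simpa using he d x hx
      rw [← add_sub_cancel (e x) x]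
      refine Submodule.add_mem _ (Submodule.subset_span ⟨⟨0, ?_, ?_⟩, hex⟩)
        (Submodule.subset_span ⟨⟨1, ?_, ?_⟩, Submodule.sub_mem _ hx hex⟩)
      · rw [hn, hee, sub_self, Nat.cast_zero, zero_smul]
      · rw [hee, if_pos rfl]
      · rw [hn, map_sub, hee, sub_self, sub_zero, Nat.cast_one, one_smul]
      · rw [map_sub, hee, sub_self, if_neg one_ne_zero]
    · exact bot_le

/-- It suffices to consider the products of at most `k` homogeneous elements. -/
theorem weightFiltration_induction {p : GSym 𝒰 → Prop} {k d : ℤ}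
    (prod : ∀ l : List (ℤ × U), (∀ q ∈ l, q.2 ∈ 𝒰 q.1) → (l.length : ℤ) ≤ k →
      (l.map Prod.fst).sum = d → p (l.map fun q => ι 𝒰 q.2).prod) (zero : p 0)
    (add : ∀ a b, p a → p b → p (a + b)) (smul : ∀ (c : K) a, p a → p (c • a)) {a : GSym 𝒰}
    (ha : a ∈ weightFiltration 𝒰 k d) : p a := by
  induction ha using Submodule.span_induction with
  | mem a h =>
    obtain ⟨l, hl, hk, rfl, rfl⟩ := h
    by_cases hpos : ∀ q ∈ l, 1 ≤ q.1
    · have hlen : (l.length : ℤ) ≤ (l.map Prod.fst).sum := by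
        clear * - hpos
        induction l with
        | nil => simp
        | cons q l ih =>
          have h1 := hpos q List.mem_cons_self
          have h2 := ih fun r hr => hpos r (List.mem_cons_of_mem _ hr)
          simp only [List.length_cons, List.map_cons, List.sum_cons]
          push_cast
          omega
      have h := prod (l.map Prod.snd) (by
        intro q hq
        obtain ⟨r, hr, rfl⟩ := List.mem_map.1 hq
        exact generatorFiltration_le _ _ (hl r hr)) (by rw [List.length_map]; omega)
        (by rw [List.map_map]; rfl)
      rwa [List.map_map] at h
    -- A factor placed in a filtration step below one is zero, so the whole product vanishes.
    · push Not at hpos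
      obtain ⟨q, hq, hq1⟩ := hpos
      have hq0 : q.2.2 = 0 := by
        have h := hl q hq
        rw [generatorFiltration, if_neg (by omega)] at h
        exact h
      have h0 : (l.map fun q => ι 𝒰 q.2.2).prod = 0 :=
        List.prod_eq_zero (List.mem_map.2 ⟨q, hq, by rw [hq0, map_zero]⟩)
      rw [h0]
      exact zero
  | zero => exact zero
  | add a b _ _ iha ihb => exact add _ _ iha ihb
  | smul c a _ ih => exact smul _ _ ih

end GSym

/-! ### The weight filtration and the operators of the transfer. -/

namespace GSym

variable {K : Type*} [Field K] {U : Type*} [AddCommGroup U] [Module K U]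
variable {𝒰 : ℤ → Submodule K U} [DirectSum.Decomposition 𝒰]

omit [DirectSum.Decomposition 𝒰] in
theorem weightProj_prod (l : List U) (n : ℕ) : weightProj 𝒰 n (l.map (ι 𝒰)).prod =
    if l.length = n then (l.map (ι 𝒰)).prod else 0 := by
  induction l generalizing n with
  | nil => simp [weightProj_one, eq_comm]
  | cons x l ih =>
    rw [List.map_cons, List.prod_cons]
    rcases n with - | n
    · rw [weightProj_zero_ι_mul, if_neg (by simp)]
    · rw [weightProj_succ_ι_mul, ih, List.length_cons]
      simp only [Nat.add_right_cancel_iff]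
      split_ifs
      exacts [rfl, mul_zero _]

omit [DirectSum.Decomposition 𝒰] in
theorem weightProj_mem {d : ℤ} {a : GSym 𝒰} (ha : a ∈ degree 𝒰 d) (n : ℕ) :
    weightProj 𝒰 n a ∈ weightFiltration 𝒰 n d := by
  induction ha using Submodule.span_induction with
  | mem a h =>
    obtain ⟨l, hl, rfl, rfl⟩ := h
    have e : (l.map fun p => ι 𝒰 p.2) = (l.map Prod.snd).map (ι 𝒰) := by rw [List.map_map]; rfl
    rw [e, weightProj_prod, ← e, List.length_map]
    split_ifs with hn
    · refine Submodule.subset_span ⟨l.map fun p => (1, p), ?_, ?_, ?_, ?_⟩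
      · intro p hp
        obtain ⟨q, hq, rfl⟩ := List.mem_map.1 hp
        rw [generatorFiltration, if_pos le_rfl]
        exact hl q hq
      · rw [List.map_map]
        change (l.map (fun _ => (1 : ℤ))).sum ≤ n
        simp [hn]
      · rw [List.map_map]; rfl
      · rw [List.map_map]; rfl
    · exact Submodule.zero_mem _
  | zero => rw [map_zero]; exact Submodule.zero_mem _
  | add a b _ _ iha ihb => rw [map_add]; exact Submodule.add_mem _ iha ihb
  | smul c a _ ih => rw [map_smul]; exact Submodule.smul_mem _ _ ih

omit [DirectSum.Decomposition 𝒰] in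
theorem isBihomogeneousMap_weightProj (n : ℕ) :
    IsBihomogeneousMap (weightFiltration 𝒰) (weightFiltration 𝒰) 0 0 (weightProj 𝒰 n) := by
  intro k d a ha
  rw [add_zero, add_zero]
  refine weightFiltration_induction (p := fun a => weightProj 𝒰 n a ∈ weightFiltration 𝒰 k d)
    ?_ ?_ ?_ ?_ ha
  · rintro l hl hk rfl
    have hd : (l.map fun p => ι 𝒰 p.2).prod ∈ degree 𝒰 (l.map Prod.fst).sum :=
      Submodule.subset_span ⟨l, hl, rfl, rfl⟩
    have h := weightProj_mem hd n
    have e : (l.map fun p => ι 𝒰 p.2) = (l.map Prod.snd).map (ι 𝒰) := by rw [List.map_map]; rfl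
    by_cases hn : l.length = n
    · exact filtration_mono _ (by omega) h
    · rw [e, weightProj_prod, List.length_map, if_neg hn]
      exact Submodule.zero_mem _
  · rw [map_zero]; exact Submodule.zero_mem _
  · intro a b ha hb; rw [map_add]; exact Submodule.add_mem _ ha hb
  · intro c a ha; rw [map_smul]; exact Submodule.smul_mem _ _ ha

omit [DirectSum.Decomposition 𝒰] in
theorem exists_mem_weightFiltration {d : ℤ} {a : GSym 𝒰} (ha : a ∈ degree 𝒰 d) :
    ∃ k, a ∈ weightFiltration 𝒰 k d := by
  induction ha using Submodule.span_induction with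
  | mem a ha =>
    obtain ⟨l, hl, rfl, rfl⟩ := ha
    induction l with
    | nil => exact ⟨0, one_mem_filtration⟩
    | cons p l ih =>
      obtain ⟨k, hk⟩ := ih fun q hq => hl q (List.mem_cons_of_mem _ hq)
      exact ⟨1 + k, mul_mem_filtration (ι_mem_weightFiltration (hl p List.mem_cons_self)) hk⟩
  | zero => exact ⟨0, Submodule.zero_mem _⟩
  | add a b _ _ iha ihb =>
    obtain ⟨k, hk⟩ := iha
    obtain ⟨l, hl⟩ := ihb
    exact ⟨max k l, Submodule.add_mem _ (filtration_mono _ (le_max_left _ _) hk)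
      (filtration_mono _ (le_max_right _ _) hl)⟩
  | smul c a _ ih =>
    obtain ⟨k, hk⟩ := ih
    exact ⟨k, Submodule.smul_mem _ _ hk⟩

omit [DirectSum.Decomposition 𝒰] in
theorem isHomogeneousMap_of_isBihomogeneousMap {s t : ℤ} {φ : GSym 𝒰 →ₗ[K] GSym 𝒰}
    (hφ : IsBihomogeneousMap (weightFiltration 𝒰) (weightFiltration 𝒰) s t φ) :
    IsHomogeneousMap (degree 𝒰) (degree 𝒰) t φ := fun d a ha => by
  obtain ⟨k, hk⟩ := exists_mem_weightFiltration ha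
  exact filtration_le generatorFiltration_le _ _ (hφ k d a hk)

omit [DirectSum.Decomposition 𝒰] in
theorem weightFiltration_eq_bot {k : ℤ} (d : ℤ) (hk : k < 0) : weightFiltration 𝒰 k d = ⊥ := by
  rw [eq_bot_iff]
  intro a ha
  refine weightFiltration_induction (p := fun a => a = 0) ?_ rfl ?_ ?_ ha
  · intro l _ hl _
    omega
  · rintro a b rfl rfl
    rw [add_zero]
  · rintro c a rfl
    rw [smul_zero]

omit [DirectSum.Decomposition 𝒰] in
/-- A Taylor coefficient that vanishes on `1`. -/
theorem isBihomogeneousMap_ι_comp {q : GSym 𝒰 →ₗ[K] U} {t : ℤ}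
    (hq : IsHomogeneousMap (degree 𝒰) 𝒰 t q) (h1 : q 1 = 0) :
    IsBihomogeneousMap (weightFiltration 𝒰) (weightFiltration 𝒰) 0 t (ι 𝒰 ∘ₗ q) := by
  intro k d a ha
  rcases lt_or_ge k 1 with hk | hk
  · have h : (ι 𝒰 ∘ₗ q) a = 0 := by
      refine weightFiltration_induction (p := fun a => (ι 𝒰 ∘ₗ q) a = 0) ?_ (map_zero _) ?_ ?_ ha
      · intro l _ hl _
        obtain rfl : l = [] := List.length_eq_zero_iff.1 (by omega)
        rw [List.map_nil, List.prod_nil, LinearMap.comp_apply, h1, map_zero]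
      · intro a b ha hb; rw [map_add, ha, hb, add_zero]
      · intro c a ha; rw [map_smul, ha, smul_zero]
    rw [h]
    exact Submodule.zero_mem _
  · exact filtration_mono _ (by omega)
      (ι_mem_weightFiltration (hq d a (filtration_le generatorFiltration_le _ _ ha)))

omit [DirectSum.Decomposition 𝒰] in
/-- A Taylor coefficient that vanishes on `1` and on `U`. -/
theorem isBihomogeneousMap_ι_comp_of_ι {q : GSym 𝒰 →ₗ[K] U} {t : ℤ}
    (hq : IsHomogeneousMap (degree 𝒰) 𝒰 t q) (h1 : q 1 = 0) (hι : ∀ x, q (ι 𝒰 x) = 0) :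
    IsBihomogeneousMap (weightFiltration 𝒰) (weightFiltration 𝒰) (-1) t (ι 𝒰 ∘ₗ q) := by
  intro k d a ha
  rcases lt_or_ge k 2 with hk | hk
  -- Below weight two there are only multiples of `1` and generators, where `q` vanishes. From
  -- weight two on, a value of weight one lies at least one step lower.
  · have h : (ι 𝒰 ∘ₗ q) a = 0 := by
      refine weightFiltration_induction (p := fun a => (ι 𝒰 ∘ₗ q) a = 0) ?_ (map_zero _) ?_ ?_ ha
      · intro l _ hl _
        rcases l with - | ⟨x, - | ⟨y, l⟩⟩
        · rw [List.map_nil, List.prod_nil, LinearMap.comp_apply, h1, map_zero]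
        · rw [List.map_cons, List.map_nil, List.prod_singleton, LinearMap.comp_apply, hι, map_zero]
        · simp only [List.length_cons] at hl
          omega
      · intro a b ha hb; rw [map_add, ha, hb, add_zero]
      · intro c a ha; rw [map_smul, ha, smul_zero]
    rw [h]
    exact Submodule.zero_mem _
  · exact filtration_mono _ (by omega)
      (ι_mem_weightFiltration (hq d a (filtration_le generatorFiltration_le _ _ ha)))

theorem isBihomogeneousMap_linearCoderivation_weight {d : U →ₗ[K] U} {t : ℤ}
    (hd : IsHomogeneousMap 𝒰 𝒰 t d) : IsBihomogeneousMap (weightFiltration 𝒰) (weightFiltration 𝒰)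
      0 t (linearCoderivation 𝒰 d) := by
  refine isBihomogeneousMap_linearCoderivation generatorFiltration_le (fun k i x hx => ?_) hd
  rw [add_zero]
  rw [generatorFiltration] at hx ⊢
  split_ifs at hx ⊢
  · exact hd i x hx
  · rw [(Submodule.mem_bot K).1 hx, map_zero]; exact Submodule.zero_mem _

theorem isBihomogeneousMap_symmetrizedHomotopy {e h : U →ₗ[K] U} (he : IsHomogeneousMap 𝒰 𝒰 0 e)
    (hh : IsHomogeneousMap 𝒰 𝒰 (-1) h) : IsBihomogeneousMap (weightFiltration 𝒰)
      (weightFiltration 𝒰) 0 (-1) (symmetrizedHomotopy 𝒰 e h) := by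
  have hcoeff : ∀ {f : U →ₗ[K] U} {t : ℤ}, IsHomogeneousMap 𝒰 𝒰 t f →
      IsBihomogeneousMap (weightFiltration 𝒰) (weightFiltration 𝒰) 0 t (ι 𝒰 ∘ₗ f ∘ₗ proj 𝒰) :=
    fun hf => isBihomogeneousMap_ι_comp (hf.comp (proj_degree 𝒰) (zero_add _)) (by
      rw [LinearMap.comp_apply, proj_one, map_zero])
  have hpow : ∀ {f : U →ₗ[K] U}, IsHomogeneousMap 𝒰 𝒰 0 f → ∀ n : ℕ,
      IsBihomogeneousMap (weightFiltration 𝒰) (weightFiltration 𝒰) 0 0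
        (WithConv.toConv (ι 𝒰 ∘ₗ f ∘ₗ proj 𝒰) ^ n).ofConv := by
    intro f hf n
    induction n with
    | zero =>
      rw [pow_zero]
      intro k d a ha
      rw [add_zero, add_zero]
      change algebraMap K _ (CoalgebraStruct.counit a) ∈ _
      rw [← weightProj_zero]
      simpa using isBihomogeneousMap_weightProj 0 k d a ha
    | succ n ih =>
      rw [pow_succ]
      exact isBihomogeneousMap_conv generatorFiltration_le ih (hcoeff hf) (add_zero 0) (add_zero 0)
  have hterm : ∀ n, IsBihomogeneousMap (weightFiltration 𝒰) (weightFiltration 𝒰) 0 (-1)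
      (symmetrizedHomotopyTerm 𝒰 e h n) := by
    intro n
    rcases n with - | n
    · rw [symmetrizedHomotopyTerm, Finset.univ_eq_empty, Finset.sum_empty, smul_zero]
      exact fun _ _ _ _ => Submodule.zero_mem _
    · rw [symmetrizedHomotopyTerm_succ he hh, WithConv.ofConv_sum]
      refine (IsBihomogeneousMap.sum _ fun j _ => ?_).smul _
      refine isBihomogeneousMap_conv generatorFiltration_le (hcoeff hh)
        (isBihomogeneousMap_conv generatorFiltration_le (hpow he j)
          (by simpa using hpow IsHomogeneousMap.id (n - j)) (add_zero 0) (add_zero 0))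
        (add_zero 0) (add_zero _)
  intro k d a ha
  rw [symmetrizedHomotopy_apply a (Nat.lt_succ_self _)]
  refine Submodule.sum_mem _ fun n _ => hterm n k d _ ?_
  simpa using isBihomogeneousMap_weightProj n k d a ha

/-! ### The geometric series of an operator that lowers the weight -/

section GeomWeight

variable {M : Module.End K (GSym 𝒰)}
  (hM : IsBihomogeneousMap (weightFiltration 𝒰) (weightFiltration 𝒰) (-1) 0 M)

omit [DirectSum.Decomposition 𝒰] in
include hM in
theorem isBihomogeneousMap_pow (k : ℕ) :
    IsBihomogeneousMap (weightFiltration 𝒰) (weightFiltration 𝒰) (-k) 0 (M ^ k) := by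
  induction k with
  | zero => exact fun k d a ha => by simpa using ha
  | succ k ih =>
    rw [pow_succ]
    exact ih.comp hM (by push_cast; ring) (add_zero 0)

include hM in
-- Each application lowers the weight by one and there are no negative weights. This is why
-- truncating the geometric series at the weight loses nothing.
theorem pow_weightProj {k n : ℕ} (h : n < k) (a : GSym 𝒰) : (M ^ k) (weightProj 𝒰 n a) = 0 := by
  induction a using DirectSum.Decomposition.inductionOn (degree 𝒰) with
  | zero => rw [map_zero, map_zero]
  | @homogeneous d a =>
    have h1 := isBihomogeneousMap_pow hM k _ _ _ (weightProj_mem a.2 n)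
    rw [weightFiltration_eq_bot _ (by omega)] at h1
    exact h1
  | add a b ha hb => rw [map_add, map_add, ha, hb, add_zero]

include hM in
-- Extra powers vanish, so the cutoff, which depends on the weight component in the definition, may
-- be replaced by any uniform bound. A common bound is what allows the series of two elements to be
-- compared.
theorem geomWeight_apply (a : GSym 𝒰) {N : ℕ} (hN : (weights 𝒰 a).natDegree < N) :
    geomWeight 𝒰 M a = ∑ k ∈ Finset.range N, (M ^ k) a := by
  rw [geomWeight, lsum_weights 𝒰 _ a hN]
  conv_rhs => rw [← sum_weightProj 𝒰 a hN]
  simp only [map_sum]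
  rw [Finset.sum_comm]
  refine Finset.sum_congr rfl fun n hn => ?_
  rw [LinearMap.sum_apply]
  refine Finset.sum_subset (fun k hk => ?_) fun k _ hk => ?_
  · rw [Finset.mem_range] at *
    omega
  · rw [Finset.mem_range] at hk
    exact pow_weightProj hM (by omega) a

include hM in
theorem pow_eq_zero (a : GSym 𝒰) {N : ℕ} (hN : (weights 𝒰 a).natDegree < N) : (M ^ N) a = 0 := by
  rw [← sum_weightProj 𝒰 a hN, map_sum]
  exact Finset.sum_eq_zero fun n hn => pow_weightProj hM (Finset.mem_range.1 hn) a

include hM in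
theorem geomWeight_eq (a : GSym 𝒰) : geomWeight 𝒰 M a = a + M (geomWeight 𝒰 M a) := by
  have hlt := Nat.lt_succ_self (weights 𝒰 a).natDegree
  rw [geomWeight_apply hM a hlt, map_sum]
  simp only [← Module.End.mul_apply, ← pow_succ']
  have h := Finset.sum_range_succ' (fun k => (M ^ k) a) (weights 𝒰 a).natDegree.succ
  rw [Finset.sum_range_succ, pow_eq_zero hM a hlt, add_zero, pow_zero] at h
  rw [h, add_comm]
  rfl

include hM in
theorem geomWeight_eq' (a : GSym 𝒰) : geomWeight 𝒰 M a = a + geomWeight 𝒰 M (M a) := by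
  have hlt := Nat.lt_succ_of_le (le_max_left (weights 𝒰 a).natDegree (weights 𝒰 (M a)).natDegree)
  have hlt' := Nat.lt_succ_of_le (le_max_right (weights 𝒰 a).natDegree (weights 𝒰 (M a)).natDegree)
  rw [geomWeight_apply hM a hlt, geomWeight_apply hM _ hlt']
  simp only [← Module.End.mul_apply, ← pow_succ]
  have h := Finset.sum_range_succ' (fun k => (M ^ k) a)
    (max (weights 𝒰 a).natDegree (weights 𝒰 (M a)).natDegree).succ
  rw [Finset.sum_range_succ, pow_eq_zero hM a hlt, add_zero, pow_zero] at h
  rw [h, add_comm]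
  rfl

include hM in
theorem geomWeight_degree : IsHomogeneousMap (degree 𝒰) (degree 𝒰) 0 (geomWeight 𝒰 M) := by
  intro d a ha
  rw [geomWeight_apply hM a (Nat.lt_succ_self _)]
  refine Submodule.sum_mem _ fun k _ => ?_
  exact isHomogeneousMap_of_isBihomogeneousMap (isBihomogeneousMap_pow hM k) d a ha

end GeomWeight

end GSym

/-! ### Linear operators on formal power series -/

section SeriesLinear

variable {K : Type*} [Field K] {A B A' : Type*} [Ring A] [Algebra K A] [Ring B] [Algebra K B]
  [Ring A'] [Algebra K A']

open Finset.HasAntidiagonal (antidiagonal)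

/-- The constant term is split off repeatedly. Commuting with the variable takes the place of a
continuity assumption: each coefficient of the value involves only finitely many coefficients of
`f`. -/
theorem coeff_apply_of_X_mul {M N : Type*} [Ring M] [Ring N] {T : M⟦X⟧ →+ N⟦X⟧}
    (hT : ∀ f, T (PowerSeries.X * f) = PowerSeries.X * T f) (f : M⟦X⟧) (n : ℕ) :
    PowerSeries.coeff n (T f) = ∑ q ∈ antidiagonal n,
      PowerSeries.coeff q.1 (T (PowerSeries.C (PowerSeries.coeff q.2 f))) := by
  induction n generalizing f with
  | zero =>
    rw [Finset.Nat.antidiagonal_zero, Finset.sum_singleton]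
    conv_lhs => rw [PowerSeries.eq_X_mul_shift_add_const f, map_add, hT, map_add]
    rw [PowerSeries.coeff_zero_X_mul, zero_add, ← PowerSeries.coeff_zero_eq_constantCoeff_apply f]
  | succ n ih =>
    rw [Finset.Nat.antidiagonal_succ', Finset.sum_cons, Finset.sum_map]
    conv_lhs => rw [PowerSeries.eq_X_mul_shift_add_const f, map_add, hT, map_add,
      PowerSeries.coeff_succ_X_mul, ih]
    rw [add_comm, PowerSeries.coeff_zero_eq_constantCoeff]
    simp

theorem mul_X_mul {R : Type*} [Ring R] (a b : R⟦X⟧) :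
    a * (PowerSeries.X * b) = PowerSeries.X * (a * b) := by
  rw [← mul_assoc, ← PowerSeries.X_mul, mul_assoc]

theorem mul_C_X_mul {R : Type*} [Ring R] (a b : R⟦X⟧⟦X⟧) :
    a * (PowerSeries.C PowerSeries.X * b) = PowerSeries.C PowerSeries.X * (a * b) := by
  have hc : PowerSeries.C PowerSeries.X * a = a * PowerSeries.C (PowerSeries.X : R⟦X⟧) := by
    ext n
    rw [PowerSeries.coeff_C_mul, PowerSeries.coeff_mul_C, PowerSeries.X_mul]
  rw [← mul_assoc, ← hc, mul_assoc]

/-- A `K`-linear operator on formal power series in `z` with coefficients formal power series in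
`t` that commutes with the multiplications by both variables. The outer variable is `z`. -/
structure IsSeriesLinear (T : A⟦X⟧⟦X⟧ →ₗ[K] B⟦X⟧⟦X⟧) : Prop where
  X_mul : ∀ f, T (PowerSeries.X * f) = PowerSeries.X * T f
  C_X_mul : ∀ f, T (PowerSeries.C PowerSeries.X * f) = PowerSeries.C PowerSeries.X * T f

/-- The coefficient of `zⁿ tᵏ`. -/
def coeffS (A : Type*) [Ring A] [Algebra K A] (n k : ℕ) : A⟦X⟧⟦X⟧ →ₗ[K] A :=
  coeffT A k ∘ₗ coeffT A⟦X⟧ n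

/-- The inclusion of the constants. -/
def constS (A : Type*) [Ring A] [Algebra K A] : A →ₗ[K] A⟦X⟧⟦X⟧ :=
  constT A⟦X⟧ ∘ₗ constT A

theorem coeffS_apply (n k : ℕ) (f : A⟦X⟧⟦X⟧) :
    coeffS (K := K) A n k f = PowerSeries.coeff k (PowerSeries.coeff n f) := rfl

theorem constS_apply (a : A) :
    constS (K := K) A a = PowerSeries.C (PowerSeries.C a) := rfl

theorem series_ext (f g : A⟦X⟧⟦X⟧) (h : ∀ n k, coeffS (K := K) A n k f = coeffS (K := K) A n k g) :
    f = g := by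
  ext n k
  exact h n k

theorem coeffS_constS (n k : ℕ) (a : A) :
    coeffS (K := K) A n k (constS (K := K) A a) = if n = 0 ∧ k = 0 then a else 0 := by
  rw [coeffS_apply, constS_apply, PowerSeries.coeff_C]
  by_cases hn : n = 0
  · simp [hn, PowerSeries.coeff_C]
  · simp [hn]

theorem coeffS_mul (n k : ℕ) (f g : A⟦X⟧⟦X⟧) : coeffS (K := K) A n k (f * g) =
    ∑ q ∈ antidiagonal n, ∑ r ∈ antidiagonal k,
      coeffS (K := K) A q.1 r.1 f * coeffS (K := K) A q.2 r.2 g := by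
  simp only [coeffS_apply, PowerSeries.coeff_mul, map_sum]

namespace IsSeriesLinear

variable {T S : A⟦X⟧⟦X⟧ →ₗ[K] B⟦X⟧⟦X⟧}

theorem comp {S : B⟦X⟧⟦X⟧ →ₗ[K] A'⟦X⟧⟦X⟧} (hS : IsSeriesLinear S) (hT : IsSeriesLinear T) :
    IsSeriesLinear (S ∘ₗ T) where
  X_mul f := by rw [LinearMap.comp_apply, hT.X_mul, hS.X_mul]; rfl
  C_X_mul f := by rw [LinearMap.comp_apply, hT.C_X_mul, hS.C_X_mul]; rfl

theorem add (hS : IsSeriesLinear S) (hT : IsSeriesLinear T) : IsSeriesLinear (S + T) where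
  X_mul f := by rw [LinearMap.add_apply, hT.X_mul, hS.X_mul, ← mul_add]; rfl
  C_X_mul f := by rw [LinearMap.add_apply, hT.C_X_mul, hS.C_X_mul, ← mul_add]; rfl

theorem coeffS_apply (hT : IsSeriesLinear T) (n k : ℕ) (f : A⟦X⟧⟦X⟧) :
    coeffS (K := K) B n k (T f) = ∑ q ∈ antidiagonal n, ∑ r ∈ antidiagonal k,
      coeffS (K := K) B q.1 r.1 (T (constS (K := K) A (coeffS (K := K) A q.2 r.2 f))) := by
  change PowerSeries.coeff k (PowerSeries.coeff n (T f)) = _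
  have h1 := coeff_apply_of_X_mul (T := T.toAddMonoidHom) hT.X_mul f n
  change PowerSeries.coeff n (T f) = _ at h1
  rw [h1, map_sum]
  refine Finset.sum_congr rfl fun q _ => ?_
  let T' : A⟦X⟧ →+ B⟦X⟧ :=
    { toFun := fun a => PowerSeries.coeff q.1 (T (PowerSeries.C a))
      map_zero' := by rw [map_zero, map_zero, map_zero]
      map_add' := fun a b => by rw [map_add, map_add, map_add] }
  refine coeff_apply_of_X_mul (T := T') (fun a => ?_) _ k
  change PowerSeries.coeff q.1 (T (PowerSeries.C (PowerSeries.X * a))) = _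
  rw [map_mul, hT.C_X_mul, PowerSeries.coeff_C_mul]
  rfl

theorem ext (hT : IsSeriesLinear T) (hS : IsSeriesLinear S)
    (h : ∀ a, T (constS (K := K) A a) = S (constS (K := K) A a)) : T = S := by
  refine LinearMap.ext fun f => series_ext (K := K) _ _ fun n k => ?_
  rw [hT.coeffS_apply, hS.coeffS_apply]
  simp only [h]

/-- A twisted product rule extends from the constants. -/
theorem mul_rule {T₁ T₂ T₃ T₄ : A⟦X⟧⟦X⟧ →ₗ[K] B⟦X⟧⟦X⟧} (hT : IsSeriesLinear T)
    (h₁ : IsSeriesLinear T₁) (h₂ : IsSeriesLinear T₂) (h₃ : IsSeriesLinear T₃)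
    (h₄ : IsSeriesLinear T₄)
    (h : ∀ a b, T (constS (K := K) A (a * b)) =
      T₁ (constS (K := K) A a) * T₂ (constS (K := K) A b) +
        T₃ (constS (K := K) A a) * T₄ (constS (K := K) A b)) (f g : A⟦X⟧⟦X⟧) :
    T (f * g) = T₁ f * T₂ g + T₃ f * T₄ g := by
  have hsl : ∀ a : A⟦X⟧⟦X⟧, IsSeriesLinear (T ∘ₗ LinearMap.mulLeft K a) := fun a =>
    ⟨fun b => by
      simp only [LinearMap.comp_apply, LinearMap.mulLeft_apply]
      rw [mul_X_mul, hT.X_mul], fun b => by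
      simp only [LinearMap.comp_apply, LinearMap.mulLeft_apply]
      rw [mul_C_X_mul, hT.C_X_mul]⟩
  have hsr : ∀ a : A⟦X⟧⟦X⟧, IsSeriesLinear (T ∘ₗ LinearMap.mulRight K a) := fun a =>
    ⟨fun b => by
      simp only [LinearMap.comp_apply, LinearMap.mulRight_apply]
      rw [mul_assoc, hT.X_mul], fun b => by
      simp only [LinearMap.comp_apply, LinearMap.mulRight_apply]
      rw [mul_assoc, hT.C_X_mul]⟩
  have hl : ∀ {T : A⟦X⟧⟦X⟧ →ₗ[K] B⟦X⟧⟦X⟧}, IsSeriesLinear T → ∀ b : B⟦X⟧⟦X⟧,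
      IsSeriesLinear (LinearMap.mulLeft K b ∘ₗ T) := fun hT b =>
    ⟨fun a => by
      simp only [LinearMap.comp_apply, LinearMap.mulLeft_apply]
      rw [hT.X_mul, mul_X_mul], fun a => by
      simp only [LinearMap.comp_apply, LinearMap.mulLeft_apply]
      rw [hT.C_X_mul, mul_C_X_mul]⟩
  have hr : ∀ {T : A⟦X⟧⟦X⟧ →ₗ[K] B⟦X⟧⟦X⟧}, IsSeriesLinear T → ∀ b : B⟦X⟧⟦X⟧,
      IsSeriesLinear (LinearMap.mulRight K b ∘ₗ T) := fun hT b =>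
    ⟨fun a => by
      simp only [LinearMap.comp_apply, LinearMap.mulRight_apply]
      rw [hT.X_mul, mul_assoc], fun a => by
      simp only [LinearMap.comp_apply, LinearMap.mulRight_apply]
      rw [hT.C_X_mul, mul_assoc]⟩
  -- The rule is extended in one argument at a time: first for a constant times a series, then for
  -- an arbitrary first factor.
  have step : ∀ (a : A) (g : A⟦X⟧⟦X⟧), T (constS (K := K) A a * g) =
      T₁ (constS (K := K) A a) * T₂ g + T₃ (constS (K := K) A a) * T₄ g := fun a g =>
    LinearMap.congr_fun ((hsl (constS (K := K) A a)).ext ((hl h₂ (T₁ (constS (K := K) A a))).add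
      (hl h₄ (T₃ (constS (K := K) A a)))) fun b => by
        rw [LinearMap.comp_apply, LinearMap.mulLeft_apply]
        have e : constS (K := K) A a * constS (K := K) A b = constS (K := K) A (a * b) := by
          rw [constS_apply, constS_apply, constS_apply, map_mul, map_mul]
        rw [e, h]
        rfl) g
  exact LinearMap.congr_fun ((hsr g).ext ((hr h₁ (T₂ g)).add (hr h₃ (T₄ g))) fun a => step a g) f

theorem map_mul {T : A⟦X⟧⟦X⟧ →ₗ[K] B⟦X⟧⟦X⟧} (hT : IsSeriesLinear T)
    (h : ∀ a b, T (constS (K := K) A (a * b)) =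
      T (constS (K := K) A a) * T (constS (K := K) A b)) (f g : A⟦X⟧⟦X⟧) : T (f * g) = T f * T g := by
  have h0 : IsSeriesLinear (0 : A⟦X⟧⟦X⟧ →ₗ[K] B⟦X⟧⟦X⟧) :=
    ⟨fun f => (mul_zero _).symm, fun f => (mul_zero _).symm⟩
  have e := mul_rule hT hT hT h0 h0 (fun a b => by rw [h, LinearMap.zero_apply, zero_mul, add_zero]) f g
  rwa [LinearMap.zero_apply, zero_mul, add_zero] at e

end IsSeriesLinear

/-- The extension of a map to formal power series. -/
def extS (φ : A →ₗ[K] B⟦X⟧⟦X⟧) : A⟦X⟧⟦X⟧ →ₗ[K] B⟦X⟧⟦X⟧ where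
  toFun f := PowerSeries.mk fun n => PowerSeries.mk fun k =>
    ∑ q ∈ antidiagonal n, ∑ r ∈ antidiagonal k,
      coeffS (K := K) B q.1 r.1 (φ (coeffS (K := K) A q.2 r.2 f))
  map_add' f g := by
    ext n k
    simp [Finset.sum_add_distrib]
  map_smul' c f := by
    refine series_ext (K := K) _ _ fun n k => ?_
    rw [map_smul, coeffS_apply, coeffS_apply, PowerSeries.coeff_mk, PowerSeries.coeff_mk,
      PowerSeries.coeff_mk, PowerSeries.coeff_mk]
    simp [Finset.smul_sum]

theorem coeffS_extS (φ : A →ₗ[K] B⟦X⟧⟦X⟧) (n k : ℕ) (f : A⟦X⟧⟦X⟧) :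
    coeffS (K := K) B n k (extS φ f) = ∑ q ∈ antidiagonal n, ∑ r ∈ antidiagonal k,
      coeffS (K := K) B q.1 r.1 (φ (coeffS (K := K) A q.2 r.2 f)) := by
  change PowerSeries.coeff k (PowerSeries.coeff n (PowerSeries.mk fun n => PowerSeries.mk fun k =>
    ∑ q ∈ antidiagonal n, ∑ r ∈ antidiagonal k,
      coeffS (K := K) B q.1 r.1 (φ (coeffS (K := K) A q.2 r.2 f)))) = _
  rw [PowerSeries.coeff_mk, PowerSeries.coeff_mk]

theorem extS_constS (φ : A →ₗ[K] B⟦X⟧⟦X⟧) (a : A) : extS φ (constS (K := K) A a) = φ a := by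
  refine series_ext (K := K) _ _ fun n k => ?_
  rw [coeffS_extS, Finset.sum_eq_single (n, 0), Finset.sum_eq_single (k, 0)]
  · rw [coeffS_constS, if_pos ⟨rfl, rfl⟩]
  · rintro ⟨p, q⟩ h hne
    have hq : q ≠ 0 := by
      rintro rfl
      rw [Finset.HasAntidiagonal.mem_antidiagonal] at h
      exact hne (by rw [← h]; rfl)
    rw [coeffS_constS, if_neg (by simp [hq]), map_zero, map_zero]
  · intro h
    simp at h
  · rintro ⟨p, q⟩ h hne
    have hq : q ≠ 0 := by
      rintro rfl
      rw [Finset.HasAntidiagonal.mem_antidiagonal] at h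
      exact hne (by rw [← h]; rfl)
    refine Finset.sum_eq_zero fun r _ => ?_
    rw [coeffS_constS, if_neg (by simp [hq]), map_zero, map_zero]
  · intro h
    simp at h

theorem isSeriesLinear_extS (φ : A →ₗ[K] B⟦X⟧⟦X⟧) : IsSeriesLinear (extS φ) where
  X_mul f := by
    refine series_ext (K := K) _ _ fun n k => ?_
    rw [coeffS_extS]
    rcases n with - | n
    · simp [coeffS_apply]
    · rw [Finset.Nat.antidiagonal_succ', Finset.sum_cons, Finset.sum_map]
      have h0 : ∀ r, coeffS (K := K) A 0 r (PowerSeries.X * f) = 0 := fun r => by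
        rw [coeffS_apply, PowerSeries.coeff_zero_X_mul, map_zero]
      have h1 : ∀ m r, coeffS (K := K) A (m + 1) r (PowerSeries.X * f) = coeffS (K := K) A m r f :=
        fun m r => by rw [coeffS_apply, PowerSeries.coeff_succ_X_mul, coeffS_apply]
      simp only [h0, map_zero, Finset.sum_const_zero, zero_add, Function.Embedding.coe_prodMap,
        Prod.map, Function.Embedding.coeFn_mk, Function.Embedding.refl_apply,
        Nat.succ_eq_add_one, h1]
      rw [← coeffS_extS, coeffS_apply, coeffS_apply, PowerSeries.coeff_succ_X_mul]
  C_X_mul f := by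
    refine series_ext (K := K) _ _ fun n k => ?_
    rw [coeffS_extS]
    rcases k with - | k
    · simp [coeffS_apply, PowerSeries.coeff_C_mul]
    · have h0 : ∀ r, coeffS (K := K) A r 0 (PowerSeries.C PowerSeries.X * f) = 0 := fun r => by
        rw [coeffS_apply, PowerSeries.coeff_C_mul, PowerSeries.coeff_zero_X_mul]
      have h1 : ∀ m r, coeffS (K := K) A r (m + 1) (PowerSeries.C PowerSeries.X * f) =
          coeffS (K := K) A r m f := fun m r => by
        rw [coeffS_apply, PowerSeries.coeff_C_mul, PowerSeries.coeff_succ_X_mul, coeffS_apply]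
      simp only [Finset.Nat.antidiagonal_succ', Finset.sum_cons, Finset.sum_map, h0, map_zero,
        zero_add, Function.Embedding.coe_prodMap, Prod.map, Function.Embedding.coeFn_mk,
        Function.Embedding.refl_apply, Nat.succ_eq_add_one, h1]
      rw [← coeffS_extS, coeffS_apply, coeffS_apply, PowerSeries.coeff_C_mul,
        PowerSeries.coeff_succ_X_mul]

end SeriesLinear

/-! ### Coefficientwise maps, algebra morphisms and convolution on series. -/

section SeriesAlgebra

variable {K : Type*} [Field K] {A B A' : Type*} [Ring A] [Algebra K A] [Ring B] [Algebra K B]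
  [Ring A'] [Algebra K A']

open Finset.HasAntidiagonal (antidiagonal)

/-- The coefficientwise application of a linear map. -/
def mapS (φ : A →ₗ[K] B) : A⟦X⟧⟦X⟧ →ₗ[K] B⟦X⟧⟦X⟧ := mapT (mapT φ)

theorem coeff_mapT (φ : A →ₗ[K] B) (n : ℕ) (a : A⟦X⟧) :
    PowerSeries.coeff n (mapT φ a) = φ (PowerSeries.coeff n a) :=
  PowerSeries.coeff_mk n fun n => φ (PowerSeries.coeff n a)

theorem coeffS_mapS (φ : A →ₗ[K] B) (n k : ℕ) (f : A⟦X⟧⟦X⟧) :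
    coeffS (K := K) B n k (mapS φ f) = φ (coeffS (K := K) A n k f) := by
  rw [coeffS_apply, mapS, coeff_mapT, coeff_mapT, coeffS_apply]

theorem mapS_constS (φ : A →ₗ[K] B) (a : A) :
    mapS φ (constS (K := K) A a) = constS (K := K) B (φ a) := by
  refine series_ext (K := K) _ _ fun n k => ?_
  rw [coeffS_mapS, coeffS_constS, coeffS_constS]
  split_ifs
  exacts [rfl, map_zero φ]

theorem isSeriesLinear_mapS (φ : A →ₗ[K] B) : IsSeriesLinear (mapS φ) where
  X_mul f := by
    ext n k
    rcases n with - | n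
    · rw [mapS, coeff_mapT, PowerSeries.coeff_zero_X_mul, PowerSeries.coeff_zero_X_mul, map_zero]
    · rw [mapS, coeff_mapT, PowerSeries.coeff_succ_X_mul, PowerSeries.coeff_succ_X_mul, coeff_mapT,
        coeff_mapT, coeff_mapT]
  C_X_mul f := by
    ext n k
    rw [mapS, coeff_mapT, PowerSeries.coeff_C_mul, PowerSeries.coeff_C_mul, coeff_mapT, coeff_mapT]
    rcases k with - | k
    · rw [PowerSeries.coeff_zero_X_mul, PowerSeries.coeff_zero_X_mul, map_zero]
    · rw [PowerSeries.coeff_succ_X_mul, PowerSeries.coeff_succ_X_mul, coeff_mapT]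

theorem constS_mul (a b : A) :
    constS (K := K) A (a * b) = constS (K := K) A a * constS (K := K) A b := by
  rw [constS_apply, constS_apply, constS_apply, map_mul, map_mul]

theorem constS_one : constS (K := K) A 1 = 1 := by
  rw [constS_apply, map_one, map_one]

theorem mapS_mul_rule {D D₁ D₂ E₁ E₂ : A →ₗ[K] B}
    (h : ∀ a b, D (a * b) = D₁ a * E₁ b + E₂ a * D₂ b) (f g : A⟦X⟧⟦X⟧) :
    mapS D (f * g) = mapS D₁ f * mapS E₁ g + mapS E₂ f * mapS D₂ g := by
  refine (isSeriesLinear_mapS D).mul_rule (isSeriesLinear_mapS _) (isSeriesLinear_mapS _)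
    (isSeriesLinear_mapS _) (isSeriesLinear_mapS _) (fun a b => ?_) f g
  rw [mapS_constS, h, map_add, constS_mul, constS_mul, mapS_constS, mapS_constS, mapS_constS,
    mapS_constS]

/-- An operator on formal power series that is an algebra morphism. -/
structure IsSeriesAlgHom (T : A⟦X⟧⟦X⟧ →ₗ[K] B⟦X⟧⟦X⟧) : Prop extends IsSeriesLinear T where
  map_one : T 1 = 1
  map_mul : ∀ f g, T (f * g) = T f * T g

theorem IsSeriesAlgHom.comp {T : A⟦X⟧⟦X⟧ →ₗ[K] B⟦X⟧⟦X⟧} {S : B⟦X⟧⟦X⟧ →ₗ[K] A'⟦X⟧⟦X⟧}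
    (hS : IsSeriesAlgHom S) (hT : IsSeriesAlgHom T) : IsSeriesAlgHom (S ∘ₗ T) where
  toIsSeriesLinear := hS.toIsSeriesLinear.comp hT.toIsSeriesLinear
  map_one := by rw [LinearMap.comp_apply, hT.map_one, hS.map_one]
  map_mul f g := by rw [LinearMap.comp_apply, hT.map_mul, hS.map_mul]; rfl

theorem isSeriesAlgHom_mapS (φ : A →ₐ[K] B) : IsSeriesAlgHom (mapS φ.toLinearMap) where
  toIsSeriesLinear := isSeriesLinear_mapS _
  map_one := by
    rw [← constS_one (K := K), mapS_constS, AlgHom.toLinearMap_apply, map_one, constS_one]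
  map_mul := (isSeriesLinear_mapS _).map_mul fun a b => by
    rw [mapS_constS, mapS_constS, mapS_constS, AlgHom.toLinearMap_apply, map_mul, constS_mul]
    rfl

theorem isSeriesAlgHom_extS (φ : A →ₐ[K] B⟦X⟧⟦X⟧) : IsSeriesAlgHom (extS φ.toLinearMap) where
  toIsSeriesLinear := isSeriesLinear_extS _
  map_one := by
    rw [← constS_one (K := K), extS_constS, AlgHom.toLinearMap_apply, map_one]
  map_mul := (isSeriesLinear_extS _).map_mul fun a b => by
    rw [extS_constS, extS_constS, extS_constS, AlgHom.toLinearMap_apply, map_mul]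
    rfl

theorem isSeriesAlgHom_id : IsSeriesAlgHom (K := K) (A := A) (LinearMap.id) where
  X_mul _ := rfl
  C_X_mul _ := rfl
  map_one := rfl
  map_mul _ _ := rfl

section Convolution

variable {C : Type*} [AddCommGroup C] [Module K C] [CoalgebraStruct K C]

theorem coeffS_conv (φ ψ : C →ₗ[K] A⟦X⟧⟦X⟧) (n k : ℕ) (c : C) :
    coeffS (K := K) A n k (conv φ ψ c) = ∑ q ∈ antidiagonal n, ∑ r ∈ antidiagonal k,
      conv (coeffS (K := K) A q.1 r.1 ∘ₗ φ) (coeffS (K := K) A q.2 r.2 ∘ₗ ψ) c := by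
  simp only [conv_apply]
  generalize CoalgebraStruct.comul (R := K) c = t
  induction t with
  | zero => simp
  | tmul a b => simp [coeffS_mul]
  | add s t hs ht => simp only [map_add, hs, ht, Finset.sum_add_distrib]

theorem coeff_conv (φ ψ : C →ₗ[K] A⟦X⟧) (n : ℕ) (c : C) :
    PowerSeries.coeff n (conv φ ψ c) = ∑ q ∈ antidiagonal n,
      conv (coeffT A q.1 ∘ₗ φ) (coeffT A q.2 ∘ₗ ψ) c := by
  simp only [conv_apply]
  generalize CoalgebraStruct.comul (R := K) c = t
  induction t with
  | zero => simp
  | tmul a b => simp [PowerSeries.coeff_mul]; rfl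
  | add s t hs ht => simp only [map_add, hs, ht, Finset.sum_add_distrib]

theorem IsSeriesAlgHom.comp_convList {T : A⟦X⟧⟦X⟧ →ₗ[K] B⟦X⟧⟦X⟧} (hT : IsSeriesAlgHom T)
    (l : List (C →ₗ[K] A⟦X⟧⟦X⟧)) : T ∘ₗ convList l = convList (l.map (T ∘ₗ ·)) :=
  IBL.comp_convList hT.map_mul (fun c => by
    rw [Algebra.algebraMap_eq_smul_one, map_smul, hT.map_one, Algebra.algebraMap_eq_smul_one]) l

theorem constS_comp_convList (l : List (C →ₗ[K] A)) : constS (K := K) A ∘ₗ convList l =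
    convList (l.map (constS (K := K) A ∘ₗ ·)) :=
  comp_convList constS_mul (fun c => by
    rw [Algebra.algebraMap_eq_smul_one, map_smul, constS_one, Algebra.algebraMap_eq_smul_one]) l

end Convolution

end SeriesAlgebra

/-! ### Series with coefficients in a symmetric algebra. -/

namespace GSym

variable {K : Type*} [Field K] {U V M : Type*} [AddCommGroup U] [Module K U] [AddCommGroup V]
  [Module K V] [Ring M] [Algebra K M]
variable {𝒰 : ℤ → Submodule K U} [DirectSum.Decomposition 𝒰]
variable {𝒱 : ℤ → Submodule K V} [DirectSum.Decomposition 𝒱]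

open Finset.HasAntidiagonal (antidiagonal)

omit [DirectSum.Decomposition 𝒰] in
/-- Morphisms of algebras are determined by their values on the generators. -/
theorem seriesAlgHom_ext {T S : (GSym 𝒰)⟦X⟧⟦X⟧ →ₗ[K] M⟦X⟧⟦X⟧} (hT : IsSeriesAlgHom T)
    (hS : IsSeriesAlgHom S)
    (h : ∀ x, T (constS (K := K) _ (ι 𝒰 x)) = S (constS (K := K) _ (ι 𝒰 x))) : T = S := by
  refine hT.toIsSeriesLinear.ext hS.toIsSeriesLinear fun a => ?_
  induction a using induction 𝒰 with
  | one => rw [constS_one, hT.map_one, hS.map_one]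
  | ι_mul x a ha => rw [constS_mul, hT.map_mul, hS.map_mul, ha, h]
  | add a b ha hb => simp only [map_add, ha, hb]
  | smul c a ha => simp only [map_smul, ha]

omit [DirectSum.Decomposition 𝒰] in
/-- Twisted derivations are determined by their values on the generators. -/
theorem seriesDerivation_ext {Φ Ψ D D' : (GSym 𝒰)⟦X⟧⟦X⟧ →ₗ[K] M⟦X⟧⟦X⟧} (hD : IsSeriesLinear D)
    (hD' : IsSeriesLinear D') (h : ∀ f g, D (f * g) = D f * Φ g + Ψ f * D g)
    (h' : ∀ f g, D' (f * g) = D' f * Φ g + Ψ f * D' g) (h1 : D 1 = D' 1)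
    (hι : ∀ x, D (constS (K := K) _ (ι 𝒰 x)) = D' (constS (K := K) _ (ι 𝒰 x))) : D = D' := by
  refine hD.ext hD' fun a => ?_
  induction a using induction 𝒰 with
  | one => rw [constS_one, h1]
  | ι_mul x a ha => rw [constS_mul, h, h', ha, hι]
  | add a b ha hb => simp only [map_add, ha, hb]
  | smul c a ha => simp only [map_smul, ha]

variable (𝒱) in
/-- A formal power series of degree `d`, the degree of `t` being `2`. -/
def HasDegreeS (f : (GSym 𝒱)⟦X⟧⟦X⟧) (d : ℤ) : Prop :=
  ∀ n k : ℕ, coeffS (K := K) _ n k f ∈ degree 𝒱 (d - 2 * k)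

/-- The degree of `t` is even and that of `z` is zero, so all coefficients of a homogeneous series
contribute the same Koszul sign. -/
theorem HasDegreeS.mul_comm {f g : (GSym 𝒱)⟦X⟧⟦X⟧} {d e : ℤ} (hf : HasDegreeS 𝒱 f d)
    (hg : HasDegreeS 𝒱 g e) : f * g = ((-1 : K) ^ (d * e)) • (g * f) := by
  refine series_ext (K := K) _ _ fun n k => ?_
  rw [map_smul, coeffS_mul, coeffS_mul, ← Finset.Nat.sum_antidiagonal_swap, Finset.smul_sum]
  refine Finset.sum_congr rfl fun q _ => ?_
  rw [← Finset.Nat.sum_antidiagonal_swap, Finset.smul_sum]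
  refine Finset.sum_congr rfl fun r _ => ?_
  rw [mul_comm_graded 𝒱 (hf _ _) (hg _ _)]
  congr 1
  refine neg_one_zpow_congr ⟨2 * r.1 * r.2 - d * r.1 - e * r.2, ?_⟩
  simp only [Prod.fst_swap, Prod.snd_swap]
  ring

/-- The algebra morphism extending a map of degree zero from the generators. -/
def liftS (φ : U →ₗ[K] (GSym 𝒱)⟦X⟧⟦X⟧) (hφ : ∀ i, ∀ x ∈ 𝒰 i, HasDegreeS 𝒱 (φ x) i) :
    (GSym 𝒰)⟦X⟧⟦X⟧ →ₗ[K] (GSym 𝒱)⟦X⟧⟦X⟧ :=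
  extS (lift 𝒰 φ fun i j x y hx hy => (hφ i x hx).mul_comm (hφ j y hy)).toLinearMap

omit [DirectSum.Decomposition 𝒰] in
theorem isSeriesAlgHom_liftS (φ : U →ₗ[K] (GSym 𝒱)⟦X⟧⟦X⟧)
    (hφ : ∀ i, ∀ x ∈ 𝒰 i, HasDegreeS 𝒱 (φ x) i) : IsSeriesAlgHom (liftS φ hφ) :=
  isSeriesAlgHom_extS _

omit [DirectSum.Decomposition 𝒰] in
theorem liftS_ι (φ : U →ₗ[K] (GSym 𝒱)⟦X⟧⟦X⟧) (hφ : ∀ i, ∀ x ∈ 𝒰 i, HasDegreeS 𝒱 (φ x) i) (x : U) :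
    liftS φ hφ (constS (K := K) _ (ι 𝒰 x)) = φ x := by
  rw [liftS, extS_constS]
  exact lift_ι 𝒰 _ _ x

end GSym

/-! ### The coexponential automorphism -/

section Coefficients

variable (K : Type*) [Field K]

/-- The power series `(exp(w) - 1) / w`. -/
def expSeries : K⟦X⟧ := PowerSeries.mk fun n => ((n + 1).factorial : K)⁻¹

/-- The power series `log(1 + w) / w`. -/
def logSeries : K⟦X⟧ := PowerSeries.mk fun n => (-1 : K) ^ n / ((n + 1 : ℕ) : K)

open Finset.HasAntidiagonal (antidiagonal)

variable {K}

/-- Compares the coefficients of degree `m + 1` in the composite, after extracting the powers of the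
variable. Dividing both series by their variable is the normalization in which `z` counts the
increase of symmetric degree. -/
theorem sum_antidiagonal_of_subst_eq_X {P Q : K⟦X⟧}
    (h : (PowerSeries.X * Q).subst (PowerSeries.X * P) = (PowerSeries.X : K⟦X⟧)) (m : ℕ) :
    ∑ q ∈ antidiagonal m, PowerSeries.coeff q.2 Q * PowerSeries.coeff q.1 (P ^ (q.2 + 1)) =
      if m = 0 then 1 else 0 := by
  have hs : PowerSeries.HasSubst (PowerSeries.X * P) :=
    PowerSeries.HasSubst.of_constantCoeff_zero' (by simp)
  have h1 := congrArg (PowerSeries.coeff (m + 1)) h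
  rw [PowerSeries.coeff_subst' hs, PowerSeries.coeff_X] at h1
  simp only [Nat.add_eq_right] at h1
  rw [← h1]
  have hz : ∀ d, d ∉ Finset.range (m + 2) → PowerSeries.coeff d (PowerSeries.X * Q) •
      PowerSeries.coeff (m + 1) ((PowerSeries.X * P) ^ d) = 0 := by
    intro d hd
    rw [Finset.mem_range, not_lt] at hd
    rw [mul_pow, PowerSeries.coeff_X_pow_mul', if_neg (by omega), smul_zero]
  rw [finsum_eq_sum_of_support_subset _ (s := Finset.range (m + 2)) (fun d hd => by
    by_contra hd'
    exact hd (hz d hd')), Finset.sum_range_succ', PowerSeries.coeff_zero_X_mul, zero_smul, add_zero,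
    ← Finset.Nat.sum_antidiagonal_swap,
    Finset.Nat.sum_antidiagonal_eq_sum_range_succ_mk]
  refine Finset.sum_congr rfl fun d hd => ?_
  have hd' : d ≤ m := Nat.lt_succ_iff.1 (Finset.mem_range.1 hd)
  rw [PowerSeries.coeff_succ_X_mul, mul_pow, PowerSeries.coeff_X_pow_mul', if_pos (by omega),
    smul_eq_mul]
  simp only [Prod.swap]
  rw [Nat.add_sub_add_right]

variable [CharZero K]

omit [CharZero K] in
theorem X_mul_expSeries [Algebra ℚ K] :
    PowerSeries.X * expSeries K = PowerSeries.exp K - 1 := by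
  ext n
  rcases n with - | n
  · simp
  · rw [PowerSeries.coeff_succ_X_mul, expSeries, PowerSeries.coeff_mk, map_sub, PowerSeries.coeff_exp,
      PowerSeries.coeff_one, if_neg n.succ_ne_zero, sub_zero]
    simp

theorem X_mul_logSeries [Algebra ℚ K] : PowerSeries.X * logSeries K = PowerSeries.log K := by
  ext n
  rcases n with - | n
  · simp
  · rw [PowerSeries.coeff_succ_X_mul, logSeries, PowerSeries.coeff_mk, PowerSeries.coeff_log]
    simp [pow_succ]

/-- Both sides vanish at zero and have derivative one: the derivative `1/(1 + w)` of the logarithm,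
evaluated at `exp(w) - 1`, is inverse to `exp(w)`. -/
theorem log_subst_exp [Algebra ℚ K] :
    (PowerSeries.log K).subst (PowerSeries.exp K - 1) = (PowerSeries.X : K⟦X⟧) := by
  have hs : PowerSeries.HasSubst (PowerSeries.exp K - 1) := PowerSeries.HasSubst.exp_sub_one
  refine PowerSeries.derivative.ext ?_ ?_
  · rw [PowerSeries.derivative_subst hs, PowerSeries.deriv_log, PowerSeries.derivative_X, map_sub,
      PowerSeries.derivative_exp, PowerSeries.derivative_one, sub_zero]
    have h1 : (PowerSeries.mk fun n => algebraMap ℚ K ((-1) ^ n)) * (1 + PowerSeries.X) = 1 := by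
      ext n
      rcases n with - | n
      · simp
      · rw [mul_add, mul_one, map_add, PowerSeries.coeff_succ_mul_X, PowerSeries.coeff_one,
          if_neg n.succ_ne_zero, PowerSeries.coeff_mk, PowerSeries.coeff_mk, pow_succ]
        simp
    have h2 := congrArg (PowerSeries.subst (PowerSeries.exp K - 1) (S := K)) h1
    rw [← PowerSeries.coe_substAlgHom hs, map_mul, map_add, map_one] at h2
    rw [PowerSeries.coe_substAlgHom hs, PowerSeries.subst_X hs, add_sub_cancel] at h2
    exact h2
  · rw [PowerSeries.constantCoeff_X]
    exact PowerSeries.constantCoeff_subst_eq_zero (by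
      change PowerSeries.constantCoeff (PowerSeries.exp K - 1) = 0
      simp) _ PowerSeries.constantCoeff_log

/-- The series `exp(w) - 1` has invertible linear coefficient, hence a compositional inverse; the
one-sided inverse found in `log_subst_exp` must coincide with it. -/
theorem exp_subst_log [Algebra ℚ K] :
    (PowerSeries.exp K - 1).subst (PowerSeries.log K) = (PowerSeries.X : K⟦X⟧) := by
  have hP0 : PowerSeries.constantCoeff (PowerSeries.exp K - 1) = 0 := by simp
  have hP1 : PowerSeries.coeff 1 (PowerSeries.exp K - 1) = 1 := by
    simp [PowerSeries.coeff_exp, PowerSeries.coeff_one]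
  let _ : Invertible (PowerSeries.coeff 1 (PowerSeries.exp K - 1)) := hP1 ▸ invertibleOne
  have e : (PowerSeries.log K) = (PowerSeries.exp K - 1).substInv := by
    have h := PowerSeries.subst_comp_subst_apply (R := K) (PowerSeries.HasSubst.exp_sub_one (A := K))
      (b := (PowerSeries.exp K - 1).substInv) (PowerSeries.HasSubst.of_constantCoeff_zero' (by simp))
      (PowerSeries.log K)
    rw [log_subst_exp, PowerSeries.subst_substInv_right _ hP0,
      PowerSeries.subst_X (PowerSeries.HasSubst.of_constantCoeff_zero' (by simp))] at h
    rw [h, ← PowerSeries.map_algebraMap_eq_subst_X]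
    simp
  rw [e]
  exact PowerSeries.subst_substInv_right _ hP0

end Coefficients

/-! ### Convolution powers and series in them. -/

section ConvPower

variable {K : Type*} [Field K] {C A : Type*} [AddCommGroup C] [Module K C] [Coalgebra K C] [Ring A]
  [Algebra K A]

open Finset.HasAntidiagonal (antidiagonal)

/-- The convolution power `φ ⋆ ⋯ ⋆ φ`. -/
abbrev convPow (φ : C →ₗ[K] A) (n : ℕ) : C →ₗ[K] A := convList (List.replicate n φ)

theorem convPow_succ (φ : C →ₗ[K] A) (n : ℕ) : convPow φ (n + 1) = conv φ (convPow φ n) := rfl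

theorem conv_convPow (φ : C →ₗ[K] A) (m n : ℕ) :
    conv (convPow φ m) (convPow φ n) = convPow φ (m + n) := by
  rw [convPow, convPow, convPow, convList_replicate, convList_replicate, convList_replicate, pow_add]
  rfl

theorem convPow_one (φ : C →ₗ[K] A) : convPow φ 1 = φ := conv_nil φ

/-- The map `c ↦ ∑ₙ Pₙ φ^{⋆(n + m)}(c) zⁿ`. -/
def convSeries (φ : C →ₗ[K] A) (P : K⟦X⟧) (m : ℕ) : C →ₗ[K] A⟦X⟧⟦X⟧ where
  toFun c := PowerSeries.mk fun n => PowerSeries.C (PowerSeries.coeff n P • convPow φ (n + m) c)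
  map_add' c d := by
    ext n : 1
    simp only [PowerSeries.coeff_mk, map_add, smul_add]
  map_smul' r c := by
    ext n : 1
    change PowerSeries.coeff n (PowerSeries.mk fun n =>
      (PowerSeries.C (PowerSeries.coeff n P • convPow φ (n + m) (r • c)) : A⟦X⟧)) =
      r • PowerSeries.coeff n (PowerSeries.mk fun n =>
        (PowerSeries.C (PowerSeries.coeff n P • convPow φ (n + m) c) : A⟦X⟧))
    rw [PowerSeries.coeff_mk, PowerSeries.coeff_mk, (convPow φ (n + m)).map_smul, smul_comm]
    exact (constT A).map_smul r _

theorem coeffS_convSeries (φ : C →ₗ[K] A) (P : K⟦X⟧) (m n k : ℕ) (c : C) :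
    coeffS (K := K) A n k (convSeries φ P m c) =
      if k = 0 then PowerSeries.coeff n P • convPow φ (n + m) c else 0 := by
  change PowerSeries.coeff k (PowerSeries.coeff n (PowerSeries.mk fun n =>
    (PowerSeries.C (PowerSeries.coeff n P • convPow φ (n + m) c) : A⟦X⟧))) = _
  rw [PowerSeries.coeff_mk, PowerSeries.coeff_C]

/-- The exponent of `φ` exceeds that of `z` by the number of factors, recorded in `m` and `l`. With
this bookkeeping convolution becomes multiplication of scalar power series. -/
theorem conv_convSeries (φ : C →ₗ[K] A) (P Q : K⟦X⟧) (m l : ℕ) :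
    conv (convSeries φ P m) (convSeries φ Q l) = convSeries φ (P * Q) (m + l) := by
  refine LinearMap.ext fun c => series_ext (K := K) _ _ fun n k => ?_
  have e : ∀ (P : K⟦X⟧) (m n k : ℕ), coeffS (K := K) A n k ∘ₗ convSeries φ P m =
      if k = 0 then PowerSeries.coeff n P • convPow φ (n + m) else 0 := fun P m n k =>
    LinearMap.ext fun c => by
      rw [LinearMap.comp_apply, coeffS_convSeries]
      split_ifs <;> rfl
  rw [coeffS_conv, coeffS_convSeries]
  simp only [e]
  split_ifs with hk
  · subst hk
    rw [PowerSeries.coeff_mul, Finset.sum_smul]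
    refine Finset.sum_congr rfl fun q hq => ?_
    rw [Finset.Nat.antidiagonal_zero, Finset.sum_singleton, if_pos rfl, if_pos rfl, smul_conv, conv_smul,
      conv_convPow, smul_smul, ← Finset.HasAntidiagonal.mem_antidiagonal.1 hq]
    rw [show q.1 + q.2 + (m + l) = q.1 + m + (q.2 + l) by ring]
    rfl
  · refine Finset.sum_eq_zero fun q _ => Finset.sum_eq_zero fun r hr => ?_
    rw [Finset.HasAntidiagonal.mem_antidiagonal] at hr
    by_cases h1 : r.1 = 0
    · rw [if_neg (by omega : ¬ r.2 = 0), conv_zero]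
      rfl
    · rw [if_neg h1, zero_conv]
      rfl

theorem convPow_convSeries (φ : C →ₗ[K] A) (P : K⟦X⟧) (n : ℕ) :
    convPow (convSeries φ P 1) n = convSeries φ (P ^ n) n := by
  induction n with
  | zero =>
    refine LinearMap.ext fun c => series_ext (K := K) _ _ fun n k => ?_
    rw [coeffS_convSeries, convPow, List.replicate_zero, convList_nil, LinearMap.comp_apply,
      Algebra.linearMap_apply, Algebra.algebraMap_eq_smul_one, map_smul, ← constS_one (K := K),
      coeffS_constS, pow_zero, PowerSeries.coeff_one]
    by_cases hn : n = 0 <;> by_cases hk : k = 0 <;>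
      simp [hn, hk, convPow, convList_nil, Algebra.algebraMap_eq_smul_one]
  | succ n ih => rw [convPow_succ, ih, conv_convSeries, pow_succ', add_comm 1 n]

/-- The value of an operator on a series of convolution powers. -/
theorem IsSeriesLinear.coeffS_convSeries {B : Type*} [Ring B] [Algebra K B]
    {T : A⟦X⟧⟦X⟧ →ₗ[K] B⟦X⟧⟦X⟧} (hT : IsSeriesLinear T) (φ : C →ₗ[K] A) (P : K⟦X⟧) (m n k : ℕ) (c : C) :
    coeffS (K := K) B n k (T (convSeries φ P m c)) = ∑ q ∈ antidiagonal n,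
      PowerSeries.coeff q.2 P •
        coeffS (K := K) B q.1 k (T (constS (K := K) A (convPow φ (q.2 + m) c))) := by
  rw [hT.coeffS_apply]
  refine Finset.sum_congr rfl fun q _ => ?_
  rw [Finset.sum_eq_single (k, 0)]
  · rw [IBL.coeffS_convSeries, if_pos rfl, map_smul, map_smul, map_smul]
  · rintro ⟨p, r⟩ h hne
    have hr : r ≠ 0 := by
      rintro rfl
      rw [Finset.HasAntidiagonal.mem_antidiagonal] at h
      exact hne (by rw [← h]; rfl)
    rw [IBL.coeffS_convSeries, if_neg hr, map_zero, map_zero, map_zero]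
  · intro h
    simp at h

end ConvPower

/-! ### Coexponential-type automorphisms and the operators commuting with them. -/

namespace GSym

variable {K : Type*} [Field K] {U V M : Type*} [AddCommGroup U] [Module K U] [AddCommGroup V]
  [Module K V] [Ring M] [Algebra K M]
variable {𝒰 : ℤ → Submodule K U} [DirectSum.Decomposition 𝒰]
variable {𝒱 : ℤ → Submodule K V} [DirectSum.Decomposition 𝒱]

open Finset.HasAntidiagonal (antidiagonal)

theorem isHomogeneousMap_convPow_ι (n : ℕ) :
    IsHomogeneousMap (degree 𝒰) (degree (degree 𝒰)) 0 (convPow (ι (degree 𝒰)) n) := by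
  induction n with
  | zero => exact isHomogeneousMap_convList_nil 𝒰
  | succ n ih => exact isHomogeneousMap_conv 𝒰 (ι_degree (degree 𝒰)) ih (add_zero 0)

/-- The algebra morphism `c ↦ ∑ₙ Pₙ πΔⁿ(c) zⁿ`. -/
def convHom (𝒰 : ℤ → Submodule K U) [DirectSum.Decomposition 𝒰] (P : K⟦X⟧) :
    (GSym (degree 𝒰))⟦X⟧⟦X⟧ →ₗ[K] (GSym (degree 𝒰))⟦X⟧⟦X⟧ :=
  liftS (𝒰 := degree 𝒰) (convSeries (ι (degree 𝒰)) P 1) fun i x hx n k => by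
    rw [coeffS_convSeries]
    split_ifs with hk
    · subst hk
      have h := isHomogeneousMap_convPow_ι (n + 1) i x hx
      rw [add_zero] at h
      simpa using Submodule.smul_mem _ _ h
    · exact Submodule.zero_mem _

theorem isSeriesAlgHom_convHom (P : K⟦X⟧) : IsSeriesAlgHom (convHom 𝒰 P) :=
  isSeriesAlgHom_liftS _ _

theorem convHom_ι (P : K⟦X⟧) (c : GSym 𝒰) :
    convHom 𝒰 P (constS (K := K) _ (ι (degree 𝒰) c)) = convSeries (ι (degree 𝒰)) P 1 c :=
  liftS_ι _ _ _

/-- Algebra morphisms respect convolution powers, so the `m`-th power is governed by `P ^ m`. This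
reduces compositions of such morphisms to substitution of scalar power series. -/
theorem convHom_convPow (P : K⟦X⟧) (m : ℕ) (c : GSym 𝒰) :
    convHom 𝒰 P (constS (K := K) _ (convPow (ι (degree 𝒰)) m c)) =
      convSeries (ι (degree 𝒰)) (P ^ m) m c := by
  suffices h : convHom 𝒰 P ∘ₗ (constS (K := K) _ ∘ₗ convPow (ι (degree 𝒰)) m) =
    convSeries (ι (degree 𝒰)) (P ^ m) m from LinearMap.congr_fun h c
  rw [constS_comp_convList, (isSeriesAlgHom_convHom P).comp_convList, List.map_map,
    List.map_replicate, ← convPow_convSeries]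
  congr 2
  exact LinearMap.ext fun c => convHom_ι P c

/-- Composition corresponds to substituting `w P(w)` into `w Q(w)`; the series `w` itself
corresponds to the identity morphism. -/
theorem convHom_comp_convHom {P Q : K⟦X⟧}
    (h : (PowerSeries.X * Q).subst (PowerSeries.X * P) = (PowerSeries.X : K⟦X⟧)) :
    convHom 𝒰 P ∘ₗ convHom 𝒰 Q = LinearMap.id := by
  refine seriesAlgHom_ext ((isSeriesAlgHom_convHom P).comp (isSeriesAlgHom_convHom Q))
    isSeriesAlgHom_id fun c => series_ext (K := K) _ _ fun n k => ?_
  rw [LinearMap.comp_apply, convHom_ι,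
    (isSeriesAlgHom_convHom P).toIsSeriesLinear.coeffS_convSeries, LinearMap.id_apply, coeffS_constS]
  have e : ∀ q ∈ antidiagonal n, PowerSeries.coeff q.2 Q • coeffS (K := K) _ q.1 k
      (convHom 𝒰 P (constS (K := K) _ (convPow (ι (degree 𝒰)) (q.2 + 1) c))) =
      (PowerSeries.coeff q.2 Q * PowerSeries.coeff q.1 (P ^ (q.2 + 1))) •
        if k = 0 then convPow (ι (degree 𝒰)) (n + 1) c else 0 := fun q hq => by
    rw [Finset.HasAntidiagonal.mem_antidiagonal] at hq
    rw [convHom_convPow, coeffS_convSeries, ← add_assoc, hq, mul_smul]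
    split_ifs
    · rfl
    · simp
  rw [Finset.sum_congr rfl e, ← Finset.sum_smul, sum_antidiagonal_of_subst_eq_X h]
  by_cases hn : n = 0 <;> by_cases hk : k = 0 <;> simp [hn, hk]
  exact LinearMap.congr_fun (convPow_one _) c

/-- With leading coefficient one, generators are fixed modulo `z`. Conjugation by `E` therefore does
not change leading terms. -/
theorem coeffS_zero_convHom {P : K⟦X⟧} (hP : PowerSeries.coeff 0 P = 1)
    (f : (GSym (degree 𝒰))⟦X⟧⟦X⟧) (k : ℕ) :
    coeffS (K := K) _ 0 k (convHom 𝒰 P f) = coeffS (K := K) _ 0 k f := by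
  have h1 : ∀ (a : GSym (degree 𝒰)) (k : ℕ), coeffS (K := K) _ 0 k
      (convHom 𝒰 P (constS (K := K) _ a)) = if k = 0 then a else 0 := by
    intro a
    induction a using induction (degree 𝒰) with
    | one =>
      intro k
      rw [constS_one, (isSeriesAlgHom_convHom P).map_one, ← constS_one (K := K), coeffS_constS]
      simp
    | ι_mul x a ha =>
      intro k
      rw [constS_mul, (isSeriesAlgHom_convHom P).map_mul, convHom_ι, coeffS_mul,
        Finset.Nat.antidiagonal_zero, Finset.sum_singleton, Finset.sum_eq_single (0, k)]
      · rw [coeffS_convSeries, ha, if_pos rfl, hP, one_smul, zero_add, convPow_one, mul_ite, mul_zero]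
      · rintro ⟨p, r⟩ h hne
        have hp : p ≠ 0 := by
          rintro rfl
          rw [Finset.HasAntidiagonal.mem_antidiagonal, zero_add] at h
          exact hne (by rw [← h])
        rw [coeffS_convSeries, if_neg hp, zero_mul]
      · intro h
        simp at h
    | add a b ha hb =>
      intro k
      rw [map_add, map_add, map_add, ha, hb]
      split_ifs
      exacts [rfl, add_zero 0]
    | smul c a ha =>
      intro k
      rw [map_smul, map_smul, map_smul, ha, smul_ite, smul_zero]
  rw [(isSeriesAlgHom_convHom P).toIsSeriesLinear.coeffS_apply, Finset.Nat.antidiagonal_zero,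
    Finset.sum_singleton, Finset.sum_eq_single (0, k)]
  · rw [h1, if_pos rfl]
  · rintro ⟨p, r⟩ h hne
    have hp : p ≠ 0 := by
      rintro rfl
      rw [Finset.HasAntidiagonal.mem_antidiagonal, zero_add] at h
      exact hne (by rw [← h])
    rw [h1, if_neg hp]
  · intro h
    simp at h

omit [DirectSum.Decomposition 𝒰] in
theorem comp_convSeries {C A B : Type*} [AddCommGroup C] [Module K C] [Coalgebra K C] [Ring A]
    [Algebra K A] [Ring B] [Algebra K B] {C' : Type*} [AddCommGroup C'] [Module K C']
    [Coalgebra K C'] {φ : C →ₗ[K] A} {φ' : C' →ₗ[K] B} {D : A →ₗ[K] B} {d : C →ₗ[K] C'}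
    (h : ∀ n c, D (convPow φ n c) = convPow φ' n (d c)) (P : K⟦X⟧) (m : ℕ) (c : C) :
    mapS D (convSeries φ P m c) = convSeries φ' P m (d c) := by
  refine series_ext (K := K) _ _ fun n k => ?_
  rw [coeffS_mapS, coeffS_convSeries, coeffS_convSeries]
  split_ifs
  · rw [map_smul, h]
  · rw [map_zero]

/-! ### Operators commuting with the coexponential automorphism -/

variable {f : U →ₗ[K] V} (hf : IsHomogeneousMap 𝒰 𝒱 0 f)

/-- `S(S(f))`. -/
abbrev mapMap (hf : IsHomogeneousMap 𝒰 𝒱 0 f) : GSym (degree 𝒰) →ₐ[K] GSym (degree 𝒱) :=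
  map (map f hf).toLinearMap (map_degree 𝒰 f hf)

theorem mapMap_convPow (n : ℕ) (c : GSym 𝒰) :
    mapMap hf (convPow (ι (degree 𝒰)) n c) = convPow (ι (degree 𝒱)) n (map f hf c) := by
  suffices h : (mapMap hf).toLinearMap ∘ₗ convPow (ι (degree 𝒰)) n =
      convPow (ι (degree 𝒱)) n ∘ₗ (map f hf).toLinearMap from LinearMap.congr_fun h c
  induction n with
  | zero =>
    refine LinearMap.ext fun c => ?_
    simp only [convPow, List.replicate_zero, convList_nil, LinearMap.comp_apply,
      AlgHom.toLinearMap_apply, Algebra.linearMap_apply, AlgHom.commutes, counit_map]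
  | succ n ih =>
    rw [convPow_succ, convPow_succ, comp_conv (map_mul (mapMap hf)), conv_comp_map, ih]
    congr 1
    exact LinearMap.ext fun c => map_ι _ _ _ c

/-- `S(f)` is a coalgebra morphism, so `S(S(f))` commutes with iterated coproducts and hence with
`E` and its inverse. In other words, `S(f)` has no higher cocumulants. -/
theorem mapS_mapMap_convHom (P : K⟦X⟧) (a : (GSym (degree 𝒰))⟦X⟧⟦X⟧) :
    mapS (mapMap hf).toLinearMap (convHom 𝒰 P a) = convHom 𝒱 P (mapS (mapMap hf).toLinearMap a) := by
  refine LinearMap.congr_fun (seriesAlgHom_ext ((isSeriesAlgHom_mapS (mapMap hf)).comp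
    (isSeriesAlgHom_convHom P)) ((isSeriesAlgHom_convHom P).comp (isSeriesAlgHom_mapS (mapMap hf)))
    fun c => ?_) a
  rw [LinearMap.comp_apply, LinearMap.comp_apply, convHom_ι, mapS_constS, AlgHom.toLinearMap_apply,
    mapMap, map_ι, convHom_ι]
  exact comp_convSeries (mapMap_convPow hf) P 1 c

omit [DirectSum.Decomposition 𝒱] in
theorem isSeriesAlgHom_mapS_twist (𝒰 : ℤ → Submodule K U) [DirectSum.Decomposition 𝒰] (k : ℤ) :
    IsSeriesAlgHom (mapS (twist (degree 𝒰) k)) where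
  toIsSeriesLinear := isSeriesLinear_mapS _
  map_one := by rw [← constS_one (K := K), mapS_constS, twist_one]
  map_mul := (isSeriesLinear_mapS _).map_mul fun a b => by
    rw [mapS_constS, mapS_constS, mapS_constS, twist_mul, constS_mul]

theorem twist_convPow (k : ℤ) (n : ℕ) (c : GSym 𝒰) :
    twist (degree (degree 𝒰)) k (convPow (ι (degree 𝒰)) n c) =
      convPow (ι (degree 𝒰)) n (twist (degree 𝒰) k c) := by
  rw [(isHomogeneousMap_convPow_ι n).twist_apply, mul_zero, zpow_zero, one_smul]

theorem mapS_twist_convHom (k : ℤ) (P : K⟦X⟧) (a : (GSym (degree 𝒰))⟦X⟧⟦X⟧) :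
    mapS (twist (degree (degree 𝒰)) k) (convHom 𝒰 P a) =
      convHom 𝒰 P (mapS (twist (degree (degree 𝒰)) k) a) := by
  suffices h : mapS (twist (degree (degree 𝒰)) k) ∘ₗ convHom 𝒰 P =
    convHom 𝒰 P ∘ₗ mapS (twist (degree (degree 𝒰)) k) from LinearMap.congr_fun h a
  refine seriesAlgHom_ext ((isSeriesAlgHom_mapS_twist (degree 𝒰) k).comp
    (isSeriesAlgHom_convHom P)) ((isSeriesAlgHom_convHom P).comp
      (isSeriesAlgHom_mapS_twist (degree 𝒰) k)) fun c => ?_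
  rw [LinearMap.comp_apply, LinearMap.comp_apply, convHom_ι, mapS_constS, twist_ι, convHom_ι]
  exact comp_convSeries (twist_convPow k) P 1 c

variable {h : U →ₗ[K] U} {k : ℤ} (hh : IsHomogeneousMap 𝒰 𝒰 k h)

include hh in
-- The coderivation rule distributes `h̃` over the factors of an iterated coproduct, and the
-- derivation of `S(S(U))` extending `h̃` acts by the same signed sum.
theorem linearCoderivation_convPow (n : ℕ) (c : GSym 𝒰) :
    linearCoderivation (degree 𝒰) (linearCoderivation 𝒰 h) (convPow (ι (degree 𝒰)) n c) =
      convPow (ι (degree 𝒰)) n (linearCoderivation 𝒰 h c) := by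
  suffices e : linearCoderivation (degree 𝒰) (linearCoderivation 𝒰 h) ∘ₗ
      convPow (ι (degree 𝒰)) n = convPow (ι (degree 𝒰)) n ∘ₗ linearCoderivation 𝒰 h from
    LinearMap.congr_fun e c
  have hd := linearCoderivation_degree hh
  induction n with
  | zero =>
    refine LinearMap.ext fun c => ?_
    simp only [convPow, List.replicate_zero, convList_nil, LinearMap.comp_apply,
      Algebra.linearMap_apply, Algebra.algebraMap_eq_smul_one, map_smul, linearCoderivation_one]
    rw [counit_linearCoderivation 𝒰 hh, zero_smul, smul_zero]
  | succ n ih =>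
    rw [convPow_succ, comp_conv_of_add (E₁ := LinearMap.id) (linearCoderivation_mul hd), conv_comp_linearCoderivation hh,
      LinearMap.id_comp, ih]
    congr 2
    · exact LinearMap.ext fun c => linearCoderivation_ι hd c
    · exact LinearMap.ext fun c => twist_ι _ k c

include hh in
theorem mapS_linearCoderivation_mul (f g : (GSym 𝒰)⟦X⟧⟦X⟧) :
    mapS (linearCoderivation 𝒰 h) (f * g) = mapS (linearCoderivation 𝒰 h) f * g +
      mapS (twist (degree 𝒰) k) f * mapS (linearCoderivation 𝒰 h) g := by
  have e := mapS_mul_rule (D := linearCoderivation 𝒰 h) (E₁ := LinearMap.id)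
    (linearCoderivation_mul hh) f g
  have e1 : mapS (LinearMap.id : GSym 𝒰 →ₗ[K] GSym 𝒰) = LinearMap.id :=
    LinearMap.ext fun f => series_ext (K := K) _ _ fun n k => coeffS_mapS _ _ _ _
  rwa [e1, LinearMap.id_apply] at e

theorem mapS_linearCoderivation_one : mapS (linearCoderivation 𝒰 h) 1 = 0 := by
  rw [← constS_one (K := K), mapS_constS, linearCoderivation_one, map_zero]

include hh in
-- Being a coderivation, `h̃` has no higher cobrackets. This commutation with `E` is the reason for
-- working with `h̃` in place of `ĥ`.
theorem mapS_linearCoderivation_convHom (P : K⟦X⟧) (a : (GSym (degree 𝒰))⟦X⟧⟦X⟧) :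
    mapS (linearCoderivation (degree 𝒰) (linearCoderivation 𝒰 h)) (convHom 𝒰 P a) =
      convHom 𝒰 P (mapS (linearCoderivation (degree 𝒰) (linearCoderivation 𝒰 h)) a) := by
  have hd := linearCoderivation_degree hh
  have hE := isSeriesAlgHom_convHom (𝒰 := 𝒰) P
  suffices e : mapS (linearCoderivation (degree 𝒰) (linearCoderivation 𝒰 h)) ∘ₗ convHom 𝒰 P =
    convHom 𝒰 P ∘ₗ mapS (linearCoderivation (degree 𝒰) (linearCoderivation 𝒰 h)) from
    LinearMap.congr_fun e a
  refine seriesDerivation_ext (Φ := convHom 𝒰 P)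
    (Ψ := convHom 𝒰 P ∘ₗ mapS (twist (degree (degree 𝒰)) k))
    ((isSeriesLinear_mapS _).comp hE.toIsSeriesLinear)
    (hE.toIsSeriesLinear.comp (isSeriesLinear_mapS _)) (fun f g => ?_) (fun f g => ?_) ?_ fun c => ?_
  · simp only [LinearMap.comp_apply]
    rw [hE.map_mul, mapS_linearCoderivation_mul hd, mapS_twist_convHom]
  · simp only [LinearMap.comp_apply]
    rw [mapS_linearCoderivation_mul hd, map_add, hE.map_mul, hE.map_mul]
  · rw [LinearMap.comp_apply, LinearMap.comp_apply, hE.map_one, mapS_linearCoderivation_one, map_zero]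
  · rw [LinearMap.comp_apply, LinearMap.comp_apply, convHom_ι, mapS_constS, linearCoderivation_ι hd,
      convHom_ι]
    exact comp_convSeries (linearCoderivation_convPow hh) P 1 c

end GSym

section SeriesLinear

variable {K : Type*} [Field K] {A B : Type*} [Ring A] [Algebra K A] [Ring B] [Algebra K B]

theorem IsSeriesLinear.smul {T : A⟦X⟧⟦X⟧ →ₗ[K] B⟦X⟧⟦X⟧} (hT : IsSeriesLinear T) (c : K) :
    IsSeriesLinear (c • T) where
  X_mul f := by
    rw [LinearMap.smul_apply, LinearMap.smul_apply, hT.X_mul, mul_smul_comm]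
  C_X_mul f := by
    rw [LinearMap.smul_apply, LinearMap.smul_apply, hT.C_X_mul, mul_smul_comm]

theorem isSeriesLinear_zero : IsSeriesLinear (0 : A⟦X⟧⟦X⟧ →ₗ[K] B⟦X⟧⟦X⟧) :=
  ⟨fun _ => (mul_zero _).symm, fun _ => (mul_zero _).symm⟩

theorem coeffS_mul_constS (n k : ℕ) (f : A⟦X⟧⟦X⟧) (b : A) :
    coeffS (K := K) A n k (f * constS (K := K) A b) = coeffS (K := K) A n k f * b := by
  rw [coeffS_apply, constS_apply, PowerSeries.coeff_mul_C, PowerSeries.coeff_mul_C, coeffS_apply]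

theorem coeffS_constS_mul (n k : ℕ) (f : A⟦X⟧⟦X⟧) (b : A) :
    coeffS (K := K) A n k (constS (K := K) A b * f) = b * coeffS (K := K) A n k f := by
  rw [coeffS_apply, constS_apply, PowerSeries.coeff_C_mul, PowerSeries.coeff_C_mul, coeffS_apply]

end SeriesLinear

/-! ### Components and degrees of `K[[t]]`-linear maps. -/

section HomT

variable {K : Type*} [Field K] {U V W : Type*} [AddCommGroup U] [Module K U] [AddCommGroup V]
  [Module K V] [AddCommGroup W] [Module K W]
variable {𝒰 : ℤ → Submodule K U} {𝒱 : ℤ → Submodule K V} {𝒲 : ℤ → Submodule K W}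

open Finset.HasAntidiagonal (antidiagonal)

theorem X_smul (a : (GSym 𝒰)⟦X⟧) : (PowerSeries.X : K⟦X⟧) • a = PowerSeries.X * a := by
  change PowerSeries.map (algebraMap K (GSym 𝒰)) PowerSeries.X * a = _
  rw [PowerSeries.map_X]

theorem component_apply (F : HomT 𝒰 𝒱) (n : ℕ) (a : GSym 𝒰) :
    component F n a = PowerSeries.coeff n (F (PowerSeries.C a)) := rfl

theorem coeff_apply (F : HomT 𝒰 𝒱) (n : ℕ) (a : (GSym 𝒰)⟦X⟧) : PowerSeries.coeff n (F a) =
    ∑ q ∈ antidiagonal n, component F q.1 (PowerSeries.coeff q.2 a) :=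
  coeff_apply_of_X_mul (T := F.toAddMonoidHom) (fun f => by
    rw [LinearMap.toAddMonoidHom_coe, ← X_smul, map_smul, X_smul]) a n

theorem hom_ext {F G : HomT 𝒰 𝒱} (h : ∀ n a, component F n a = component G n a) : F = G := by
  refine LinearMap.ext fun a => PowerSeries.ext fun n => ?_
  simp only [coeff_apply, h]

theorem component_comp (G : HomT 𝒱 𝒲) (F : HomT 𝒰 𝒱) (n : ℕ) (a : GSym 𝒰) :
    component (G ∘ₗ F) n a = ∑ q ∈ antidiagonal n, component G q.1 (component F q.2 a) :=
  coeff_apply G n _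

theorem component_add (F G : HomT 𝒰 𝒱) (n : ℕ) (a : GSym 𝒰) :
    component (F + G) n a = component F n a + component G n a :=
  map_add (PowerSeries.coeff n) _ _

theorem component_sub (F G : HomT 𝒰 𝒱) (n : ℕ) (a : GSym 𝒰) :
    component (F - G) n a = component F n a - component G n a :=
  map_sub (PowerSeries.coeff n) _ _

theorem component_ofComponents (φ : ℕ → GSym 𝒰 →ₗ[K] GSym 𝒱) (n : ℕ) (a : GSym 𝒰) :
    component (ofComponents φ) n a = φ n a := by
  rw [component_apply]
  change PowerSeries.coeff n (PowerSeries.mk fun n => ∑ q ∈ antidiagonal n,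
    φ q.1 (PowerSeries.coeff q.2 (PowerSeries.C a))) = _
  rw [PowerSeries.coeff_mk, Finset.sum_eq_single (n, 0)]
  · simp
  · rintro ⟨p, q⟩ h hne
    have hq : q ≠ 0 := by
      rintro rfl
      rw [Finset.HasAntidiagonal.mem_antidiagonal] at h
      exact hne (by rw [← h]; rfl)
    rw [PowerSeries.coeff_C, if_neg hq, map_zero]
  · intro h
    simp at h

theorem component_extendT (φ : GSym 𝒰 →ₗ[K] GSym 𝒱) (n : ℕ) (a : GSym 𝒰) :
    component (extendT φ) n a = if n = 0 then φ a else 0 := by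
  rw [extendT, component_ofComponents]
  split_ifs <;> rfl

theorem component_id (n : ℕ) (a : GSym 𝒰) :
    component (LinearMap.id : HomT 𝒰 𝒰) n a = if n = 0 then a else 0 :=
  PowerSeries.coeff_C n a

theorem component_comp_extendT (G : HomT 𝒱 𝒲) (φ : GSym 𝒰 →ₗ[K] GSym 𝒱) (n : ℕ) (a : GSym 𝒰) :
    component (G ∘ₗ extendT φ) n a = component G n (φ a) := by
  rw [component_comp, Finset.sum_eq_single (n, 0)]
  · rw [component_extendT, if_pos rfl]
  · rintro ⟨p, q⟩ h hne
    have hq : q ≠ 0 := by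
      rintro rfl
      rw [Finset.HasAntidiagonal.mem_antidiagonal] at h
      exact hne (by rw [← h]; rfl)
    rw [component_extendT, if_neg hq, map_zero]
  · intro h
    simp at h

theorem component_extendT_comp (φ : GSym 𝒱 →ₗ[K] GSym 𝒲) (F : HomT 𝒰 𝒱) (n : ℕ) (a : GSym 𝒰) :
    component (extendT φ ∘ₗ F) n a = φ (component F n a) := by
  rw [component_comp, Finset.sum_eq_single (0, n)]
  · rw [component_extendT, if_pos rfl]
  · rintro ⟨p, q⟩ h hne
    have hp : p ≠ 0 := by
      rintro rfl
      rw [Finset.HasAntidiagonal.mem_antidiagonal, zero_add] at h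
      exact hne (by rw [← h])
    rw [component_extendT, if_neg hp]
  · intro h
    simp at h

/-- `F = ∑ tⁿ Fₙ` is of degree `d`, the degree of `t` being `2`. -/
def HasDegree (d : ℤ) (F : HomT 𝒰 𝒱) : Prop :=
  ∀ n : ℕ, IsHomogeneousMap (GSym.degree 𝒰) (GSym.degree 𝒱) (d - 2 * n) (component F n)

theorem HasDegree.comp {d e : ℤ} {G : HomT 𝒱 𝒲} {F : HomT 𝒰 𝒱} (hG : HasDegree e G)
    (hF : HasDegree d F) : HasDegree (d + e) (G ∘ₗ F) := fun n i a ha => by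
  rw [component_comp]
  refine Submodule.sum_mem _ fun q hq => ?_
  rw [Finset.HasAntidiagonal.mem_antidiagonal] at hq
  have h := hG q.1 _ _ (hF q.2 i a ha)
  rw [← hq]
  convert h using 2
  push_cast
  ring

theorem HasDegree.sub {d : ℤ} {F G : HomT 𝒰 𝒱} (hF : HasDegree d F) (hG : HasDegree d G) :
    HasDegree d (F - G) := fun n i a ha => by
  rw [component_sub]
  exact Submodule.sub_mem _ (hF n i a ha) (hG n i a ha)

theorem HasDegree.extendT {d : ℤ} {φ : GSym 𝒰 →ₗ[K] GSym 𝒱}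
    (hφ : IsHomogeneousMap (GSym.degree 𝒰) (GSym.degree 𝒱) d φ) : HasDegree d (extendT φ) :=
  fun n i a ha => by
    rw [component_extendT]
    split_ifs with hn
    · subst hn
      simpa using hφ i a ha
    · exact Submodule.zero_mem _

end HomT

/-! ### Extension of operators on `S(U)[[t]]` to the symmetric algebra of `S(U)`. -/

namespace GSym

variable {K : Type*} [Field K] {U V W : Type*} [AddCommGroup U] [Module K U] [AddCommGroup V]
  [Module K V] [AddCommGroup W] [Module K W]
variable {𝒰 : ℤ → Submodule K U} [DirectSum.Decomposition 𝒰]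
variable {𝒱 : ℤ → Submodule K V} [DirectSum.Decomposition 𝒱]

open Finset.HasAntidiagonal (antidiagonal)

/-- The inclusion `S(U)[[t]] → S(S(U))[[t]][[z]]`. -/
def ιS (𝒰 : ℤ → Submodule K U) [DirectSum.Decomposition 𝒰] :
    (GSym 𝒰)⟦X⟧ →ₗ[K] (GSym (degree 𝒰))⟦X⟧⟦X⟧ :=
  constT _ ∘ₗ mapT (ι (degree 𝒰))

theorem coeffS_ιS (n k : ℕ) (a : (GSym 𝒰)⟦X⟧) : coeffS (K := K) _ n k (ιS 𝒰 a) =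
    if n = 0 then ι (degree 𝒰) (PowerSeries.coeff k a) else 0 := by
  change PowerSeries.coeff k (PowerSeries.coeff n (PowerSeries.C (mapT (ι (degree 𝒰)) a))) = _
  rw [PowerSeries.coeff_C]
  split_ifs
  · rw [coeff_mapT]
  · rw [map_zero]

theorem ιS_C (a : GSym 𝒰) : ιS 𝒰 (PowerSeries.C a) = constS (K := K) _ (ι (degree 𝒰) a) := by
  refine series_ext (K := K) _ _ fun n k => ?_
  rw [coeffS_ιS, coeffS_constS, PowerSeries.coeff_C]
  by_cases hn : n = 0 <;> by_cases hk : k = 0 <;> simp [hn, hk]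

theorem _root_.IBL.IsSeriesLinear.apply_ιS {T : (GSym (degree 𝒰))⟦X⟧⟦X⟧ →ₗ[K] (GSym (degree 𝒱))⟦X⟧⟦X⟧}
    (hT : IsSeriesLinear T) {F : HomT 𝒰 𝒱}
    (h : ∀ c, T (constS (K := K) _ (ι (degree 𝒰) c)) = ιS 𝒱 (F (PowerSeries.C c)))
    (b : (GSym 𝒰)⟦X⟧) : T (ιS 𝒰 b) = ιS 𝒱 (F b) := by
  refine series_ext (K := K) _ _ fun n k => ?_
  rw [hT.coeffS_apply, Finset.sum_eq_single (n, 0)]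
  · simp only [coeffS_ιS, if_true, h, coeff_apply F k b]
    split_ifs with hn
    · rw [map_sum]
      rfl
    · exact Finset.sum_const_zero
  · rintro ⟨p, q⟩ h' hne
    have hq : q ≠ 0 := by
      rintro rfl
      rw [Finset.HasAntidiagonal.mem_antidiagonal] at h'
      exact hne (by rw [← h']; rfl)
    refine Finset.sum_eq_zero fun r _ => ?_
    rw [coeffS_ιS, if_neg hq, map_zero, map_zero, map_zero]
  · intro h'
    simp at h'

/-- The algebra morphism `S(F)` for `F` of degree zero. -/
def symSeries (F : HomT 𝒰 𝒱) (hF : HasDegree 0 F) :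
    (GSym (degree 𝒰))⟦X⟧⟦X⟧ →ₗ[K] (GSym (degree 𝒱))⟦X⟧⟦X⟧ :=
  liftS (𝒰 := degree 𝒰) (ιS 𝒱 ∘ₗ restrictT F) fun i x hx n k => by
    rw [LinearMap.comp_apply, coeffS_ιS]
    split_ifs
    · have h := hF k i x hx
      rw [zero_sub, ← sub_eq_add_neg] at h
      exact ι_mem_degree _ h
    · exact Submodule.zero_mem _

variable {F : HomT 𝒰 𝒱} {hF : HasDegree 0 F}

omit [DirectSum.Decomposition 𝒰] in
theorem isSeriesAlgHom_symSeries : IsSeriesAlgHom (symSeries F hF) := isSeriesAlgHom_liftS _ _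

omit [DirectSum.Decomposition 𝒰] in
theorem symSeries_ι (c : GSym 𝒰) : symSeries F hF (constS (K := K) _ (ι (degree 𝒰) c)) =
    ιS 𝒱 (F (PowerSeries.C c)) := liftS_ι _ _ _

theorem symSeries_ιS (b : (GSym 𝒰)⟦X⟧) : symSeries F hF (ιS 𝒰 b) = ιS 𝒱 (F b) :=
  isSeriesAlgHom_symSeries.toIsSeriesLinear.apply_ιS symSeries_ι b

/-- The derivation extending `δ`. -/
def derSeries (δ : HomT 𝒰 𝒰) : (GSym (degree 𝒰))⟦X⟧⟦X⟧ →ₗ[K] (GSym (degree 𝒰))⟦X⟧⟦X⟧ :=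
  extS (constT _ ∘ₗ
    { toFun := fun a => PowerSeries.mk fun k => linearCoderivation (degree 𝒰) (component δ k) a
      map_add' := fun a b => by
        ext k
        simp only [PowerSeries.coeff_mk, map_add]
      map_smul' := fun c a => by
        ext k
        change PowerSeries.coeff k (PowerSeries.mk fun k =>
          linearCoderivation (degree 𝒰) (component δ k) (c • a)) = c • PowerSeries.coeff k
            (PowerSeries.mk fun k => linearCoderivation (degree 𝒰) (component δ k) a)
        rw [PowerSeries.coeff_mk, PowerSeries.coeff_mk, map_smul] })

variable {δ : HomT 𝒰 𝒰}

theorem isSeriesLinear_derSeries : IsSeriesLinear (derSeries δ) := isSeriesLinear_extS _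

theorem coeffS_derSeries (n k : ℕ) (a : GSym (degree 𝒰)) :
    coeffS (K := K) _ n k (derSeries δ (constS (K := K) _ a)) =
      if n = 0 then linearCoderivation (degree 𝒰) (component δ k) a else 0 := by
  rw [derSeries, extS_constS]
  change PowerSeries.coeff k (PowerSeries.coeff n (PowerSeries.C (PowerSeries.mk fun k =>
    linearCoderivation (degree 𝒰) (component δ k) a))) = _
  rw [PowerSeries.coeff_C]
  split_ifs
  · rw [PowerSeries.coeff_mk]
  · rw [map_zero]

variable (hδ : HasDegree 1 δ)

theorem derSeries_one : derSeries δ 1 = 0 := by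
  refine series_ext (K := K) _ _ fun n k => ?_
  rw [← constS_one (K := K), coeffS_derSeries, linearCoderivation_one, map_zero]
  exact ite_self 0

include hδ in
theorem derSeries_ι (c : GSym 𝒰) : derSeries δ (constS (K := K) _ (ι (degree 𝒰) c)) =
    ιS 𝒰 (δ (PowerSeries.C c)) := by
  refine series_ext (K := K) _ _ fun n k => ?_
  rw [coeffS_derSeries, coeffS_ιS, linearCoderivation_ι (hδ k)]
  rfl

include hδ in
theorem derSeries_ιS (b : (GSym 𝒰)⟦X⟧) : derSeries δ (ιS 𝒰 b) = ιS 𝒰 (δ b) :=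
  isSeriesLinear_derSeries.apply_ιS (derSeries_ι hδ) b

/-- As `t` has even degree, every component of `δ` is odd, and a single sign operator serves all of
them. -/
theorem even_one_sub_two_mul_sub (k : ℕ) : Even ((1 - 2 * k : ℤ) - 1) := ⟨-k, by ring⟩

/-- The sign operator of the symmetric algebra of `S(U)`. -/
abbrev signS (𝒰 : ℤ → Submodule K U) [DirectSum.Decomposition 𝒰] :
    (GSym (degree 𝒰))⟦X⟧⟦X⟧ →ₗ[K] (GSym (degree 𝒰))⟦X⟧⟦X⟧ := mapS (twist (degree (degree 𝒰)) 1)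

theorem signS_signS (f : (GSym (degree 𝒰))⟦X⟧⟦X⟧) : signS 𝒰 (signS 𝒰 f) = f := by
  refine series_ext (K := K) _ _ fun n k => ?_
  rw [coeffS_mapS, coeffS_mapS, twist_twist, twist_even _ ⟨1, rfl⟩]
  rfl

include hδ in
theorem derSeries_mul (f g : (GSym (degree 𝒰))⟦X⟧⟦X⟧) :
    derSeries δ (f * g) = derSeries δ f * g + signS 𝒰 f * derSeries δ g := by
  have hid : IsSeriesLinear (K := K) (A := GSym (degree 𝒰)) LinearMap.id :=
    isSeriesAlgHom_id.toIsSeriesLinear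
  refine isSeriesLinear_derSeries.mul_rule isSeriesLinear_derSeries hid (isSeriesLinear_mapS _)
    isSeriesLinear_derSeries (fun a b => series_ext (K := K) _ _ fun n k => ?_) f g
  rw [map_add, LinearMap.id_apply, mapS_constS, coeffS_mul_constS, coeffS_constS_mul,
    coeffS_derSeries, coeffS_derSeries, coeffS_derSeries, linearCoderivation_mul (hδ k),
    twist_congr _ (even_one_sub_two_mul_sub k)]
  split_ifs
  · rfl
  · rw [zero_mul, mul_zero, add_zero]

include hδ in
theorem signS_derSeries (f : (GSym (degree 𝒰))⟦X⟧⟦X⟧) :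
    signS 𝒰 (derSeries δ f) = (-1 : K) • derSeries δ (signS 𝒰 f) := by
  suffices h : signS 𝒰 ∘ₗ derSeries δ = (-1 : K) • (derSeries δ ∘ₗ signS 𝒰) from
    LinearMap.congr_fun h f
  refine ((isSeriesLinear_mapS _).comp isSeriesLinear_derSeries).ext
    ((isSeriesLinear_derSeries.comp (isSeriesLinear_mapS _)).smul _)
    fun a => series_ext (K := K) _ _ fun n k => ?_
  rw [LinearMap.comp_apply, LinearMap.smul_apply, LinearMap.comp_apply, mapS_constS, map_smul,
    coeffS_mapS, coeffS_derSeries, coeffS_derSeries]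
  split_ifs
  · rw [(linearCoderivation_degree (hδ k)).twist_apply, one_mul,
      neg_one_zpow_congr (even_one_sub_two_mul_sub k), zpow_one]
  · rw [map_zero, smul_zero]

end GSym

/-! ### Sums over compositions. -/

section CompositionSum

open Finset.HasAntidiagonal (antidiagonal)

variable {X Y : Type*} [AddCommMonoid X] [AddCommMonoid Y]

/-- A composition of a positive number is a first block followed by a composition of the rest;
blocks are positive, hence the form `q.1 + 1`. -/
theorem sum_composition_succ (n : ℕ) (Φ : List ℕ → X) :
    ∑ c : Composition (n + 1), Φ c.blocks =
      ∑ q ∈ antidiagonal n, ∑ c : Composition q.2, Φ ((q.1 + 1) :: c.blocks) := by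
  rw [Finset.sum_sigma']
  symm
  refine Finset.sum_bij (fun a ha => ⟨(a.1.1 + 1) :: a.2.blocks, ?_, ?_⟩) ?_ ?_ ?_ ?_
  · intro i hi
    rcases List.mem_cons.1 hi with rfl | hi
    exacts [Nat.succ_pos _, a.2.blocks_pos hi]
  · rw [Finset.mem_sigma, Finset.HasAntidiagonal.mem_antidiagonal] at ha
    rw [List.sum_cons, a.2.blocks_sum, ← ha.1]
    ring
  · exact fun _ _ => Finset.mem_univ _
  · rintro ⟨⟨p, q⟩, c⟩ _ ⟨⟨p', q'⟩, c'⟩ _ h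
    simp only [Composition.mk.injEq, List.cons.injEq, Nat.add_right_cancel_iff] at h
    obtain ⟨rfl, h⟩ := h
    have hq : q = q' := c.blocks_sum.symm.trans ((congrArg List.sum h).trans c'.blocks_sum)
    subst hq
    rw [Composition.ext h]
  · rintro ⟨l, hl, hs⟩ -
    rcases l with - | ⟨b, l⟩
    · simp at hs
    · have hb : 0 < b := hl List.mem_cons_self
      rw [List.sum_cons] at hs
      refine ⟨⟨(b - 1, l.sum), ⟨l, fun hi => hl (List.mem_cons_of_mem _ hi), rfl⟩⟩, ?_, ?_⟩
      · rw [Finset.mem_sigma, Finset.HasAntidiagonal.mem_antidiagonal]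
        have h' : b + l.sum = n + 1 := hs
        exact ⟨show b - 1 + l.sum = n by omega, Finset.mem_univ _⟩
      · simp only [Nat.sub_add_cancel hb]
  · exact fun _ _ => rfl

/-- The sum of `Φ l` over the lists `l` of `m` positive integers with sum `m + j`. -/
def listSum : ℕ → ℕ → (List ℕ → X) → X
  | 0, j, Φ => if j = 0 then Φ [] else 0
  | m + 1, j, Φ => ∑ q ∈ antidiagonal j, listSum m q.2 fun l => Φ ((q.1 + 1) :: l)

theorem map_listSum (L : X →+ Y) (m j : ℕ) (Φ : List ℕ → X) :
    L (listSum m j Φ) = listSum m j fun l => L (Φ l) := by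
  induction m generalizing j Φ with
  | zero =>
    rw [listSum, listSum]
    split_ifs
    exacts [rfl, map_zero L]
  | succ m ih => simp only [listSum, map_sum, ih]

theorem listSum_add (m j : ℕ) (Φ Ψ : List ℕ → X) :
    listSum m j (fun l => Φ l + Ψ l) = listSum m j Φ + listSum m j Ψ := by
  induction m generalizing j Φ Ψ with
  | zero =>
    simp only [listSum]
    split_ifs
    exacts [rfl, (add_zero 0).symm]
  | succ m ih => simp only [listSum, ih, Finset.sum_add_distrib]

theorem listSum_congr (m j : ℕ) {Φ Ψ : List ℕ → X} (h : ∀ l, l.length = m → Φ l = Ψ l) :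
    listSum m j Φ = listSum m j Ψ := by
  induction m generalizing j Φ Ψ with
  | zero => rw [listSum, listSum, h [] rfl]
  | succ m ih =>
    rw [listSum, listSum]
    exact Finset.sum_congr rfl fun q _ => ih _ fun l hl => h _ (by rw [List.length_cons, hl])

/-- Groups the compositions by their number `m` of blocks, `j` being the total excess of the blocks
over one. Separating the first block leads to smaller totals, whence the strong induction. -/
theorem sum_composition (n : ℕ) (Φ : List ℕ → X) :
    ∑ c : Composition n, Φ c.blocks = ∑ q ∈ antidiagonal n, listSum q.2 q.1 Φ := by
  induction n using Nat.strong_induction_on generalizing Φ with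
  | _ n ih =>
    rcases n with - | n
    · rw [Finset.Nat.antidiagonal_zero, Finset.sum_singleton, listSum, if_pos rfl,
        Finset.sum_eq_single (Composition.ones 0)]
      · rfl
      · intro c _ hc
        refine absurd (Composition.ext ?_) hc
        rw [List.eq_nil_of_length_eq_zero (Nat.le_zero.1 c.length_le)]
        rfl
      · intro h
        exact absurd (Finset.mem_univ _) h
    · rw [sum_composition_succ, Finset.Nat.antidiagonal_succ', Finset.sum_cons, listSum,
        if_neg n.succ_ne_zero, zero_add, Finset.sum_map]
      have e : ∀ q ∈ antidiagonal n, ∑ c : Composition q.2, Φ ((q.1 + 1) :: c.blocks) =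
          ∑ r ∈ antidiagonal q.2, listSum r.2 r.1 fun l => Φ ((q.1 + 1) :: l) := fun q hq =>
        ih q.2 (Nat.lt_succ_of_le ((Finset.HasAntidiagonal.mem_antidiagonal.1 hq) ▸
          Nat.le_add_left _ _)) fun l => Φ ((q.1 + 1) :: l)
      rw [Finset.sum_congr rfl e]
      simp only [Function.Embedding.coe_prodMap, Prod.map, Function.Embedding.coeFn_mk,
        Function.Embedding.refl_apply, Nat.succ_eq_add_one, listSum]
      rw [Finset.sum_sigma', Finset.sum_sigma']
      -- Reassociates the triple formed by the excess of the first block, the excess of the others,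
      -- and the number of the others.
      refine Finset.sum_nbij' (fun x => ⟨(x.1.1 + x.2.1, x.2.2), (x.1.1, x.2.1)⟩)
        (fun x => ⟨(x.2.1, x.2.2 + x.1.2), (x.2.2, x.1.2)⟩) ?_ ?_ ?_ ?_ ?_
      · rintro ⟨⟨i, j⟩, ⟨k, l⟩⟩ hx
        simp only [Finset.mem_sigma, Finset.HasAntidiagonal.mem_antidiagonal] at hx ⊢
        obtain ⟨rfl, rfl⟩ := hx
        exact ⟨by omega, trivial⟩
      · rintro ⟨⟨i, j⟩, ⟨k, l⟩⟩ hx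
        simp only [Finset.mem_sigma, Finset.HasAntidiagonal.mem_antidiagonal] at hx ⊢
        obtain ⟨rfl, rfl⟩ := hx
        exact ⟨by omega, trivial⟩
      · rintro ⟨⟨i, j⟩, ⟨k, l⟩⟩ hx
        simp only [Finset.mem_sigma, Finset.HasAntidiagonal.mem_antidiagonal] at hx
        obtain ⟨rfl, rfl⟩ := hx
        rfl
      · rintro ⟨⟨i, j⟩, ⟨k, l⟩⟩ hx
        simp only [Finset.mem_sigma, Finset.HasAntidiagonal.mem_antidiagonal] at hx
        obtain ⟨rfl, rfl⟩ := hx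
        rfl
      · rintro ⟨⟨i, j⟩, ⟨k, l⟩⟩ _
        rfl

/-- The sum over all compositions with a weight depending on the length only. -/
theorem sum_composition_smul {R : Type*} [Semiring R] [Module R X] (n : ℕ) (w : ℕ → R)
    (Φ : List ℕ → X) : ∑ c : Composition (n + 1), w c.length • Φ c.blocks =
      ∑ q ∈ antidiagonal n, w (q.2 + 1) • listSum (q.2 + 1) q.1 Φ := by
  have h := sum_composition (n + 1) fun l => w l.length • Φ l
  refine h.trans ?_
  rw [Finset.Nat.antidiagonal_succ', Finset.sum_cons, listSum, if_neg n.succ_ne_zero, zero_add,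
    Finset.sum_map]
  refine Finset.sum_congr rfl fun q _ => ?_
  simp only [Function.Embedding.coe_prodMap, Prod.map, Function.Embedding.coeFn_mk,
    Function.Embedding.refl_apply, Nat.succ_eq_add_one]
  rw [listSum_congr (Ψ := fun l => w (q.2 + 1) • Φ l) _ _ fun l hl => by rw [hl]]
  exact (map_listSum (DistribSMul.toAddMonoidHom X (w (q.2 + 1))) _ _ _).symm

end CompositionSum

/-! ### Expansion of convolution powers over lists of blocks. -/

section ConvolutionSum

open Finset.HasAntidiagonal (antidiagonal)

variable {K : Type*} [Field K] {C A Y : Type*} [AddCommGroup C] [Module K C] [CoalgebraStruct K C]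
  [Ring A] [Algebra K A]

/-- The sum over `j` of the products of the maps `g b x`, where `x` is `p` to the left of the
`j`-th place, `q` at the `j`-th place, and `r` to the right of it. -/
def placeSum (g : ℕ → Y → C →ₗ[K] A) (p q r : Y) : List ℕ → C →ₗ[K] A
  | [] => 0
  | b :: l => conv (g b q) (convList (l.map fun b => g b r)) + conv (g b p) (placeSum g p q r l)

/-- Turns the recursion on the first block into the sum over a marked place that occurs in the
definition of the cobracket. -/
theorem placeSum_eq (g : ℕ → Y → C →ₗ[K] A) (p q r : Y) (l : List ℕ) : placeSum g p q r l =
    ∑ j : Fin l.length, convList (List.ofFn fun i : Fin l.length =>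
      g (l.get i) (if i < j then p else if i = j then q else r)) := by
  induction l with
  | nil => rfl
  | cons b l ih =>
    rw [placeSum, ih]
    change _ = ∑ j : Fin (l.length + 1), convList (List.ofFn fun i : Fin (l.length + 1) =>
      g ((b :: l).get i) (if i < j then p else if i = j then q else r))
    rw [Fin.sum_univ_succ, conv_sum]
    congr 1
    · rw [List.ofFn_succ, convList_cons]
      congr 2
      have e : l.map (fun b => g b r) = List.ofFn fun i : Fin l.length => g (l.get i) r := by
        conv_lhs => rw [← List.ofFn_get l, List.map_ofFn]
        rfl
      rw [e]
      congr 1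
    · refine Finset.sum_congr rfl fun j _ => ?_
      rw [List.ofFn_succ, convList_cons]
      congr 2
      congr 1
      funext i
      simp only [Fin.succ_lt_succ_iff, Fin.succ_inj]
      rfl

/-- A product of `m` series is expanded. The coefficient of index `n` in one factor corresponds to a
block of size `n + 1`, so index `j` collects the lists of `m` blocks of total `m + j`. -/
theorem coeff_convPow (ψ : C →ₗ[K] A⟦X⟧) {g : ℕ → C →ₗ[K] A}
    (hg : ∀ n, coeffT A n ∘ₗ ψ = g (n + 1)) (m j : ℕ) :
    coeffT A j ∘ₗ convList (List.replicate m ψ) = listSum m j fun l => convList (l.map g) := by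
  induction m generalizing j with
  | zero =>
    refine LinearMap.ext fun c => ?_
    rw [List.replicate_zero, convList_nil, listSum, LinearMap.comp_apply, LinearMap.comp_apply,
      Algebra.linearMap_apply, Algebra.algebraMap_eq_smul_one, map_smul]
    change _ • PowerSeries.coeff j 1 = _
    rw [PowerSeries.coeff_one]
    split_ifs
    · rw [List.map_nil, convList_nil, LinearMap.comp_apply, Algebra.linearMap_apply,
        Algebra.algebraMap_eq_smul_one]
    · rw [smul_zero]
      rfl
  | succ m ih =>
    refine LinearMap.ext fun c => ?_
    rw [List.replicate_succ, convList_cons, LinearMap.comp_apply]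
    change PowerSeries.coeff j _ = _
    rw [coeff_conv, listSum, LinearMap.sum_apply]
    refine Finset.sum_congr rfl fun q _ => ?_
    rw [hg, ih]
    exact LinearMap.congr_fun (map_listSum (convBilin C A (g (q.1 + 1))).toAddMonoidHom _ _ _) c

/-- The values of a twisted derivation on convolution powers. -/
def derPow (ψ' ψt ψ : C →ₗ[K] A) : ℕ → C →ₗ[K] A
  | 0 => 0
  | m + 1 => conv ψ' (convList (List.replicate m ψ)) + conv ψt (derPow ψ' ψt ψ m)

theorem coeff_derPow {ψ' ψt ψ : C →ₗ[K] A⟦X⟧} {g : ℕ → Y → C →ₗ[K] A} {p q r : Y}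
    (hp : ∀ n, coeffT A n ∘ₗ ψt = g (n + 1) p) (hq : ∀ n, coeffT A n ∘ₗ ψ' = g (n + 1) q)
    (hr : ∀ n, coeffT A n ∘ₗ ψ = g (n + 1) r) (m j : ℕ) :
    coeffT A j ∘ₗ derPow ψ' ψt ψ m = listSum m j (placeSum g p q r) := by
  induction m generalizing j with
  | zero =>
    rw [derPow, listSum, LinearMap.comp_zero]
    exact (ite_self _).symm
  | succ m ih =>
    refine LinearMap.ext fun c => ?_
    rw [derPow, LinearMap.comp_apply, LinearMap.add_apply, map_add]
    change PowerSeries.coeff j _ + PowerSeries.coeff j _ = _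
    rw [coeff_conv, coeff_conv, listSum, ← Finset.sum_add_distrib, LinearMap.sum_apply]
    refine Finset.sum_congr rfl fun u _ => ?_
    rw [hp, hq, ih, coeff_convPow ψ (g := fun b => g b r) hr]
    simp only [placeSum]
    rw [listSum_add]
    refine congrArg₂ (· + ·) ?_ ?_
    · exact LinearMap.congr_fun (map_listSum (convBilin C A (g (u.1 + 1) q)).toAddMonoidHom _ _ _) c
    · exact LinearMap.congr_fun (map_listSum (convBilin C A (g (u.1 + 1) p)).toAddMonoidHom _ _ _) c

theorem comp_convPow_of_derivation {B : Type*} [Ring B] [Algebra K B] {D Φ Ψ : A →ₗ[K] B}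
    (h : ∀ a b, D (a * b) = D a * Φ b + Ψ a * D b) (h1 : D 1 = 0)
    (hΦ : ∀ a b, Φ (a * b) = Φ a * Φ b) (hΦ1 : Φ 1 = 1) (φ : C →ₗ[K] A) (m : ℕ) :
    D ∘ₗ convList (List.replicate m φ) = derPow (D ∘ₗ φ) (Ψ ∘ₗ φ) (Φ ∘ₗ φ) m := by
  induction m with
  | zero =>
    refine LinearMap.ext fun c => ?_
    rw [List.replicate_zero, convList_nil, LinearMap.comp_apply, LinearMap.comp_apply,
      Algebra.linearMap_apply, Algebra.algebraMap_eq_smul_one, map_smul, h1, smul_zero]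
    rfl
  | succ m ih =>
    rw [List.replicate_succ, convList_cons, comp_conv_of_add h, derPow, ih,
      comp_convList hΦ (fun c => by
        rw [Algebra.algebraMap_eq_smul_one, map_smul, hΦ1, Algebra.algebraMap_eq_smul_one]),
      List.map_replicate]

end ConvolutionSum

/-! ### Cobrackets and cocumulants as coefficients of conjugated operators. -/

namespace GSym

variable {K : Type*} [Field K] {U V : Type*} [AddCommGroup U] [Module K U] [AddCommGroup V]
  [Module K V]
variable {𝒰 : ℤ → Submodule K U} [DirectSum.Decomposition 𝒰]
variable {𝒱 : ℤ → Submodule K V} [DirectSum.Decomposition 𝒱]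

open Finset.HasAntidiagonal (antidiagonal)

variable (𝒰) in
/-- The coexponential automorphism `E`, with `zⁿ` recording the increase of the symmetric degree. -/
abbrev expHom : (GSym (degree 𝒰))⟦X⟧⟦X⟧ →ₗ[K] (GSym (degree 𝒰))⟦X⟧⟦X⟧ := convHom 𝒰 (expSeries K)

variable (𝒰) in
/-- The inverse of the coexponential automorphism. -/
abbrev logHom : (GSym (degree 𝒰))⟦X⟧⟦X⟧ →ₗ[K] (GSym (degree 𝒰))⟦X⟧⟦X⟧ := convHom 𝒰 (logSeries K)

theorem expHom_logHom [CharZero K] (f : (GSym (degree 𝒰))⟦X⟧⟦X⟧) :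
    expHom 𝒰 (logHom 𝒰 f) = f := by
  let _ : Algebra ℚ K := DivisionRing.toRatAlgebra
  have h := convHom_comp_convHom (𝒰 := 𝒰) (P := expSeries K) (Q := logSeries K) (by
    rw [X_mul_expSeries, X_mul_logSeries, log_subst_exp])
  exact LinearMap.congr_fun h f

theorem logHom_expHom [CharZero K] (f : (GSym (degree 𝒰))⟦X⟧⟦X⟧) :
    logHom 𝒰 (expHom 𝒰 f) = f := by
  let _ : Algebra ℚ K := DivisionRing.toRatAlgebra
  have h := convHom_comp_convHom (𝒰 := 𝒰) (P := logSeries K) (Q := expSeries K) (by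
    rw [X_mul_expSeries, X_mul_logSeries, exp_subst_log])
  exact LinearMap.congr_fun h f

theorem coeff_expHom_ιS (n : ℕ) (b : (GSym 𝒰)⟦X⟧) :
    PowerSeries.coeff n (expHom 𝒰 (ιS 𝒰 b)) = mapT (coexpTerm 𝒰 (n + 1)) b := by
  ext k
  change coeffS (K := K) (GSym (degree 𝒰)) n k (expHom 𝒰 (ιS 𝒰 b)) = _
  rw [(isSeriesAlgHom_convHom _).toIsSeriesLinear.coeffS_apply, Finset.sum_eq_single (n, 0),
    Finset.sum_eq_single (0, k)]
  · rw [coeffS_ιS, if_pos rfl, convHom_ι, coeffS_convSeries, if_pos rfl, coeff_mapT, expSeries,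
      PowerSeries.coeff_mk]
    rfl
  · rintro ⟨p, r⟩ h hne
    have hp : p ≠ 0 := by
      rintro rfl
      rw [Finset.HasAntidiagonal.mem_antidiagonal, zero_add] at h
      exact hne (by rw [← h])
    rw [coeffS_ιS, if_pos rfl, convHom_ι, coeffS_convSeries, if_neg hp]
  · intro h
    simp at h
  · rintro ⟨p, q⟩ h hne
    have hq : q ≠ 0 := by
      rintro rfl
      rw [Finset.HasAntidiagonal.mem_antidiagonal] at h
      exact hne (by rw [← h]; rfl)
    refine Finset.sum_eq_zero fun r _ => ?_
    rw [coeffS_ιS, if_neg hq, map_zero, map_zero, map_zero]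
  · intro h
    simp at h

/-- The operator `E δ̃ L`, whose components on `S(U)` are the Koszul cobrackets. -/
def cobracketSeries (δ : HomT 𝒰 𝒰) : (GSym (degree 𝒰))⟦X⟧⟦X⟧ →ₗ[K] (GSym (degree 𝒰))⟦X⟧⟦X⟧ :=
  expHom 𝒰 ∘ₗ derSeries δ ∘ₗ logHom 𝒰

/-- The morphism `E S(F) L`, whose components on `S(U)` are the cocumulants. -/
def cumulantSeries (F : HomT 𝒰 𝒱) (hF : HasDegree 0 F) :
    (GSym (degree 𝒰))⟦X⟧⟦X⟧ →ₗ[K] (GSym (degree 𝒱))⟦X⟧⟦X⟧ :=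
  expHom 𝒱 ∘ₗ symSeries F hF ∘ₗ logHom 𝒰

/-- The coefficients of an operator applied to the logarithm of a generator. -/
theorem coeff_apply_convSeries {A B : Type*} [Ring A] [Algebra K A] [Ring B] [Algebra K B]
    {C : Type*} [AddCommGroup C] [Module K C] [Coalgebra K C]
    {T : A⟦X⟧⟦X⟧ →ₗ[K] B⟦X⟧⟦X⟧} (hT : IsSeriesLinear T) (φ : C →ₗ[K] A) (P : K⟦X⟧) (m n : ℕ) (c : C) :
    PowerSeries.coeff n (T (convSeries φ P m c)) = ∑ q ∈ antidiagonal n,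
      PowerSeries.coeff q.2 P •
        PowerSeries.coeff q.1 (T (constS (K := K) A (convPow φ (q.2 + m) c))) := by
  ext k
  rw [map_sum]
  exact hT.coeffS_convSeries φ P m n k c

/-- The logarithm contributes the weights `(-1)^{k-1}/k` on `k`-fold convolution powers, the
multiplicative operator `E S(F)` acts on each factor, and the coefficient of `zⁿ` distributes the
symmetric degree `n + 1` over the `k` factors. This is the sum over compositions in the definition.
-/
theorem cocumulant_succ {F : HomT 𝒰 𝒱} {hF : HasDegree 0 F} (n : ℕ) (c : GSym 𝒰) :
    cocumulant F (n + 1) c =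
      PowerSeries.coeff n (cumulantSeries F hF (constS (K := K) _ (ι (degree 𝒰) c))) := by
  have hT : IsSeriesAlgHom (expHom 𝒱 ∘ₗ symSeries F hF) :=
    (isSeriesAlgHom_convHom _).comp isSeriesAlgHom_symSeries
  change _ = PowerSeries.coeff n ((expHom 𝒱 ∘ₗ symSeries F hF)
    (logHom 𝒰 (constS (K := K) _ (ι (degree 𝒰) c))))
  rw [convHom_ι, coeff_apply_convSeries hT.toIsSeriesLinear]
  let g : ℕ → GSym 𝒰 →ₗ[K] (GSym (degree 𝒱))⟦X⟧ := fun b => mapT (coexpTerm 𝒱 b) ∘ₗ restrictT F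
  have hg : ∀ n, coeffT _ n ∘ₗ ((expHom 𝒱 ∘ₗ symSeries F hF) ∘ₗ constS (K := K) _ ∘ₗ
      ι (degree 𝒰)) = g (n + 1) := fun n => LinearMap.ext fun c => by
    change PowerSeries.coeff n (expHom 𝒱 (symSeries F hF (constS (K := K) _ (ι (degree 𝒰) c)))) = _
    rw [symSeries_ι, coeff_expHom_ιS]
    rfl
  have h := LinearMap.congr_fun (sum_composition_smul n
    (fun m => ((-1 : K) ^ (m + 1) / (m : K))) fun l => convList (l.map g)) c
  have e : cocumulant F (n + 1) = ∑ c : Composition (n + 1),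
      ((-1 : K) ^ (c.length + 1) / (c.length : K)) • convList (c.blocks.map g) := by
    refine Finset.sum_congr rfl fun c _ => ?_
    rw [← c.ofFn_blocksFun, List.map_ofFn]
    rfl
  rw [e, h, LinearMap.sum_apply]
  refine Finset.sum_congr rfl fun q _ => ?_
  rw [LinearMap.smul_apply]
  congr 1
  · rw [logSeries, PowerSeries.coeff_mk, pow_succ, pow_succ]
    simp
  · rw [← coeff_convPow _ hg, ← List.map_replicate (f := fun φ => (expHom 𝒱 ∘ₗ symSeries F hF) ∘ₗ φ),
      ← hT.comp_convList, ← List.map_replicate (f := fun φ => constS (K := K) _ ∘ₗ φ),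
      ← constS_comp_convList]
    rfl

variable {δ : HomT 𝒰 𝒰} (hδ : HasDegree 1 δ)

include hδ in
theorem expHom_derSeries_mul (f g : (GSym (degree 𝒰))⟦X⟧⟦X⟧) :
    (expHom 𝒰 ∘ₗ derSeries δ) (f * g) = (expHom 𝒰 ∘ₗ derSeries δ) f * expHom 𝒰 g +
      (expHom 𝒰 ∘ₗ signS 𝒰) f * (expHom 𝒰 ∘ₗ derSeries δ) g := by
  simp only [LinearMap.comp_apply]
  rw [derSeries_mul hδ, map_add, (isSeriesAlgHom_convHom _).map_mul,
    (isSeriesAlgHom_convHom _).map_mul]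

include hδ in
-- As for cocumulants, except that `E δ̃` is a twisted derivation along `E`: one factor carries `δ`,
-- the factors before it carry the parity sign, and those after it only `E`.
theorem koszulCobracket_succ (n : ℕ) (c : GSym 𝒰) :
    koszulCobracket δ (n + 1) c =
      PowerSeries.coeff n (cobracketSeries δ (constS (K := K) _ (ι (degree 𝒰) c))) := by
  have hE : IsSeriesAlgHom (expHom 𝒰) := isSeriesAlgHom_convHom _
  have hT : IsSeriesLinear (expHom 𝒰 ∘ₗ derSeries δ) :=
    hE.toIsSeriesLinear.comp isSeriesLinear_derSeries
  change _ = PowerSeries.coeff n ((expHom 𝒰 ∘ₗ derSeries δ)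
    (logHom 𝒰 (constS (K := K) _ (ι (degree 𝒰) c))))
  rw [convHom_ι, coeff_apply_convSeries hT]
  let g : ℕ → (GSym 𝒰 →ₗ[K] (GSym 𝒰)⟦X⟧) → GSym 𝒰 →ₗ[K] (GSym (degree 𝒰))⟦X⟧ :=
    fun b φ => mapT (coexpTerm 𝒰 b) ∘ₗ φ
  let p : GSym 𝒰 →ₗ[K] (GSym 𝒰)⟦X⟧ := constT (GSym 𝒰) ∘ₗ parity (degree 𝒰)
  have hp : ∀ n, coeffT _ n ∘ₗ ((expHom 𝒰 ∘ₗ signS 𝒰) ∘ₗ constS (K := K) _ ∘ₗ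
      ι (degree 𝒰)) = g (n + 1) p := fun n => LinearMap.ext fun c => by
    change PowerSeries.coeff n (expHom 𝒰 (signS 𝒰 (constS (K := K) _ (ι (degree 𝒰) c)))) = _
    rw [mapS_constS, twist_ι, ← ιS_C, coeff_expHom_ιS, ← parity_eq_twist]
    rfl
  have hq : ∀ n, coeffT _ n ∘ₗ ((expHom 𝒰 ∘ₗ derSeries δ) ∘ₗ constS (K := K) _ ∘ₗ
      ι (degree 𝒰)) = g (n + 1) (restrictT δ) := fun n => LinearMap.ext fun c => by
    change PowerSeries.coeff n (expHom 𝒰 (derSeries δ (constS (K := K) _ (ι (degree 𝒰) c)))) = _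
    rw [derSeries_ι hδ, coeff_expHom_ιS]
    rfl
  have hr : ∀ n, coeffT _ n ∘ₗ (expHom 𝒰 ∘ₗ constS (K := K) _ ∘ₗ ι (degree 𝒰)) =
      g (n + 1) (constT (GSym 𝒰)) := fun n => LinearMap.ext fun c => by
    change PowerSeries.coeff n (expHom 𝒰 (constS (K := K) _ (ι (degree 𝒰) c))) = _
    rw [← ιS_C, coeff_expHom_ιS]
    rfl
  have h := LinearMap.congr_fun (sum_composition_smul n
    (fun m => ((-1 : K) ^ (m + 1) / (m : K))) (placeSum g p (restrictT δ) (constT (GSym 𝒰)))) c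
  have e : koszulCobracket δ (n + 1) = ∑ c : Composition (n + 1),
      ((-1 : K) ^ (c.length + 1) / (c.length : K)) •
        placeSum g p (restrictT δ) (constT (GSym 𝒰)) c.blocks := by
    refine Finset.sum_congr rfl fun c _ => ?_
    rw [placeSum_eq]
    rfl
  rw [e, h, LinearMap.sum_apply]
  refine Finset.sum_congr rfl fun q _ => ?_
  rw [LinearMap.smul_apply]
  congr 1
  · rw [logSeries, PowerSeries.coeff_mk, pow_succ, pow_succ]
    simp
  · rw [← coeff_derPow hp hq hr]
    have h1 : (expHom 𝒰 ∘ₗ derSeries δ) 1 = 0 := by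
      rw [LinearMap.comp_apply, derSeries_one, map_zero]
    rw [← comp_convPow_of_derivation (expHom_derSeries_mul hδ) h1 hE.map_mul hE.map_one,
      ← List.map_replicate (f := fun φ => constS (K := K) _ ∘ₗ φ), ← constS_comp_convList]
    rfl

end GSym

/-! ### Series whose coefficient of `zⁿ` is divisible by `tⁿ`. -/

section Admissible

variable {K : Type*} [Field K] {A B : Type*} [Ring A] [Algebra K A] [Ring B] [Algebra K B]

open Finset.HasAntidiagonal (antidiagonal)

variable (K) in
/-- The coefficient of `zⁿ` is divisible by `tⁿ`. -/
def IsAdmissible (f : A⟦X⟧⟦X⟧) : Prop := ∀ n k : ℕ, k < n → coeffS (K := K) A n k f = 0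

theorem IsAdmissible.add {f g : A⟦X⟧⟦X⟧} (hf : IsAdmissible K f) (hg : IsAdmissible K g) :
    IsAdmissible K (f + g) := fun n k h => by rw [map_add, hf n k h, hg n k h, add_zero]

theorem IsAdmissible.smul {f : A⟦X⟧⟦X⟧} (c : K) (hf : IsAdmissible K f) : IsAdmissible K (c • f) :=
  fun n k h => by rw [map_smul, hf n k h, smul_zero]

theorem IsAdmissible.mul {f g : A⟦X⟧⟦X⟧} (hf : IsAdmissible K f) (hg : IsAdmissible K g) :
    IsAdmissible K (f * g) := fun n k h => by
  rw [coeffS_mul]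
  refine Finset.sum_eq_zero fun q hq => Finset.sum_eq_zero fun r hr => ?_
  rw [Finset.HasAntidiagonal.mem_antidiagonal] at hq hr
  by_cases h1 : r.1 < q.1
  · rw [hf _ _ h1, zero_mul]
  · rw [hg q.2 r.2 (by omega), mul_zero]

theorem isAdmissible_constS (a : A) : IsAdmissible K (constS (K := K) A a) := fun n k h => by
  rw [coeffS_constS, if_neg (by omega)]

theorem IsAdmissible.mapS {f : A⟦X⟧⟦X⟧} (φ : A →ₗ[K] B) (hf : IsAdmissible K f) :
    IsAdmissible K (mapS φ f) := fun n k h => by rw [coeffS_mapS, hf n k h, map_zero]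

theorem IsAdmissible.apply {T : A⟦X⟧⟦X⟧ →ₗ[K] B⟦X⟧⟦X⟧} (hT : IsSeriesLinear T)
    (h : ∀ a, IsAdmissible K (T (constS (K := K) A a))) {f : A⟦X⟧⟦X⟧} (hf : IsAdmissible K f) :
    IsAdmissible K (T f) := fun n k hnk => by
  rw [hT.coeffS_apply]
  refine Finset.sum_eq_zero fun q hq => Finset.sum_eq_zero fun r hr => ?_
  rw [Finset.HasAntidiagonal.mem_antidiagonal] at hq hr
  by_cases h1 : r.1 < q.1
  · exact h _ _ _ h1
  · rw [hf q.2 r.2 (by omega), map_zero, map_zero, map_zero]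

/-- Solutions of an admissible equation with injective leading term are admissible. -/
theorem isAdmissible_of_apply_eq_zero {P : A⟦X⟧⟦X⟧ →ₗ[K] A⟦X⟧⟦X⟧} (hP : IsSeriesLinear P)
    (hPa : ∀ a, IsAdmissible K (P (constS (K := K) A a))) {s : A →ₗ[K] B}
    (hinj : ∀ v, coeffS (K := K) A 0 0 (P (constS (K := K) A v)) = 0 → s v = 0 → v = 0)
    {f : A⟦X⟧⟦X⟧} (hf : P f = 0) (hs : IsAdmissible K (mapS s f)) : IsAdmissible K f := by
  intro n k
  induction k using Nat.strong_induction_on generalizing n with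
  | _ k ih =>
    intro hnk
    refine hinj _ ?_ (by rw [← coeffS_mapS]; exact hs n k hnk)
    have h0 : coeffS (K := K) A n k (P f) = 0 := by rw [hf, map_zero]
    -- For `k < n`, a term `z^p t^r` of `P` has `r ≥ p` by admissibility and meets the coefficient
    -- of `z^{n-p} t^{k-r}` in `f`, where again `k - r < n - p`. Unless `p = r = 0`, the power of
    -- `t` has dropped and this coefficient vanishes by induction. Only the leading term of `P`
    -- remains.
    rw [hP.coeffS_apply, Finset.sum_eq_single (0, n), Finset.sum_eq_single (0, k)] at h0
    · exact h0
    · rintro ⟨p, r⟩ hr hne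
      rw [Finset.HasAntidiagonal.mem_antidiagonal] at hr
      have hp : p ≠ 0 := by
        rintro rfl
        exact hne (by rw [← hr, zero_add])
      have h1 : r < k := by simp only at hr; omega
      rw [ih r h1 n (h1.trans hnk), map_zero, map_zero, map_zero]
    · intro h
      simp at h
    · rintro ⟨p, q⟩ hq hne
      rw [Finset.HasAntidiagonal.mem_antidiagonal] at hq
      have hp : p ≠ 0 := by
        rintro rfl
        exact hne (by rw [← hq, zero_add])
      refine Finset.sum_eq_zero fun r hr => ?_
      rw [Finset.HasAntidiagonal.mem_antidiagonal] at hr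
      by_cases h1 : r.1 < p
      · exact hPa _ _ _ h1
      · simp only at hq
        rw [ih r.2 (by omega) q (by omega), map_zero, map_zero, map_zero]
    · intro h
      simp at h

/-- The dual argument, with the admissible operator composed on the right and the induction running
over the components of `T` on constants. The leading term must now be jointly surjective with `s`,
in the sense that no nonzero linear map kills both images. -/
theorem isAdmissible_of_comp_eq_zero {P : A⟦X⟧⟦X⟧ →ₗ[K] A⟦X⟧⟦X⟧}
    (hPa : ∀ a, IsAdmissible K (P (constS (K := K) A a))) {s : A →ₗ[K] A}
    (hinj : ∀ φ : A →ₗ[K] B, (∀ v, φ (coeffS (K := K) A 0 0 (P (constS (K := K) A v))) = 0) →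
      (∀ v, φ (s v) = 0) → φ = 0)
    {T : A⟦X⟧⟦X⟧ →ₗ[K] B⟦X⟧⟦X⟧} (hT : IsSeriesLinear T) (hTP : ∀ f, T (P f) = 0)
    (hs : ∀ a, IsAdmissible K (T (constS (K := K) A (s a)))) (a : A) :
    IsAdmissible K (T (constS (K := K) A a)) := by
  intro n k hnk
  suffices h : coeffS (K := K) B n k ∘ₗ T ∘ₗ constS (K := K) A = 0 from LinearMap.congr_fun h a
  induction k using Nat.strong_induction_on generalizing n with
  | _ k ih =>
    refine hinj _ (fun v => ?_) fun v => hs v n k hnk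
    have h0 : coeffS (K := K) B n k (T (P (constS (K := K) A v))) = 0 := by rw [hTP, map_zero]
    rw [hT.coeffS_apply, Finset.sum_eq_single (n, 0), Finset.sum_eq_single (k, 0)] at h0
    · exact h0
    · rintro ⟨r, p⟩ hr hne
      rw [Finset.HasAntidiagonal.mem_antidiagonal] at hr
      have hp : p ≠ 0 := by
        rintro rfl
        exact hne (by rw [← hr]; rfl)
      have h1 : r < k := by simp only at hr; omega
      exact LinearMap.congr_fun (ih r h1 n (h1.trans hnk)) _
    · intro h
      simp at h
    · rintro ⟨q, p⟩ hq hne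
      rw [Finset.HasAntidiagonal.mem_antidiagonal] at hq
      have hp : p ≠ 0 := by
        rintro rfl
        exact hne (by rw [← hq]; rfl)
      refine Finset.sum_eq_zero fun r hr => ?_
      rw [Finset.HasAntidiagonal.mem_antidiagonal] at hr
      by_cases h1 : r.2 < p
      · rw [hPa _ _ _ h1, map_zero, map_zero, map_zero]
      · simp only at hq
        exact LinearMap.congr_fun (ih r.1 (by omega) q (by omega)) _
    · intro h
      simp at h

end Admissible

/-! ### The conditions on cobrackets and cocumulants as admissibility. -/

namespace GSym

variable {K : Type*} [Field K] {U V : Type*} [AddCommGroup U] [Module K U] [AddCommGroup V]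
  [Module K V]
variable {𝒰 : ℤ → Submodule K U} [DirectSum.Decomposition 𝒰]
variable {𝒱 : ℤ → Submodule K V} [DirectSum.Decomposition 𝒱]

open Finset.HasAntidiagonal (antidiagonal)

omit [DirectSum.Decomposition 𝒰] in
-- Admissible series form a subalgebra, so generators suffice.
theorem isAdmissible_algHom {M : Type*} [Ring M] [Algebra K M]
    {T : (GSym 𝒰)⟦X⟧⟦X⟧ →ₗ[K] M⟦X⟧⟦X⟧} (hT : IsSeriesAlgHom T)
    (h : ∀ x, IsAdmissible K (T (constS (K := K) _ (ι 𝒰 x)))) (a : GSym 𝒰) :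
    IsAdmissible K (T (constS (K := K) _ a)) := by
  induction a using induction 𝒰 with
  | one =>
    rw [constS_one, hT.map_one, ← constS_one (K := K)]
    exact isAdmissible_constS 1
  | ι_mul x a ha =>
    rw [constS_mul, hT.map_mul]
    exact (h x).mul ha
  | add a b ha hb =>
    rw [map_add, map_add]
    exact ha.add hb
  | smul c a ha =>
    rw [map_smul, map_smul]
    exact ha.smul c

section Cobracket

variable [CharZero K] {δ : HomT 𝒰 𝒰} (hδ : HasDegree 1 δ)

omit [CharZero K] in
theorem isSeriesLinear_cobracketSeries : IsSeriesLinear (cobracketSeries δ) :=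
  (isSeriesAlgHom_convHom _).toIsSeriesLinear.comp
    (isSeriesLinear_derSeries.comp (isSeriesAlgHom_convHom _).toIsSeriesLinear)

omit [CharZero K] in
theorem cobracketSeries_one : cobracketSeries δ 1 = 0 := by
  rw [cobracketSeries, LinearMap.comp_apply, LinearMap.comp_apply, (isSeriesAlgHom_convHom _).map_one,
    derSeries_one, map_zero]

include hδ in
theorem cobracketSeries_mul (f g : (GSym (degree 𝒰))⟦X⟧⟦X⟧) :
    cobracketSeries δ (f * g) = cobracketSeries δ f * g + signS 𝒰 f * cobracketSeries δ g := by
  simp only [cobracketSeries, LinearMap.comp_apply]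
  rw [(isSeriesAlgHom_convHom _).map_mul, derSeries_mul hδ, map_add, (isSeriesAlgHom_convHom _).map_mul,
    (isSeriesAlgHom_convHom _).map_mul, expHom_logHom, ← mapS_twist_convHom, expHom_logHom]

include hδ in
-- The conjugate of `δ̃` is a derivation up to signs, and signs and constants preserve
-- admissibility, so the condition spreads from generators to products. On generators the
-- coefficient of `zⁿ` is the cobracket of order `n + 1`, which explains the exponent `n - 1` in
-- order `n`; order one imposes nothing.
theorem isAdmissible_cobracketSeries_iff :
    (∀ n : ℕ, 2 ≤ n → ∀ a : GSym 𝒰, PowerSeries.X ^ (n - 1) ∣ koszulCobracket δ n a) ↔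
      ∀ a, IsAdmissible K (cobracketSeries δ (constS (K := K) _ a)) := by
  constructor
  · intro h a
    induction a using induction (degree 𝒰) with
    | one =>
      rw [constS_one, cobracketSeries_one]
      exact fun n k _ => map_zero _
    | ι_mul x a ha =>
      rw [constS_mul, cobracketSeries_mul hδ]
      refine IsAdmissible.add (IsAdmissible.mul ?_ (isAdmissible_constS a))
        (((isAdmissible_constS _).mapS _).mul ha)
      intro n k hk
      rcases n with - | n
      · omega
      · have h1 := h (n + 2) (by omega) x
        rw [koszulCobracket_succ hδ, PowerSeries.X_pow_dvd_iff] at h1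
        exact h1 k hk
    | add a b ha hb =>
      rw [map_add, map_add]
      exact ha.add hb
    | smul c a ha =>
      rw [map_smul, map_smul]
      exact ha.smul c
  · intro h n hn a
    obtain ⟨n, rfl⟩ := Nat.exists_eq_add_of_le' hn
    rw [show n + 2 = (n + 1) + 1 from rfl, koszulCobracket_succ hδ, PowerSeries.X_pow_dvd_iff]
    exact fun k hk => h (ι (degree 𝒰) a) (n + 1) k hk

omit [CharZero K] in
theorem isAdmissible_cumulantSeries_iff {F : HomT 𝒰 𝒱} {hF : HasDegree 0 F} :
    (∀ n : ℕ, 2 ≤ n → ∀ a : GSym 𝒰, PowerSeries.X ^ (n - 1) ∣ cocumulant F n a) ↔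
      ∀ a, IsAdmissible K (cumulantSeries F hF (constS (K := K) _ a)) := by
  constructor
  · intro h
    refine isAdmissible_algHom ((isSeriesAlgHom_convHom _).comp
      (isSeriesAlgHom_symSeries.comp (isSeriesAlgHom_convHom _))) fun x n k hk => ?_
    rcases n with - | n
    · omega
    · have h1 := h (n + 2) (by omega) x
      rw [cocumulant_succ (hF := hF), PowerSeries.X_pow_dvd_iff] at h1
      exact h1 k hk
  · intro h n hn a
    obtain ⟨n, rfl⟩ := Nat.exists_eq_add_of_le' hn
    rw [show n + 2 = (n + 1) + 1 from rfl, cocumulant_succ (hF := hF), PowerSeries.X_pow_dvd_iff]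
    exact fun k hk => h (ι (degree 𝒰) a) (n + 1) k hk

omit [CharZero K] in
theorem coeffS_zero_cobracketSeries (a : GSym (degree 𝒰)) (k : ℕ) :
    coeffS (K := K) _ 0 k (cobracketSeries δ (constS (K := K) _ a)) =
      linearCoderivation (degree 𝒰) (component δ k) a := by
  have h0 : PowerSeries.coeff 0 (expSeries K) = 1 := by simp [expSeries]
  have h1 : PowerSeries.coeff 0 (logSeries K) = 1 := by simp [logSeries]
  rw [cobracketSeries, LinearMap.comp_apply, LinearMap.comp_apply, coeffS_zero_convHom h0,
    isSeriesLinear_derSeries.coeffS_apply, Finset.Nat.antidiagonal_zero, Finset.sum_singleton,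
    Finset.sum_eq_single (k, 0)]
  · rw [coeffS_zero_convHom h1, coeffS_derSeries, if_pos rfl, coeffS_constS, if_pos ⟨rfl, rfl⟩]
  · rintro ⟨p, r⟩ h hne
    have hr : r ≠ 0 := by
      rintro rfl
      rw [Finset.HasAntidiagonal.mem_antidiagonal] at h
      exact hne (by rw [← h]; rfl)
    rw [coeffS_zero_convHom h1, coeffS_constS, if_neg (by simp [hr]), map_zero, map_zero, map_zero]
  · intro h
    simp at h

end Cobracket

end GSym

/-! ### The anticommutator of `δ` with the coderivation extending the homotopy. -/

namespace GSym

variable {K : Type*} [Field K] {U V : Type*} [AddCommGroup U] [Module K U] [AddCommGroup V]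
  [Module K V]
variable {𝒰 : ℤ → Submodule K U} [DirectSum.Decomposition 𝒰]
variable {𝒱 : ℤ → Submodule K V} [DirectSum.Decomposition 𝒱]

open Finset.HasAntidiagonal (antidiagonal)

theorem mapS_ιS {φ : GSym (degree 𝒰) →ₗ[K] GSym (degree 𝒱)} {ψ : GSym 𝒰 →ₗ[K] GSym 𝒱}
    (h : ∀ c, φ (ι (degree 𝒰) c) = ι (degree 𝒱) (ψ c)) (b : (GSym 𝒰)⟦X⟧) :
    mapS φ (ιS 𝒰 b) = ιS 𝒱 (extendT ψ b) := by
  refine (isSeriesLinear_mapS φ).apply_ιS (fun c => ?_) b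
  rw [mapS_constS, h]
  refine series_ext (K := K) _ _ fun n k => ?_
  have e : PowerSeries.coeff k (extendT ψ (PowerSeries.C c)) = if k = 0 then ψ c else 0 :=
    component_extendT ψ k c
  rw [coeffS_ιS, coeffS_constS, e]
  by_cases hn : n = 0 <;> by_cases hk : k = 0 <;> simp [hn, hk]

variable (𝒰) in
/-- The anticommutator of `δ` with the coderivation extending `h`. -/
def anticommutator (h : U →ₗ[K] U) (δ : HomT 𝒰 𝒰) : HomT 𝒰 𝒰 :=
  extendT (linearCoderivation 𝒰 h) ∘ₗ δ + δ ∘ₗ extendT (linearCoderivation 𝒰 h)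

variable (𝒰) in
/-- The derivation of `S(S(U))` extending the coderivation of `S(U)` extending `h`. -/
abbrev homotopyS (h : U →ₗ[K] U) : (GSym (degree 𝒰))⟦X⟧⟦X⟧ →ₗ[K] (GSym (degree 𝒰))⟦X⟧⟦X⟧ :=
  mapS (linearCoderivation (degree 𝒰) (linearCoderivation 𝒰 h))

/-- The derivation extending the anticommutator. -/
def antiSeries (h : U →ₗ[K] U) (δ : HomT 𝒰 𝒰) :
    (GSym (degree 𝒰))⟦X⟧⟦X⟧ →ₗ[K] (GSym (degree 𝒰))⟦X⟧⟦X⟧ :=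
  homotopyS 𝒰 h ∘ₗ derSeries δ + derSeries δ ∘ₗ homotopyS 𝒰 h

/-- The conjugate of `antiSeries` by the coexponential automorphism. -/
def antiCobracket (h : U →ₗ[K] U) (δ : HomT 𝒰 𝒰) :
    (GSym (degree 𝒰))⟦X⟧⟦X⟧ →ₗ[K] (GSym (degree 𝒰))⟦X⟧⟦X⟧ :=
  homotopyS 𝒰 h ∘ₗ cobracketSeries δ + cobracketSeries δ ∘ₗ homotopyS 𝒰 h

section

variable {h : U →ₗ[K] U} (hh : IsHomogeneousMap 𝒰 𝒰 (-1) h) {δ : HomT 𝒰 𝒰} (hδ : HasDegree 1 δ)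

theorem isSeriesLinear_antiSeries : IsSeriesLinear (antiSeries h δ) :=
  ((isSeriesLinear_mapS _).comp isSeriesLinear_derSeries).add
    (isSeriesLinear_derSeries.comp (isSeriesLinear_mapS _))

theorem isSeriesLinear_antiCobracket : IsSeriesLinear (antiCobracket h δ) :=
  ((isSeriesLinear_mapS _).comp isSeriesLinear_cobracketSeries).add
    (isSeriesLinear_cobracketSeries.comp (isSeriesLinear_mapS _))

include hh in
-- The extension of `h̃` commutes with `E`, so conjugating the anticommutator only affects the
-- factor `δ̃`.
theorem antiCobracket_apply (f : (GSym (degree 𝒰))⟦X⟧⟦X⟧) :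
    antiCobracket h δ f = expHom 𝒰 (antiSeries h δ (logHom 𝒰 f)) := by
  simp only [antiCobracket, antiSeries, cobracketSeries, LinearMap.add_apply, LinearMap.comp_apply,
    map_add, mapS_linearCoderivation_convHom hh]

include hh in
theorem signS_homotopyS (f : (GSym (degree 𝒰))⟦X⟧⟦X⟧) :
    signS 𝒰 (homotopyS 𝒰 h f) = (-1 : K) • homotopyS 𝒰 h (signS 𝒰 f) := by
  refine series_ext (K := K) _ _ fun n k => ?_
  rw [map_smul, coeffS_mapS, coeffS_mapS, coeffS_mapS, coeffS_mapS,
    (linearCoderivation_degree (linearCoderivation_degree hh)).twist_apply]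
  congr 1
  norm_num

include hh in
theorem homotopyS_mul (f g : (GSym (degree 𝒰))⟦X⟧⟦X⟧) :
    homotopyS 𝒰 h (f * g) = homotopyS 𝒰 h f * g + signS 𝒰 f * homotopyS 𝒰 h g := by
  rw [homotopyS, mapS_linearCoderivation_mul (linearCoderivation_degree hh), signS,
    twist_congr _ (show Even ((-1 : ℤ) - 1) by decide)]

include hh hδ in
-- The anticommutator of two odd derivations is an even derivation: the cross terms cancel in pairs.
-- Being free of signs, it combines directly with algebra morphisms.
theorem antiSeries_mul (f g : (GSym (degree 𝒰))⟦X⟧⟦X⟧) :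
    antiSeries h δ (f * g) = antiSeries h δ f * g + f * antiSeries h δ g := by
  simp only [antiSeries, LinearMap.add_apply, LinearMap.comp_apply]
  rw [derSeries_mul hδ, homotopyS_mul hh f g, map_add, map_add, homotopyS_mul hh, homotopyS_mul hh,
    derSeries_mul hδ, derSeries_mul hδ, signS_signS, signS_derSeries hδ, signS_homotopyS hh]
  rw [smul_mul_assoc, smul_mul_assoc, add_mul, mul_add]
  module

include hδ in
theorem antiSeries_ι (hh : IsHomogeneousMap 𝒰 𝒰 (-1) h) (c : GSym 𝒰) :
    antiSeries h δ (constS (K := K) _ (ι (degree 𝒰) c)) =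
      ιS 𝒰 (anticommutator 𝒰 h δ (PowerSeries.C c)) := by
  have hd := linearCoderivation_degree hh
  rw [antiSeries, LinearMap.add_apply, LinearMap.comp_apply, LinearMap.comp_apply, ← ιS_C,
    derSeries_ιS hδ, mapS_ιS (linearCoderivation_ι hd), mapS_ιS (linearCoderivation_ι hd),
    derSeries_ιS hδ, ← map_add]
  rfl

theorem antiSeries_one : antiSeries h δ 1 = 0 := by
  rw [antiSeries, LinearMap.add_apply, LinearMap.comp_apply, LinearMap.comp_apply, derSeries_one,
    mapS_linearCoderivation_one, map_zero, map_zero, add_zero]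

omit [DirectSum.Decomposition 𝒱] in
include hh hδ in
-- The composite is a derivation along `S(F)`, hence zero once it vanishes on generators; there it
-- is the anticommutator applied to `F`.
theorem antiSeries_symSeries {F : HomT 𝒱 𝒰} {hF : HasDegree 0 F}
    (hz : anticommutator 𝒰 h δ ∘ₗ F = 0) (f : (GSym (degree 𝒱))⟦X⟧⟦X⟧) :
    antiSeries h δ (symSeries F hF f) = 0 := by
  suffices e : antiSeries h δ ∘ₗ symSeries F hF = 0 from LinearMap.congr_fun e f
  have hS := isSeriesAlgHom_symSeries (F := F) (hF := hF)
  refine seriesDerivation_ext (Φ := symSeries F hF) (Ψ := symSeries F hF)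
    (isSeriesLinear_antiSeries.comp hS.toIsSeriesLinear) isSeriesLinear_zero (fun f g => ?_)
    (fun f g => ?_) ?_ fun c => ?_
  · simp only [LinearMap.comp_apply]
    rw [hS.map_mul, antiSeries_mul hh hδ]
  · simp only [LinearMap.zero_apply, zero_mul, mul_zero, add_zero]
  · rw [LinearMap.comp_apply, hS.map_one, antiSeries_one, LinearMap.zero_apply]
  · rw [LinearMap.comp_apply, symSeries_ι,
      isSeriesLinear_antiSeries.apply_ιS (antiSeries_ι hδ hh), LinearMap.zero_apply]
    have h0 := LinearMap.congr_fun hz (PowerSeries.C c)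
    rw [LinearMap.comp_apply, LinearMap.zero_apply] at h0
    rw [h0, map_zero]

include hh hδ in
theorem symSeries_antiSeries {G : HomT 𝒰 𝒱} {hG : HasDegree 0 G}
    (hz : G ∘ₗ anticommutator 𝒰 h δ = 0) (f : (GSym (degree 𝒰))⟦X⟧⟦X⟧) :
    symSeries G hG (antiSeries h δ f) = 0 := by
  suffices e : symSeries G hG ∘ₗ antiSeries h δ = 0 from LinearMap.congr_fun e f
  have hS := isSeriesAlgHom_symSeries (F := G) (hF := hG)
  refine seriesDerivation_ext (Φ := symSeries G hG) (Ψ := symSeries G hG)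
    (hS.toIsSeriesLinear.comp isSeriesLinear_antiSeries) isSeriesLinear_zero (fun f g => ?_)
    (fun f g => ?_) ?_ fun c => ?_
  · simp only [LinearMap.comp_apply]
    rw [antiSeries_mul hh hδ, map_add, hS.map_mul, hS.map_mul]
  · simp only [LinearMap.zero_apply, zero_mul, mul_zero, add_zero]
  · rw [LinearMap.comp_apply, antiSeries_one, map_zero, LinearMap.zero_apply]
  · rw [LinearMap.comp_apply, antiSeries_ι hδ hh, symSeries_ιS, LinearMap.zero_apply]
    have h0 := LinearMap.congr_fun hz (PowerSeries.C c)
    rw [LinearMap.comp_apply, LinearMap.zero_apply] at h0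
    rw [h0, map_zero]

/-- The factor coming from `h` involves neither `z` nor `t`, so divisibility is inherited from the
cobrackets of `δ`. -/
theorem isAdmissible_antiCobracket
    (hcob : ∀ a, IsAdmissible K (cobracketSeries δ (constS (K := K) _ a))) (a : GSym (degree 𝒰)) :
    IsAdmissible K (antiCobracket h δ (constS (K := K) _ a)) := by
  rw [antiCobracket, LinearMap.add_apply, LinearMap.comp_apply, LinearMap.comp_apply, mapS_constS]
  exact ((hcob a).mapS _).add (hcob _)

include hh hδ in
-- Modulo `z` the conjugation by `E` is invisible, and the graded commutator of two extended
-- derivations extends the graded commutator.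
theorem coeffS_zero_antiCobracket (a : GSym (degree 𝒰)) :
    coeffS (K := K) _ 0 0 (antiCobracket h δ (constS (K := K) _ a)) =
      linearCoderivation (degree 𝒰) (component (anticommutator 𝒰 h δ) 0) a := by
  have e : component (anticommutator 𝒰 h δ) 0 = linearCoderivation 𝒰 h ∘ₗ component δ 0 -
      ((-1 : K) ^ ((-1 : ℤ) * (1 - 2 * (0 : ℕ)))) • (component δ 0 ∘ₗ linearCoderivation 𝒰 h) := by
    refine LinearMap.ext fun c => ?_
    rw [anticommutator, component_add, component_extendT_comp, component_comp_extendT]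
    norm_num
  rw [antiCobracket, LinearMap.add_apply, LinearMap.comp_apply, LinearMap.comp_apply, map_add,
    mapS_constS, coeffS_mapS, coeffS_zero_cobracketSeries, coeffS_zero_cobracketSeries, e,
    ← linearCoderivation_comm (linearCoderivation_degree hh) (hδ 0)]
  norm_num
  have e2 : ∀ x y : GSym (degree 𝒰), x - (-1 : K) • y = x + y := fun x y => by module
  exact (e2 _ _).symm

end

/-! ### Admissibility of the transferred structure -/

section Transfer

variable [CharZero K] {h : U →ₗ[K] U} (hh : IsHomogeneousMap 𝒰 𝒰 (-1) h) {δ : HomT 𝒰 𝒰}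
  (hδ : HasDegree 1 δ) {e : U →ₗ[K] U} {he : IsHomogeneousMap 𝒰 𝒰 0 e}
  {s : U →ₗ[K] V} {hs : IsHomogeneousMap 𝒰 𝒱 0 s} {t : V →ₗ[K] U} {ht : IsHomogeneousMap 𝒱 𝒰 0 t}

omit [CharZero K] in
theorem mapS_mapMap_symSeries {F : HomT 𝒱 𝒰} {hF : HasDegree 0 F}
    (heF : extendT (map e he).toLinearMap ∘ₗ F = extendT (map t ht).toLinearMap)
    (f : (GSym (degree 𝒱))⟦X⟧⟦X⟧) :
    mapS (mapMap he).toLinearMap (symSeries F hF f) = mapS (mapMap ht).toLinearMap f := by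
  suffices h : mapS (mapMap he).toLinearMap ∘ₗ symSeries F hF = mapS (mapMap ht).toLinearMap from
    LinearMap.congr_fun h f
  refine seriesAlgHom_ext ((isSeriesAlgHom_mapS _).comp isSeriesAlgHom_symSeries)
    (isSeriesAlgHom_mapS _) fun c => ?_
  rw [LinearMap.comp_apply, symSeries_ι, ← ιS_C,
    mapS_ιS (φ := (mapMap he).toLinearMap) (map_ι (degree 𝒰) _ _),
    mapS_ιS (φ := (mapMap ht).toLinearMap) (map_ι (degree 𝒱) _ _), ← heF]
  rfl

omit [CharZero K] in
theorem symSeries_mapS_mapMap {G : HomT 𝒰 𝒱} {hG : HasDegree 0 G}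
    (heG : G ∘ₗ extendT (map e he).toLinearMap = extendT (map s hs).toLinearMap)
    (f : (GSym (degree 𝒰))⟦X⟧⟦X⟧) :
    symSeries G hG (mapS (mapMap he).toLinearMap f) = mapS (mapMap hs).toLinearMap f := by
  suffices h : symSeries G hG ∘ₗ mapS (mapMap he).toLinearMap = mapS (mapMap hs).toLinearMap from
    LinearMap.congr_fun h f
  refine seriesAlgHom_ext (isSeriesAlgHom_symSeries.comp (isSeriesAlgHom_mapS _))
    (isSeriesAlgHom_mapS _) fun c => ?_
  rw [LinearMap.comp_apply, ← ιS_C,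
    mapS_ιS (φ := (mapMap he).toLinearMap) (map_ι (degree 𝒰) _ _),
    mapS_ιS (φ := (mapMap hs).toLinearMap) (map_ι (degree 𝒰) _ _), symSeries_ιS, ← heG]
  rfl

variable (hcob : ∀ a, IsAdmissible K (cobracketSeries δ (constS (K := K) _ a)))

include hh hδ hcob in
-- The conjugated anticommutator annihilates `E S(F) E⁻¹`, because the anticommutator annihilates
-- `F`. Moreover `S(S(e))` maps `E S(F) E⁻¹` to the extension of a linear map of generators, which
-- commutes with `E` and so involves no `z`. These two equations are the input of
-- `isAdmissible_of_apply_eq_zero`.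
theorem isAdmissible_cumulantSeries_of_comp {F : HomT 𝒱 𝒰} {hF : HasDegree 0 F}
    (hz : anticommutator 𝒰 h δ ∘ₗ F = 0)
    (heF : extendT (map e he).toLinearMap ∘ₗ F = extendT (map t ht).toLinearMap)
    (hinj : ∀ v, linearCoderivation (degree 𝒰) (component (anticommutator 𝒰 h δ) 0) v = 0 →
      mapMap he v = 0 → v = 0) (a : GSym (degree 𝒱)) :
    IsAdmissible K (cumulantSeries F hF (constS (K := K) _ a)) := by
  refine isAdmissible_of_apply_eq_zero (P := antiCobracket h δ) (s := (mapMap he).toLinearMap)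
    isSeriesLinear_antiCobracket (isAdmissible_antiCobracket hcob) (fun v h1 h2 => hinj v ?_ h2) ?_ ?_
  · rw [← coeffS_zero_antiCobracket hh hδ, h1]
  · rw [antiCobracket_apply hh, cumulantSeries, LinearMap.comp_apply, LinearMap.comp_apply,
      logHom_expHom, antiSeries_symSeries hh hδ hz, map_zero]
  · rw [cumulantSeries, LinearMap.comp_apply, LinearMap.comp_apply, mapS_mapMap_convHom,
      mapS_mapMap_symSeries heF, mapS_mapMap_convHom, expHom_logHom]
    exact (isAdmissible_constS a).mapS _

include hh hδ hcob in
-- The same two equations with the composition reversed, as input of `isAdmissible_of_comp_eq_zero`.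
theorem isAdmissible_cumulantSeries_of_comp' {G : HomT 𝒰 𝒱} {hG : HasDegree 0 G}
    (hz : G ∘ₗ anticommutator 𝒰 h δ = 0)
    (heG : G ∘ₗ extendT (map e he).toLinearMap = extendT (map s hs).toLinearMap)
    (hinj : ∀ φ : GSym (degree 𝒰) →ₗ[K] GSym (degree 𝒱),
      (∀ v, φ (linearCoderivation (degree 𝒰) (component (anticommutator 𝒰 h δ) 0) v) = 0) →
      (∀ v, φ (mapMap he v) = 0) → φ = 0) (a : GSym (degree 𝒰)) :
    IsAdmissible K (cumulantSeries G hG (constS (K := K) _ a)) := by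
  have hT : IsSeriesLinear (cumulantSeries G hG) := (isSeriesAlgHom_convHom _).toIsSeriesLinear.comp
    (isSeriesAlgHom_symSeries.toIsSeriesLinear.comp (isSeriesAlgHom_convHom _).toIsSeriesLinear)
  refine isAdmissible_of_comp_eq_zero (P := antiCobracket h δ) (s := (mapMap he).toLinearMap)
    (isAdmissible_antiCobracket hcob) (fun φ h1 h2 => hinj φ (fun v => ?_) h2) hT (fun f => ?_)
    (fun a => ?_) a
  · rw [← coeffS_zero_antiCobracket hh hδ, h1]
  · rw [antiCobracket_apply hh, cumulantSeries, LinearMap.comp_apply, LinearMap.comp_apply,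
      logHom_expHom, symSeries_antiSeries hh hδ hz, map_zero]
  · rw [cumulantSeries, LinearMap.comp_apply, LinearMap.comp_apply, ← mapS_constS,
      ← mapS_mapMap_convHom, symSeries_mapS_mapMap heG, mapS_mapMap_convHom, expHom_logHom]
    exact (isAdmissible_constS a).mapS _

omit [CharZero K] in
-- Since `G` is a left inverse of the outer morphism, the two morphisms cancel on the factors that
-- are not differentiated. The right-hand side is thus a derivation, and it has the values of `δ'`
-- on generators.
theorem derSeries_transfer {G : HomT 𝒰 𝒱} {hG : HasDegree 0 G} {δ' : HomT 𝒱 𝒱}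
    (hδ : HasDegree 1 δ) (hδ' : HasDegree 1 δ')
    (hGt : G ∘ₗ extendT (map t ht).toLinearMap = LinearMap.id)
    (e' : δ' = G ∘ₗ δ ∘ₗ extendT (map t ht).toLinearMap) :
    derSeries δ' = symSeries G hG ∘ₗ derSeries δ ∘ₗ mapS (mapMap ht).toLinearMap := by
  have hS := isSeriesAlgHom_symSeries (F := G) (hF := hG)
  have hM := isSeriesAlgHom_mapS (mapMap ht)
  have h1 : ∀ f, symSeries G hG (mapS (mapMap ht).toLinearMap f) = f := by
    intro f
    suffices h : symSeries G hG ∘ₗ mapS (mapMap ht).toLinearMap = LinearMap.id from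
      LinearMap.congr_fun h f
    refine seriesAlgHom_ext (hS.comp hM) isSeriesAlgHom_id fun c => ?_
    rw [LinearMap.comp_apply, ← ιS_C,
      mapS_ιS (φ := (mapMap ht).toLinearMap) (map_ι (degree 𝒱) _ _), symSeries_ιS]
    exact congrArg (ιS 𝒱) (LinearMap.congr_fun hGt _)
  have h2 : ∀ f, signS 𝒰 (mapS (mapMap ht).toLinearMap f) =
      mapS (mapMap ht).toLinearMap (signS 𝒱 f) := fun f =>
    series_ext (K := K) _ _ fun n k => by
      simp only [coeffS_mapS]
      rw [(map_degree (degree 𝒱) _ _).twist_apply, mul_zero, zpow_zero, one_smul]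
  refine seriesDerivation_ext (Φ := LinearMap.id) (Ψ := signS 𝒱) isSeriesLinear_derSeries
    (hS.toIsSeriesLinear.comp (isSeriesLinear_derSeries.comp hM.toIsSeriesLinear))
    (derSeries_mul hδ') (fun f g => ?_) ?_ fun c => ?_
  · simp only [LinearMap.comp_apply, LinearMap.id_apply]
    rw [hM.map_mul, derSeries_mul hδ, map_add, hS.map_mul, hS.map_mul, h1, h2, h1]
  · simp only [LinearMap.comp_apply]
    rw [hM.map_one, derSeries_one, derSeries_one, map_zero]
  · simp only [LinearMap.comp_apply]
    rw [derSeries_ι hδ', ← ιS_C, mapS_ιS (φ := (mapMap ht).toLinearMap) (map_ι (degree 𝒱) _ _),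
      derSeries_ιS hδ, symSeries_ιS, e']
    rfl

include hδ hcob in
-- Inserting `E⁻¹ E` writes the conjugate of `δ̃'` as the conjugate of `S(G)`, after that of `δ̃`,
-- after a map without `z` and `t`. Admissible operators compose, so the cobrackets of `δ'` are
-- controlled by the cocumulants of `G`.
theorem isAdmissible_cobracketSeries_transfer {G : HomT 𝒰 𝒱} {hG : HasDegree 0 G} {δ' : HomT 𝒱 𝒱}
    (hδ' : HasDegree 1 δ') (hGt : G ∘ₗ extendT (map t ht).toLinearMap = LinearMap.id)
    (e' : δ' = G ∘ₗ δ ∘ₗ extendT (map t ht).toLinearMap)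
    (hGa : ∀ a, IsAdmissible K (cumulantSeries G hG (constS (K := K) _ a))) (a : GSym (degree 𝒱)) :
    IsAdmissible K (cobracketSeries δ' (constS (K := K) _ a)) := by
  have hT : IsSeriesLinear (cumulantSeries G hG) := (isSeriesAlgHom_convHom _).toIsSeriesLinear.comp
    (isSeriesAlgHom_symSeries.toIsSeriesLinear.comp (isSeriesAlgHom_convHom _).toIsSeriesLinear)
  have e1 : cobracketSeries δ' (constS (K := K) _ a) =
      cumulantSeries G hG (cobracketSeries δ (constS (K := K) _ (mapMap ht a))) := by
    simp only [cobracketSeries, cumulantSeries, LinearMap.comp_apply]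
    rw [logHom_expHom, derSeries_transfer (hG := hG) hδ hδ' hGt e']
    simp only [LinearMap.comp_apply]
    rw [mapS_mapMap_convHom, mapS_constS]
    rfl
  rw [e1]
  exact IsAdmissible.apply hT hGa (hcob _)

end Transfer

end GSym

/-! ### The constant term `δ₀` as a coderivation. -/

namespace GSym

variable {K : Type*} [Field K] {U : Type*} [AddCommGroup U] [Module K U]
variable {𝒰 : ℤ → Submodule K U} [DirectSum.Decomposition 𝒰]

open Finset.HasAntidiagonal (antidiagonal)

omit [DirectSum.Decomposition 𝒰] in
theorem ext_weightProj {a b : GSym 𝒰} (h : ∀ n, weightProj 𝒰 n a = weightProj 𝒰 n b) : a = b := by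
  have hlt := Nat.lt_succ_of_le (le_max_left (weights 𝒰 a).natDegree (weights 𝒰 b).natDegree)
  have hlt' := Nat.lt_succ_of_le (le_max_right (weights 𝒰 a).natDegree (weights 𝒰 b).natDegree)
  exact (sum_weightProj 𝒰 a hlt).symm.trans
    ((Finset.sum_congr rfl fun n _ => h n).trans (sum_weightProj 𝒰 b hlt'))

theorem weightProj_zero_conv_ι (q : GSym 𝒰 →ₗ[K] U) (φ : GSym 𝒰 →ₗ[K] GSym 𝒰) (a : GSym 𝒰) :
    weightProj 𝒰 0 (conv (ι 𝒰 ∘ₗ q) φ a) = 0 := by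
  rw [conv_apply]
  generalize CoalgebraStruct.comul (R := K) a = t
  induction t with
  | zero => simp only [map_zero]
  | tmul a b => exact weightProj_zero_ι_mul 𝒰 _ _
  | add s t hs ht => simp only [map_add, hs, ht, add_zero]

theorem weightProj_succ_conv_ι (q : GSym 𝒰 →ₗ[K] U) (φ : GSym 𝒰 →ₗ[K] GSym 𝒰) (n : ℕ)
    (a : GSym 𝒰) : weightProj 𝒰 (n + 1) (conv (ι 𝒰 ∘ₗ q) φ a) =
      conv (ι 𝒰 ∘ₗ q) (weightProj 𝒰 n ∘ₗ φ) a := by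
  rw [conv_apply, conv_apply]
  generalize CoalgebraStruct.comul (R := K) a = t
  induction t with
  | zero => simp only [map_zero]
  | tmul a b => exact weightProj_succ_ι_mul 𝒰 n _ _
  | add s t hs ht => simp only [map_add, hs, ht]

/-- The algebra morphism `S(S(U)) → S(U)` extending the projection to `U`. -/
def liftProj (𝒰 : ℤ → Submodule K U) [DirectSum.Decomposition 𝒰] :
    GSym (degree 𝒰) →ₐ[K] GSym 𝒰 :=
  lift (degree 𝒰) (ι 𝒰 ∘ₗ proj 𝒰) fun i j x y hx hy => by
    have hx' := proj_degree 𝒰 i x hx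
    have hy' := proj_degree 𝒰 j y hy
    rw [add_zero] at hx' hy'
    exact ι_mul_ι 𝒰 hx' hy'

theorem liftProj_ι (c : GSym 𝒰) : liftProj 𝒰 (ι (degree 𝒰) c) = ι 𝒰 (proj 𝒰 c) :=
  lift_ι (degree 𝒰) _ _ c

theorem liftProj_convPow (n : ℕ) (c : GSym 𝒰) :
    liftProj 𝒰 (convPow (ι (degree 𝒰)) n c) = convPow (ι 𝒰 ∘ₗ proj 𝒰) n c := by
  suffices h : (liftProj 𝒰).toLinearMap ∘ₗ convPow (ι (degree 𝒰)) n =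
    convPow (ι 𝒰 ∘ₗ proj 𝒰) n from LinearMap.congr_fun h c
  rw [comp_convList (map_mul (liftProj 𝒰)) (AlgHom.commutes _), List.map_replicate]
  congr 2
  exact LinearMap.ext fun c => liftProj_ι c

/-- After projection of every factor to `U`, the factors of the iterated coproduct become
interchangeable. The derivation acts on each of the `n + 1` factors in turn, and graded
commutativity brings all these terms to the same form. -/
theorem liftProj_linearCoderivation_convPow {d : GSym 𝒰 →ₗ[K] GSym 𝒰}
    (hd : IsHomogeneousMap (degree 𝒰) (degree 𝒰) 1 d) (n : ℕ) :
    (liftProj 𝒰).toLinearMap ∘ₗ linearCoderivation (degree 𝒰) d ∘ₗ convPow (ι (degree 𝒰)) (n + 1) =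
      (n + 1 : K) • conv (ι 𝒰 ∘ₗ proj 𝒰 ∘ₗ d) (convPow (ι 𝒰 ∘ₗ proj 𝒰) n) := by
  have hu : (liftProj 𝒰).toLinearMap ∘ₗ linearCoderivation (degree 𝒰) d ∘ₗ ι (degree 𝒰) =
      ι 𝒰 ∘ₗ proj 𝒰 ∘ₗ d := LinearMap.ext fun c => by
    simp only [LinearMap.comp_apply]
    rw [linearCoderivation_ι hd]
    exact liftProj_ι _
  induction n with
  | zero =>
    rw [zero_add, convPow_one, hu, Nat.cast_zero, zero_add, one_smul]
    exact (conv_nil _).symm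
  | succ n ih =>
    have ht : (liftProj 𝒰).toLinearMap ∘ₗ twist (degree (degree 𝒰)) 1 ∘ₗ ι (degree 𝒰) =
        ι 𝒰 ∘ₗ proj 𝒰 ∘ₗ twist (degree 𝒰) 1 := LinearMap.ext fun c => by
      simp only [LinearMap.comp_apply]
      rw [twist_ι]
      exact liftProj_ι _
    have hcomm : conv (ι 𝒰 ∘ₗ proj 𝒰 ∘ₗ twist (degree 𝒰) 1) (ι 𝒰 ∘ₗ proj 𝒰 ∘ₗ d) =
        conv (ι 𝒰 ∘ₗ proj 𝒰 ∘ₗ d) (ι 𝒰 ∘ₗ proj 𝒰) := by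
      have h := conv_comm 𝒰 (φ := ι 𝒰 ∘ₗ proj 𝒰 ∘ₗ twist (degree 𝒰) 1) (ψ := ι 𝒰 ∘ₗ proj 𝒰 ∘ₗ d)
        (k := 0) (l := 1) fun i j a ha b hb => by
          refine mul_comm_graded 𝒰 ?_ ?_
          · exact (((ι_degree 𝒰).comp (proj_degree 𝒰) (add_zero 0)).comp
              (isHomogeneousMap_twist 1) (add_zero 0)) i a ha
          · exact (((ι_degree 𝒰).comp (proj_degree 𝒰) (add_zero 0)).comp hd (add_zero 1)) j b hb
      rw [zero_mul, zpow_zero, one_smul, twist_zero, LinearMap.comp_id] at h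
      rw [h]
      congr 1
      refine LinearMap.ext fun c => ?_
      simp only [LinearMap.comp_apply]
      rw [twist_twist, twist_even _ ⟨1, rfl⟩]
      rfl
    have hm : ∀ a b, (liftProj 𝒰).toLinearMap (a * b) =
        (liftProj 𝒰).toLinearMap a * (liftProj 𝒰).toLinearMap b := map_mul (liftProj 𝒰)
    rw [convPow_succ, comp_conv_of_add (E₁ := LinearMap.id) (linearCoderivation_mul hd),
      LinearMap.comp_add, comp_conv hm, comp_conv hm, hu, ht, ih, LinearMap.id_comp, conv_smul,
      ← conv_assoc, hcomm, conv_assoc, ← convPow_succ]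
    have e : (liftProj 𝒰).toLinearMap ∘ₗ convPow (ι (degree 𝒰)) (n + 1) =
        convPow (ι 𝒰 ∘ₗ proj 𝒰) (n + 1) := LinearMap.ext fun c => liftProj_convPow _ c
    rw [e]
    push_cast
    module

variable [CharZero K]

/-- An operator vanishing on the counit and compatible with the powers of the coproduct is the
coderivation with its own corestriction. -/
theorem eq_conv_of_convPow {d : GSym 𝒰 →ₗ[K] GSym 𝒰}
    (hd : IsHomogeneousMap (degree 𝒰) (degree 𝒰) 1 d)
    (h0 : ∀ a, CoalgebraStruct.counit (R := K) (d a) = 0)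
    (h : ∀ n c, linearCoderivation (degree 𝒰) d (convPow (ι (degree 𝒰)) (n + 1) c) =
      convPow (ι (degree 𝒰)) (n + 1) (d c)) (a : GSym 𝒰) :
    d a = conv (ι 𝒰 ∘ₗ proj 𝒰 ∘ₗ d) LinearMap.id a := by
  -- The component of weight `n + 1` is read off from the `(n + 1)`-fold coproduct with all factors
  -- projected to `U`; there `d` acts on one factor at a time.
  refine ext_weightProj fun n => ?_
  rcases n with - | n
  · rw [weightProj_zero, h0, map_zero, weightProj_zero_conv_ι]
  · have e := LinearMap.congr_fun (liftProj_linearCoderivation_convPow hd n) a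
    simp only [LinearMap.comp_apply] at e
    rw [h, AlgHom.toLinearMap_apply, liftProj_convPow] at e
    have hn : ((n + 1 : ℕ) : K) ≠ 0 := Nat.cast_ne_zero.2 n.succ_ne_zero
    rw [weightProj_succ_conv_ι, LinearMap.comp_id, weightProj_eq_convList, weightProj_eq_convList,
      conv_smul, LinearMap.smul_apply, LinearMap.smul_apply]
    refine (congrArg (_ • ·) e).trans ?_
    rw [LinearMap.smul_apply, smul_smul, Nat.factorial_succ, Nat.cast_mul, mul_inv]
    congr 1
    push_cast at hn ⊢
    field_simp

/-- At `t⁰` admissibility leaves no positive power of `z` in `E δ̃ E⁻¹`, so the extension of `δ₀`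
commutes with `E`. Hence `δ₀` is compatible with all iterated coproducts and is determined by its
corestriction to `U`. -/
theorem component_zero_eq_conv {δ : HomT 𝒰 𝒰} (hδ : HasDegree 1 δ)
    (h0 : ∀ a, CoalgebraStruct.counit (R := K) (component δ 0 a) = 0)
    (hcob : ∀ a, IsAdmissible K (cobracketSeries δ (constS (K := K) _ a))) (a : GSym 𝒰) :
    component δ 0 a = conv (ι 𝒰 ∘ₗ proj 𝒰 ∘ₗ component δ 0) LinearMap.id a := by
  have hd : IsHomogeneousMap (degree 𝒰) (degree 𝒰) 1 (component δ 0) := by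
    have := hδ 0
    simpa using this
  refine eq_conv_of_convPow hd h0 (fun n c => ?_) a
  have hE : ∀ b : (GSym 𝒰)⟦X⟧, coeffS (K := K) _ n 0 (expHom 𝒰 (ιS 𝒰 b)) =
      coexpTerm 𝒰 (n + 1) (PowerSeries.coeff 0 b) := fun b => by
    rw [coeffS_apply, coeff_expHom_ιS, coeff_mapT]
  -- The identity `(E δ̃ E⁻¹) E = E δ̃` on a generator, in the coefficient of `zⁿ t⁰`.
  have e : coeffS (K := K) _ n 0
      (cobracketSeries δ (expHom 𝒰 (constS (K := K) _ (ι (degree 𝒰) c)))) =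
      coexpTerm 𝒰 (n + 1) (component δ 0 c) := by
    rw [cobracketSeries, LinearMap.comp_apply, LinearMap.comp_apply, logHom_expHom, derSeries_ι hδ, hE]
    rfl
  rw [isSeriesLinear_cobracketSeries.coeffS_apply, Finset.sum_eq_single (0, n),
    Finset.Nat.antidiagonal_zero, Finset.sum_singleton, coeffS_zero_cobracketSeries, ← ιS_C, hE,
    PowerSeries.coeff_zero_C, coexpTerm, LinearMap.smul_apply, LinearMap.smul_apply, map_smul] at e
  · exact smul_right_injective _ (inv_ne_zero (Nat.cast_ne_zero.2 (n + 1).factorial_ne_zero)) e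
  · rintro ⟨p, r⟩ h hne
    have hp : p ≠ 0 := by
      rintro rfl
      rw [Finset.HasAntidiagonal.mem_antidiagonal, zero_add] at h
      exact hne (by rw [← h])
    rw [Finset.Nat.antidiagonal_zero, Finset.sum_singleton]
    exact hcob _ _ _ (Nat.pos_of_ne_zero hp)
  · intro h
    simp at h

end GSym

/-! ### The perturbation lemma -/

section Perturbation

variable {R M M' : Type*} [Ring R] [AddCommGroup M] [Module R M] [AddCommGroup M'] [Module R M']

/-- A contraction `(σ, τ, h)` of `(M, d)` onto `(M', d')`, and solutions `F`, `G` of the fixed point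
equations for the perturbation of `d` to `δ`. -/
structure IsPerturbation (σ : M →ₗ[R] M') (τ : M' →ₗ[R] M) (h d : M →ₗ[R] M) (d' : M' →ₗ[R] M')
    (δ : M →ₗ[R] M) (F : M' →ₗ[R] M) (G : M →ₗ[R] M') : Prop where
  σ_τ : ∀ x, σ (τ x) = x
  σ_h : ∀ x, σ (h x) = 0
  h_τ : ∀ x, h (τ x) = 0
  h_h : ∀ x, h (h x) = 0
  homotopy : ∀ x, h (d x) + d (h x) = τ (σ x) - x
  σ_d : ∀ x, σ (d x) = d' (σ x)
  τ_d : ∀ x, τ (d' x) = d (τ x)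
  F_eq : ∀ x, F x = τ x + h (δ (F x) - d (F x))
  G_eq : ∀ x, G x = σ x + G (δ (h x) - d (h x))

namespace IsPerturbation

variable {σ : M →ₗ[R] M'} {τ : M' →ₗ[R] M} {h d : M →ₗ[R] M} {d' : M' →ₗ[R] M'}
  {δ : M →ₗ[R] M} {F : M' →ₗ[R] M} {G : M →ₗ[R] M'} (H : IsPerturbation σ τ h d d' δ F G)

include H

theorem σ_F (x : M') : σ (F x) = x := by
  rw [H.F_eq, map_add, H.σ_τ, H.σ_h, add_zero]

theorem h_F (x : M') : h (F x) = 0 := by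
  rw [H.F_eq, map_add, H.h_τ, H.h_h, add_zero]

theorem G_τ (x : M') : G (τ x) = x := by
  rw [H.G_eq, H.h_τ, map_zero, map_zero, sub_zero, map_zero, add_zero, H.σ_τ]

theorem G_h (x : M) : G (h x) = 0 := by
  rw [H.G_eq, H.h_h, map_zero, map_zero, sub_zero, map_zero, add_zero, H.σ_h]

/-- Given `h F = 0` and `σ F = id`, the homotopy identity turns `-h d F` into `F - τ`. This is
already everything that the fixed point equation adds to `τ`, so `h δ F` must vanish. -/
theorem h_δ_F (x : M') : h (δ (F x)) = 0 := by
  have h1 := H.F_eq x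
  have h2 := H.homotopy (F x)
  rw [H.h_F, map_zero, add_zero, H.σ_F] at h2
  rw [map_sub, h2] at h1
  linear_combination (norm := abel1) -h1

theorem G_δ_h (x : M) : G (δ (h x)) = 0 := by
  have h1 := H.G_eq x
  have h2 := congrArg G (H.homotopy x)
  rw [map_add, H.G_h, zero_add, map_sub, H.G_τ] at h2
  rw [map_sub, h2] at h1
  linear_combination (norm := abel1) -h1

/-- These are the two usual formulas for the transferred differential. The fixed point equation of
`G`, applied to `(δ - d) F`, relates them because `h (δ - d) F = F - τ`. -/
theorem G_δ_τ (x : M') : G (δ (τ x)) = σ (δ (F x)) := by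
  have h4 : F x - τ x = h (δ (F x) - d (F x)) := sub_eq_iff_eq_add'.2 (H.F_eq x)
  have h5 := H.G_eq (δ (F x) - d (F x))
  have h6 : G (d (τ x)) = d' x := by rw [← H.τ_d, H.G_τ]
  rw [← h4] at h5
  simp only [map_sub] at h5
  rw [H.σ_d, H.σ_F, h6] at h5
  linear_combination (norm := abel1) h5

end IsPerturbation

end Perturbation

set_option linter.unusedSectionVars false

/-! ### The contraction of `S(U)` onto `S(V)`. -/

namespace Contraction

open GSym

variable {K : Type*} [Field K] [CharZero K] {U V : Type*} [AddCommGroup U] [Module K U]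
  [AddCommGroup V] [Module K V]
variable {𝒰 : ℤ → Submodule K U} [DirectSum.Decomposition 𝒰]
variable {𝒱 : ℤ → Submodule K V} [DirectSum.Decomposition 𝒱]
variable {dU : U →ₗ[K] U} {dV : V →ₗ[K] V} (c : Contraction 𝒰 dU 𝒱 dV)

/-- The projector `τ σ`. -/
abbrev e : U →ₗ[K] U := c.τ ∘ₗ c.σ

/-- The projector `1 - τ σ`. -/
abbrev n : U →ₗ[K] U := LinearMap.id - c.e

/-- The coderivation of `S(U)` extending `1 - τ σ`. -/
abbrev symN : GSym 𝒰 →ₗ[K] GSym 𝒰 := linearCoderivation 𝒰 c.n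

section Basic

omit [CharZero K]

theorem e_degree : IsHomogeneousMap 𝒰 𝒰 0 c.e := c.τ_degree.comp c.σ_degree (add_zero 0)

theorem n_degree : IsHomogeneousMap 𝒰 𝒰 0 c.n := IsHomogeneousMap.id.sub c.e_degree

theorem σ_τ_apply (x : V) : c.σ (c.τ x) = x := LinearMap.congr_fun c.σ_τ x

theorem σ_h_apply (x : U) : c.σ (c.h x) = 0 := LinearMap.congr_fun c.σ_h x

theorem h_τ_apply (x : V) : c.h (c.τ x) = 0 := LinearMap.congr_fun c.h_τ x

theorem e_e (x : U) : c.e (c.e x) = c.e x := congrArg c.τ (c.σ_τ_apply _)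

theorem e_h (x : U) : c.e (c.h x) = 0 := (congrArg c.τ (c.σ_h_apply x)).trans (map_zero _)

theorem h_e (x : U) : c.h (c.e x) = 0 := c.h_τ_apply _

theorem e_d (x : U) : c.e (dU x) = dU (c.e x) :=
  (congrArg c.τ (LinearMap.congr_fun c.σ_comm x)).trans (LinearMap.congr_fun c.τ_comm (c.σ x))

theorem symσ_symτ (a : GSym 𝒱) : c.symσ (c.symτ a) = a := by
  suffices h : (map c.σ c.σ_degree).comp (map c.τ c.τ_degree) = AlgHom.id K _ from
    AlgHom.congr_fun h a
  refine algHom_ext 𝒱 fun x => ?_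
  rw [AlgHom.comp_apply, map_ι, map_ι, c.σ_τ_apply, AlgHom.id_apply]

theorem map_e (a : GSym 𝒰) : map c.e c.e_degree a = c.symτ (c.symσ a) := by
  suffices h : map c.e c.e_degree = (map c.τ c.τ_degree).comp (map c.σ c.σ_degree) from
    AlgHom.congr_fun h a
  refine algHom_ext 𝒰 fun x => ?_
  rw [AlgHom.comp_apply, map_ι, map_ι, map_ι, LinearMap.comp_apply]

theorem symσ_symh (a : GSym 𝒰) : c.symσ (c.symh a) = 0 :=
  map_symmetrizedHomotopy c.e_degree c.h_degree c.σ_degree c.σ_h a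

theorem symσ_linearCoderivation_h (a : GSym 𝒰) : c.symσ (linearCoderivation 𝒰 c.h a) = 0 := by
  refine (linearCoderivation_map (dV := 0) c.h_degree IsHomogeneousMap.zero c.σ_degree ?_ a).trans ?_
  · rw [c.σ_h, LinearMap.zero_comp]
  · rw [linearCoderivation_zero, LinearMap.zero_apply]

theorem linearCoderivation_h_symτ (a : GSym 𝒱) : linearCoderivation 𝒰 c.h (c.symτ a) = 0 := by
  refine (linearCoderivation_map (d := 0) IsHomogeneousMap.zero c.h_degree c.τ_degree ?_ a).symm.trans ?_
  · rw [c.h_τ, LinearMap.comp_zero]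
  · rw [linearCoderivation_zero, LinearMap.zero_apply, map_zero]

theorem symN_symτ (a : GSym 𝒱) : c.symN (c.symτ a) = 0 := by
  refine (linearCoderivation_map (d := 0) IsHomogeneousMap.zero c.n_degree c.τ_degree ?_ a).symm.trans ?_
  · refine LinearMap.ext fun x => ?_
    simp [c.σ_τ_apply]
  · rw [linearCoderivation_zero, LinearMap.zero_apply, map_zero]

theorem symσ_d (hU : IsHomogeneousMap 𝒰 𝒰 1 dU) (hV : IsHomogeneousMap 𝒱 𝒱 1 dV) (a : GSym 𝒰) :
    c.symσ (linearCoderivation 𝒰 dU a) = linearCoderivation 𝒱 dV (c.symσ a) :=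
  linearCoderivation_map hU hV c.σ_degree c.σ_comm a

theorem symτ_d (hU : IsHomogeneousMap 𝒰 𝒰 1 dU) (hV : IsHomogeneousMap 𝒱 𝒱 1 dV) (a : GSym 𝒱) :
    c.symτ (linearCoderivation 𝒱 dV a) = linearCoderivation 𝒰 dU (c.symτ a) :=
  linearCoderivation_map hV hU c.τ_degree c.τ_comm a

/-- `symN` commutes with the coderivation extending a map which commutes with `τ σ`. -/
theorem symN_linearCoderivation {d : U →ₗ[K] U} {k : ℤ} (hd : IsHomogeneousMap 𝒰 𝒰 k d)
    (h : ∀ x, c.e (d x) = d (c.e x)) (a : GSym 𝒰) :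
    c.symN (linearCoderivation 𝒰 d a) = linearCoderivation 𝒰 d (c.symN a) := by
  have e := linearCoderivation_comm c.n_degree hd a
  have h0 : c.n ∘ₗ d - (-1 : K) ^ (0 * k) • d ∘ₗ c.n = 0 := by
    refine LinearMap.ext fun x => ?_
    rw [zero_mul, zpow_zero, one_smul, LinearMap.sub_apply, LinearMap.comp_apply,
      LinearMap.comp_apply, LinearMap.sub_apply, LinearMap.sub_apply, LinearMap.id_apply,
      LinearMap.id_apply, h, map_sub, sub_self, LinearMap.zero_apply]
  rw [h0, linearCoderivation_zero, zero_mul, zpow_zero, one_smul] at e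
  exact sub_eq_zero.1 e

end Basic

theorem symN_symh (a : GSym 𝒰) : c.symN (c.symh a) = linearCoderivation 𝒰 c.h a :=
  linearCoderivation_symmetrizedHomotopy c.e_degree c.h_degree c.e_e c.e_h a

theorem symh_symN (a : GSym 𝒰) : c.symh (c.symN a) = linearCoderivation 𝒰 c.h a :=
  symmetrizedHomotopy_linearCoderivation c.e_degree c.h_degree c.e_e c.h_e a

theorem isEigenFiltration : IsEigenFiltration (degree 𝒰) (weightFiltration 𝒰) c.symN
    (map c.e c.e_degree).toLinearMap :=
  GSym.isEigenFiltration c.n_degree c.e_degree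
    (isEigenFiltration_generatorFiltration c.e_degree (fun _ => rfl) c.e_e)

/-- An element of `S(U)` is determined by its images under `symN` and `symσ`. -/
theorem ext_symN {a b : GSym 𝒰} (hN : c.symN a = c.symN b) (hσ : c.symσ a = c.symσ b) : a = b := by
  refine sub_eq_zero.1 (c.isEigenFiltration.eq_zero_of_apply_eq_zero (r := 0) ?_ ?_ ?_)
  · intro k d x _
    exact Submodule.zero_mem _
  · rw [map_sub, hN, sub_self, LinearMap.zero_apply, add_zero]
  · rw [AlgHom.toLinearMap_apply, map_e, map_sub, hσ, sub_self, map_zero]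

/-- The graded commutator of the odd operator `h̃` with itself is `2 h̃²`, and it extends the one of
`h`, which is zero; two is then divided out. -/
theorem linearCoderivation_h_h (a : GSym 𝒰) :
    linearCoderivation 𝒰 c.h (linearCoderivation 𝒰 c.h a) = 0 := by
  have e := linearCoderivation_comm c.h_degree c.h_degree a
  have h1 : (-1 : K) ^ ((-1 : ℤ) * -1) = -1 := by norm_num
  rw [c.h_h, smul_zero, sub_zero, linearCoderivation_zero, LinearMap.zero_apply, h1] at e
  have h2 : ∀ x : GSym 𝒰, x - (-1 : K) • x = (2 : K) • x := fun x => by module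
  exact (smul_eq_zero_iff_right (two_ne_zero (α := K))).1 ((h2 _).symm.trans e)

theorem linearCoderivation_h_symh (a : GSym 𝒰) : linearCoderivation 𝒰 c.h (c.symh a) = 0 := by
  refine c.ext_symN ?_ ?_
  · rw [c.symN_linearCoderivation c.h_degree fun x => by rw [c.e_h, c.h_e], c.symN_symh,
      c.linearCoderivation_h_h, map_zero]
  · rw [c.symσ_linearCoderivation_h, map_zero]

/-- Testing against `N` and `S(σ)` replaces the outer `ĥ` by the coderivation `h̃`, where the
relations between maps of `U` apply. The other side conditions follow the same pattern. -/
theorem symh_symh (a : GSym 𝒰) : c.symh (c.symh a) = 0 := by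
  refine c.ext_symN ?_ ?_
  · rw [c.symN_symh, c.linearCoderivation_h_symh, map_zero]
  · rw [c.symσ_symh, map_zero]

theorem symh_symτ (a : GSym 𝒱) : c.symh (c.symτ a) = 0 := by
  refine c.ext_symN ?_ ?_
  · rw [c.symN_symh, c.linearCoderivation_h_symτ, map_zero]
  · rw [c.symσ_symh, map_zero]

theorem symh_one : c.symh 1 = 0 := by
  refine c.ext_symN ?_ ?_
  · rw [c.symN_symh, linearCoderivation_one, map_zero]
  · rw [c.symσ_symh, map_zero]

theorem symh_ι (x : U) : c.symh (ι 𝒰 x) = ι 𝒰 (c.h x) := by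
  refine c.ext_symN ?_ ?_
  · rw [c.symN_symh, linearCoderivation_ι c.h_degree, linearCoderivation_ι c.n_degree,
      LinearMap.sub_apply, c.e_h, sub_zero, LinearMap.id_apply]
  · rw [c.symσ_symh, symσ, AlgHom.toLinearMap_apply, map_ι, c.σ_h_apply, map_zero]

theorem counit_symh (a : GSym 𝒰) : CoalgebraStruct.counit (R := K) (c.symh a) = 0 := by
  rw [← counit_map 𝒰 c.σ c.σ_degree, ← AlgHom.toLinearMap_apply]
  exact (congrArg _ (c.symσ_symh a)).trans (map_zero _)

/-- The graded commutator of the coderivations `h̃` and `d̃_U` extends `h d_U + d_U h = -(1 - e)`.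
-/
theorem linearCoderivation_homotopy (hU : IsHomogeneousMap 𝒰 𝒰 1 dU) (a : GSym 𝒰) :
    linearCoderivation 𝒰 c.h (linearCoderivation 𝒰 dU a) +
      linearCoderivation 𝒰 dU (linearCoderivation 𝒰 c.h a) + c.symN a = 0 := by
  have e := linearCoderivation_comm c.h_degree hU a
  have h1 : (-1 : K) ^ ((-1 : ℤ) * 1) = -1 := by norm_num
  have h2 : c.h ∘ₗ dU - (-1 : K) • dU ∘ₗ c.h + c.n = 0 := by
    rw [neg_smul, one_smul, sub_neg_eq_add, c.homotopy]
    exact sub_add_sub_cancel' _ _ _ |>.trans (by simp)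
  have h3 : ∀ x y : GSym 𝒰, x + y = x - (-1 : K) • y := fun x y => by module
  have h4 := LinearMap.congr_fun (congrArg (linearCoderivation 𝒰) h2) a
  rw [linearCoderivation_add, LinearMap.add_apply, linearCoderivation_zero,
    LinearMap.zero_apply] at h4
  rw [h1] at e
  rw [h3 (linearCoderivation 𝒰 c.h _), e]
  exact h4

/-- Applying `N` gives the identity for `h̃`, since `N` commutes with `d̃_U` and kills the image of
`S(τ)`. Applying `S(σ)` removes all terms containing `ĥ`. -/
theorem symh_homotopy (hU : IsHomogeneousMap 𝒰 𝒰 1 dU) (hV : IsHomogeneousMap 𝒱 𝒱 1 dV)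
    (a : GSym 𝒰) : c.symh (linearCoderivation 𝒰 dU a) + linearCoderivation 𝒰 dU (c.symh a) =
      c.symτ (c.symσ a) - a := by
  refine eq_sub_of_add_eq (c.ext_symN ?_ ?_)
  · rw [map_add, map_add, c.symN_symh, c.symN_linearCoderivation hU c.e_d, c.symN_symh, c.symN_symτ,
      c.linearCoderivation_homotopy hU]
  · rw [map_add, map_add, c.symσ_symh, zero_add, c.symσ_d hU hV, c.symσ_symh, map_zero, zero_add,
      c.symσ_symτ]

end Contraction

/-! ### Geometric series of operators divisible by `t`. -/

section GeometricSeries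

variable {K : Type*} [Field K] {U V W : Type*} [AddCommGroup U] [Module K U] [AddCommGroup V]
  [Module K V] [AddCommGroup W] [Module K W]
variable {𝒰 : ℤ → Submodule K U} {𝒱 : ℤ → Submodule K V} {𝒲 : ℤ → Submodule K W}

open Finset.HasAntidiagonal (antidiagonal)

theorem coeff_extendT (φ : GSym 𝒰 →ₗ[K] GSym 𝒱) (n : ℕ) (f : (GSym 𝒰)⟦X⟧) :
    PowerSeries.coeff n (extendT φ f) = φ (PowerSeries.coeff n f) := by
  rw [coeff_apply, Finset.sum_eq_single (0, n)]
  · rw [component_extendT, if_pos rfl]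
  · rintro ⟨i, j⟩ hq hne
    rw [component_extendT, if_neg]
    rintro rfl
    rw [Finset.HasAntidiagonal.mem_antidiagonal, zero_add] at hq
    exact hne (by rw [← hq])
  · intro h
    simp at h

theorem extendT_comp (ψ : GSym 𝒱 →ₗ[K] GSym 𝒲) (φ : GSym 𝒰 →ₗ[K] GSym 𝒱) (f : (GSym 𝒰)⟦X⟧) :
    extendT (ψ ∘ₗ φ) f = extendT ψ (extendT φ f) :=
  PowerSeries.ext fun n => by simp only [coeff_extendT, LinearMap.comp_apply]

theorem extendT_add (φ ψ : GSym 𝒰 →ₗ[K] GSym 𝒱) (f : (GSym 𝒰)⟦X⟧) :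
    extendT (φ + ψ) f = extendT φ f + extendT ψ f :=
  PowerSeries.ext fun n => by simp only [coeff_extendT, LinearMap.add_apply, map_add]

theorem extendT_C (φ : GSym 𝒰 →ₗ[K] GSym 𝒱) (a : GSym 𝒰) :
    extendT φ (PowerSeries.C a) = PowerSeries.C (φ a) :=
  PowerSeries.ext fun n => by
    rw [coeff_extendT, PowerSeries.coeff_C, PowerSeries.coeff_C]
    split_ifs
    · rfl
    · exact map_zero φ

theorem apply_eq_zero_of_component {F : HomT 𝒰 𝒱} (h : ∀ n a, component F n a = 0)
    (f : (GSym 𝒰)⟦X⟧) : F f = 0 :=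
  PowerSeries.ext fun n => by
    rw [coeff_apply, Finset.sum_eq_zero fun q _ => h q.1 _, map_zero]

variable {N : HomT 𝒰 𝒰}

/-- Without constant term, the `k`-th power is divisible by `tᵏ`; this makes the truncation in
`geomT` exact. -/
theorem component_pow_eq_zero (hN : ∀ a, component N 0 a = 0) {k n : ℕ} (h : n < k) (a : GSym 𝒰) :
    component ((N : Module.End K⟦X⟧ _) ^ k) n a = 0 := by
  induction k generalizing n a with
  | zero => exact absurd h n.not_lt_zero
  | succ k ih =>
    rw [pow_succ, Module.End.mul_eq_comp, component_comp]
    refine Finset.sum_eq_zero fun q hq => ?_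
    rw [Finset.HasAntidiagonal.mem_antidiagonal] at hq
    rcases Nat.eq_zero_or_pos q.2 with h0 | h0
    · rw [h0, hN, map_zero]
    · exact ih (by omega) _

theorem component_geomT (hN : ∀ a, component N 0 a = 0) {M n : ℕ} (h : n < M) (a : GSym 𝒰) :
    component (geomT N) n a =
      ∑ k ∈ Finset.range M, component ((N : Module.End K⟦X⟧ _) ^ k) n a := by
  rw [geomT, component_ofComponents, LinearMap.sum_apply]
  refine Finset.sum_subset (Finset.range_mono h) fun k _ hk => ?_
  rw [Finset.mem_range, not_lt] at hk
  exact component_pow_eq_zero hN hk a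

theorem component_pow_zero (n : ℕ) (a : GSym 𝒰) :
    component ((N : Module.End K⟦X⟧ _) ^ 0) n a = if n = 0 then a else 0 := by
  rw [pow_zero]
  exact component_id n a

theorem geomT_apply (hN : ∀ a, component N 0 a = 0) (f : (GSym 𝒰)⟦X⟧) :
    geomT N f = f + N (geomT N f) := by
  suffices h : geomT N = LinearMap.id + N ∘ₗ geomT N from LinearMap.congr_fun h f
  refine hom_ext fun n a => ?_
  rw [component_geomT hN (Nat.lt_succ_self n |>.trans (Nat.lt_succ_self _)), Finset.sum_range_succ',
    component_pow_zero, component_add, component_id, add_comm, component_comp]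
  congr 1
  simp_rw [pow_succ', Module.End.mul_eq_comp, component_comp]
  rw [Finset.sum_comm]
  refine Finset.sum_congr rfl fun q hq => ?_
  rw [← map_sum, component_geomT hN]
  rw [Finset.HasAntidiagonal.mem_antidiagonal] at hq
  omega

theorem geomT_apply' (hN : ∀ a, component N 0 a = 0) (f : (GSym 𝒰)⟦X⟧) :
    geomT N f = f + geomT N (N f) := by
  suffices h : geomT N = LinearMap.id + geomT N ∘ₗ N from LinearMap.congr_fun h f
  refine hom_ext fun n a => ?_
  rw [component_geomT hN (Nat.lt_succ_self n |>.trans (Nat.lt_succ_self _)), Finset.sum_range_succ',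
    component_pow_zero, component_add, component_id, add_comm, component_comp]
  congr 1
  simp_rw [pow_succ, Module.End.mul_eq_comp, component_comp]
  rw [Finset.sum_comm]
  refine Finset.sum_congr rfl fun q hq => ?_
  rw [component_geomT hN]
  rw [Finset.HasAntidiagonal.mem_antidiagonal] at hq
  omega

theorem hasDegree_geomT (hN : HasDegree 0 N) : HasDegree 0 (geomT N) := fun n i a ha => by
  rw [geomT, component_ofComponents, LinearMap.sum_apply]
  have h (k : ℕ) : HasDegree 0 ((N : Module.End K⟦X⟧ _) ^ k : Module.End K⟦X⟧ _) := by
    induction k with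
    | zero =>
      intro n i a ha
      rw [component_pow_zero]
      split_ifs with h0
      · simpa [h0] using ha
      · exact Submodule.zero_mem _
    | succ k ih =>
      rw [pow_succ, Module.End.mul_eq_comp]
      have h := ih.comp hN
      rwa [add_zero] at h
  exact Submodule.sum_mem _ fun k _ => h k n i a ha

end GeometricSeries

/-! ### Fixed point equations for the transferred maps. -/

namespace Contraction

open GSym

variable {K : Type*} [Field K] [CharZero K] {U V : Type*} [AddCommGroup U] [Module K U]
  [AddCommGroup V] [Module K V]
variable {𝒰 : ℤ → Submodule K U} [DirectSum.Decomposition 𝒰]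
variable {𝒱 : ℤ → Submodule K V} [DirectSum.Decomposition 𝒱]
variable {δ : HomT 𝒰 𝒰} {dV : V →ₗ[K] V} (c : Contraction 𝒰 (linearPart δ) 𝒱 dV)

theorem _root_.IBL.IsIBLAlgebra.hasDegree (hδ : IsIBLAlgebra δ) : HasDegree 1 δ := hδ.degree_one

theorem _root_.IBL.IsIBLAlgebra.isAdmissible (hδ : IsIBLAlgebra δ) (a : GSym (degree 𝒰)) :
    IsAdmissible K (cobracketSeries δ (constS (K := K) _ a)) :=
  (isAdmissible_cobracketSeries_iff hδ.hasDegree).1 hδ.cobracket a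

theorem _root_.IBL.IsIBLAlgebra.linearPart_degree (hδ : IsIBLAlgebra δ) :
    IsHomogeneousMap 𝒰 𝒰 1 (linearPart δ) := by
  have h := ((proj_degree 𝒰).comp (hδ.degree_one 0) (add_zero _)).comp (ι_degree 𝒰) (zero_add _)
  simpa [linearPart, LinearMap.comp_assoc] using h

theorem _root_.IBL.IsIBLAlgebra.component_one (hδ : IsIBLAlgebra δ) (n : ℕ) :
    component δ n 1 = 0 := by
  rw [component_apply, map_one, hδ.map_one, map_zero]

variable (hδ : IsIBLAlgebra δ)

include hδ

/-- The perturbation has no constant and no linear Taylor coefficient. -/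
theorem isBihomogeneousMap_pert₀ :
    IsBihomogeneousMap (weightFiltration 𝒰) (weightFiltration 𝒰) (-1) 1 (c.pert₀ δ) := by
  have h0 : IsHomogeneousMap (degree 𝒰) (degree 𝒰) 1 (component δ 0) := by
    have h := hδ.degree_one 0
    simpa using h
  -- Both `δ₀` and `d̃_U` are coderivations, so their difference is governed by one map to `U`. That
  -- map vanishes on `U` because `d_U` is the linear part of `δ`, and this is what lowers the
  -- weight.
  have e : c.pert₀ δ =
      conv (ι 𝒰 ∘ₗ (proj 𝒰 ∘ₗ component δ 0 - linearPart δ ∘ₗ proj 𝒰)) LinearMap.id := by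
    refine LinearMap.ext fun a => ?_
    rw [pert₀, LinearMap.sub_apply,
      component_zero_eq_conv hδ.hasDegree (hδ.counit 0) hδ.isAdmissible, linearCoderivation]
    have h1 : ι 𝒰 ∘ₗ (proj 𝒰 ∘ₗ component δ 0 - linearPart δ ∘ₗ proj 𝒰) =
        ι 𝒰 ∘ₗ proj 𝒰 ∘ₗ component δ 0 - ι 𝒰 ∘ₗ linearPart δ ∘ₗ proj 𝒰 :=
      LinearMap.comp_sub _ _ _
    rw [h1, sub_conv]
    rfl
  rw [e]
  refine isBihomogeneousMap_conv generatorFiltration_le (isBihomogeneousMap_ι_comp_of_ι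
    (((proj_degree 𝒰).comp h0 (add_zero 1)).sub
      (hδ.linearPart_degree.comp (proj_degree 𝒰) (zero_add 1))) ?_ fun x => ?_)
    IsBihomogeneousMap.id (add_zero _) (add_zero _)
  · rw [LinearMap.sub_apply, LinearMap.comp_apply, LinearMap.comp_apply, hδ.component_one, proj_one,
      map_zero, map_zero, sub_zero]
  · rw [LinearMap.sub_apply, LinearMap.comp_apply, LinearMap.comp_apply, proj_ι]
    exact sub_self _

omit hδ in
theorem isBihomogeneousMap_symh :
    IsBihomogeneousMap (weightFiltration 𝒰) (weightFiltration 𝒰) 0 (-1) c.symh :=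
  isBihomogeneousMap_symmetrizedHomotopy c.e_degree c.h_degree

theorem isBihomogeneousMap_symh_pert₀ : IsBihomogeneousMap (weightFiltration 𝒰)
    (weightFiltration 𝒰) (-1) 0 (c.symh ∘ₗ c.pert₀ δ) :=
  c.isBihomogeneousMap_symh.comp (c.isBihomogeneousMap_pert₀ hδ) (by norm_num) (by norm_num)

theorem isBihomogeneousMap_pert₀_symh : IsBihomogeneousMap (weightFiltration 𝒰)
    (weightFiltration 𝒰) (-1) 0 (c.pert₀ δ ∘ₗ c.symh) :=
  (c.isBihomogeneousMap_pert₀ hδ).comp c.isBihomogeneousMap_symh (by norm_num) (by norm_num)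

/-! ### The first step -/

theorem symh_geomWeight (a : GSym 𝒰) : c.symh (geomWeight 𝒰 (c.pert₀ δ ∘ₗ c.symh) a) =
    geomWeight 𝒰 (c.symh ∘ₗ c.pert₀ δ) (c.symh a) := by
  have h1 := Nat.lt_succ_of_le
    (le_max_left (weights 𝒰 a).natDegree (weights 𝒰 (c.symh a)).natDegree)
  have h2 := Nat.lt_succ_of_le
    (le_max_right (weights 𝒰 a).natDegree (weights 𝒰 (c.symh a)).natDegree)
  rw [geomWeight_apply (c.isBihomogeneousMap_pert₀_symh hδ) a h1,
    geomWeight_apply (c.isBihomogeneousMap_symh_pert₀ hδ) _ h2, map_sum]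
  refine Finset.sum_congr rfl fun k _ => ?_
  exact (LinearMap.congr_fun (mul_pow_mul (M := Module.End K (GSym 𝒰)) c.symh (c.pert₀ δ) k) a).symm

theorem F₀_apply (a : GSym 𝒱) : c.F₀ δ a = c.symτ a + c.symh (c.pert₀ δ (c.F₀ δ a)) :=
  geomWeight_eq (c.isBihomogeneousMap_symh_pert₀ hδ) _

theorem H₀_apply (a : GSym 𝒰) : c.H₀ δ a = c.symh a + c.symh (c.pert₀ δ (c.H₀ δ a)) :=
  geomWeight_eq (c.isBihomogeneousMap_symh_pert₀ hδ) _

theorem H₀_apply' (a : GSym 𝒰) : c.H₀ δ a = c.symh a + c.H₀ δ (c.pert₀ δ (c.symh a)) :=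
  geomWeight_eq' (c.isBihomogeneousMap_symh_pert₀ hδ) _

theorem G₀_apply (a : GSym 𝒰) : c.G₀ δ a = c.symσ a + c.symσ (c.pert₀ δ (c.H₀ δ a)) := by
  rw [G₀, LinearMap.comp_apply, geomWeight_eq (c.isBihomogeneousMap_pert₀_symh hδ), map_add,
    LinearMap.comp_apply, c.symh_geomWeight hδ]
  rfl

theorem G₀_apply' (a : GSym 𝒰) : c.G₀ δ a = c.symσ a + c.G₀ δ (c.pert₀ δ (c.symh a)) := by
  rw [G₀, LinearMap.comp_apply, geomWeight_eq' (c.isBihomogeneousMap_pert₀_symh hδ), map_add]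
  rfl

omit hδ in
theorem symσ_degree : IsHomogeneousMap (degree 𝒰) (degree 𝒱) 0 c.symσ := map_degree 𝒰 _ _

omit hδ in
theorem symτ_degree : IsHomogeneousMap (degree 𝒱) (degree 𝒰) 0 c.symτ := map_degree 𝒱 _ _

theorem F₀_degree : IsHomogeneousMap (degree 𝒱) (degree 𝒰) 0 (c.F₀ δ) :=
  (geomWeight_degree (c.isBihomogeneousMap_symh_pert₀ hδ)).comp c.symτ_degree (add_zero 0)

theorem G₀_degree : IsHomogeneousMap (degree 𝒰) (degree 𝒱) 0 (c.G₀ δ) :=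
  c.symσ_degree.comp (geomWeight_degree (c.isBihomogeneousMap_pert₀_symh hδ)) (add_zero 0)

theorem H₀_degree : IsHomogeneousMap (degree 𝒰) (degree 𝒰) (-1) (c.H₀ δ) :=
  (geomWeight_degree (c.isBihomogeneousMap_symh_pert₀ hδ)).comp
    (isHomogeneousMap_of_isBihomogeneousMap c.isBihomogeneousMap_symh) (add_zero _)

/-! ### The second step -/

omit hδ [CharZero K] in
theorem component_zero_pert (a : GSym 𝒰) : component (c.pert δ) 0 a = 0 := by
  rw [pert, component_sub, component_extendT, if_pos rfl]
  exact sub_self _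

omit hδ [CharZero K] in
theorem component_zero_H₀_pert (a : GSym 𝒰) :
    component (extendT (c.H₀ δ) ∘ₗ c.pert δ) 0 a = 0 := by
  rw [component_extendT_comp, component_zero_pert, map_zero]

omit hδ [CharZero K] in
theorem component_zero_pert_H₀ (a : GSym 𝒰) :
    component (c.pert δ ∘ₗ extendT (c.H₀ δ)) 0 a = 0 := by
  rw [component_comp_extendT, component_zero_pert]

theorem hasDegree_pert : HasDegree 1 (c.pert δ) := by
  refine hδ.hasDegree.sub (HasDegree.extendT ?_)
  have h := hδ.degree_one 0
  simpa using h

theorem hasDegree_transferF : HasDegree 0 (c.transferF δ) := by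
  have h := (HasDegree.extendT (c.H₀_degree hδ)).comp (c.hasDegree_pert hδ)
  have h' := (hasDegree_geomT (N := extendT (c.H₀ δ) ∘ₗ c.pert δ)
    (by simpa using h)).comp (HasDegree.extendT (c.F₀_degree hδ))
  rwa [add_zero] at h'

theorem hasDegree_transferG : HasDegree 0 (c.transferG δ) := by
  have h := (c.hasDegree_pert hδ).comp (HasDegree.extendT (c.H₀_degree hδ))
  have h' := (HasDegree.extendT (c.G₀_degree hδ)).comp
    (hasDegree_geomT (N := c.pert δ ∘ₗ extendT (c.H₀ δ)) (by simpa using h))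
  rwa [add_zero] at h'

omit hδ [CharZero K] in
-- The two perturbations add up to `δ - d̃_U`, so the two steps together perturb `d̃_U` to `δ`.
theorem extendT_pert₀_add_pert (f : (GSym 𝒰)⟦X⟧) : extendT (c.pert₀ δ) f + c.pert δ f =
    δ f - extendT (linearCoderivation 𝒰 (linearPart δ)) f := by
  have h1 := extendT_add (c.pert₀ δ) (linearCoderivation 𝒰 (linearPart δ)) f
  have h2 : c.pert₀ δ + linearCoderivation 𝒰 (linearPart δ) = component δ 0 :=
    LinearMap.ext fun a => sub_add_cancel (component δ 0 a) _
  have h3 : c.pert δ f = δ f - extendT (component δ 0) f := rfl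
  rw [h2] at h1
  rw [h3, h1]
  abel

omit hδ [CharZero K] in
theorem transferF_apply₀ (f : (GSym 𝒱)⟦X⟧) : c.transferF δ f =
    extendT (c.F₀ δ) f + extendT (c.H₀ δ) (c.pert δ (c.transferF δ f)) :=
  geomT_apply c.component_zero_H₀_pert _

omit hδ [CharZero K] in
theorem transferG_apply₀ (f : (GSym 𝒰)⟦X⟧) : c.transferG δ f =
    extendT (c.G₀ δ) f + c.transferG δ (c.pert δ (extendT (c.H₀ δ) f)) := by
  rw [transferG, LinearMap.comp_apply, geomT_apply' c.component_zero_pert_H₀, map_add]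
  rfl

/-- Eliminating `F₀` and `H₀` between the fixed point equations of the two steps leaves the equation
for the total perturbation. -/
theorem transferF_apply (f : (GSym 𝒱)⟦X⟧) : c.transferF δ f = extendT c.symτ f +
    extendT c.symh (δ (c.transferF δ f) -
      extendT (linearCoderivation 𝒰 (linearPart δ)) (c.transferF δ f)) := by
  have hF (f) : extendT (c.F₀ δ) f =
      extendT c.symτ f + extendT c.symh (extendT (c.pert₀ δ) (extendT (c.F₀ δ) f)) :=
    PowerSeries.ext fun n => by simp only [coeff_extendT, map_add]; exact c.F₀_apply hδ _
  have hH (f) : extendT (c.H₀ δ) f =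
      extendT c.symh f + extendT c.symh (extendT (c.pert₀ δ) (extendT (c.H₀ δ) f)) :=
    PowerSeries.ext fun n => by simp only [coeff_extendT, map_add]; exact c.H₀_apply hδ _
  rw [← c.extendT_pert₀_add_pert, map_add]
  have h1 := c.transferF_apply₀ f
  have h2 := congrArg (fun x => extendT c.symh (extendT (c.pert₀ δ) x)) h1
  simp only [map_add] at h2
  rw [h2, h1]
  nth_rewrite 1 [hF, hH]
  rw [← h1]
  abel

theorem transferG_apply (f : (GSym 𝒰)⟦X⟧) : c.transferG δ f = extendT c.symσ f +
    c.transferG δ (δ (extendT c.symh f) -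
      extendT (linearCoderivation 𝒰 (linearPart δ)) (extendT c.symh f)) := by
  have hG (f) : extendT (c.G₀ δ) f =
      extendT c.symσ f + extendT (c.G₀ δ) (extendT (c.pert₀ δ) (extendT c.symh f)) :=
    PowerSeries.ext fun n => by simp only [coeff_extendT, map_add]; exact c.G₀_apply' hδ _
  have hH (f) : extendT (c.H₀ δ) f =
      extendT c.symh f + extendT (c.H₀ δ) (extendT (c.pert₀ δ) (extendT c.symh f)) :=
    PowerSeries.ext fun n => by simp only [coeff_extendT, map_add]; exact c.H₀_apply' hδ _
  have h1 := c.transferG_apply₀ f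
  have h2 := c.transferG_apply₀ (extendT (c.pert₀ δ) (extendT c.symh f))
  rw [← c.extendT_pert₀_add_pert, map_add, h2, h1, hG f, hH f]
  simp only [map_add]
  abel

/-- Eliminates `G₀` and `δ₀'` in the same way. The term `d̃_V` is recovered from `S(σ) d̃_U F`, for
which `S(σ) F = id` is needed. -/
theorem transfer_apply (hV : IsHomogeneousMap 𝒱 𝒱 1 dV) (f : (GSym 𝒱)⟦X⟧)
    (hσF : extendT c.symσ (c.transferF δ f) = f) :
    c.transfer δ f = extendT c.symσ (δ (c.transferF δ f)) := by
  have hG (f) : extendT (c.G₀ δ) f =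
      extendT c.symσ f + extendT c.symσ (extendT (c.pert₀ δ) (extendT (c.H₀ δ) f)) :=
    PowerSeries.ext fun n => by simp only [coeff_extendT, map_add]; exact c.G₀_apply hδ _
  have hd : extendT (c.δ₀' δ) f = extendT (linearCoderivation 𝒱 dV) f +
      extendT c.symσ (extendT (c.pert₀ δ) (extendT (c.F₀ δ) f)) := by
    rw [δ₀', extendT_add, extendT_comp, extendT_comp]
    rfl
  have hd' : extendT c.symσ (extendT (linearCoderivation 𝒰 (linearPart δ)) (c.transferF δ f)) =
      extendT (linearCoderivation 𝒱 dV) f := by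
    conv_rhs => rw [← hσF]
    exact PowerSeries.ext fun n => by
      simp only [coeff_extendT]
      exact c.symσ_d hδ.linearPart_degree hV _
  have h1 : c.transfer δ f =
      extendT (c.δ₀' δ) f + extendT (c.G₀ δ) (c.pert δ (c.transferF δ f)) := rfl
  have h2 := congrArg (fun x => extendT c.symσ (extendT (c.pert₀ δ) x)) (c.transferF_apply₀ f)
  have h3 := congrArg (extendT c.symσ) (c.extendT_pert₀_add_pert (c.transferF δ f))
  simp only [map_add, map_sub] at h2 h3
  rw [hd'] at h3
  rw [h1, hd, hG]
  linear_combination (norm := abel1) h3 - h2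

end Contraction

theorem GSym.conv_ι {K : Type*} [Field K] {U B : Type*} [AddCommGroup U] [Module K U] [Ring B]
    [Algebra K B] {𝒰 : ℤ → Submodule K U} [DirectSum.Decomposition 𝒰] (φ ψ : GSym 𝒰 →ₗ[K] B)
    (x : U) : conv φ ψ (ι 𝒰 x) = φ (ι 𝒰 x) * ψ 1 + φ 1 * ψ (ι 𝒰 x) := by
  suffices h : conv φ ψ ∘ₗ ι 𝒰 = LinearMap.mulRight K (ψ 1) ∘ₗ φ ∘ₗ ι 𝒰 +
      LinearMap.mulLeft K (φ 1) ∘ₗ ψ ∘ₗ ι 𝒰 from LinearMap.congr_fun h x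
  refine homogeneous_ext (𝒰 := 𝒰) fun i x hx => ?_
  have h := conv_ι_mul 𝒰 φ ψ hx 1
  rw [conv_one, conv_one] at h
  simp only [LinearMap.comp_apply, LinearMap.mulLeft_apply, mul_one, twist_one] at h
  exact h

/-! ### Uniqueness through the anticommutator. -/

namespace Contraction

open GSym

open Finset.HasAntidiagonal (antidiagonal)

variable {K : Type*} [Field K] [CharZero K] {U V : Type*} [AddCommGroup U] [Module K U]
  [AddCommGroup V] [Module K V]
variable {𝒰 : ℤ → Submodule K U} [DirectSum.Decomposition 𝒰]
variable {𝒱 : ℤ → Submodule K V} [DirectSum.Decomposition 𝒱]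
variable {δ : HomT 𝒰 𝒰} {dV : V →ₗ[K] V} (c : Contraction 𝒰 (linearPart δ) 𝒱 dV)

/-- On a generator the coderivation `δ₀` involves only its constant and linear Taylor coefficients,
and the constant one vanishes. -/
theorem component_zero_ι (hδ : IsIBLAlgebra δ) (x : U) :
    component δ 0 (ι 𝒰 x) = ι 𝒰 (linearPart δ x) := by
  rw [component_zero_eq_conv hδ.hasDegree (hδ.counit 0) hδ.isAdmissible, conv_ι,
    LinearMap.comp_apply, LinearMap.comp_apply, LinearMap.comp_apply, LinearMap.comp_apply,
    hδ.component_one, map_zero, map_zero, zero_mul, add_zero, LinearMap.id_apply, mul_one]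
  rfl

theorem pert₀_ι (hδ : IsIBLAlgebra δ) (x : U) : c.pert₀ δ (ι 𝒰 x) = 0 := by
  rw [pert₀, LinearMap.sub_apply, component_zero_ι hδ, linearCoderivation_ι hδ.linearPart_degree]
  exact sub_self _

theorem isPerturbation (hδ : IsIBLAlgebra δ) (hV : IsHomogeneousMap 𝒱 𝒱 1 dV) :
    IsPerturbation (extendT c.symσ) (extendT c.symτ) (extendT c.symh)
      (extendT (linearCoderivation 𝒰 (linearPart δ))) (extendT (linearCoderivation 𝒱 dV)) δ
      (c.transferF δ) (c.transferG δ) where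
  σ_τ f := PowerSeries.ext fun n => by simp only [coeff_extendT, c.symσ_symτ]
  σ_h f := PowerSeries.ext fun n => by simp only [coeff_extendT, c.symσ_symh, map_zero]
  h_τ f := PowerSeries.ext fun n => by simp only [coeff_extendT, c.symh_symτ, map_zero]
  h_h f := PowerSeries.ext fun n => by simp only [coeff_extendT, c.symh_symh, map_zero]
  homotopy f := PowerSeries.ext fun n => by
    simp only [coeff_extendT, map_add, map_sub]
    exact c.symh_homotopy hδ.linearPart_degree hV _
  σ_d f := PowerSeries.ext fun n => by
    simp only [coeff_extendT]
    exact c.symσ_d hδ.linearPart_degree hV _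
  τ_d f := PowerSeries.ext fun n => by
    simp only [coeff_extendT]
    exact c.symτ_d hδ.linearPart_degree hV _
  F_eq := c.transferF_apply hδ
  G_eq := c.transferG_apply hδ

/-! ### The anticommutator with the coderivation extending the homotopy -/

theorem extendT_symN_symh (f : (GSym 𝒰)⟦X⟧) :
    extendT (linearCoderivation 𝒰 c.h) f = extendT c.symN (extendT c.symh f) :=
  PowerSeries.ext fun n => by simp only [coeff_extendT, c.symN_symh]

theorem extendT_symh_symN (f : (GSym 𝒰)⟦X⟧) :
    extendT (linearCoderivation 𝒰 c.h) f = extendT c.symh (extendT c.symN f) :=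
  PowerSeries.ext fun n => by simp only [coeff_extendT, c.symh_symN]

theorem anticommutator_apply (h : U →ₗ[K] U) (f : (GSym 𝒰)⟦X⟧) : anticommutator 𝒰 h δ f =
    extendT (linearCoderivation 𝒰 h) (δ f) + δ (extendT (linearCoderivation 𝒰 h) f) := rfl

/-- Writing `h̃ = N ĥ` in both terms leaves `ĥ δ F` and `ĥ F`, which vanish by the perturbation
lemma. For `G` the other factorization `h̃ = ĥ N` is the useful one. -/
theorem anticommutator_transferF (hδ : IsIBLAlgebra δ) (hV : IsHomogeneousMap 𝒱 𝒱 1 dV)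
    (f : (GSym 𝒱)⟦X⟧) : anticommutator 𝒰 c.h δ (c.transferF δ f) = 0 := by
  have H := c.isPerturbation hδ hV
  rw [anticommutator_apply, extendT_symN_symh, extendT_symN_symh, H.h_δ_F, H.h_F, map_zero,
    map_zero, add_zero]

theorem transferG_anticommutator (hδ : IsIBLAlgebra δ) (hV : IsHomogeneousMap 𝒱 𝒱 1 dV)
    (f : (GSym 𝒰)⟦X⟧) : c.transferG δ (anticommutator 𝒰 c.h δ f) = 0 := by
  have H := c.isPerturbation hδ hV
  rw [anticommutator_apply, extendT_symh_symN, extendT_symh_symN, map_add, H.G_h, H.G_δ_h, add_zero]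

/-- Both sides equal `δ h̃ δ`, because `δ² = 0`. The anticommutator can therefore test the chain map
equations for `F` and `G`. -/
theorem anticommutator_δ (hδ : IsIBLAlgebra δ) (f : (GSym 𝒰)⟦X⟧) :
    anticommutator 𝒰 c.h δ (δ f) = δ (anticommutator 𝒰 c.h δ f) := by
  have h (f) : δ (δ f) = 0 := LinearMap.congr_fun hδ.sq_zero f
  rw [anticommutator_apply, anticommutator_apply, map_add, h, h, map_zero, zero_add, add_zero]

/-- The part of the anticommutator which lowers the weight, with the opposite sign. -/
def antiPert : GSym 𝒰 →ₗ[K] GSym 𝒰 :=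
  (-1 : K) • (linearCoderivation 𝒰 c.h ∘ₗ c.pert₀ δ + c.pert₀ δ ∘ₗ linearCoderivation 𝒰 c.h)

theorem isBihomogeneousMap_antiPert (hδ : IsIBLAlgebra δ) :
    IsBihomogeneousMap (weightFiltration 𝒰) (weightFiltration 𝒰) (-1) 0 c.antiPert := by
  have h1 := isBihomogeneousMap_linearCoderivation_weight c.h_degree
  have h2 := c.isBihomogeneousMap_pert₀ hδ
  exact ((h1.comp h2 (by norm_num) (by norm_num)).add
    (h2.comp h1 (by norm_num) (by norm_num))).smul _

/-- The part `d̃_U` of `δ₀` contributes `-N` by the homotopy identity, and the rest contains `δ₀⁺`,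
which lowers the weight. So the constant term is triangular with diagonal `-N`. -/
theorem component_zero_anticommutator (hδ : IsIBLAlgebra δ) :
    component (anticommutator 𝒰 c.h δ) 0 = (-1 : K) • (c.symN + c.antiPert) := by
  refine LinearMap.ext fun a => ?_
  have h1 := c.linearCoderivation_homotopy hδ.linearPart_degree a
  have h2 (b) : component δ 0 b = c.pert₀ δ b + linearCoderivation 𝒰 (linearPart δ) b :=
    (sub_add_cancel (component δ 0 b) _).symm
  rw [anticommutator, component_add, component_extendT_comp, component_comp_extendT, h2, h2, map_add,
    LinearMap.smul_apply, LinearMap.add_apply, antiPert, LinearMap.smul_apply, LinearMap.add_apply,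
    LinearMap.comp_apply, LinearMap.comp_apply]
  have h3 : ∀ p q r s t : GSym 𝒰, q + s + t = 0 →
      p + q + (r + s) = (-1 : K) • (t + (-1 : K) • (p + r)) := fun p q r s t h => by
    rw [← eq_neg_iff_add_eq_zero] at h
    have h' : p + q + (r + s) = p + r + (q + s) := by abel
    rw [h', h]
    module
  exact h3 _ _ _ _ _ h1

/-- An element is determined by its images under the anticommutator and `S(σ)`. -/
theorem eq_zero_of_anticommutator (hδ : IsIBLAlgebra δ) {f : (GSym 𝒰)⟦X⟧}
    (h1 : anticommutator 𝒰 c.h δ f = 0) (h2 : extendT c.symσ f = 0) : f = 0 := by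
  refine PowerSeries.ext fun n => ?_
  rw [map_zero]
  induction n using Nat.strong_induction_on with
  | _ n ih =>
    -- The lower coefficients of `f` vanish by induction, so only the constant term of the
    -- anticommutator acts on the `n`-th one.
    have e := congrArg (PowerSeries.coeff n) h1
    rw [coeff_apply, map_zero, Finset.sum_eq_single (0, n), component_zero_anticommutator _ hδ,
      LinearMap.smul_apply, smul_eq_zero_iff_right (neg_ne_zero.2 one_ne_zero)] at e
    · refine c.isEigenFiltration.eq_zero_of_apply_eq_zero (c.isBihomogeneousMap_antiPert hδ) e ?_
      rw [AlgHom.toLinearMap_apply, map_e, ← coeff_extendT, h2, map_zero, map_zero]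
    · rintro ⟨i, j⟩ hq hne
      have hq' := Finset.HasAntidiagonal.mem_antidiagonal.1 hq
      have hi : i ≠ 0 := by
        rintro rfl
        exact hne (by rw [← hq', zero_add])
      rw [ih j (by simp only at hq'; omega), map_zero]
    · intro h
      simp at h

/-- A family of maps is determined by its compositions with the anticommutator and `S(τ)`. -/
theorem family_eq_zero {M : Type*} [AddCommGroup M] [Module K M] (hδ : IsIBLAlgebra δ)
    {φ : ℕ → GSym 𝒰 →ₗ[K] M}
    (h1 : ∀ n a, ∑ q ∈ antidiagonal n, φ q.1 (component (anticommutator 𝒰 c.h δ) q.2 a) = 0)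
    (h2 : ∀ n a, φ n (c.symτ a) = 0) (n : ℕ) : φ n = 0 := by
  induction n using Nat.strong_induction_on with
  | _ n ih =>
    refine c.isEigenFiltration.eq_zero_of_comp_eq_zero (c.isBihomogeneousMap_antiPert hδ)
      (fun a => ?_) fun a => ?_
    · have e := h1 n a
      rw [Finset.sum_eq_single (n, 0), component_zero_anticommutator _ hδ, LinearMap.smul_apply,
        map_smul, smul_eq_zero_iff_right (neg_ne_zero.2 one_ne_zero)] at e
      · exact e
      · rintro ⟨i, j⟩ hq hne
        have hq' := Finset.HasAntidiagonal.mem_antidiagonal.1 hq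
        have hj : j ≠ 0 := by
          rintro rfl
          exact hne (by rw [← hq', add_zero])
        rw [ih i (by simp only at hq'; omega), LinearMap.zero_apply]
      · intro h
        simp at h
    · rw [AlgHom.toLinearMap_apply, map_e, h2]

end Contraction

/-! ### The transferred structure and the transferred morphisms. -/

namespace Contraction

open GSym

open Finset.HasAntidiagonal (antidiagonal)

variable {K : Type*} [Field K] [CharZero K] {U V : Type*} [AddCommGroup U] [Module K U]
  [AddCommGroup V] [Module K V]
variable {𝒰 : ℤ → Submodule K U} [DirectSum.Decomposition 𝒰]
variable {𝒱 : ℤ → Submodule K V} [DirectSum.Decomposition 𝒱]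
variable {δ : HomT 𝒰 𝒰} {dV : V →ₗ[K] V} (c : Contraction 𝒰 (linearPart δ) 𝒱 dV)

section Equations

variable (hδ : IsIBLAlgebra δ) (hV : IsHomogeneousMap 𝒱 𝒱 1 dV)

include hδ hV

theorem transfer_eq (f : (GSym 𝒱)⟦X⟧) :
    c.transfer δ f = extendT c.symσ (δ (c.transferF δ f)) :=
  c.transfer_apply hδ hV f ((c.isPerturbation hδ hV).σ_F f)

theorem transfer_eq' (f : (GSym 𝒱)⟦X⟧) :
    c.transfer δ f = c.transferG δ (δ (extendT c.symτ f)) := by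
  rw [c.transfer_eq hδ hV, (c.isPerturbation hδ hV).G_δ_τ]

/-- The difference is annihilated by the anticommutator, which commutes with `δ` and kills `F`, and
by `S(σ)`, since `S(σ) F = id` and `δ' = S(σ) δ F`. Such an element is zero. -/
theorem transferF_transfer (f : (GSym 𝒱)⟦X⟧) :
    c.transferF δ (c.transfer δ f) = δ (c.transferF δ f) := by
  refine sub_eq_zero.1 (c.eq_zero_of_anticommutator hδ ?_ ?_)
  · rw [map_sub, c.anticommutator_transferF hδ hV, c.anticommutator_δ hδ,
      c.anticommutator_transferF hδ hV, map_zero, sub_zero]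
  · rw [map_sub, (c.isPerturbation hδ hV).σ_F, c.transfer_eq hδ hV, sub_self]

/-- Dually, the difference vanishes after precomposition with the anticommutator and with `S(τ)`,
the latter because `G S(τ) = id` and `δ' = G δ S(τ)`. -/
theorem transferG_δ (f : (GSym 𝒰)⟦X⟧) :
    c.transferG δ (δ f) = c.transfer δ (c.transferG δ f) := by
  suffices h : ∀ n, component (c.transferG δ ∘ₗ δ - c.transfer δ ∘ₗ c.transferG δ) n = 0 from
    sub_eq_zero.1 (apply_eq_zero_of_component (fun n a => LinearMap.congr_fun (h n) a) f)
  refine c.family_eq_zero hδ (fun n a => ?_) fun n a => ?_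
  · rw [← component_comp, component_apply, LinearMap.comp_apply, LinearMap.sub_apply,
      LinearMap.comp_apply, LinearMap.comp_apply, ← c.anticommutator_δ hδ,
      c.transferG_anticommutator hδ hV, c.transferG_anticommutator hδ hV, map_zero, sub_zero,
      map_zero]
  · rw [component_apply, ← extendT_C, LinearMap.sub_apply, LinearMap.comp_apply,
      LinearMap.comp_apply, (c.isPerturbation hδ hV).G_τ, c.transfer_eq' hδ hV, sub_self, map_zero]

theorem transfer_transfer (f : (GSym 𝒱)⟦X⟧) : c.transfer δ (c.transfer δ f) = 0 := by
  rw [c.transfer_eq hδ hV (c.transfer δ f), c.transferF_transfer hδ hV]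
  have h : δ (δ (c.transferF δ f)) = 0 := LinearMap.congr_fun hδ.sq_zero _
  rw [h, map_zero]

omit hδ hV in
theorem extendT_one {φ : GSym 𝒰 →ₗ[K] GSym 𝒱} {b : GSym 𝒱} (h : φ 1 = b) :
    extendT φ 1 = PowerSeries.C b := by
  rw [← h, ← extendT_C, map_one (PowerSeries.C : GSym 𝒰 →+* _)]

theorem transferF_one : c.transferF δ 1 = 1 := by
  have h1 : extendT c.symτ 1 = 1 :=
    (extendT_one (map_one (map c.τ c.τ_degree))).trans (map_one _)
  have h2 : extendT c.symσ 1 = 1 :=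
    (extendT_one (map_one (map c.σ c.σ_degree))).trans (map_one _)
  have h3 : extendT (linearCoderivation 𝒰 c.h) 1 = 0 :=
    (extendT_one (linearCoderivation_one 𝒰 _)).trans (map_zero _)
  refine sub_eq_zero.1 (c.eq_zero_of_anticommutator hδ ?_ ?_)
  · rw [map_sub, c.anticommutator_transferF hδ hV, anticommutator_apply, h3, hδ.map_one, map_zero,
      map_zero, add_zero, sub_zero]
  · rw [map_sub, (c.isPerturbation hδ hV).σ_F, h2, sub_self]

theorem transferG_one : c.transferG δ 1 = 1 := by
  have h2 : extendT c.symσ 1 = 1 :=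
    (extendT_one (map_one (map c.σ c.σ_degree))).trans (map_one _)
  have h3 : extendT c.symh 1 = 0 := (extendT_one c.symh_one).trans (map_zero _)
  rw [c.transferG_apply hδ, h2, h3, map_zero, map_zero, sub_zero, map_zero, add_zero]

theorem transfer_one : c.transfer δ 1 = 0 := by
  rw [c.transfer_eq hδ hV, c.transferF_one hδ hV, hδ.map_one, map_zero]

omit hV in
theorem counit_δ (n : ℕ) (f : (GSym 𝒰)⟦X⟧) :
    CoalgebraStruct.counit (R := K) (PowerSeries.coeff n (δ f)) = 0 := by
  rw [coeff_apply, map_sum]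
  exact Finset.sum_eq_zero fun q _ => hδ.counit _ _

omit hδ hV in
theorem counit_symσ (a : GSym 𝒰) :
    CoalgebraStruct.counit (R := K) (c.symσ a) = CoalgebraStruct.counit (R := K) a :=
  counit_map 𝒰 c.σ c.σ_degree a

omit hδ hV in
theorem counit_symτ (a : GSym 𝒱) :
    CoalgebraStruct.counit (R := K) (c.symτ a) = CoalgebraStruct.counit (R := K) a :=
  counit_map 𝒱 c.τ c.τ_degree a

theorem counit_transfer (n : ℕ) (a : GSym 𝒱) :
    CoalgebraStruct.counit (R := K) (component (c.transfer δ) n a) = 0 := by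
  rw [component_apply, c.transfer_eq hδ hV, coeff_extendT, c.counit_symσ, counit_δ hδ]

theorem counit_transferF (n : ℕ) (a : GSym 𝒱) :
    CoalgebraStruct.counit (R := K) (component (c.transferF δ) n a) =
      if n = 0 then CoalgebraStruct.counit (R := K) a else 0 := by
  rw [component_apply, c.transferF_apply hδ, map_add, coeff_extendT, coeff_extendT, map_add,
    c.counit_symh, add_zero, c.counit_symτ, PowerSeries.coeff_C]
  split_ifs
  · rfl
  · exact map_zero _

/-- The fixed point equation of `G` has `G` on the outside, so the counit cannot be evaluated
through it as for `F`. Instead, the counit and its composite with `G` both vanish on the image of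
the anticommutator and agree on the image of `S(τ)`. -/
theorem counit_transferG (n : ℕ) (a : GSym 𝒰) :
    CoalgebraStruct.counit (R := K) (component (c.transferG δ) n a) =
      if n = 0 then CoalgebraStruct.counit (R := K) a else 0 := by
  have key := c.family_eq_zero hδ (φ := fun n => CoalgebraStruct.counit (R := K) ∘ₗ
    (component (c.transferG δ) n) - if n = 0 then CoalgebraStruct.counit (R := K) else 0) ?_ ?_ n
  · have h := LinearMap.congr_fun key a
    rw [LinearMap.sub_apply, LinearMap.comp_apply, LinearMap.zero_apply, sub_eq_zero] at h
    rw [h]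
    split_ifs <;> rfl
  · intro n a
    have hP (n : ℕ) : CoalgebraStruct.counit (R := K)
        (component (anticommutator 𝒰 c.h δ) n a) = 0 := by
      rw [component_apply, anticommutator_apply, map_add, map_add, coeff_extendT,
        counit_linearCoderivation 𝒰 c.h_degree, counit_δ hδ, add_zero]
    have hG := congrArg (fun f => CoalgebraStruct.counit (R := K) (PowerSeries.coeff n f))
      (c.transferG_anticommutator hδ hV (PowerSeries.C a))
    have e := component_comp (c.transferG δ) (anticommutator 𝒰 c.h δ) n a
    rw [component_apply, LinearMap.comp_apply] at e
    simp only [e, map_sum, map_zero] at hG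
    simp only [LinearMap.sub_apply, LinearMap.comp_apply, Finset.sum_sub_distrib]
    rw [hG, Finset.sum_eq_zero, sub_zero]
    intro q _
    split_ifs
    · exact hP _
    · rfl
  · intro n a
    have e : component (c.transferG δ) n (c.symτ a) = if n = 0 then a else 0 := by
      rw [component_apply, ← extendT_C, (c.isPerturbation hδ hV).G_τ, PowerSeries.coeff_C]
    simp only [LinearMap.sub_apply, LinearMap.comp_apply]
    rw [e]
    split_ifs
    · rw [c.counit_symτ, sub_self]
    · rw [map_zero, LinearMap.zero_apply, sub_zero]

/-! ### The linear parts -/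

omit hδ hV in
theorem coeff_zero_pert (f : (GSym 𝒰)⟦X⟧) : PowerSeries.coeff 0 (c.pert δ f) = 0 := by
  rw [coeff_apply, Finset.Nat.antidiagonal_zero, Finset.sum_singleton, c.component_zero_pert]

omit hV in
theorem F₀_ι (x : V) : c.F₀ δ (ι 𝒱 x) = ι 𝒰 (c.τ x) := by
  have e : c.symτ (ι 𝒱 x) = ι 𝒰 (c.τ x) := map_ι _ _ _ _
  rw [F₀, LinearMap.comp_apply, e, geomWeight_eq' (c.isBihomogeneousMap_symh_pert₀ hδ),
    LinearMap.comp_apply, c.pert₀_ι hδ, map_zero, map_zero, add_zero]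

omit hV in
-- `δ₀⁺` vanishes on generators and `δ₊` is divisible by `t`, so no correction term reaches the
-- linear part. The same holds for `G` and `δ'`.
theorem linearPart_transferF : linearPart (c.transferF δ) = c.τ := by
  refine LinearMap.ext fun x => ?_
  rw [linearPart, LinearMap.comp_apply, LinearMap.comp_apply, component_apply,
    c.transferF_apply₀, map_add, coeff_extendT, coeff_extendT, c.coeff_zero_pert, map_zero, add_zero,
    PowerSeries.coeff_zero_C, c.F₀_ι hδ, proj_ι]

omit hV in
theorem linearPart_transferG : linearPart (c.transferG δ) = c.σ := by
  refine LinearMap.ext fun x => ?_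
  have h : PowerSeries.coeff 0 (c.transferG δ (c.pert δ (extendT (c.H₀ δ) (PowerSeries.C (ι 𝒰 x))))) =
      0 := by
    rw [coeff_apply, Finset.Nat.antidiagonal_zero, Finset.sum_singleton, c.coeff_zero_pert, map_zero]
  have e : c.symσ (ι 𝒰 x) = ι 𝒱 (c.σ x) := map_ι _ _ _ _
  rw [linearPart, LinearMap.comp_apply, LinearMap.comp_apply, component_apply,
    c.transferG_apply₀, map_add, h, coeff_extendT, add_zero, PowerSeries.coeff_zero_C,
    c.G₀_apply' hδ, c.symh_ι, c.pert₀_ι hδ, map_zero, add_zero, e, proj_ι]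

theorem linearPart_transfer : linearPart (c.transfer δ) = dV := by
  refine LinearMap.ext fun x => ?_
  have h1 : c.transfer δ (PowerSeries.C (ι 𝒱 x)) = extendT (c.δ₀' δ) (PowerSeries.C (ι 𝒱 x)) +
      extendT (c.G₀ δ) (c.pert δ (c.transferF δ (PowerSeries.C (ι 𝒱 x)))) := rfl
  have h2 : c.δ₀' δ (ι 𝒱 x) =
      linearCoderivation 𝒱 dV (ι 𝒱 x) + c.symσ (c.pert₀ δ (c.F₀ δ (ι 𝒱 x))) := rfl
  rw [linearPart, LinearMap.comp_apply, LinearMap.comp_apply, component_apply, h1, map_add,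
    coeff_extendT, coeff_extendT, c.coeff_zero_pert, map_zero, add_zero, PowerSeries.coeff_zero_C,
    h2, c.F₀_ι hδ, c.pert₀_ι hδ, map_zero, add_zero, linearCoderivation_ι hV, proj_ι]

/-! ### Cumulants and cobrackets -/

omit hδ hV in
-- The passage from `U` to `S(U)` is repeated, starting from the weight filtration of `S(U)`.
theorem isEigenFiltration_mapMap : IsEigenFiltration (degree (degree 𝒰))
    (filtration (degree 𝒰) (weightFiltration 𝒰)) (linearCoderivation (degree 𝒰) c.symN)
    (mapMap c.e_degree).toLinearMap :=
  GSym.isEigenFiltration (linearCoderivation_degree c.n_degree) (map_degree 𝒰 _ c.e_degree)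
    c.isEigenFiltration

omit hV in
theorem linearCoderivation_component_anticommutator (a : GSym (degree 𝒰)) :
    linearCoderivation (degree 𝒰) (component (anticommutator 𝒰 c.h δ) 0) a =
      (-1 : K) • (linearCoderivation (degree 𝒰) c.symN a +
        linearCoderivation (degree 𝒰) c.antiPert a) := by
  rw [c.component_zero_anticommutator hδ, linearCoderivation_smul, linearCoderivation_add]
  rfl

omit hV in
theorem isBihomogeneousMap_linearCoderivation_antiPert :
    IsBihomogeneousMap (filtration (degree 𝒰) (weightFiltration 𝒰))
      (filtration (degree 𝒰) (weightFiltration 𝒰)) (-1) 0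
      (linearCoderivation (degree 𝒰) c.antiPert) :=
  isBihomogeneousMap_linearCoderivation (filtration_le generatorFiltration_le)
    (c.isBihomogeneousMap_antiPert hδ)
    (isHomogeneousMap_of_isBihomogeneousMap (c.isBihomogeneousMap_antiPert hδ))

/-- Up to sign, the leading term of the conjugated anticommutator is the derivation extending `N`
plus a part that lowers the filtration of `S(S(U))`. It is thus injective on the kernel of
`S(S(e))`. -/
theorem isAdmissible_transferF (a : GSym (degree 𝒱)) : IsAdmissible K
    (cumulantSeries (c.transferF δ) (c.hasDegree_transferF hδ) (constS (K := K) _ a)) := by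
  refine isAdmissible_cumulantSeries_of_comp c.h_degree hδ.hasDegree (he := c.e_degree)
    (ht := c.τ_degree) hδ.isAdmissible
    (LinearMap.ext fun f => c.anticommutator_transferF hδ hV f) (LinearMap.ext fun f => ?_)
    (fun v h1 h2 => ?_) a
  · rw [LinearMap.comp_apply]
    conv_rhs => rw [← (c.isPerturbation hδ hV).σ_F f]
    exact PowerSeries.ext fun n => by
      simp only [coeff_extendT]
      exact c.map_e _
  · rw [c.linearCoderivation_component_anticommutator hδ,
      smul_eq_zero_iff_right (neg_ne_zero.2 one_ne_zero)] at h1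
    exact c.isEigenFiltration_mapMap.eq_zero_of_apply_eq_zero
      (c.isBihomogeneousMap_linearCoderivation_antiPert hδ) h1 h2

/-- By the same triangularity, a linear map out of `S(S(U))` that kills the image of the leading
term and the image of `S(S(e))` is zero. -/
theorem isAdmissible_transferG (a : GSym (degree 𝒰)) : IsAdmissible K
    (cumulantSeries (c.transferG δ) (c.hasDegree_transferG hδ) (constS (K := K) _ a)) := by
  refine isAdmissible_cumulantSeries_of_comp' c.h_degree hδ.hasDegree (he := c.e_degree)
    (hs := c.σ_degree) hδ.isAdmissible
    (LinearMap.ext fun f => c.transferG_anticommutator hδ hV f) (LinearMap.ext fun f => ?_)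
    (fun φ h1 h2 => ?_) a
  · have e : extendT (map c.e c.e_degree).toLinearMap f = extendT c.symτ (extendT c.symσ f) :=
      PowerSeries.ext fun n => by
        simp only [coeff_extendT]
        exact c.map_e _
    rw [LinearMap.comp_apply, e, (c.isPerturbation hδ hV).G_τ]
    rfl
  · refine c.isEigenFiltration_mapMap.eq_zero_of_comp_eq_zero
      (c.isBihomogeneousMap_linearCoderivation_antiPert hδ) (fun v => ?_) h2
    have h := h1 v
    rwa [c.linearCoderivation_component_anticommutator hδ, map_smul,
      smul_eq_zero_iff_right (neg_ne_zero.2 one_ne_zero)] at h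

theorem hasDegree_transfer : HasDegree 1 (c.transfer δ) := by
  have e : c.transfer δ = c.transferG δ ∘ₗ δ ∘ₗ extendT c.symτ :=
    LinearMap.ext fun f => c.transfer_eq' hδ hV f
  have h := (c.hasDegree_transferG hδ).comp
    (hδ.hasDegree.comp (HasDegree.extendT c.symτ_degree))
  rw [e]
  simpa using h

/-! ### The homotopy transfer theorem -/

theorem isIBLAlgebra_transfer : IsIBLAlgebra (c.transfer δ) where
  degree_one := c.hasDegree_transfer hδ hV
  map_one := c.transfer_one hδ hV
  counit := c.counit_transfer hδ hV
  sq_zero := LinearMap.ext fun f => c.transfer_transfer hδ hV f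
  cobracket := (isAdmissible_cobracketSeries_iff (c.hasDegree_transfer hδ hV)).2 fun a =>
    isAdmissible_cobracketSeries_transfer hδ.hasDegree (ht := c.τ_degree) hδ.isAdmissible
      (c.hasDegree_transfer hδ hV)
      (LinearMap.ext fun f => (c.isPerturbation hδ hV).G_τ f)
      (LinearMap.ext fun f => c.transfer_eq' hδ hV f) (c.isAdmissible_transferG hδ hV) a

theorem isIBLMorphism_transferF : IsIBLMorphism (c.transfer δ) δ (c.transferF δ) where
  degree_zero n := by simpa using c.hasDegree_transferF hδ n
  map_one := c.transferF_one hδ hV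
  counit := c.counit_transferF hδ hV
  comm := LinearMap.ext fun f => c.transferF_transfer hδ hV f
  cocumulant := isAdmissible_cumulantSeries_iff.2 (c.isAdmissible_transferF hδ hV)

theorem isIBLMorphism_transferG : IsIBLMorphism δ (c.transfer δ) (c.transferG δ) where
  degree_zero n := by simpa using c.hasDegree_transferG hδ n
  map_one := c.transferG_one hδ hV
  counit := c.counit_transferG hδ hV
  comm := LinearMap.ext fun f => c.transferG_δ hδ hV f
  cocumulant := isAdmissible_cumulantSeries_iff.2 (c.isAdmissible_transferG hδ hV)

end Equations

end Contraction

end IBL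

end

theorem mainTheorem2 {K : Type*} [Field K] [CharZero K]
    {U V : Type*} [AddCommGroup U] [Module K U] [AddCommGroup V] [Module K V]
    (𝒰 : ℤ → Submodule K U) [DirectSum.Decomposition 𝒰]
    (𝒱 : ℤ → Submodule K V) [DirectSum.Decomposition 𝒱]
    (δ : IBL.HomT 𝒰 𝒰) (hδ : IBL.IsIBLAlgebra δ)
    (dV : V →ₗ[K] V) (hdV : IBL.IsDifferential 𝒱 dV)
    (c : IBL.Contraction 𝒰 (IBL.linearPart δ) 𝒱 dV) :
    IBL.IsIBLAlgebra (c.transfer δ) ∧ IBL.linearPart (c.transfer δ) = dV ∧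
    IBL.IsIBLMorphism (c.transfer δ) δ (c.transferF δ) ∧ IBL.linearPart (c.transferF δ) = c.τ ∧
    IBL.IsIBLMorphism δ (c.transfer δ) (c.transferG δ) ∧ IBL.linearPart (c.transferG δ) = c.σ :=
  have hV := hdV.degree_one
  ⟨c.isIBLAlgebra_transfer hδ hV, c.linearPart_transfer hδ hV,
    c.isIBLMorphism_transferF hδ hV, c.linearPart_transferF hδ,
    c.isIBLMorphism_transferG hδ hV, c.linearPart_transferG hδ⟩
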